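/- **Setting.** Let $n\ge 2$ and let $\mathcal T$ be a finite conforming simplicial triangulation of a bounded polyhedral domain $D\subset\mathbb R^n$ (that is, $D$ is the interior of the union of the closed elements), with interior faces $\mathcal S$ and diameters $h_T,h_F$, shape regular with parameter $\kappa>0$: every $T\in\mathcal T$ contains a ball of radius $h_T/\kappa$. Let $\mathcal X=H^1_0(D)$ with $\|v\|_{\mathcal X}=\|\nabla v\|_{L^2(D)}$, let $p\ge1$ and let $\varphi_0,\dots,\varphi_{N-1}$ be a basis of the space $\mathcal X_p(\mathcal T)\subset\mathcal X$ of finite element functions that are polynomials of degree at most $p$ on every element. Let $\Gamma=\mathbb R^L$, $\vartheta,\rho\ge 0$, $\alpha_\ell\ge0$ and $\sigma_\ell=\exp(\vartheta\rho\alpha_\ell)$ with $\sigma_\ell^2<2$ $(1\le\ell\le L)$. Let $\gamma$ be the standard Gaussian measure on $\Gamma$, $\gamma_{\vartheta\rho}=\bigotimes_\ell N(0,\sigma_\ell^2)$ and $\zeta_{\vartheta\rho}=d\gamma_{\vartheta\rho}/d\gamma$. Let $H_k$ be the normalized Hermite polynomials, orthonormal for $N(0,1)$, and $H_\mu(y)=\prod_\ell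 H_{\mu_\ell}(y_\ell/\sigma_\ell)$, which are orthonormal for $\gamma_{\vartheta\rho}$. For $M\le L$ and $q_\ell,d_m\ge1$ let $\Lambda=\{\mu:\mu_m\le d_m-1\ (m\le M),\ \mu_\ell=0\ (\ell>M)\}$, $\Delta=\{\nu:\nu_\ell\le q_\ell-1\}$ and $\Xi=\Delta+\Lambda$. The coefficient is given in tensor train format, $$a_{\Delta,s}(x,y)=\sum_{\nu\in\Delta}\Big(\sum_{k_1=1}^{s_1}\cdots\sum_{k_{L+1}=1}^{s_{L+1}}a_0[k_1](x)\prod_{\ell=1}^LA_\ell(k_\ell,\nu_\ell,k_{\ell+1})\Big)H_\nu(y),\qquad s_{L+1}=1,$$ where on each element every $a_0[k]$ is the restriction of a $C^1$ function on $\mathbb R^n$; let $f\in L^2(D)$. Put $$\langle\mathcal A_+(v),w\rangle_{\vartheta\rho}=\int_\Gamma\int_D a_{\Delta,s}\nabla v\cdot\nabla w\,dx\,d\gamma_{\vartheta\rho}(y),\qquad \|v\|_{\mathcal A_+}^2=\langle \mathcal A_+(v),v\rangle_{\vartheta\rho},$$ and let $\mathcal V_{\vartheta\rho}$ be the space of measurable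 $v:\Gamma\to\mathcal X$ with $\int_\Gamma\int_D|a_{\Delta,s}||\nabla v|^2\,dx\,d\gamma_{\vartheta\rho}<\infty$. Assume that the problem is coercive: there is $\check c^+_{\vartheta\rho}>0$ such that all $v\in\mathcal V_{\vartheta\rho}$ lie in $L^2(\Gamma,\gamma;\mathcal X)$ and satisfy $\|v\|_{\mathcal A_+}^2\ge(\check c^+_{\vartheta\rho})^2\|v\|^2_{L^2(\Gamma,\gamma;\mathcal X)}$. Let $u\in\mathcal V_{\vartheta\rho}$ satisfy $\langle\mathcal A_+(u),v\rangle_{\vartheta\rho}=\int_\Gamma\int_D fv\,dx\,d\gamma_{\vartheta\rho}$ for all $v\in\mathcal V_{\vartheta\rho}$. Let $\Pi:\mathcal X\to\mathcal X_1(\mathcal T)$ be the Clément operator: $\Pi v$ is the continuous piecewise affine function whose value at an interior vertex $z$ is the mean of $v$ over the union of the elements containing $z$, and whose value at boundary vertices is $0$. Put $\mathcal Iv=\sum_{\mu\in\Lambda}\Pi\big(\int_\Gamma vH_\mu\,d\gamma_{\vartheta\rho}\big)H_\mu$ and $c_{\mathcal I}=\sup_{v\in\mathcal V_{\vartheta\rho},\,\|v\|_{\mathcal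 A_+}\ne0}\|(\mathrm{id}-\mathcal I)v\|_{\mathcal A_+}/\|v\|_{\mathcal A_+}$. **Estimators.** Let $\mathcal V_N=\mathrm{span}\{\varphi_iH_\mu:0\le i<N,\ \mu\in\Lambda\}$. For $w_N=\sum_i\sum_{\mu\in\Lambda}W(i,\mu)\varphi_iH_\mu\in\mathcal V_N$ let $r(\cdot,\eta)$, $\eta\in\Xi$, be the Hermite coefficients of the flux, $a_{\Delta,s}\nabla w_N=\sum_{\eta\in\Xi}r(\cdot,\eta)H_\eta$. With $\nu_{T,F}$ the unit normal of $F$ pointing out of $T$, put $$\mathrm{est}_{\det}^2=\sum_{T\in\mathcal T}h_T^2\Big\|\Big(f+\sum_{\eta\in\Lambda}\operatorname{div}r(\cdot,\eta)H_\eta\Big)\zeta_{\vartheta\rho}\Big\|^2_{L^2(\Gamma,\gamma;L^2(T))}+\sum_{F\in\mathcal S}h_F\Big\|\sum_{T\supset F}\nu_{T,F}\cdot\sum_{\eta\in\Lambda}r(\cdot,\eta)|_TH_\eta\,\zeta_{\vartheta\rho}\Big\|^2_{L^2(\Gamma,\gamma;L^2(F))},$$ $$\mathrm{est}_{\mathrm{param}}^2=\int_\Gamma\int_D\Big|\sum_{\eta\in\Xi\setminus\Lambda}r(x,\eta)H_\eta(y)\zeta_{\vartheta\rho}(y)\Big|^2dx\,d\gamma(y),\qquad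 \mathrm{est}_{\mathrm{disc}}=\big\|(\mathbf A W-F)\mathbf H^{-1/2}\big\|_{\ell^2},$$ where $\mathbf A_{(i,\mu),(j,\nu)}=\langle\mathcal A_+(\varphi_jH_\nu),\varphi_iH_\mu\rangle_{\vartheta\rho}$, $F_{(i,\mu)}=\int_\Gamma\int_Df\varphi_iH_\mu\,dx\,d\gamma_{\vartheta\rho}$ and $\mathbf H_{(i,\mu),(j,\nu)}=\int_D\nabla\varphi_i\cdot\nabla\varphi_j\,dx\ \prod_{m=1}^M\int_{\mathbb R}H_{\mu_m}(t/\sigma_m)H_{\nu_m}(t/\sigma_m)\,d\gamma_m(t)$, with $\gamma_m=N(0,1)$. **Statement.** There is a constant $c_{\det}>0$ that depends only on $n$ and the shape regularity parameter $\kappa$ such that, in every setting as above and for every $w_N\in\mathcal V_N$, $$\|u-w_N\|_{\mathcal A_+}^2\le(\check c^+_{\vartheta\rho})^{-2}\,\mathrm{est}_{\mathrm{all}}(w_N)^2,\qquad \mathrm{est}_{\mathrm{all}}(w_N)^2=\big(c_{\det}\,\mathrm{est}_{\det}+\mathrm{est}_{\mathrm{param}}+c_{\mathcal I}\,\mathrm{est}_{\mathrm{disc}}\big)^2+\mathrm{est}_{\mathrm{disc}}^2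 .$$ -/

import Mathlib

open MeasureTheory ProbabilityTheory Set
open scoped BigOperators RealInnerProductSpace ContDiff

noncomputable section

namespace LognormalTT

/-- The space `ℝ^n` with its Euclidean norm. -/
abbrev E (n : ℕ) := EuclideanSpace ℝ (Fin n)

variable {n : ℕ}

/-! ### Triangulations -/

/-- The closed simplex spanned by a finite set of vertices. -/
def hull (T : Finset (E n)) : Set (E n) := convexHull ℝ (T : Set (E n))

/-- A conforming simplicial triangulation of a bounded polyhedral domain: a finite geometric
simplicial complex, all of whose faces are faces of `n`-dimensional simplices. -/
structure Mesh (n : ℕ) where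
  /-- the complex (a face is stored as its set of vertices) -/
  K : Geometry.SimplicialComplex ℝ (E n)
  finite_faces : K.faces.Finite
  pure_dim : ∀ s ∈ K.faces, ∃ T ∈ K.faces, s ⊆ T ∧ T.card = n + 1

/-- The polyhedral domain `D` that is triangulated. -/
def Mesh.domain (𝒯 : Mesh n) : Set (E n) := interior 𝒯.K.space

open Classical in
/-- The elements (`n`-dimensional simplices) of the triangulation. -/
def Mesh.elems (𝒯 : Mesh n) : Finset (Finset (E n)) :=
  𝒯.finite_faces.toFinset.filter (fun T => T.card = n + 1)

open Classical in
/-- The interior faces: `(n-1)`-dimensional simplices shared by two different elements. -/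
def Mesh.intFaces (𝒯 : Mesh n) : Finset (Finset (E n)) :=
  𝒯.finite_faces.toFinset.filter (fun F => F.card = n ∧
    ∃ T ∈ 𝒯.elems, ∃ T' ∈ 𝒯.elems, T ≠ T' ∧ F ⊆ T ∧ F ⊆ T')

/-- The diameter `h_T` or `h_F` of a simplex. -/
def diam (T : Finset (E n)) : ℝ := Metric.diam (hull T)

/-- Shape regularity with parameter `κ`: every element `T` contains a ball of radius `h_T / κ`. -/
def Mesh.ShapeRegular (𝒯 : Mesh n) (κ : ℝ) : Prop :=
  ∀ T ∈ 𝒯.elems, ∃ c : E n, Metric.closedBall c (diam T / κ) ⊆ hull T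

/-- The vertex patch `ω_z`: the union of all elements with vertex `z`. -/
def Mesh.patch (𝒯 : Mesh n) (z : E n) : Set (E n) :=
  ⋃ T ∈ {T | T ∈ 𝒯.elems ∧ z ∈ T}, hull T

/-- The unit normal of the face `F` of the element `T` that points out of `T`. -/
def outerNormal (T F : Finset (E n)) : E n :=
  Classical.epsilon fun ν : E n => ‖ν‖ = 1 ∧ (∀ x ∈ F, ∀ y ∈ F, ⟪ν, x - y⟫ = 0) ∧
    ∀ x ∈ F, ∀ z ∈ T, ⟪ν, z - x⟫ ≤ 0

/-! ### The space `𝒳 = H¹₀(D)` -/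

/-- Pairs `(v, ∇ v)` of square integrable functions on `D`. -/
abbrev PairL2 (D : Set (E n)) :=
  Lp ℝ 2 (volume.restrict D) × Lp (E n) 2 (volume.restrict D)

/-- `H¹₀(D)`: the closure of the test functions `C_c^∞(D)`, with an element represented by the
pair of the function and its weak gradient. -/
def H10 (D : Set (E n)) : Submodule ℝ (PairL2 D) :=
  (Submodule.span ℝ {v : PairL2 D | ∃ g : E n → ℝ, ContDiff ℝ ∞ g ∧ HasCompactSupport g ∧
    tsupport g ⊆ D ∧ v.1 =ᵐ[volume.restrict D] g ∧
    v.2 =ᵐ[volume.restrict D] gradient g}).topologicalClosure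

instance (D : Set (E n)) : CompleteSpace (H10 D) :=
  (Submodule.isClosed_topologicalClosure _).completeSpace_coe

/-- The underlying function. -/
def H10.val {D : Set (E n)} (v : H10 D) : E n → ℝ := v.1.1

/-- The weak gradient. -/
def H10.grad {D : Set (E n)} (v : H10 D) : E n → E n := v.1.2

/-- The norm `‖v‖_𝒳 = ‖∇ v‖_{L²(D)}`. -/
def H10.normX {D : Set (E n)} (v : H10 D) : ℝ := ‖v.1.2‖

/-! ### Finite elements -/

/-- The restriction of `v` to the (open) element `T` is the polynomial `P`. -/
def IsPolyOn {D : Set (E n)} (v : H10 D) (T : Finset (E n)) (P : MvPolynomial (Fin n) ℝ) : Prop :=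
  H10.val v =ᵐ[volume.restrict (D ∩ interior (hull T))] fun x => MvPolynomial.eval x.ofLp P

/-- The finite element space `𝒳_p(𝒯)` of functions in `H¹₀(D)` that are polynomials of degree at
most `p` on every element. -/
def Mesh.fe (𝒯 : Mesh n) (p : ℕ) : Submodule ℝ (H10 𝒯.domain) where
  carrier := {v | ∀ T ∈ 𝒯.elems, ∃ P : MvPolynomial (Fin n) ℝ, P.totalDegree ≤ p ∧ IsPolyOn v T P}
  zero_mem' := by
    intro T _
    refine ⟨0, by simp, ?_⟩
    have h : (((0 : H10 𝒯.domain).1.1 : Lp ℝ 2 (volume.restrict 𝒯.domain)) : E n → ℝ)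
        =ᵐ[volume.restrict 𝒯.domain] 0 := Lp.coeFn_zero ..
    filter_upwards [ae_restrict_of_ae_restrict_of_subset inter_subset_left h] with x hx
    simpa [H10.val] using hx
  add_mem' := by
    intro v w hv hw T hT
    obtain ⟨P, hP, hvP⟩ := hv T hT
    obtain ⟨Q, hQ, hwQ⟩ := hw T hT
    refine ⟨P + Q, (MvPolynomial.totalDegree_add P Q).trans (max_le hP hQ), ?_⟩
    have h : (((v + w).1.1 : Lp ℝ 2 (volume.restrict 𝒯.domain)) : E n → ℝ)
        =ᵐ[volume.restrict 𝒯.domain] v.1.1 + w.1.1 := Lp.coeFn_add v.1.1 w.1.1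
    filter_upwards [ae_restrict_of_ae_restrict_of_subset inter_subset_left h, hvP, hwQ]
      with x hx hxP hxQ
    simp only [H10.val] at hx hxP hxQ ⊢
    rw [hx, Pi.add_apply, hxP, hxQ, map_add]
  smul_mem' := by
    intro c v hv T hT
    obtain ⟨P, hP, hvP⟩ := hv T hT
    refine ⟨c • P, (MvPolynomial.totalDegree_smul_le c P).trans hP, ?_⟩
    have h : (((c • v).1.1 : Lp ℝ 2 (volume.restrict 𝒯.domain)) : E n → ℝ)
        =ᵐ[volume.restrict 𝒯.domain] c • v.1.1 := Lp.coeFn_smul c v.1.1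
    filter_upwards [ae_restrict_of_ae_restrict_of_subset inter_subset_left h, hvP] with x hx hxP
    simp only [H10.val] at hx hxP ⊢
    rw [hx, Pi.smul_apply, hxP, MvPolynomial.smul_eval, smul_eq_mul]

open Classical in
/-- The (unique) polynomial that a finite element function is equal to on the element `T`. -/
def polyOn {D : Set (E n)} (v : H10 D) (T : Finset (E n)) : MvPolynomial (Fin n) ℝ :=
  if h : ∃ P, IsPolyOn v T P then h.choose else 0

/-- The gradient of that polynomial, defined up to the boundary of `T`. -/
def gradOn {D : Set (E n)} (v : H10 D) (T : Finset (E n)) (x : E n) : E n :=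
  WithLp.toLp 2 fun j => MvPolynomial.eval x.ofLp (MvPolynomial.pderiv j (polyOn v T))

open Classical in
/-- `w` is the Clément interpolant of `v`: continuous, piecewise affine, with value at an interior
vertex `z` the mean of `v` over the patch `ω_z`, and with value zero at the boundary vertices. -/
def Mesh.IsClement (𝒯 : Mesh n) (v w : H10 𝒯.domain) : Prop :=
  w ∈ 𝒯.fe 1 ∧ ∀ T ∈ 𝒯.elems, ∀ z ∈ T, MvPolynomial.eval z.ofLp (polyOn w T) =
    if z ∈ 𝒯.domain then ⨍ x in 𝒯.patch z, H10.val v x else 0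

/-- The Clément interpolation operator `𝒳 → 𝒳_1(𝒯) ⊆ 𝒳_p(𝒯)`. -/
def Mesh.clement (𝒯 : Mesh n) (v : H10 𝒯.domain) : H10 𝒯.domain :=
  Classical.epsilon (𝒯.IsClement v)

open Classical in
/-- For a function `g` that is `C¹` up to the boundary of the element `T`, a `C¹` extension of
`g` from the open element (its values on the closed element are unique). -/
def extOn (T : Finset (E n)) (g : E n → ℝ) : E n → ℝ :=
  if h : ∃ G : E n → ℝ, ContDiff ℝ 1 G ∧ EqOn g G (interior (hull T)) then h.choose else g

/-- The classical divergence of a vector field. -/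
def divergence (g : E n → E n) (x : E n) : ℝ :=
  ∑ j, (fderiv ℝ g x (EuclideanSpace.single j 1)).ofLp j

/-! ### Hermite polynomials -/

/-- The normalized Hermite polynomials, orthonormal with respect to `N(0,1)`. -/
def hermiteN (k : ℕ) (t : ℝ) : ℝ :=
  Polynomial.aeval t (Polynomial.hermite k) / √(k.factorial : ℝ)

/-- The coefficients in the linearization `H_i H_j = ∑ₖ κ_{i,j,k} H_k`. -/
def tripleCoeff (i j k : ℕ) : ℝ :=
  ∫ t, hermiteN i t * hermiteN j t * hermiteN k t ∂(gaussianReal 0 1)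

/-- Multi-indices `μ` with `μ_ℓ = 0, …, b_ℓ - 1`. -/
def box {L : ℕ} (b : Fin L → ℕ) : Finset (Fin L → ℕ) :=
  Fintype.piFinset fun l => Finset.range (b l)

/-! ### The parametric problem -/

/-- The data of the semi-discretized parametric problem over a triangulated domain. -/
structure Data (𝒯 : Mesh n) where
  /-- number of parameters, `Γ = ℝ^L` -/
  L : ℕ
  /-- number of parameters that are active in the discrete solution -/
  M : ℕ
  M_le : M ≤ L
  /-- the weights `α_ℓ` -/
  α : Fin L → ℝ
  α_nonneg : ∀ l, 0 ≤ α l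
  ϑ : ℝ
  ϑ_nonneg : 0 ≤ ϑ
  ρ : ℝ
  ρ_nonneg : 0 ≤ ρ
  /-- the coefficient has degrees `0, …, q_ℓ - 1` in `y_ℓ` -/
  q : Fin L → ℕ
  q_pos : ∀ l, 1 ≤ q l
  /-- the discrete solution has degrees `0, …, d_m - 1` in `y_m`, `m ≤ M`; the values of this
  function at the other parameters are not used -/
  dim : Fin L → ℕ
  dim_pos : ∀ l, 1 ≤ dim l
  /-- the tensor train ranks `s_1, …, s_L, s_{L+1} = 1` of the coefficient -/
  s : Fin (L + 1) → ℕ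
  s_last : s (Fin.last L) = 1
  /-- the components of the coefficient in the tensor train format -/
  a0 : Fin (s 0) → E n → ℝ
  A : (l : Fin L) → Fin (s l.castSucc) → ℕ → Fin (s l.succ) → ℝ
  /-- on every element, the first component is `C¹` up to the boundary -/
  a0_smooth : ∀ k, ∀ T ∈ 𝒯.elems, ∃ G : E n → ℝ, ContDiff ℝ 1 G ∧ EqOn (a0 k) G (interior (hull T))
  /-- the source term -/
  f : E n → ℝ
  f_memLp : MemLp f 2 (volume.restrict 𝒯.domain)

namespace Data

variable {𝒯 : Mesh n} (P : Data 𝒯)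

/-- `σ_ℓ = exp(ϑ ρ α_ℓ)`. -/
def σ (l : Fin P.L) : ℝ := Real.exp (P.ϑ * P.ρ * P.α l)

/-- The standard Gaussian measure `γ` on `Γ = ℝ^L`. -/
def γ : Measure (Fin P.L → ℝ) := Measure.pi fun _ => gaussianReal 0 1

/-- The Gaussian measure `γ_{ϑρ} = ⨂ N(0, σ_ℓ²)`. -/
def γρ : Measure (Fin P.L → ℝ) := Measure.pi fun l => gaussianReal 0 (Real.toNNReal (P.σ l ^ 2))

/-- The density `ζ_{ϑρ}` of `γ_{ϑρ}` with respect to `γ`. -/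
def ζ (y : Fin P.L → ℝ) : ℝ :=
  ∏ l, (P.σ l)⁻¹ * Real.exp ((1 - (P.σ l ^ 2)⁻¹) / 2 * y l ^ 2)

/-- The scaled Hermite polynomials, orthonormal with respect to `γ_{ϑρ}`. -/
def H (μ : Fin P.L → ℕ) (y : Fin P.L → ℝ) : ℝ := ∏ l, hermiteN (μ l) (y l / P.σ l)

/-- The numbers of degrees of the discrete solution, `1` for the inactive parameters. -/
def dimΛ (l : Fin P.L) : ℕ := if (l : ℕ) < P.M then P.dim l else 1

/-- The set `Λ` of solution multi-indices. -/
def Λ : Finset (Fin P.L → ℕ) := box P.dimΛ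

/-- The set `Δ` of coefficient multi-indices. -/
def Δ : Finset (Fin P.L → ℕ) := box P.q

/-- The set `Ξ = Δ + Λ` of residual multi-indices. -/
def Ξ : Finset (Fin P.L → ℕ) := box fun l => P.q l + P.dimΛ l - 1

/-- Evaluation of the tensor train with the value `c` of the first component. -/
def ttEval (c : Fin (P.s 0) → ℝ) (ν : Fin P.L → ℕ) : ℝ :=
  ∑ k : (l : Fin (P.L + 1)) → Fin (P.s l), c (k 0) * ∏ l : Fin P.L, P.A l (k l.castSucc) (ν l) (k l.succ)

/-- The approximate coefficient `a_{Δ,s}(x, y)`. -/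
def a (x : E n) (y : Fin P.L → ℝ) : ℝ :=
  ∑ ν ∈ P.Δ, P.ttEval (fun k => P.a0 k x) ν * P.H ν y

/-- Functions of the parameter with values in `𝒳 = H¹₀(D)`. -/
abbrev Fn := (Fin P.L → ℝ) → H10 𝒯.domain

/-- The bilinear form `⟨𝒜₊ v, w⟩_{ϑρ}`. -/
def B (v w : P.Fn) : ℝ :=
  ∫ y, (∫ x in 𝒯.domain, P.a x y * ⟪H10.grad (v y) x, H10.grad (w y) x⟫) ∂P.γρ

/-- The energy space `𝒱_{ϑρ}`. -/
def MemV (v : P.Fn) : Prop :=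
  AEStronglyMeasurable v P.γ ∧
  Integrable (fun y => ∫ x in 𝒯.domain, |P.a x y| * ‖H10.grad (v y) x‖ ^ 2) P.γρ

/-- The energy norm `‖v‖_{𝒜₊}`. -/
def energyNorm (v : P.Fn) : ℝ := √(P.B v v)

/-- Coercivity `‖v‖_{𝒜₊} ≥ č ‖v‖_{L²(Γ,γ;𝒳)}` on `𝒱_{ϑρ} ⊆ L²(Γ,γ;𝒳)`. -/
def Coercive (c : ℝ) : Prop :=
  ∀ v : P.Fn, P.MemV v → Integrable (fun y => H10.normX (v y) ^ 2) P.γ ∧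
    c ^ 2 * ∫ y, H10.normX (v y) ^ 2 ∂P.γ ≤ P.B v v

/-- `⟨f, v⟩_{ϑρ}`. -/
def load (v : P.Fn) : ℝ := ∫ y, (∫ x in 𝒯.domain, P.f x * H10.val (v y) x) ∂P.γρ

/-- `u ∈ 𝒱_{ϑρ}` solves `𝒜₊(u) = f` weakly. -/
def IsSolution (u : P.Fn) : Prop := P.MemV u ∧ ∀ v : P.Fn, P.MemV v → P.B u v = P.load v

/-- The tensorized Clément operator
`(ℐ v)(y) = ∑_{μ ∈ Λ} (Clément interpolant of v_μ) H_μ(y)`, `v_μ = ∫ v H_μ dγ_{ϑρ}`. -/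
def interp (v : P.Fn) : P.Fn := fun y =>
  ∑ μ ∈ P.Λ, P.H μ y • 𝒯.clement (∫ y', P.H μ y' • v y' ∂P.γρ)

/-- The norm `c_ℐ` of `id - ℐ` with respect to the energy norm. -/
def cI : ℝ :=
  sSup {r | ∃ v : P.Fn, P.MemV v ∧ P.energyNorm v ≠ 0 ∧
    r = P.energyNorm (v - P.interp v) / P.energyNorm v}

/-! ### The discrete function and its residual -/

variable {N p : ℕ} (φ : Module.Basis (Fin N) ℝ (𝒯.fe p)) (W : Fin N × P.Λ → ℝ)

/-- `w_N(y) = ∑_i ∑_{μ ∈ Λ} W(i, μ) φ_i H_μ(y)`. -/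
def discreteFn : P.Fn := fun y => ∑ iμ : Fin N × P.Λ, (W iμ * P.H iμ.2 y) • (φ iμ.1 : H10 𝒯.domain)

/-- The coefficient of `H_η` in the product of `∑_ν (ttEval c ν) H_ν` and
`∑_i ∑_μ W(i, μ) (g i) H_μ`. -/
def resCoeff (c : Fin (P.s 0) → ℝ) (g : Fin N → E n) (η : Fin P.L → ℕ) : E n :=
  ∑ ν ∈ P.Δ, ∑ iμ : Fin N × P.Λ,
    (P.ttEval c ν * W iμ * ∏ l, tripleCoeff (iμ.2.1 l) (ν l) (η l)) • g iμ.1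

/-- The flux coefficients `r(x, η)`, with `a_{Δ,s} ∇ w_N = ∑_{η ∈ Ξ} r(·, η) H_η`. -/
def res (η : Fin P.L → ℕ) (x : E n) : E n :=
  P.resCoeff W (fun k => P.a0 k x) (fun i => H10.grad (φ i : H10 𝒯.domain) x) η

/-- The flux coefficients on the element `T`, up to the boundary of `T`. -/
def resOn (T : Finset (E n)) (η : Fin P.L → ℕ) (x : E n) : E n :=
  P.resCoeff W (fun k => extOn T (P.a0 k) x) (fun i => gradOn (φ i : H10 𝒯.domain) T x) η

/-! ### Error estimators -/

/-- The element part of the active residual, `f + ∑_{η ∈ Λ} div r(·, η) H_η` on `T`. -/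
def activeRes (T : Finset (E n)) (x : E n) (y : Fin P.L → ℝ) : ℝ :=
  P.f x + ∑ η ∈ P.Λ, divergence (P.resOn φ W T η) x * P.H η y

/-- The face part of the active residual: the jump of the normal component of the active flux
`∑_{η ∈ Λ} r(·, η) H_η` over `F`. -/
def activeJump (F : Finset (E n)) (x : E n) (y : Fin P.L → ℝ) : ℝ :=
  ∑ T ∈ {T ∈ 𝒯.elems | F ⊆ T}, ∑ η ∈ P.Λ, ⟪outerNormal T F, P.resOn φ W T η x⟫ * P.H η y

/-- `est_{det,T}`. -/
def estDetT (T : Finset (E n)) : ℝ :=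
  diam T * √(∫ y, (∫ x in hull T, (P.activeRes φ W T x y * P.ζ y) ^ 2) ∂P.γ)

/-- `est_{det,F}`, with the surface measure on `F`. -/
def estDetF (F : Finset (E n)) : ℝ :=
  √(diam F) * √(∫ y, (∫ x in hull F, (P.activeJump φ W F x y * P.ζ y) ^ 2 ∂(μHE[n - 1])) ∂P.γ)

/-- The deterministic estimator. -/
def estDet : ℝ :=
  √(∑ T ∈ 𝒯.elems, P.estDetT φ W T ^ 2 + ∑ F ∈ 𝒯.intFaces, P.estDetF φ W F ^ 2)

/-- The parametric (tail) estimator. -/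
def estParam : ℝ :=
  √(∫ y, (∫ x in 𝒯.domain, ‖∑ η ∈ P.Ξ \ P.Λ, (P.H η y * P.ζ y) • P.res φ W η x‖ ^ 2) ∂P.γ)

/-- The Galerkin matrix `𝐀`. -/
def galerkinMatrix : Matrix (Fin N × P.Λ) (Fin N × P.Λ) ℝ := fun iμ jν =>
  P.B (fun y => P.H jν.2 y • (φ jν.1 : H10 𝒯.domain)) (fun y => P.H iμ.2 y • (φ iμ.1 : H10 𝒯.domain))

/-- The load vector `F`. -/
def loadVector : Fin N × P.Λ → ℝ := fun iμ =>
  P.load (fun y => P.H iμ.2 y • (φ iμ.1 : H10 𝒯.domain))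

/-- The basis change matrix `Z_0 ⊗ Z_1 ⊗ ⋯ ⊗ Z_M`; the inactive parameters contribute factors
`1`, since all indices in `Λ` vanish there. -/
def basisChange : Matrix (Fin N × P.Λ) (Fin N × P.Λ) ℝ := fun iμ jν =>
  (∫ x in 𝒯.domain, ⟪H10.grad (φ iμ.1 : H10 𝒯.domain) x, H10.grad (φ jν.1 : H10 𝒯.domain) x⟫) *
  ∏ l, ∫ t, hermiteN (iμ.2.1 l) (t / P.σ l) * hermiteN (jν.2.1 l) (t / P.σ l) ∂(gaussianReal 0 1)

/-- The algebraic estimator `‖(𝐀 W - F) 𝐇^{-1/2}‖_{ℓ²}`; the power `-1/2` of the symmetric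
positive definite matrix is taken by functional calculus. -/
def estDisc : ℝ :=
  ‖WithLp.toLp 2 (Matrix.mulVec (cfc (fun t : ℝ => (√t)⁻¹) (P.basisChange φ))
    (Matrix.mulVec (P.galerkinMatrix φ) W - P.loadVector φ))‖

/-- The square of the overall estimator, with the constant `c` of the deterministic part. -/
def estAllSq (c : ℝ) : ℝ :=
  (c * P.estDet φ W + P.estParam φ W + P.cI * P.estDisc φ W) ^ 2 + P.estDisc φ W ^ 2

end Data

end LognormalTT

end

noncomputable section

namespace LognormalTT

variable {n : ℕ}

/-! ### Simplices and barycentric coordinates -/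

/-! The error splits orthogonally. Under coercivity the Galerkin matrix is injective, so the span of
the functions φ_i H_μ contains a Galerkin solution g. With v = u - g and d = g - w_N, Galerkin
orthogonality gives ‖u - w_N‖² = ‖v‖² + ‖d‖² in the energy norm.

The part d is algebraic. B(d, d) is, up to sign, the Euclidean pairing of 𝐀W - F with the
coefficients of d, and 𝐇 is the Gram matrix of the tensor basis in L²(Γ, γ; 𝒳). Duality
(`abs_dotProduct_le_of_posDef`) bounds the pairing by est_disc times the L²(Γ, γ; 𝒳) norm of d, and
coercivity turns this into ‖d‖ ≤ est_disc / č.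

For v, the function ℐv is discrete, so ‖v‖² = B(v, z) with z = v - ℐv. This is the residual of w_N
at z minus B(d, z), and the last term costs ‖d‖ c_ℐ ‖v‖. The residual is expanded in Hermite
polynomials with η ∈ Ξ. Since ℐv only has modes in Λ, the modes in Ξ \ Λ see v itself, and the
Cauchy–Schwarz inequality produces est_param. For η ∈ Λ the moment of z is the moment of v minus its
Clément interpolant. The Clément operator is linear and bounded, so it commutes with integration
over the parameter, and the active part of the residual at z equals the active part tested with y ↦
v(y) - Πv(y). No projection in y is left (`Data.det_eq`). The active residual can therefore be
estimated at each fixed y by deterministic residual analysis, after which the Cauchy–Schwarz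
inequality in y gives c_det est_det times the L²(Γ, γ; 𝒳) norm of v. The condition σ_ℓ² < 2 enters
because it puts H_μ ζ into L²(γ), which makes moments with respect to γ_{ϑρ} bounded on L²(γ).

The deterministic estimate (`Mesh.abs_residual_sub_clement_le`) integrates by parts on every element
and uses interpolation bounds for the Clément operator on elements and faces. Their constants may
depend on n and κ only. They come from Poincaré's inequality on convex sets, from a trace inequality
obtained from the divergence theorem with the field g(x)(x - z), and from chains of face neighbors
around a vertex. At most κ^n elements share a vertex; around an interior vertex any two of them are
joined by a chain, and around a boundary vertex a chain reaches a boundary face, on which the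
function vanishes. The topological input is `Mesh.biUnion_mem_nhds`: a family of elements at a
vertex that is closed under passing to face neighbors covers a neighborhood of that vertex.

These bounds are shown for test functions and carried to H¹₀(D) by density. This needs the Clément
operator to exist as a bounded operator on H¹₀(D), hence that continuous piecewise affine functions
with zero boundary values belong to H¹₀(D), which follows by soft thresholding and mollification
(`H10.exists_of_lipschitz`). -/

/-- A finite set of `n + 1` affinely independent points of `ℝ^n`. -/
def IsSimplex (T : Finset (E n)) : Prop :=
  T.card = n + 1 ∧ AffineIndependent ℝ ((↑) : T → E n)

/-- The vertices of a simplex as an affine basis. -/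
def IsSimplex.basis {T : Finset (E n)} (h : IsSimplex T) : AffineBasis T ℝ (E n) :=
  ⟨(↑), h.2, by
    rw [h.2.affineSpan_eq_top_iff_card_eq_finrank_add_one]
    simp [h.1]⟩

@[simp] lemma IsSimplex.basis_apply {T : Finset (E n)} (h : IsSimplex T) (z : T) :
    h.basis z = z := rfl

open Classical in
/-- The barycentric coordinate of the vertex `z` of the simplex `T`. -/
def bary (T : Finset (E n)) (z : E n) : E n →ᵃ[ℝ] ℝ :=
  if h : IsSimplex T ∧ z ∈ T then h.1.basis.coord ⟨z, h.2⟩ else 0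

lemma IsSimplex.bary_eq {T : Finset (E n)} (h : IsSimplex T) (z : T) :
    bary T z = h.basis.coord z := by
  simp [bary, h]

lemma IsSimplex.bary_self {T : Finset (E n)} (h : IsSimplex T) {z : E n} (hz : z ∈ T) :
    bary T z z = 1 := by
  rw [h.bary_eq ⟨z, hz⟩]
  exact h.basis.coord_apply_eq ⟨z, hz⟩

lemma IsSimplex.bary_ne {T : Finset (E n)} (h : IsSimplex T) {z w : E n} (hz : z ∈ T)
    (hw : w ∈ T) (hzw : w ≠ z) : bary T z w = 0 := by
  rw [h.bary_eq ⟨z, hz⟩]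
  exact h.basis.coord_apply_ne (i := ⟨z, hz⟩) (j := ⟨w, hw⟩) (by simpa [eq_comm] using hzw)

lemma IsSimplex.sum_bary {T : Finset (E n)} (h : IsSimplex T) (x : E n) :
    ∑ z ∈ T, bary T z x = 1 := by
  rw [← Finset.sum_coe_sort]
  simp_rw [h.bary_eq]
  exact h.basis.sum_coord_apply_eq_one x

lemma IsSimplex.sum_bary_smul {T : Finset (E n)} (h : IsSimplex T) (x : E n) :
    ∑ z ∈ T, bary T z x • z = x := by
  rw [← Finset.sum_coe_sort T (fun z => bary T z x • z)]
  simp_rw [h.bary_eq]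
  exact h.basis.linear_combination_coord_eq_self x

lemma sum_affine_apply {ι V : Type*} [AddCommGroup V] [Module ℝ V] (s : Finset ι) (w : ι → ℝ)
    (p : ι → V) (hw : ∑ i ∈ s, w i = 1) (g : V →ᵃ[ℝ] ℝ) :
    g (∑ i ∈ s, w i • p i) = ∑ i ∈ s, w i * g (p i) := by
  have h := Finset.map_affineCombination s p w hw g
  rw [Finset.affineCombination_eq_linear_combination _ _ _ hw,
    Finset.affineCombination_eq_linear_combination _ _ _ hw] at h
  simpa using h

lemma IsSimplex.affine_eq_sum {T : Finset (E n)} (h : IsSimplex T) (g : E n →ᵃ[ℝ] ℝ) (x : E n) :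
    g x = ∑ z ∈ T, bary T z x * g z := by
  conv_lhs => rw [← h.sum_bary_smul x]
  exact sum_affine_apply T _ _ (h.sum_bary x) g

lemma IsSimplex.mem_hull_iff {T : Finset (E n)} (h : IsSimplex T) {x : E n} :
    x ∈ hull T ↔ ∀ z ∈ T, 0 ≤ bary T z x := by
  have := h.basis.convexHull_eq_nonneg_coord
  have hr : range h.basis = (T : Set (E n)) := by ext; simp
  rw [hr] at this
  rw [hull, this]
  simp only [Set.mem_ofPred_eq]
  constructor
  · intro H z hz
    simpa [h.bary_eq ⟨z, hz⟩] using H ⟨z, hz⟩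
  · intro H z
    simpa [h.bary_eq] using H z z.2

lemma IsSimplex.interior_hull {T : Finset (E n)} (h : IsSimplex T) :
    interior (hull T) = {x | ∀ z ∈ T, 0 < bary T z x} := by
  have := h.basis.interior_convexHull
  have hr : range h.basis = (T : Set (E n)) := by ext; simp
  rw [hr] at this
  rw [hull, this]
  ext x
  simp only [Set.mem_ofPred_eq]
  constructor
  · intro H z hz
    simpa [h.bary_eq ⟨z, hz⟩] using H ⟨z, hz⟩
  · intro H z
    simpa [h.bary_eq] using H z z.2

/-- A subset of the vertices spans the face where the other coordinates vanish. -/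
lemma IsSimplex.mem_hull_sub_iff {T S : Finset (E n)} (h : IsSimplex T) (hS : S ⊆ T) {x : E n} :
    x ∈ hull S ↔ (∀ z ∈ T, 0 ≤ bary T z x) ∧ ∀ z ∈ T, z ∉ S → bary T z x = 0 := by
  constructor
  · intro hx
    refine ⟨h.mem_hull_iff.1 (convexHull_mono (by exact_mod_cast hS) hx), fun z hz hzS => ?_⟩
    rw [hull, Finset.mem_convexHull'] at hx
    obtain ⟨w, -, hw1, rfl⟩ := hx
    rw [sum_affine_apply S w _ hw1]
    refine Finset.sum_eq_zero fun y hy => ?_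
    rw [h.bary_ne hz (hS hy) (by rintro rfl; exact hzS hy), mul_zero]
  · rintro ⟨h0, h1⟩
    rw [hull, Finset.mem_convexHull']
    refine ⟨fun z => bary T z x, fun z hz => h0 z (hS hz), ?_, ?_⟩
    · rw [Finset.sum_subset hS fun z hz hzS => h1 z hz hzS, h.sum_bary]
    · rw [Finset.sum_subset hS fun z hz hzS => by simp only [h1 z hz hzS, zero_smul], h.sum_bary_smul]

lemma continuous_affine (g : E n →ᵃ[ℝ] ℝ) : Continuous g :=
  AffineMap.continuous_of_finiteDimensional g

lemma isCompact_hull (T : Finset (E n)) : IsCompact (hull T) :=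
  T.finite_toSet.isCompact_convexHull ℝ

lemma isClosed_hull (T : Finset (E n)) : IsClosed (hull T) := (isCompact_hull T).isClosed

lemma convex_hull' (T : Finset (E n)) : Convex ℝ (hull T) := convex_convexHull ℝ _

lemma subset_hull {T : Finset (E n)} {z : E n} (hz : z ∈ T) : z ∈ hull T :=
  subset_convexHull ℝ _ (by exact_mod_cast hz)

lemma hull_mono {S T : Finset (E n)} (h : S ⊆ T) : hull S ⊆ hull T :=
  convexHull_mono (by exact_mod_cast h)

lemma volume_frontier_hull (T : Finset (E n)) : volume (frontier (hull T)) = 0 :=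
  (convex_hull' T).addHaar_frontier _

lemma interior_ae_eq_hull (T : Finset (E n)) : interior (hull T) =ᵐ[volume] hull T :=
  interior_ae_eq_of_null_frontier (volume_frontier_hull T)

lemma IsSimplex.interior_nonempty {T : Finset (E n)} (h : IsSimplex T) :
    (interior (hull T)).Nonempty := by
  have hr : range h.basis = (T : Set (E n)) := by ext; simp
  have := h.basis.tot
  rw [hr] at this
  rw [hull]
  exact interior_convexHull_nonempty_iff_affineSpan_eq_top.2 this

lemma IsSimplex.volume_pos {T : Finset (E n)} (h : IsSimplex T) : 0 < volume (hull T) :=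
  (isOpen_interior.measure_pos volume h.interior_nonempty).trans_le (measure_mono interior_subset)

lemma volume_hull_lt_top (T : Finset (E n)) : volume (hull T) < ⊤ :=
  (isCompact_hull T).measure_lt_top

lemma IsSimplex.volume_real_pos {T : Finset (E n)} (h : IsSimplex T) :
    0 < volume.real (hull T) :=
  ENNReal.toReal_pos h.volume_pos.ne' (volume_hull_lt_top T).ne

lemma IsSimplex.closure_interior_hull {T : Finset (E n)} (h : IsSimplex T) :
    closure (interior (hull T)) = hull T := by
  rw [(convex_hull' T).closure_interior_eq_closure_of_nonempty_interior h.interior_nonempty,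
    (isClosed_hull T).closure_eq]

lemma bary_linear_sub {T : Finset (E n)} (z x y : E n) :
    (bary T z).linear (x - y) = bary T z x - bary T z y := by
  have := (bary T z).linearMap_vsub x y
  simpa using this

lemma bary_add {T : Finset (E n)} (z x v : E n) :
    bary T z (x + v) = bary T z x + (bary T z).linear v := by
  have := (bary T z).map_vadd x v
  simp only [vadd_eq_add] at this
  rw [add_comm x v, this, add_comm]

/-! ### Integration over simplices and their faces -/

/-- Fubini for the orthogonal splitting along `ν`, followed by a shear: the direction `e` differs
from a multiple of `ν` by a tangential vector, which only translates each slice. The normal part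
rescales the line by `⟪ν, e⟫`. -/
lemma lintegral_eq_lintegral_slices {ν e : E n} (hν : ‖ν‖ = 1) (hne : ⟪ν, e⟫ ≠ 0) (p : E n)
    {g : E n → ENNReal} (hg : Measurable g) :
    ∫⁻ x, g x = ENNReal.ofReal |⟪ν, e⟫| * ∫⁻ q : (ℝ ∙ ν)ᗮ × ℝ, g (p + q.1 + q.2 • e) := by
  have hν0 : ν ≠ 0 := by rintro rfl; simp at hν
  have hvol : (μHE[Module.finrank ℝ (E n)] : Measure (E n)) = volume :=
    InnerProductSpace.euclideanHausdorffMeasure_eq_volume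
  have hmp := (ℝ ∙ ν).measurePreserving_measurableEquivProd p
  rw [hvol] at hmp
  have h1 := hmp.symm.lintegral_comp hg
  simp only [Submodule.measurableEquivProd_symm_apply] at h1
  rw [← h1]
  have hu : MeasurePreserving (LinearIsometryEquiv.toSpanUnitSingleton (𝕜 := ℝ) ν hν)
      (volume : Measure ℝ) (volume : Measure (ℝ ∙ ν)) := LinearIsometryEquiv.measurePreserving _
  set e' : (ℝ ∙ ν)ᗮ := (ℝ ∙ ν)ᗮ.orthogonalProjectionOnto e with he'
  have hee : (e : E n) = e' + ⟪ν, e⟫ • ν := by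
    have := Submodule.starProjection_add_starProjection_orthogonal (K := ℝ ∙ ν) e
    rw [Submodule.starProjection_unit_singleton ℝ hν] at this
    rw [add_comm] at this
    exact this.symm
  rw [Measure.volume_eq_prod, lintegral_prod _ (by fun_prop), ← hu.lintegral_comp (by fun_prop)]
  have h2 : ∀ F : ℝ → ENNReal, Measurable F →
      ∫⁻ s, F s = ENNReal.ofReal |⟪ν, e⟫| * ∫⁻ s, F (⟪ν, e⟫ * s) := by
    intro F hF
    have := Real.smul_map_volume_mul_left hne
    conv_lhs => rw [← this]
    rw [lintegral_smul_measure, lintegral_map hF (by fun_prop), smul_eq_mul]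
  rw [h2 _ (by fun_prop)]
  congr 1
  rw [Measure.volume_eq_prod, lintegral_prod_symm _ (by fun_prop)]
  refine lintegral_congr fun s => ?_
  dsimp only
  -- Translation invariance on the slice absorbs the tangential part of `s • e`.
  rw [← lintegral_add_right_eq_self _ (s • e')]
  refine lintegral_congr fun w => ?_
  congr 1
  rw [LinearIsometryEquiv.toSpanUnitSingleton_apply]
  simp only [vadd_eq_add, Submodule.coe_add, Submodule.coe_smul]
  conv_rhs => rw [hee]
  rw [smul_add, smul_smul, mul_comm]
  abel

/-- The previous identity on indicators says that Lebesgue measure is a multiple of an image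
measure, which makes it available for signed integrands. -/
lemma integral_eq_integral_slices {ν e : E n} (hν : ‖ν‖ = 1) (hne : ⟪ν, e⟫ ≠ 0) (p : E n)
    {g : E n → ℝ} (hg : Integrable g) :
    ∫ x, g x = |⟪ν, e⟫| * ∫ w : (ℝ ∙ ν)ᗮ, ∫ s : ℝ, g (p + w + s • e) := by
  have hm : (volume : Measure (E n)) = ENNReal.ofReal |⟪ν, e⟫| •
      Measure.map (fun q : (ℝ ∙ ν)ᗮ × ℝ => p + (q.1 : E n) + q.2 • e) volume := by
    ext s hs
    rw [Measure.smul_apply, Measure.map_apply (by fun_prop) hs, ← lintegral_indicator_one hs,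
      lintegral_eq_lintegral_slices hν hne p (measurable_one.indicator hs), smul_eq_mul,
      ← lintegral_indicator_one (hs.preimage (by fun_prop))]
    rfl
  have hc : ENNReal.ofReal |⟪ν, e⟫| ≠ 0 := by simpa using hne
  have hg' : Integrable g
      (Measure.map (fun q : (ℝ ∙ ν)ᗮ × ℝ => p + (q.1 : E n) + q.2 • e) volume) := by
    rw [hm] at hg
    rwa [integrable_smul_measure hc ENNReal.ofReal_ne_top] at hg
  rw [hm, integral_smul_measure, integral_map (by fun_prop) hg'.1, Measure.volume_eq_prod,
    integral_prod, ENNReal.toReal_ofReal (abs_nonneg _), smul_eq_mul]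
  have := (integrable_map_measure hg'.1 (by fun_prop)).1 hg'
  exact this

lemma finrank_orthogonal_unit {ν : E n} (hν : ‖ν‖ = 1) :
    Module.finrank ℝ (ℝ ∙ ν)ᗮ = n - 1 := by
  have hν0 : ν ≠ 0 := by rintro rfl; simp at hν
  have h := (ℝ ∙ ν).finrank_add_finrank_orthogonal
  rw [finrank_span_singleton hν0, finrank_euclideanSpace_fin] at h
  omega

/-- The Euclidean normalization of Hausdorff measure makes it agree with Lebesgue measure in
dimension `n - 1`, and isometries preserve it. Surface integrals over flat faces thereby become
Lebesgue integrals. -/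
lemma map_orthogonal_volume {ν : E n} (hν : ‖ν‖ = 1) (p : E n) :
    Measure.map (fun w : (ℝ ∙ ν)ᗮ => p + (w : E n)) volume =
      (μHE[n - 1] : Measure (E n)).restrict (range fun w : (ℝ ∙ ν)ᗮ => p + (w : E n)) := by
  have hf : Isometry (fun w : (ℝ ∙ ν)ᗮ => p + (w : E n)) :=
    (isometry_add_left p).comp isometry_subtype_coe
  rw [← hf.map_euclideanHausdorffMeasure, ← finrank_orthogonal_unit hν,
    InnerProductSpace.euclideanHausdorffMeasure_eq_volume]

lemma measurableEmbedding_add_orthogonal (ν p : E n) :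
    MeasurableEmbedding (fun w : (ℝ ∙ ν)ᗮ => p + (w : E n)) := by
  have hf : Isometry (fun w : (ℝ ∙ ν)ᗮ => p + (w : E n)) :=
    (isometry_add_left p).comp isometry_subtype_coe
  exact hf.isClosedEmbedding.measurableEmbedding

/-- Integrals over a subset of a hyperplane with respect to the surface measure. -/
lemma setIntegral_surface {ν : E n} (hν : ‖ν‖ = 1) (p : E n) {F : Set (E n)}
    (hF : MeasurableSet F) (hFH : ∀ x ∈ F, ⟪ν, x - p⟫ = 0) (g : E n → ℝ) :
    ∫ x in F, g x ∂μHE[n - 1] = ∫ w : (ℝ ∙ ν)ᗮ, F.indicator g (p + w) := by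
  have hsub : F ⊆ range fun w : (ℝ ∙ ν)ᗮ => p + (w : E n) := fun x hx =>
    ⟨⟨x - p, Submodule.mem_orthogonal_singleton_iff_inner_right.2 (hFH x hx)⟩, by simp⟩
  rw [← (measurableEmbedding_add_orthogonal ν p).integral_map, map_orthogonal_volume hν,
    integral_indicator hF, Measure.restrict_restrict hF, inter_eq_left.2 hsub]

lemma surface_lt_top {ν : E n} (hν : ‖ν‖ = 1) (p : E n) {F : Set (E n)}
    (hF : IsCompact F) (hFH : ∀ x ∈ F, ⟪ν, x - p⟫ = 0) :
    (μHE[n - 1] : Measure (E n)) F < ⊤ := by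
  have hsub : F ⊆ range fun w : (ℝ ∙ ν)ᗮ => p + (w : E n) := fun x hx =>
    ⟨⟨x - p, Submodule.mem_orthogonal_singleton_iff_inner_right.2 (hFH x hx)⟩, by simp⟩
  have hf : Isometry (fun w : (ℝ ∙ ν)ᗮ => p + (w : E n)) :=
    (isometry_add_left p).comp isometry_subtype_coe
  have : (μHE[n - 1] : Measure (E n)) F =
      Measure.map (fun w : (ℝ ∙ ν)ᗮ => p + (w : E n)) volume F := by
    rw [map_orthogonal_volume hν, Measure.restrict_apply hF.measurableSet, inter_eq_left.2 hsub]
  rw [this, (measurableEmbedding_add_orthogonal ν p).map_apply]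
  exact (hf.isClosedEmbedding.isCompact_preimage hF).measure_lt_top

/-- The height of the vertex `z` of the simplex `T` over the opposite face. -/
def height (T : Finset (E n)) (z : E n) : ℝ :=
  ‖LinearMap.toContinuousLinearMap (bary T z).linear‖⁻¹

lemma IsSimplex.exists_other {T : Finset (E n)} (h : IsSimplex T) (hn : 1 ≤ n) (z : E n) :
    ∃ a ∈ T, a ≠ z := by
  by_contra! H
  have : T ⊆ {z} := fun a ha => by simpa using H a ha
  have := Finset.card_le_card this
  rw [h.1] at this
  simp at this
  omega

lemma IsSimplex.height_pos {T : Finset (E n)} (h : IsSimplex T) (hn : 1 ≤ n) {z : E n}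
    (hz : z ∈ T) : 0 < height T z := by
  obtain ⟨a, ha, haz⟩ := h.exists_other hn z
  rw [height, inv_pos, norm_pos_iff]
  intro h0
  have h1 := bary_linear_sub (T := T) z z a
  rw [h.bary_self hz, h.bary_ne hz ha haz] at h1
  have h2 := congrArg (fun f => f (z - a)) h0
  simp only [LinearMap.coe_toContinuousLinearMap', zero_apply] at h2
  linarith

/-- The normalized negative gradient of the barycentric coordinate of `z` meets the conditions in
`outerNormal`, so the choice there is meaningful. Conversely, those conditions force every candidate
to be this vector. -/
lemma IsSimplex.outerNormal_spec {T : Finset (E n)} (h : IsSimplex T) (hn : 1 ≤ n) {z : E n}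
    (hz : z ∈ T) : ‖outerNormal T (T.erase z)‖ = 1 ∧
    ∀ v, ⟪outerNormal T (T.erase z), v⟫ = -height T z * (bary T z).linear v := by
  set L := LinearMap.toContinuousLinearMap (bary T z).linear with hL
  have hh := h.height_pos hn hz
  have hspec : ∃ ν : E n, ‖ν‖ = 1 ∧ (∀ x ∈ T.erase z, ∀ y ∈ T.erase z, ⟪ν, x - y⟫ = 0) ∧
      ∀ x ∈ T.erase z, ∀ w ∈ T, ⟪ν, w - x⟫ ≤ 0 := by
    refine ⟨(-height T z) • (InnerProductSpace.toDual ℝ (E n)).symm L, ?_, ?_, ?_⟩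
    · rw [norm_smul, LinearIsometryEquiv.norm_map, Real.norm_eq_abs, abs_neg, abs_of_pos hh]
      exact inv_mul_cancel₀ (inv_pos.1 hh).ne'
    · intro x hx y hy
      rw [Finset.mem_erase] at hx hy
      rw [inner_smul_left, InnerProductSpace.toDual_symm_apply, hL,
        LinearMap.coe_toContinuousLinearMap', bary_linear_sub, h.bary_ne hz hx.2 hx.1,
        h.bary_ne hz hy.2 hy.1]
      simp
    · intro x hx w hw
      rw [Finset.mem_erase] at hx
      rw [inner_smul_left, InnerProductSpace.toDual_symm_apply, hL,
        LinearMap.coe_toContinuousLinearMap', bary_linear_sub, h.bary_ne hz hx.2 hx.1]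
      have : 0 ≤ bary T z w := h.mem_hull_iff.1 (subset_hull hw) z hz
      simp only [conj_trivial, sub_zero]
      nlinarith
  set ν := outerNormal T (T.erase z)
  obtain ⟨h1, h2, h3⟩ : ‖ν‖ = 1 ∧ (∀ x ∈ T.erase z, ∀ y ∈ T.erase z, ⟪ν, x - y⟫ = 0) ∧
      ∀ x ∈ T.erase z, ∀ w ∈ T, ⟪ν, w - x⟫ ≤ 0 := Classical.epsilon_spec hspec
  refine ⟨h1, ?_⟩
  obtain ⟨a, ha, haz⟩ := h.exists_other hn z
  set η := ⟪ν, a - z⟫ with hη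
  have hη0 : 0 ≤ η := by
    have := h3 a (Finset.mem_erase.2 ⟨haz, ha⟩) z hz
    rw [hη, ← neg_sub z a, inner_neg_right]
    exact neg_nonneg.2 this
  -- Expand `v` in the edges issuing from the vertex `a` of the face. All of them except the edge to
  -- `z` are orthogonal to `ν`.
  have key : ∀ v, ⟪ν, v⟫ = -η * (bary T z).linear v := by
    intro v
    have hv : v = ∑ w ∈ T, (bary T w).linear v • (w - a) := by
      have e1 := h.sum_bary_smul (a + v)
      have e2 := h.sum_bary_smul a
      have e3 := h.sum_bary (a + v)
      have e4 := h.sum_bary a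
      simp only [bary_add, add_smul, Finset.sum_add_distrib] at e1 e3
      rw [e2] at e1
      rw [e4] at e3
      have e5 : ∑ w ∈ T, (bary T w).linear v = 0 := by linarith
      simp only [smul_sub, Finset.sum_sub_distrib, ← Finset.sum_smul, e5, zero_smul, sub_zero]
      exact (add_left_cancel e1).symm
    conv_lhs => rw [hv]
    rw [inner_sum, Finset.sum_eq_single z]
    · rw [inner_smul_right, ← neg_sub a z, inner_neg_right, ← hη]
      ring
    · intro w hw hwz
      rw [inner_smul_right, h2 w (Finset.mem_erase.2 ⟨hwz, hw⟩) a (Finset.mem_erase.2 ⟨haz, ha⟩),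
        mul_zero]
    · exact fun H => absurd hz H
  have hνL : ν = (-η) • (InnerProductSpace.toDual ℝ (E n)).symm L := by
    refine ext_inner_right ℝ fun v => ?_
    rw [key, inner_smul_left, InnerProductSpace.toDual_symm_apply]
    simp [hL]
  have hηh : η = height T z := by
    have : ‖ν‖ = η * ‖L‖ := by
      rw [hνL, norm_smul, LinearIsometryEquiv.norm_map, Real.norm_eq_abs, abs_neg,
        abs_of_nonneg hη0]
    rw [h1] at this
    rw [height]
    exact eq_inv_of_mul_eq_one_left this.symm
  rw [← hηh]
  exact key

lemma IsSimplex.mem_face_iff {T : Finset (E n)} (h : IsSimplex T) {z x : E n} (hz : z ∈ T) :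
    x ∈ hull (T.erase z) ↔ (∀ w ∈ T, 0 ≤ bary T w x) ∧ bary T z x = 0 := by
  rw [h.mem_hull_sub_iff (Finset.erase_subset _ _)]
  refine and_congr_right fun _ => ⟨fun H => H z hz (by simp), fun H w hw hwn => ?_⟩
  have : w = z := by
    by_contra hne
    exact hwn (Finset.mem_erase.2 ⟨hne, hw⟩)
  rw [this, H]

lemma IsSimplex.face_hyperplane {T : Finset (E n)} (h : IsSimplex T) (hn : 1 ≤ n) {z p : E n}
    (hz : z ∈ T) (hp : bary T z p = 0) :
    ∀ x ∈ hull (T.erase z), ⟪outerNormal T (T.erase z), x - p⟫ = 0 := by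
  intro x hx
  rw [(h.outerNormal_spec hn hz).2, bary_linear_sub, hp, ((h.mem_face_iff hz).1 hx).2]
  simp

lemma IsSimplex.surface_face_lt_top {T : Finset (E n)} (h : IsSimplex T) (hn : 1 ≤ n) {z : E n}
    (hz : z ∈ T) : (μHE[n - 1] : Measure (E n)) (hull (T.erase z)) < ⊤ := by
  obtain ⟨a, ha, haz⟩ := h.exists_other hn z
  exact surface_lt_top (h.outerNormal_spec hn hz).1 a (isCompact_hull _)
    (h.face_hyperplane hn hz (h.bary_ne hz ha haz))

lemma IsSimplex.bary_orthogonal {T : Finset (E n)} (h : IsSimplex T) (hn : 1 ≤ n) {z : E n}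
    (hz : z ∈ T) (w : (ℝ ∙ outerNormal T (T.erase z))ᗮ) : (bary T z).linear (w : E n) = 0 := by
  have h1 := (h.outerNormal_spec hn hz).2 w
  rw [Submodule.mem_orthogonal_singleton_iff_inner_right.1 w.2] at h1
  have := h.height_pos hn hz
  have h2 : height T z * (bary T z).linear (w : E n) = 0 := by linarith
  exact (mul_eq_zero.1 h2).resolve_left this.ne'

/-! ### The divergence theorem on a simplex -/

section Divergence

variable {T : Finset (E n)} {a b : E n}

/-- The projection along `a - b` onto the face opposite to `a` maps the face opposite to `b` onto
the face opposite to `a`. -/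
lemma IsSimplex.proj_mem_face_iff (h : IsSimplex T) (ha : a ∈ T) (hb : b ∈ T) (hab : a ≠ b)
    {x : E n} (hx : bary T b x = 0) :
    x - bary T a x • (a - b) ∈ hull (T.erase a) ↔ x ∈ hull (T.erase b) := by
  have hc : ∀ c ∈ T, bary T c (x - bary T a x • (a - b)) =
      bary T c x - bary T a x * (bary T c a - bary T c b) := by
    intro c _
    rw [sub_eq_add_neg, bary_add, map_neg, map_smul, bary_linear_sub, smul_eq_mul]
    ring
  rw [h.mem_face_iff ha, h.mem_face_iff hb]
  constructor
  · rintro ⟨h0, -⟩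
    refine ⟨fun c hcT => ?_, hx⟩
    have h1 := h0 c hcT
    rw [hc c hcT] at h1
    by_cases hca : c = a
    · subst hca
      have h2 := h0 b hb
      rw [hc b hb, hx, h.bary_ne hb ha hab, h.bary_self hb] at h2
      linarith
    by_cases hcb : c = b
    · rw [hcb, hx]
    rw [h.bary_ne hcT ha (Ne.symm hca), h.bary_ne hcT hb (Ne.symm hcb)] at h1
    linarith
  · rintro ⟨h0, -⟩
    refine ⟨fun c hcT => ?_, ?_⟩
    · rw [hc c hcT]
      by_cases hca : c = a
      · subst hca
        rw [h.bary_self ha, h.bary_ne ha hb (Ne.symm hab)]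
        linarith
      by_cases hcb : c = b
      · subst hcb
        rw [hx, h.bary_self hb, h.bary_ne hb ha hab]
        linarith [h0 a ha]
      rw [h.bary_ne hcT ha (Ne.symm hca), h.bary_ne hcT hb (Ne.symm hcb)]
      linarith [h0 c hcT]
    · rw [hc a ha, h.bary_self ha, h.bary_ne ha hb (Ne.symm hab)]
      linarith

lemma IsSimplex.linear_edge (h : IsSimplex T) (ha : a ∈ T) (hb : b ∈ T) (hab : a ≠ b) :
    (bary T a).linear (a - b) = 1 ∧ (bary T b).linear (a - b) = -1 := by
  rw [bary_linear_sub, bary_linear_sub, h.bary_self ha, h.bary_ne ha hb hab.symm,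
    h.bary_self hb, h.bary_ne hb ha hab]
  norm_num

/-- Integrals over two faces are related by the projection along the edge. -/
lemma IsSimplex.height_mul_integral_proj (h : IsSimplex T) (hn : 1 ≤ n) (ha : a ∈ T) (hb : b ∈ T)
    (hab : a ≠ b) {g : E n → ℝ} (hg : Continuous g) :
    height T b * ∫ x in hull (T.erase b), g (x - bary T a x • (a - b)) ∂μHE[n - 1] =
      height T a * ∫ x in hull (T.erase a), g x ∂μHE[n - 1] := by
  set e := a - b with he
  set π : E n → E n := fun x => x - bary T a x • e with hπ
  have hπc : Continuous π := by
    have := continuous_affine (bary T a)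
    fun_prop
  obtain ⟨hea, heb⟩ : (bary T a).linear e = 1 ∧ (bary T b).linear e = -1 :=
    h.linear_edge ha hb hab
  have hha := h.height_pos hn ha
  have hhb := h.height_pos hn hb
  obtain ⟨hνa, hsa⟩ := h.outerNormal_spec hn ha
  obtain ⟨hνb, hsb⟩ := h.outerNormal_spec hn hb
  -- `Q` is a prism over the face opposite to `a` with unit length in the direction `e`. Slicing its
  -- integral from the hyperplanes of the two faces gives the two sides of the claim.
  set Q : Set (E n) := {x | π x ∈ hull (T.erase a) ∧ bary T a x ∈ Icc (0 : ℝ) 1} with hQ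
  have hQclosed : IsClosed Q :=
    ((isClosed_hull _).preimage hπc).inter (isClosed_Icc.preimage (continuous_affine _))
  have hQc : IsCompact Q := by
    have hK : IsCompact ((fun q : E n × ℝ => q.1 + q.2 • e) ''
        (hull (T.erase a) ×ˢ Icc (0 : ℝ) 1)) :=
      ((isCompact_hull _).prod isCompact_Icc).image (by fun_prop)
    refine hK.of_isClosed_subset hQclosed fun x hx => ?_
    exact ⟨(π x, bary T a x), ⟨hx.1, hx.2⟩, by simp [hπ]⟩
  have hint : Integrable (Q.indicator fun x => g (π x)) :=
    (((hg.comp hπc).continuousOn).integrableOn_compact hQc).integrable_indicator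
      hQclosed.measurableSet
  have hpis : ∀ (x : E n) (s : ℝ), π (x + s • e) = π x := by
    intro x s
    simp only [hπ, bary_add, map_smul, hea, smul_eq_mul, mul_one, add_smul]
    abel
  have hbs : ∀ (x : E n) (s : ℝ), bary T a (x + s • e) = bary T a x + s := by
    intro x s
    simp [bary_add, hea]
  -- The integrand is constant along `e`, and a line over the base meets the prism in an interval of
  -- length one.
  have hinner : ∀ x, ∫ s : ℝ, Q.indicator (fun x => g (π x)) (x + s • e) =
      (hull (T.erase a)).indicator g (π x) := by
    intro x
    have : ∀ s : ℝ, Q.indicator (fun x => g (π x)) (x + s • e) =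
        (Icc (0 : ℝ) 1).indicator (fun _ => (hull (T.erase a)).indicator g (π x))
          (s + bary T a x) := by
      intro s
      by_cases h1 : π x ∈ hull (T.erase a) <;> by_cases h2 : s + bary T a x ∈ Icc (0 : ℝ) 1
      · have : x + s • e ∈ Q := ⟨by rwa [hpis], by rwa [hbs, add_comm]⟩
        rw [indicator_of_mem this, indicator_of_mem h2, indicator_of_mem h1, hpis]
      · have : x + s • e ∉ Q := fun H => h2 (by have := H.2; rwa [hbs, add_comm] at this)
        rw [indicator_of_notMem this, indicator_of_notMem h2]
      · have : x + s • e ∉ Q := fun H => h1 (by have := H.1; rwa [hpis] at this)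
        rw [indicator_of_notMem this, indicator_of_mem h2, indicator_of_notMem h1]
      · have : x + s • e ∉ Q := fun H => h1 (by have := H.1; rwa [hpis] at this)
        rw [indicator_of_notMem this, indicator_of_notMem h2]
    simp_rw [this]
    rw [integral_add_right_eq_self (fun s => (Icc (0 : ℝ) 1).indicator
      (fun _ => (hull (T.erase a)).indicator g (π x)) s), integral_indicator measurableSet_Icc]
    simp
  have I1 := integral_eq_integral_slices (e := e) hνa (by rw [hsa, hea]; simpa using hha.ne') b hint
  have I2 := integral_eq_integral_slices (e := e) hνb (by rw [hsb, heb]; simpa using hhb.ne') a hint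
  rw [I1] at I2
  simp only [hinner] at I2
  rw [hsa, hea, hsb, heb, mul_one, abs_neg, abs_of_pos hha, mul_neg_one, neg_neg,
    abs_of_pos hhb] at I2
  rw [setIntegral_surface hνb a (isClosed_hull _).measurableSet
      (h.face_hyperplane hn hb (h.bary_ne hb ha hab)),
    setIntegral_surface hνa b (isClosed_hull _).measurableSet
      (h.face_hyperplane hn ha (h.bary_ne ha hb hab.symm))]
  refine Eq.trans ?_ (I2.symm.trans ?_)
  · congr 1
    refine integral_congr_ae (Filter.Eventually.of_forall fun w => ?_)
    dsimp only
    have hw0 : bary T b (a + (w : E n)) = 0 := by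
      rw [bary_add, h.bary_ne hb ha hab, h.bary_orthogonal hn hb]; simp
    have := h.proj_mem_face_iff ha hb hab hw0
    by_cases hm : a + (w : E n) ∈ hull (T.erase b)
    · rw [indicator_of_mem hm, indicator_of_mem (this.2 hm)]
    · rw [indicator_of_notMem hm, indicator_of_notMem (fun H => hm (this.1 H))]
  · congr 1
    refine integral_congr_ae (Filter.Eventually.of_forall fun w => ?_)
    dsimp only
    have hw0 : bary T a (b + (w : E n)) = 0 := by
      rw [bary_add, h.bary_ne ha hb hab.symm, h.bary_orthogonal hn ha]; simp
    have : π (b + (w : E n)) = b + w := by simp [hπ, hw0]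
    rw [this]

/-- Fundamental theorem of calculus on the lines parallel to the edge. A line that meets the simplex
runs from the face opposite to `a` to the face opposite to `b`, and the end value on the former is
moved there by `height_mul_integral_proj`. -/
lemma IsSimplex.integral_fderiv_edge (h : IsSimplex T) (hn : 1 ≤ n) (ha : a ∈ T) (hb : b ∈ T)
    (hab : a ≠ b) {g : E n → ℝ} (hg : ContDiff ℝ 1 g) :
    ∫ x in hull T, fderiv ℝ g x (a - b) =
      height T b * ∫ x in hull (T.erase b), g x ∂μHE[n - 1] -
      height T a * ∫ x in hull (T.erase a), g x ∂μHE[n - 1] := by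
  rw [← h.height_mul_integral_proj hn ha hb hab hg.continuous]
  set e := a - b with he
  obtain ⟨hea, heb⟩ := h.linear_edge ha hb hab
  have hhb := h.height_pos hn hb
  obtain ⟨hνb, hsb⟩ := h.outerNormal_spec hn hb
  have hdc : Continuous fun x => fderiv ℝ g x e :=
    (hg.continuous_fderiv one_ne_zero).clm_apply continuous_const
  have hint : Integrable ((hull T).indicator fun x => fderiv ℝ g x e) :=
    (hdc.continuousOn.integrableOn_compact (isCompact_hull T)).integrable_indicator
      (isClosed_hull T).measurableSet
  have I := integral_eq_integral_slices (e := e) hνb (by rw [hsb, heb]; simpa using hhb.ne') a hint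
  rw [integral_indicator (isClosed_hull T).measurableSet] at I
  have hgi : ∀ {f : E n → ℝ}, Continuous f →
      Integrable f ((μHE[n - 1] : Measure (E n)).restrict (hull (T.erase b))) := by
    intro f hf
    have hfin := h.surface_face_lt_top hn hb
    obtain ⟨C, hC⟩ := (isCompact_hull (T.erase b)).exists_bound_of_continuousOn hf.continuousOn
    exact Measure.integrableOn_of_bounded hfin.ne hf.aestronglyMeasurable
      ((ae_restrict_iff' (isClosed_hull _).measurableSet).2 (Filter.Eventually.of_forall hC))
  have hπc : Continuous fun x => x - bary T a x • e := by
    have := continuous_affine (bary T a)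
    fun_prop
  rw [I, hsb, heb, mul_neg_one, neg_neg, abs_of_pos hhb, ← mul_sub,
    ← integral_sub (hgi hg.continuous) (hgi (f := fun x => g (x - bary T a x • e))
      (hg.continuous.comp hπc)),
    setIntegral_surface hνb a (isClosed_hull _).measurableSet
      (h.face_hyperplane hn hb (h.bary_ne hb ha hab))]
  congr 1
  refine integral_congr_ae (Filter.Eventually.of_forall fun w => ?_)
  dsimp only
  set x := a + (w : E n) with hx
  have hw0 : bary T b x = 0 := by
    rw [hx, bary_add, h.bary_ne hb ha hab, h.bary_orthogonal hn hb]; simp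
  have hcoord : ∀ c ∈ T, ∀ s : ℝ, bary T c (x + s • e) =
      bary T c x + s * (bary T c a - bary T c b) := by
    intro c _ s
    rw [bary_add, map_smul, he, bary_linear_sub, smul_eq_mul]
  by_cases hm : x ∈ hull (T.erase b)
  · rw [indicator_of_mem hm]
    have hpos := (h.mem_face_iff hb).1 hm
    have hset : ∀ s : ℝ, (hull T).indicator (fun x => fderiv ℝ g x e) (x + s • e) =
        (Icc (-bary T a x) 0).indicator (fun s => fderiv ℝ g (x + s • e) e) s := by
      intro s
      -- Only the coordinates of `a` and `b` change along the line; they are `bary T a x + s` and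
      -- `-s`.
      have : x + s • e ∈ hull T ↔ s ∈ Icc (-bary T a x) 0 := by
        rw [h.mem_hull_iff]
        constructor
        · intro H
          have h1 := H a ha
          have h2 := H b hb
          rw [hcoord a ha, h.bary_self ha, h.bary_ne ha hb hab.symm] at h1
          rw [hcoord b hb, h.bary_self hb, h.bary_ne hb ha hab, hw0] at h2
          constructor <;> linarith
        · rintro ⟨h1, h2⟩ c hc
          rw [hcoord c hc]
          by_cases hca : c = a
          · subst hca
            rw [h.bary_self ha, h.bary_ne ha hb hab.symm]
            linarith
          by_cases hcb : c = b
          · subst hcb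
            rw [h.bary_self hb, h.bary_ne hb ha hab, hw0]
            linarith
          rw [h.bary_ne hc ha (Ne.symm hca), h.bary_ne hc hb (Ne.symm hcb)]
          linarith [hpos.1 c hc]
      by_cases hs : s ∈ Icc (-bary T a x) 0
      · rw [indicator_of_mem hs, indicator_of_mem (this.2 hs)]
      · rw [indicator_of_notMem hs, indicator_of_notMem (fun H => hs (this.1 H))]
    simp_rw [hset]
    rw [integral_indicator measurableSet_Icc, integral_Icc_eq_integral_Ioc,
      ← intervalIntegral.integral_of_le (by linarith [hpos.1 a ha])]
    have hderiv : ∀ s ∈ uIcc (-bary T a x) 0,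
        HasDerivAt (fun s : ℝ => g (x + s • e)) (fderiv ℝ g (x + s • e) e) s := by
      intro s _
      have h1 : HasDerivAt (fun s : ℝ => x + s • e) e s := by
        simpa using ((hasDerivAt_id s).smul_const e).const_add x
      exact ((hg.differentiable one_ne_zero _).hasFDerivAt).comp_hasDerivAt s h1
    rw [intervalIntegral.integral_eq_sub_of_hasDerivAt hderiv]
    · simp [sub_eq_add_neg]
    · exact (hdc.comp (by fun_prop)).intervalIntegrable _ _
  · rw [indicator_of_notMem hm]
    have hz : ∀ s : ℝ, (hull T).indicator (fun x => fderiv ℝ g x e) (x + s • e) = 0 := by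
      intro s
      refine indicator_of_notMem (fun H => hm ?_) _
      rw [h.mem_hull_iff] at H
      refine (h.mem_face_iff hb).2 ⟨fun c hc => ?_, hw0⟩
      have h1 := H c hc
      have h2 := H b hb
      rw [hcoord c hc] at h1
      rw [hcoord b hb, h.bary_self hb, h.bary_ne hb ha hab, hw0] at h2
      by_cases hca : c = a
      · subst hca
        rw [h.bary_self ha, h.bary_ne ha hb hab.symm] at h1
        linarith
      by_cases hcb : c = b
      · rw [hcb, hw0]
      rw [h.bary_ne hc ha (Ne.symm hca), h.bary_ne hc hb (Ne.symm hcb)] at h1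
      linarith
    simp [hz]

lemma IsSimplex.integrableOn_face (h : IsSimplex T) (hn : 1 ≤ n) {z : E n} (hz : z ∈ T)
    {f : E n → ℝ} (hf : ContinuousOn f (hull (T.erase z))) :
    IntegrableOn f (hull (T.erase z)) (μHE[n - 1]) := by
  have hfin := h.surface_face_lt_top hn hz
  obtain ⟨C, hC⟩ := (isCompact_hull (T.erase z)).exists_bound_of_continuousOn hf
  exact IntegrableOn.of_bound hfin (hf.aestronglyMeasurable (isClosed_hull _).measurableSet) C
    ((ae_restrict_iff' (isClosed_hull _).measurableSet).2 (Filter.Eventually.of_forall hC))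

/-- The divergence theorem on a simplex, for a derivative in a fixed direction. -/
lemma IsSimplex.integral_fderiv (h : IsSimplex T) (hn : 1 ≤ n) {g : E n → ℝ}
    (hg : ContDiff ℝ 1 g) (v : E n) :
    ∫ x in hull T, fderiv ℝ g x v =
      ∑ z ∈ T, ⟪outerNormal T (T.erase z), v⟫ * ∫ x in hull (T.erase z), g x ∂μHE[n - 1] := by
  have hne : T.Nonempty := Finset.card_pos.1 (by rw [h.1]; omega)
  obtain ⟨b, hb⟩ := hne
  -- The edges from a fixed vertex `b` span all directions. Since the coefficients add up to zero,
  -- the term `height T b * S b` common to all edge formulas drops out in the end.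
  have hv : v = ∑ w ∈ T, (bary T w).linear v • (w - b) := by
    have e1 := h.sum_bary_smul (b + v)
    have e2 := h.sum_bary_smul b
    have e3 := h.sum_bary (b + v)
    have e4 := h.sum_bary b
    simp only [bary_add, add_smul, Finset.sum_add_distrib] at e1 e3
    rw [e2] at e1
    rw [e4] at e3
    have e5 : ∑ w ∈ T, (bary T w).linear v = 0 := by linarith
    simp only [smul_sub, Finset.sum_sub_distrib, ← Finset.sum_smul, e5, zero_smul, sub_zero]
    exact (add_left_cancel e1).symm
  have e5 : ∑ w ∈ T, (bary T w).linear v = 0 := by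
    have e3 := h.sum_bary (b + v)
    have e4 := h.sum_bary b
    simp only [bary_add, Finset.sum_add_distrib] at e3
    linarith
  have hint : ∀ u, Integrable (fun x => fderiv ℝ g x u) (volume.restrict (hull T)) := fun u =>
    ((hg.continuous_fderiv one_ne_zero).clm_apply continuous_const).continuousOn.integrableOn_compact
      (isCompact_hull T)
  set S : E n → ℝ := fun z => ∫ x in hull (T.erase z), g x ∂μHE[n - 1] with hS
  have hedge : ∀ w ∈ T, ∫ x in hull T, fderiv ℝ g x (w - b) =
      height T b * S b - height T w * S w := by
    intro w hw
    by_cases hwb : w = b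
    · subst hwb; simp
    · exact h.integral_fderiv_edge hn hw hb hwb hg
  calc ∫ x in hull T, fderiv ℝ g x v
      = ∫ x in hull T, ∑ w ∈ T, (bary T w).linear v * fderiv ℝ g x (w - b) := by
        conv_lhs => rw [hv]
        simp only [map_sum, map_smul, smul_eq_mul]
    _ = ∑ w ∈ T, (bary T w).linear v * (height T b * S b - height T w * S w) := by
        rw [integral_finsetSum _ fun w _ => (hint _).const_mul _]
        refine Finset.sum_congr rfl fun w hw => ?_
        rw [integral_const_mul, hedge w hw]
    _ = _ := by
        simp only [mul_sub, Finset.sum_sub_distrib, ← Finset.sum_mul, e5, zero_mul, zero_sub]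
        rw [← Finset.sum_neg_distrib]
        refine Finset.sum_congr rfl fun z hz => ?_
        rw [(h.outerNormal_spec hn hz).2]
        ring

lemma divergence_eq_sum {X : E n → E n} (hX : ContDiff ℝ 1 X) (x : E n) :
    divergence X x = ∑ j, fderiv ℝ (fun y => (X y).ofLp j) x (EuclideanSpace.single j 1) := by
  refine Finset.sum_congr rfl fun j _ => ?_
  have h1 : HasFDerivAt (fun y => (X y).ofLp j)
      ((EuclideanSpace.proj j : E n →L[ℝ] ℝ).comp (fderiv ℝ X x)) x :=
    ((EuclideanSpace.proj j : E n →L[ℝ] ℝ).hasFDerivAt).comp x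
      (hX.differentiable one_ne_zero x).hasFDerivAt
  rw [h1.fderiv]
  rfl

lemma continuous_divergence {X : E n → E n} (hX : ContDiff ℝ 1 X) :
    Continuous (divergence X) := by
  unfold divergence
  refine continuous_finsetSum _ fun j _ => ?_
  have := (hX.continuous_fderiv one_ne_zero).clm_apply
    (continuous_const (y := EuclideanSpace.single j (1 : ℝ)))
  exact (EuclideanSpace.proj j : E n →L[ℝ] ℝ).continuous.comp this

/-- The divergence theorem on a simplex. -/
lemma IsSimplex.integral_divergence (h : IsSimplex T) (hn : 1 ≤ n) {X : E n → E n}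
    (hX : ContDiff ℝ 1 X) :
    ∫ x in hull T, divergence X x =
      ∑ z ∈ T, ∫ x in hull (T.erase z), ⟪outerNormal T (T.erase z), X x⟫ ∂μHE[n - 1] := by
  have hXj : ∀ j, ContDiff ℝ 1 fun y => (X y).ofLp j := fun j =>
    (EuclideanSpace.proj j : E n →L[ℝ] ℝ).contDiff.comp hX
  simp only [divergence_eq_sum hX]
  rw [integral_finsetSum]
  · simp only [h.integral_fderiv hn (hXj _)]
    rw [Finset.sum_comm]
    refine Finset.sum_congr rfl fun z hz => ?_
    simp only [← integral_const_mul]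
    rw [← integral_finsetSum]
    · refine integral_congr_ae (Filter.Eventually.of_forall fun x => ?_)
      simp only [PiLp.inner_apply]
      refine Finset.sum_congr rfl fun j _ => ?_
      simp [mul_comm]
    · intro j _
      exact h.integrableOn_face hn hz ((hXj j).continuous.const_mul _).continuousOn
  · intro j _
    exact (((hXj j).continuous_fderiv one_ne_zero).clm_apply
      continuous_const).continuousOn.integrableOn_compact (isCompact_hull T)

end Divergence

/-! ### Cauchy-Schwarz, Poincaré and trace inequalities -/

/-- The quadratic polynomial `t ↦ ∫ (t f + g)²` is nonnegative, so its discriminant is not positive.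
-/
lemma sq_integral_mul_le {α : Type*} [MeasurableSpace α] {μ : Measure α} {f g : α → ℝ}
    (hf : MemLp f 2 μ) (hg : MemLp g 2 μ) :
    (∫ x, f x * g x ∂μ) ^ 2 ≤ (∫ x, f x ^ 2 ∂μ) * ∫ x, g x ^ 2 ∂μ := by
  have hfg : Integrable (fun x => f x * g x) μ := hf.integrable_mul hg
  have hf2 : Integrable (fun x => f x ^ 2) μ := hf.integrable_sq
  have hg2 : Integrable (fun x => g x ^ 2) μ := hg.integrable_sq
  have key : ∀ t : ℝ, 0 ≤ (∫ x, f x ^ 2 ∂μ) * (t * t) + (2 * ∫ x, f x * g x ∂μ) * t +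
      ∫ x, g x ^ 2 ∂μ := by
    intro t
    have h0 : 0 ≤ ∫ x, (t * f x + g x) ^ 2 ∂μ := integral_nonneg fun x => sq_nonneg _
    have h1 : (fun x => (t * f x + g x) ^ 2) =
        fun x => (t * t) * f x ^ 2 + (2 * t) * (f x * g x) + g x ^ 2 := by
      funext x; ring
    have e1 : Integrable (fun x => (t * t) * f x ^ 2 + (2 * t) * (f x * g x)) μ :=
      (hf2.const_mul _).add (hfg.const_mul _)
    rw [h1, integral_add e1 hg2,
      integral_add (hf2.const_mul _) (hfg.const_mul _), integral_const_mul,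
      integral_const_mul] at h0
    linarith
  have := discrim_le_zero key
  rw [discrim] at this
  nlinarith

lemma abs_integral_mul_le {α : Type*} [MeasurableSpace α] {μ : Measure α} {f g : α → ℝ}
    (hf : MemLp f 2 μ) (hg : MemLp g 2 μ) :
    |∫ x, f x * g x ∂μ| ≤ √(∫ x, f x ^ 2 ∂μ) * √(∫ x, g x ^ 2 ∂μ) := by
  rw [← Real.sqrt_mul (integral_nonneg fun x => sq_nonneg _), ← Real.sqrt_sq_eq_abs]
  exact Real.sqrt_le_sqrt (sq_integral_mul_le hf hg)

lemma memLp_two_of_continuousOn {K : Set (E n)} (hK : IsCompact K) {μ : Measure (E n)}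
    (hμ : μ K < ⊤) {f : E n → ℝ} (hf : ContinuousOn f K) : MemLp f 2 (μ.restrict K) := by
  obtain ⟨C, hC⟩ := hK.exists_bound_of_continuousOn hf
  have : IsFiniteMeasure (μ.restrict K) := ⟨by rwa [Measure.restrict_apply_univ]⟩
  exact MemLp.of_bound (hf.aestronglyMeasurable hK.measurableSet) C
    ((ae_restrict_iff' hK.measurableSet).2 (Filter.Eventually.of_forall hC))

lemma sq_sub_le_integral_segment {g : E n → ℝ} (hg : ContDiff ℝ 1 g) (x y : E n) :
    (g x - g y) ^ 2 ≤ dist x y ^ 2 *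
      ∫ t in Icc (0 : ℝ) 1, ‖fderiv ℝ g (y + t • (x - y))‖ ^ 2 := by
  have hc : Continuous fun t : ℝ => fderiv ℝ g (y + t • (x - y)) :=
    (hg.continuous_fderiv one_ne_zero).comp (by fun_prop)
  have hderiv : ∀ s ∈ uIcc (0 : ℝ) 1, HasDerivAt (fun s : ℝ => g (y + s • (x - y)))
      (fderiv ℝ g (y + s • (x - y)) (x - y)) s := by
    intro s _
    have h1 : HasDerivAt (fun s : ℝ => y + s • (x - y)) (x - y) s := by
      simpa using ((hasDerivAt_id s).smul_const (x - y)).const_add y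
    exact ((hg.differentiable one_ne_zero _).hasFDerivAt).comp_hasDerivAt s h1
  have hcd : Continuous fun t : ℝ => fderiv ℝ g (y + t • (x - y)) (x - y) :=
    hc.clm_apply continuous_const
  have hI := intervalIntegral.integral_eq_sub_of_hasDerivAt hderiv (hcd.intervalIntegrable _ _)
  rw [intervalIntegral.integral_of_le zero_le_one, ← integral_Icc_eq_integral_Ioc] at hI
  simp only [one_smul, add_sub_cancel, zero_smul, add_zero] at hI
  have : IsFiniteMeasure (volume.restrict (Icc (0 : ℝ) 1)) := ⟨by simp⟩
  have hL : ∀ {f : ℝ → ℝ}, Continuous f → MemLp f 2 (volume.restrict (Icc (0 : ℝ) 1)) := by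
    intro f hf
    obtain ⟨C, hC⟩ := isCompact_Icc.exists_bound_of_continuousOn (s := Icc (0 : ℝ) 1) hf.continuousOn
    exact MemLp.of_bound hf.aestronglyMeasurable C
      ((ae_restrict_iff' measurableSet_Icc).2 (Filter.Eventually.of_forall hC))
  have hCS := sq_integral_mul_le (hL hcd) (hL (continuous_const (y := (1 : ℝ))))
  simp only [mul_one, one_pow, integral_const, measureReal_restrict_apply_univ,
    Real.volume_real_Icc_of_le zero_le_one, sub_zero, smul_eq_mul] at hCS
  rw [hI] at hCS
  refine hCS.trans ?_
  rw [← integral_const_mul]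
  refine integral_mono (hL hcd).integrable_sq ((hL hc.norm).integrable_sq.const_mul _) fun t => ?_
  dsimp only
  rw [← mul_pow, ← sq_abs, dist_eq_norm, mul_comm]
  have := (fderiv ℝ g (y + t • (x - y))).le_opNorm (x - y)
  rw [Real.norm_eq_abs] at this
  exact pow_le_pow_left₀ (abs_nonneg _) this 2

/-- The contraction towards `y` by the factor `t` has Jacobian `t ^ n ≥ 2 ^ (-n)`. This is the
source of the constant `2 ^ n` in Poincaré's inequality. -/
lemma lintegral_comp_contract {G : E n → ENNReal} (hG : Measurable G) (y : E n) {t : ℝ}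
    (ht : 1 / 2 ≤ t) : ∫⁻ x, G (y + t • (x - y)) ≤ 2 ^ n * ∫⁻ x, G x := by
  have ht0 : 0 < t := by linarith
  have h1 : ∫⁻ x, G (y + t • (x - y)) = ∫⁻ x, G (y + t • x) :=
    lintegral_sub_right_eq_self (fun x => G (y + t • x)) y
  have h2 : ∫⁻ x, G (y + t • x) = ∫⁻ x, G (y + x) ∂(Measure.map (t • ·) volume) := by
    rw [lintegral_map (by fun_prop) (by fun_prop)]
  rw [h1, h2, Measure.map_addHaar_smul _ ht0.ne', lintegral_smul_measure,
    lintegral_add_left_eq_self (fun x => G x) y, smul_eq_mul, finrank_euclideanSpace_fin]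
  gcongr
  rw [abs_of_pos (by positivity)]
  calc ENNReal.ofReal ((t ^ n)⁻¹) ≤ ENNReal.ofReal (2 ^ n) := by
        apply ENNReal.ofReal_le_ofReal
        rw [← inv_pow]
        refine pow_le_pow_left₀ (by positivity) ?_ n
        rw [inv_le_comm₀ ht0 two_pos]
        linarith
    _ = 2 ^ n := by
        rw [ENNReal.ofReal_pow two_pos.le]; norm_num

/-- The mean value of a function on a set. -/
def mean (K : Set (E n)) (g : E n → ℝ) : ℝ := ⨍ x in K, g x

/-- Poincaré's inequality on a compact convex set. -/
lemma integral_sub_mean_sq_le {K : Set (E n)} (hK : IsCompact K) (hconv : Convex ℝ K)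
    (hpos : 0 < volume.real K) {g : E n → ℝ} (hg : ContDiff ℝ 1 g) :
    ∫ x in K, (g x - mean K g) ^ 2 ≤
      2 ^ n * Metric.diam K ^ 2 * ∫ x in K, ‖fderiv ℝ g x‖ ^ 2 := by
  set d := Metric.diam K
  have hd0 : 0 ≤ d := Metric.diam_nonneg
  have hfin : volume K < ⊤ := hK.measure_lt_top
  have hL : ∀ {f : E n → ℝ}, Continuous f → MemLp f 2 (volume.restrict K) := fun hf =>
    memLp_two_of_continuousOn hK hfin hf.continuousOn
  have hgc := hg.continuous
  have hdc : Continuous fun x => ‖fderiv ℝ g x‖ := (hg.continuous_fderiv one_ne_zero).norm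
  have : IsFiniteMeasure (volume.restrict K) := ⟨by rwa [Measure.restrict_apply_univ]⟩
  have h1 : ∀ x, (g x - mean K g) ^ 2 ≤ (volume.real K)⁻¹ * ∫ y in K, (g x - g y) ^ 2 := by
    intro x
    have hm : g x - mean K g = (volume.real K)⁻¹ * ∫ y in K, (g x - g y) * 1 := by
      simp only [mul_one]
      rw [integral_sub (integrable_const _) ((hL hgc).integrable one_le_two), mean,
        setAverage_eq, integral_const, measureReal_restrict_apply_univ, smul_eq_mul, smul_eq_mul]
      field_simp
    have hCS := sq_integral_mul_le (hL (f := fun y => g x - g y) (by fun_prop))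
      (hL (continuous_const (y := (1 : ℝ))))
    rw [hm, mul_pow]
    simp only [one_pow, integral_const, measureReal_restrict_apply_univ, smul_eq_mul,
      mul_one] at hCS ⊢
    calc (volume.real K)⁻¹ ^ 2 * (∫ y in K, (g x - g y)) ^ 2
        ≤ (volume.real K)⁻¹ ^ 2 * ((∫ y in K, (g x - g y) ^ 2) * volume.real K) := by gcongr
      _ = _ := by field_simp
  -- Extension by zero allows the substitution to be carried out on the whole space; convexity keeps
  -- the segments inside `K`.
  set G : E n → ENNReal := K.indicator fun x => ENNReal.ofReal (‖fderiv ℝ g x‖ ^ 2) with hG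
  have hGm : Measurable G :=
    (ENNReal.measurable_ofReal.comp (hdc.pow 2).measurable).indicator hK.measurableSet
  have hGint : ∫⁻ x, G x = ENNReal.ofReal (∫ x in K, ‖fderiv ℝ g x‖ ^ 2) := by
    rw [hG, lintegral_indicator hK.measurableSet, ofReal_integral_eq_lintegral_ofReal
      (hL hdc).integrable_sq (Filter.Eventually.of_forall fun x => sq_nonneg _)]
  have h2 : ∀ x ∈ K, ∀ y ∈ K, ENNReal.ofReal ((g x - g y) ^ 2) ≤
      ENNReal.ofReal (d ^ 2) * ∫⁻ t in Icc (0 : ℝ) 1, G (y + t • (x - y)) := by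
    intro x hx y hy
    have hc : Continuous fun t : ℝ => ‖fderiv ℝ g (y + t • (x - y))‖ ^ 2 :=
      (hdc.comp (by fun_prop : Continuous fun t : ℝ => y + t • (x - y))).pow 2
    have e1 : ∫⁻ t in Icc (0 : ℝ) 1, G (y + t • (x - y)) =
        ENNReal.ofReal (∫ t in Icc (0 : ℝ) 1, ‖fderiv ℝ g (y + t • (x - y))‖ ^ 2) := by
      rw [ofReal_integral_eq_lintegral_ofReal (hc.continuousOn.integrableOn_compact isCompact_Icc)
        (Filter.Eventually.of_forall fun x => sq_nonneg _)]
      refine setLIntegral_congr_fun measurableSet_Icc fun t ht => ?_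
      exact indicator_of_mem (hconv.add_smul_sub_mem hy hx ht) _
    rw [e1, ← ENNReal.ofReal_mul (sq_nonneg _)]
    refine ENNReal.ofReal_le_ofReal ((sq_sub_le_integral_segment hg x y).trans ?_)
    have : dist x y ≤ d := Metric.dist_le_diam_of_mem hK.isBounded hx hy
    have h0 : 0 ≤ ∫ t in Icc (0 : ℝ) 1, ‖fderiv ℝ g (y + t • (x - y))‖ ^ 2 :=
      integral_nonneg fun t => sq_nonneg _
    gcongr
  have h3 : ∀ t ∈ Icc (0 : ℝ) 1, ∫⁻ x in K, ∫⁻ y in K, G (y + t • (x - y)) ≤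
      volume K * (2 ^ n * ∫⁻ x, G x) := by
    intro t ht
    -- Substitute in `x` if `t ≥ 1/2` and in `y` otherwise, so that the contraction factor is always
    -- at least `1/2`.
    rcases le_total (1 / 2) t with h | h
    · rw [lintegral_lintegral_swap (by fun_prop)]
      calc ∫⁻ y in K, ∫⁻ x in K, G (y + t • (x - y))
          ≤ ∫⁻ y in K, (2 ^ n * ∫⁻ x, G x) := by
            gcongr with y
            exact (setLIntegral_le_lintegral _ _).trans (lintegral_comp_contract hGm y h)
        _ = _ := by rw [lintegral_const, Measure.restrict_apply_univ, mul_comm]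
    · calc ∫⁻ x in K, ∫⁻ y in K, G (y + t • (x - y))
          ≤ ∫⁻ x in K, (2 ^ n * ∫⁻ x, G x) := by
            gcongr with x
            refine (setLIntegral_le_lintegral _ _).trans
              (le_trans (le_of_eq ?_) (lintegral_comp_contract hGm x (t := 1 - t) (by linarith)))
            refine lintegral_congr fun y => ?_
            congr 1
            module
        _ = _ := by rw [lintegral_const, Measure.restrict_apply_univ, mul_comm]
  have hdouble : ∫⁻ x in K, ∫⁻ y in K, ENNReal.ofReal ((g x - g y) ^ 2) ≤
      ENNReal.ofReal (d ^ 2) * (volume K * (2 ^ n * ∫⁻ x, G x)) := by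
    calc ∫⁻ x in K, ∫⁻ y in K, ENNReal.ofReal ((g x - g y) ^ 2)
        ≤ ∫⁻ x in K, ∫⁻ y in K, ENNReal.ofReal (d ^ 2) *
            ∫⁻ t in Icc (0 : ℝ) 1, G (y + t • (x - y)) := by
          refine setLIntegral_mono' hK.measurableSet fun x hx => ?_
          exact setLIntegral_mono' hK.measurableSet fun y hy => h2 x hx y hy
      _ = ENNReal.ofReal (d ^ 2) * ∫⁻ x in K, ∫⁻ y in K,
            ∫⁻ t in Icc (0 : ℝ) 1, G (y + t • (x - y)) := by
          simp_rw [lintegral_const_mul' _ _ ENNReal.ofReal_ne_top]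
      _ = ENNReal.ofReal (d ^ 2) * ∫⁻ t in Icc (0 : ℝ) 1, ∫⁻ x in K, ∫⁻ y in K,
            G (y + t • (x - y)) := by
          congr 1
          refine (lintegral_congr fun x => lintegral_lintegral_swap
            (Measurable.aemeasurable (by fun_prop))).trans ?_
          exact lintegral_lintegral_swap (Measurable.aemeasurable (by fun_prop))
      _ ≤ ENNReal.ofReal (d ^ 2) * ∫⁻ t in Icc (0 : ℝ) 1, volume K * (2 ^ n * ∫⁻ x, G x) := by
          exact mul_le_mul' le_rfl (setLIntegral_mono' measurableSet_Icc h3)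
      _ = _ := by simp
  have hfinal : ENNReal.ofReal (∫ x in K, (g x - mean K g) ^ 2) ≤
      ENNReal.ofReal (2 ^ n * d ^ 2 * ∫ x in K, ‖fderiv ℝ g x‖ ^ 2) := by
    rw [ofReal_integral_eq_lintegral_ofReal (hL (f := fun x => g x - mean K g) (by fun_prop)).integrable_sq
      (Filter.Eventually.of_forall fun x => sq_nonneg _)]
    calc ∫⁻ x in K, ENNReal.ofReal ((g x - mean K g) ^ 2)
        ≤ ∫⁻ x in K, ENNReal.ofReal (volume.real K)⁻¹ *
            ∫⁻ y in K, ENNReal.ofReal ((g x - g y) ^ 2) := by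
          gcongr with x
          rw [← ofReal_integral_eq_lintegral_ofReal
            (hL (f := fun y => g x - g y) (by fun_prop)).integrable_sq
            (Filter.Eventually.of_forall fun x => sq_nonneg _),
            ← ENNReal.ofReal_mul (by positivity)]
          exact ENNReal.ofReal_le_ofReal (h1 x)
      _ ≤ ENNReal.ofReal (volume.real K)⁻¹ *
            (ENNReal.ofReal (d ^ 2) * (volume K * (2 ^ n * ∫⁻ x, G x))) := by
          rw [lintegral_const_mul' _ _ ENNReal.ofReal_ne_top]
          gcongr
      _ = _ := by
          rw [hGint, ← ENNReal.ofReal_toReal hfin.ne]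
          have h2n : (2 : ENNReal) ^ n = ENNReal.ofReal (2 ^ n) := by
            rw [ENNReal.ofReal_pow two_pos.le]; norm_num
          change _ * (_ * (ENNReal.ofReal (volume.real K) * _)) = _
          have h0 : 0 ≤ ∫ x in K, ‖fderiv ℝ g x‖ ^ 2 := integral_nonneg fun x => sq_nonneg _
          rw [h2n, ← ENNReal.ofReal_mul (by positivity), ← ENNReal.ofReal_mul (by positivity),
            ← ENNReal.ofReal_mul (by positivity), ← ENNReal.ofReal_mul (by positivity)]
          congr 1
          field_simp
  exact (ENNReal.ofReal_le_ofReal_iff (mul_nonneg (by positivity)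
    (integral_nonneg fun x => sq_nonneg _))).1 hfinal

lemma divergence_smul {ψ : E n → ℝ} {X : E n → E n} (hψ : ContDiff ℝ 1 ψ) (hX : ContDiff ℝ 1 X)
    (x : E n) :
    divergence (fun y => ψ y • X y) x = ψ x * divergence X x + fderiv ℝ ψ x (X x) := by
  have hf : fderiv ℝ (fun y => ψ y • X y) x =
      ψ x • fderiv ℝ X x + (fderiv ℝ ψ x).smulRight (X x) :=
    fderiv_fun_smul (hψ.differentiable one_ne_zero x) (hX.differentiable one_ne_zero x)
  unfold divergence
  rw [hf]
  simp only [add_apply, smul_apply,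
    ContinuousLinearMap.smulRight_apply, PiLp.add_apply, PiLp.smul_apply, smul_eq_mul,
    Finset.sum_add_distrib, ← Finset.mul_sum]
  congr 1
  have hx : X x = ∑ j, (X x).ofLp j • EuclideanSpace.single j (1 : ℝ) := by
    ext i
    simp [Finset.sum_apply, Pi.single_apply]
  conv_rhs => rw [hx, map_sum]
  refine Finset.sum_congr rfl fun j _ => ?_
  rw [map_smul, smul_eq_mul, mul_comm]

lemma divergence_sub_const (z x : E n) : divergence (fun y : E n => y - z) x = n := by
  unfold divergence
  have : fderiv ℝ (fun y : E n => y - z) x = ContinuousLinearMap.id ℝ (E n) := by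
    rw [fderiv_sub_const]; exact fderiv_fun_id
  rw [this]
  simp

section Trace

variable {T : Finset (E n)} {z : E n}

/-- The divergence theorem for the field `g(x) (x - z)`: it is tangential on all faces through `z`,
and `x - z` has constant normal component `height T z` on the opposite face. -/
lemma IsSimplex.height_mul_integral_face (h : IsSimplex T) (hn : 1 ≤ n) (hz : z ∈ T)
    {g : E n → ℝ} (hg : ContDiff ℝ 1 g) :
    height T z * ∫ x in hull (T.erase z), g x ∂μHE[n - 1] =
      ∫ x in hull T, (n * g x + fderiv ℝ g x (x - z)) := by
  have hX : ContDiff ℝ 1 fun y : E n => y - z := by fun_prop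
  have hI := h.integral_divergence hn (X := fun y => g y • (y - z)) (hg.smul hX)
  simp only [divergence_smul hg hX, divergence_sub_const] at hI
  have hc : ∀ x, n * g x + fderiv ℝ g x (x - z) = g x * n + fderiv ℝ g x (x - z) :=
    fun x => by ring
  simp only [hc]
  rw [hI, Finset.sum_eq_single z]
  · rw [← integral_const_mul]
    refine setIntegral_congr_fun (isClosed_hull _).measurableSet fun x hx => ?_
    simp only [inner_smul_right]
    rw [(h.outerNormal_spec hn hz).2, bary_linear_sub, ((h.mem_face_iff hz).1 hx).2,
      h.bary_self hz]
    ring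
  · intro w hw hwz
    rw [setIntegral_congr_fun (g := fun _ => (0 : ℝ)) (isClosed_hull _).measurableSet, integral_zero]
    intro x hx
    simp only [inner_smul_right]
    rw [(h.outerNormal_spec hn hw).2, bary_linear_sub, ((h.mem_face_iff hw).1 hx).2,
      h.bary_ne hw hz (Ne.symm hwz)]
    ring
  · exact fun H => absurd hz H

lemma IsSimplex.height_mul_area (h : IsSimplex T) (hn : 1 ≤ n) (hz : z ∈ T) :
    height T z * (μHE[n - 1]).real (hull (T.erase z)) = n * volume.real (hull T) := by
  have := h.height_mul_integral_face hn hz (contDiff_const (c := (1 : ℝ)))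
  simpa [mul_comm] using this

lemma dist_le_diam {x y : E n} (hx : x ∈ hull T) (hy : y ∈ hull T) : dist x y ≤ diam T :=
  Metric.dist_le_diam_of_mem (isCompact_hull T).isBounded hx hy

/-- Trace inequality: the previous identity for `g²`, where the cross term `2 g ∇g · (x - z)` is
split by Young's inequality. The factor is `n` from the divergence of `x - z` plus `1` from Young.
-/
lemma IsSimplex.height_mul_integral_face_sq_le (h : IsSimplex T) (hn : 1 ≤ n) (hz : z ∈ T)
    {g : E n → ℝ} (hg : ContDiff ℝ 1 g) :
    height T z * ∫ x in hull (T.erase z), g x ^ 2 ∂μHE[n - 1] ≤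
      (n + 1) * (∫ x in hull T, g x ^ 2) + diam T ^ 2 * ∫ x in hull T, ‖fderiv ℝ g x‖ ^ 2 := by
  rw [h.height_mul_integral_face hn hz (hg.pow 2)]
  have hdc : Continuous fun x => ‖fderiv ℝ g x‖ := (hg.continuous_fderiv one_ne_zero).norm
  have hint : ∀ {f : E n → ℝ}, Continuous f → IntegrableOn f (hull T) := fun hf =>
    hf.continuousOn.integrableOn_compact (isCompact_hull T)
  have hgc := hg.continuous
  rw [← integral_const_mul, ← integral_const_mul, ← integral_add (hint (by fun_prop))
    (hint (by fun_prop))]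
  have hg2 := hg.pow 2
  refine setIntegral_mono_on (hint ((by fun_prop : Continuous fun x => (n : ℝ) * g x ^ 2).add
    ((hg2.continuous_fderiv one_ne_zero).clm_apply (by fun_prop)))) (hint (by fun_prop))
    (isClosed_hull T).measurableSet fun x hx => ?_
  have hf : fderiv ℝ (fun y => g y ^ 2) x = (2 * g x) • fderiv ℝ g x := by
    have := ((hg.differentiable one_ne_zero x).hasFDerivAt.pow 2).fderiv
    simpa using this
  rw [hf, smul_apply, smul_eq_mul]
  have h1 : |fderiv ℝ g x (x - z)| ≤ ‖fderiv ℝ g x‖ * diam T := by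
    have := (fderiv ℝ g x).le_opNorm (x - z)
    rw [Real.norm_eq_abs] at this
    refine this.trans ?_
    gcongr
    rw [← dist_eq_norm]
    exact dist_le_diam hx (subset_hull hz)
  have h2 : fderiv ℝ g x (x - z) ^ 2 ≤ (‖fderiv ℝ g x‖ * diam T) ^ 2 := by
    rw [← sq_abs]; gcongr
  nlinarith [sq_nonneg (g x - fderiv ℝ g x (x - z))]

lemma IsSimplex.bary_le_one (h : IsSimplex T) (hz : z ∈ T) {x : E n} (hx : x ∈ hull T) :
    bary T z x ≤ 1 := by
  rw [← h.sum_bary x]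
  exact Finset.single_le_sum (fun w hw => h.mem_hull_iff.1 hx w hw) hz

/-- Crossing the ball along the normal changes the coordinate of `z` by `2 r / height T z`, and this
coordinate stays between `0` and `1`. -/
lemma IsSimplex.two_mul_radius_le_height (h : IsSimplex T) (hn : 1 ≤ n) (hz : z ∈ T) {c : E n}
    {r : ℝ} (hr : 0 ≤ r) (hball : Metric.closedBall c r ⊆ hull T) : 2 * r ≤ height T z := by
  obtain ⟨hν, hs⟩ := h.outerNormal_spec hn hz
  set ν := outerNormal T (T.erase z)
  have hh := h.height_pos hn hz
  have hl : (bary T z).linear ν = -(height T z)⁻¹ := by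
    have := hs ν
    rw [real_inner_self_eq_norm_sq, hν] at this
    field_simp
    linarith
  have h1 : bary T z (c + (-r) • ν) ≤ 1 := h.bary_le_one hz (hball (by simp [norm_smul, hν, abs_of_nonneg hr]))
  have h2 : 0 ≤ bary T z (c + r • ν) :=
    h.mem_hull_iff.1 (hball (by simp [norm_smul, hν, abs_of_nonneg hr])) z hz
  rw [bary_add, map_smul, hl, smul_eq_mul] at h1 h2
  have : 2 * r * (height T z)⁻¹ ≤ 1 := by linarith
  rwa [← div_eq_mul_inv, div_le_one hh] at this

end Trace

/-! ### Topology of triangulations -/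

namespace Mesh

variable (𝒯 : Mesh n)

lemma mem_elems {T : Finset (E n)} : T ∈ 𝒯.elems ↔ T ∈ 𝒯.K.faces ∧ T.card = n + 1 := by
  simp [elems]

variable {𝒯}

lemma isSimplex {T : Finset (E n)} (hT : T ∈ 𝒯.elems) : IsSimplex T :=
  ⟨((𝒯.mem_elems).1 hT).2, 𝒯.K.indep ((𝒯.mem_elems).1 hT).1⟩

lemma hull_subset_space {T : Finset (E n)} (hT : T ∈ 𝒯.elems) : hull T ⊆ 𝒯.K.space :=
  Geometry.SimplicialComplex.convexHull_subset_space ((𝒯.mem_elems).1 hT).1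

lemma isOpen_domain : IsOpen 𝒯.domain := isOpen_interior

lemma interior_hull_subset_domain {T : Finset (E n)} (hT : T ∈ 𝒯.elems) :
    interior (hull T) ⊆ 𝒯.domain := interior_mono (hull_subset_space hT)

lemma space_eq : 𝒯.K.space = ⋃ T ∈ 𝒯.elems, hull T := by
  ext x
  rw [Geometry.SimplicialComplex.mem_space_iff, mem_iUnion₂]
  constructor
  · rintro ⟨s, hs, hx⟩
    obtain ⟨T, hT, hsT, hc⟩ := 𝒯.pure_dim s hs
    exact ⟨T, (𝒯.mem_elems).2 ⟨hT, hc⟩, hull_mono hsT hx⟩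
  · rintro ⟨T, hT, hx⟩
    exact ⟨T, ((𝒯.mem_elems).1 hT).1, hx⟩

lemma isCompact_space : IsCompact 𝒯.K.space := by
  rw [space_eq]
  exact 𝒯.elems.isCompact_biUnion fun T _ => isCompact_hull T

lemma domain_subset_space : 𝒯.domain ⊆ 𝒯.K.space := interior_subset

lemma exists_mem_hull {x : E n} (hx : x ∈ 𝒯.domain) : ∃ T ∈ 𝒯.elems, x ∈ hull T := by
  have := domain_subset_space hx
  rw [space_eq, mem_iUnion₂] at this
  obtain ⟨T, hT, h⟩ := this
  exact ⟨T, hT, h⟩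

/-- Elements meet only in common faces. -/
lemma mem_of_bary_ne_zero {T T' : Finset (E n)} (hT : T ∈ 𝒯.elems) (hT' : T' ∈ 𝒯.elems)
    {x z : E n} (hx : x ∈ hull T) (hx' : x ∈ hull T') (hz : z ∈ T) (hne : bary T z x ≠ 0) :
    z ∈ T' := by
  have h := 𝒯.K.inter_subset_convexHull ((𝒯.mem_elems).1 hT).1 ((𝒯.mem_elems).1 hT').1 ⟨hx, hx'⟩
  rw [← Finset.coe_inter] at h
  by_contra hz'
  refine hne ((((isSimplex hT).mem_hull_sub_iff Finset.inter_subset_left).1 h).2 z hz ?_)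
  simp [hz']

/-- At an inner point all barycentric coordinates are positive, so every vertex of `T` is a vertex
of `T'`. -/
lemma eq_of_mem_interior {T T' : Finset (E n)} (hT : T ∈ 𝒯.elems) (hT' : T' ∈ 𝒯.elems)
    {x : E n} (hx : x ∈ interior (hull T)) (hx' : x ∈ hull T') : T = T' := by
  have hpos := hx
  rw [(isSimplex hT).interior_hull] at hpos
  refine Finset.eq_of_subset_of_card_le (fun z hz => ?_) ?_
  · exact mem_of_bary_ne_zero hT hT' (interior_subset hx) hx' hz (hpos z hz).ne'
  · rw [(isSimplex hT).1, (isSimplex hT').1]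

lemma pairwise_disjoint_interior :
    (𝒯.elems : Set (Finset (E n))).PairwiseDisjoint fun T => interior (hull T) := by
  intro T hT T' hT' hne
  refine Set.disjoint_left.2 fun x hx hx' => hne (eq_of_mem_interior hT hT' hx ?_)
  exact interior_subset hx'

lemma domain_ae_eq : 𝒯.domain =ᵐ[volume] ⋃ T ∈ 𝒯.elems, interior (hull T) := by
  refine Filter.EventuallyLE.antisymm ?_ (LE.le.eventuallyLE
    (iUnion₂_subset fun T hT => interior_hull_subset_domain hT))
  have h1 : ∀ᵐ x ∂(volume : Measure (E n)), ∀ T ∈ 𝒯.elems, x ∉ frontier (hull T) := by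
    rw [Filter.eventually_all_finset]
    intro T _
    exact measure_eq_zero_iff_ae_notMem.1 (volume_frontier_hull T)
  filter_upwards [h1] with x hx hxD
  obtain ⟨T, hT, hxT⟩ := exists_mem_hull hxD
  refine mem_iUnion₂.2 ⟨T, hT, ?_⟩
  by_contra hni
  exact hx T hT ⟨subset_closure hxT, hni⟩

lemma exists_erase {T F : Finset (E n)} (hT : IsSimplex T) (hFT : F ⊆ T) (hF : F.card = n) :
    ∃ a ∈ T, F = T.erase a := by
  obtain ⟨a, ha, haF⟩ : ∃ a ∈ T, a ∉ F := by
    by_contra! H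
    have := Finset.card_le_card (show T ⊆ F from H)
    rw [hT.1, hF] at this
    omega
  refine ⟨a, ha, Finset.eq_of_subset_of_card_le (fun z hz => ?_) ?_⟩
  · exact Finset.mem_erase.2 ⟨by rintro rfl; exact haF hz, hFT hz⟩
  · rw [Finset.card_erase_of_mem ha, hT.1, hF]; simp

/-- A face that contains a point of the domain belongs to a second element. -/
lemma exists_neighbor {T : Finset (E n)} (hn : 1 ≤ n) (hT : T ∈ 𝒯.elems) {a x : E n} (ha : a ∈ T)
    (hx : x ∈ hull (T.erase a)) (hxD : x ∈ 𝒯.domain) :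
    ∃ T' ∈ 𝒯.elems, T' ≠ T ∧ T.erase a ⊆ T' := by
  have h := isSimplex hT
  -- Moving `x` slightly towards the barycenter `c` of the face yields a point of the domain in the
  -- relative interior of the face.
  set c : E n := ∑ w ∈ T.erase a, (n : ℝ)⁻¹ • w with hc
  have hcard : (T.erase a).card = n := by rw [Finset.card_erase_of_mem ha, h.1]; simp
  have hn0 : (n : ℝ) ≠ 0 := by positivity
  have hsum : ∑ w ∈ T.erase a, (n : ℝ)⁻¹ = 1 := by
    rw [Finset.sum_const, hcard, nsmul_eq_mul, mul_inv_cancel₀ hn0]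
  have hcb : ∀ w ∈ T, bary T w c = if w = a then 0 else (n : ℝ)⁻¹ := by
    intro w hw
    rw [hc, sum_affine_apply (T.erase a) _ _ hsum]
    split_ifs with hwa
    · subst hwa
      refine Finset.sum_eq_zero fun y hy => ?_
      rw [Finset.mem_erase] at hy
      rw [h.bary_ne hw hy.2 hy.1, mul_zero]
    · rw [Finset.sum_eq_single w, h.bary_self hw, mul_one]
      · intro y hy hyw
        rw [h.bary_ne hw (Finset.mem_of_mem_erase hy) hyw, mul_zero]
      · intro H
        exact absurd (Finset.mem_erase.2 ⟨hwa, hw⟩) H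
  obtain ⟨hx0, hxa⟩ := (h.mem_face_iff ha).1 hx
  have hcont : Continuous fun t : ℝ => x + t • (c - x) := by fun_prop
  have hev : ∀ᶠ t in nhdsWithin (0 : ℝ) (Ioi 0), x + t • (c - x) ∈ 𝒯.domain ∧ t < 1 := by
    refine (Filter.Eventually.and ?_ ?_).filter_mono nhdsWithin_le_nhds
    · exact hcont.continuousAt.eventually_mem (isOpen_domain.mem_nhds (by simpa using hxD))
    · exact gt_mem_nhds one_pos
  obtain ⟨t, ⟨htD, ht1⟩, ht0⟩ := (hev.and self_mem_nhdsWithin).exists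
  set x' := x + t • (c - x)
  have hb : ∀ w ∈ T, bary T w x' = (1 - t) * bary T w x + t * bary T w c := by
    intro w _
    rw [bary_add, map_smul, bary_linear_sub, smul_eq_mul]; ring
  have hpos : ∀ w ∈ T, w ≠ a → 0 < bary T w x' := by
    intro w hw hwa
    rw [hb w hw, hcb w hw, if_neg hwa]
    have := hx0 w hw
    have : 0 < t * (n : ℝ)⁻¹ := by positivity
    nlinarith
  have hza : bary T a x' = 0 := by rw [hb a ha, hcb a ha, if_pos rfl, hxa]; simp
  have hx'T : x' ∈ hull T := h.mem_hull_iff.2 fun w hw => by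
    by_cases hwa : w = a
    · rw [hwa, hza]
    · exact (hpos w hw hwa).le
  -- Points just beyond the face lie in the domain but not in `T`, hence in `C`. As `C` is closed,
  -- it contains their limit `x'`.
  set C : Set (E n) := ⋃ T' ∈ 𝒯.elems.erase T, hull T' with hC
  have hCc : IsClosed C := isClosed_biUnion_finset fun T' _ => isClosed_hull T'
  have hmem : x' ∈ C := by
    have hcont2 : Continuous fun s : ℝ => x' + s • (x' - a) := by fun_prop
    have hlim : Filter.Tendsto (fun s : ℝ => x' + s • (x' - a)) (nhdsWithin 0 (Ioi 0))
        (nhds x') := by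
      have := (hcont2.tendsto 0).mono_left (nhdsWithin_le_nhds (s := Ioi 0))
      simpa using this
    refine hCc.mem_of_tendsto hlim ?_
    have h1 : ∀ᶠ s in nhdsWithin (0 : ℝ) (Ioi 0), x' + s • (x' - a) ∈ 𝒯.domain :=
      hlim.eventually_mem (isOpen_domain.mem_nhds htD)
    filter_upwards [h1, self_mem_nhdsWithin] with s hs hs0
    obtain ⟨T', hT', hsT'⟩ := exists_mem_hull hs
    refine mem_iUnion₂.2 ⟨T', Finset.mem_erase.2 ⟨?_, hT'⟩, hsT'⟩
    rintro rfl
    have := h.mem_hull_iff.1 hsT' a ha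
    rw [bary_add, map_smul, bary_linear_sub, hza, h.bary_self ha] at this
    simp only [mem_Ioi] at hs0
    simp at this
    linarith
  obtain ⟨T', hT', hx'T'⟩ := mem_iUnion₂.1 hmem
  rw [Finset.mem_erase] at hT'
  refine ⟨T', hT'.2, hT'.1, fun w hw => ?_⟩
  rw [Finset.mem_erase] at hw
  exact mem_of_bary_ne_zero hT hT'.2 hx'T hx'T' hw.2 (hpos w hw.2 hw.1).ne'

/-- Two elements that share a face cover a neighborhood of its inner points. -/
lemma union_mem_nhds {T T' : Finset (E n)} (hT : T ∈ 𝒯.elems) (hT' : T' ∈ 𝒯.elems)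
    (hne : T' ≠ T) {a x : E n} (ha : a ∈ T) (hsub : T.erase a ⊆ T') (hxa : bary T a x = 0)
    (hpos : ∀ w ∈ T, w ≠ a → 0 < bary T w x) : hull T ∪ hull T' ∈ nhds x := by
  have h := isSimplex hT
  have h' := isSimplex hT'
  have hx : x ∈ hull (T.erase a) := (h.mem_face_iff ha).2 ⟨fun w hw => by
    by_cases hwa : w = a
    · rw [hwa, hxa]
    · exact (hpos w hw hwa).le, hxa⟩
  have hxT' : x ∈ hull T' := hull_mono hsub hx
  obtain ⟨b, hb, hbe⟩ := exists_erase h' hsub (by rw [Finset.card_erase_of_mem ha, h.1]; simp)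
  have hbT : b ∉ T := by
    intro hbT
    refine hne (Finset.eq_of_subset_of_card_le (fun w hw => ?_) (by rw [h.1, h'.1]))
    by_cases hwb : w = b
    · rwa [hwb]
    · exact Finset.mem_of_mem_erase (hbe ▸ Finset.mem_erase.2 ⟨hwb, hw⟩)
  have hxb : bary T' b x = 0 := ((h'.mem_face_iff hb).1 (hbe ▸ hx)).2
  have hface : ∀ w ∈ T', w ≠ b → w ∈ T ∧ w ≠ a := fun w hw hwb => by
    have : w ∈ T.erase a := hbe ▸ Finset.mem_erase.2 ⟨hwb, hw⟩
    exact ⟨Finset.mem_of_mem_erase this, (Finset.mem_erase.1 this).1⟩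
  have hnear : ∀ᶠ y in nhds x, ∀ w ∈ T, w ≠ a → 0 < bary T w y := by
    rw [Filter.eventually_all_finset]
    intro w hw
    by_cases hwa : w = a
    · simp [hwa]
    · filter_upwards [(continuous_affine (bary T w)).continuousAt.eventually_mem
        (Ioi_mem_nhds (hpos w hw hwa))] with y hy _ using hy
  -- The new vertex lies strictly on the other side of the face. Otherwise the segment from `x` to
  -- `b` would start inside both elements, and `b` would be a vertex of `T`.
  have hbneg : bary T a b < 0 := by
    by_contra! hge
    have hcont : Continuous fun t : ℝ => x + t • (b - x) := by fun_prop
    have hlim : Filter.Tendsto (fun t : ℝ => x + t • (b - x)) (nhdsWithin 0 (Ioi 0))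
        (nhds x) := by
      have := (hcont.tendsto 0).mono_left (nhdsWithin_le_nhds (s := Ioi 0))
      simpa using this
    have h1 : ∀ᶠ t in nhdsWithin (0 : ℝ) (Ioi 0), t < 1 :=
      (gt_mem_nhds one_pos : ∀ᶠ t in nhds (0 : ℝ), t < 1).filter_mono nhdsWithin_le_nhds
    obtain ⟨t, ⟨ht, ht1⟩, ht0⟩ := (((hlim.eventually hnear).and h1).and self_mem_nhdsWithin).exists
    have e1 : x + t • (b - x) ∈ hull T := h.mem_hull_iff.2 fun w hw => by
      by_cases hwa : w = a
      · rw [hwa, bary_add, map_smul, bary_linear_sub, hxa, smul_eq_mul]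
        simp only [zero_add, sub_zero]
        positivity
      · exact (ht w hw hwa).le
    have e2 : x + t • (b - x) ∈ hull T' :=
      (convex_hull' T').add_smul_sub_mem hxT' (subset_hull hb) ⟨ht0.le, ht1.le⟩
    refine hbT (mem_of_bary_ne_zero hT' hT e2 e1 hb ?_)
    rw [bary_add, map_smul, bary_linear_sub, hxb, h'.bary_self hb]
    simpa using ht0.ne'
  have hpos' : ∀ w ∈ T', w ≠ b → 0 < bary T' w x := by
    intro w hw hwb
    have h0 : 0 ≤ bary T' w x := h'.mem_hull_iff.1 hxT' w hw
    refine lt_of_le_of_ne h0 fun H => ?_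
    obtain ⟨hwT, hwa⟩ := hface w hw hwb
    have e := h'.affine_eq_sum (bary T w) x
    rw [Finset.sum_eq_zero] at e
    · exact (hpos w hwT hwa).ne' e
    · intro y hy
      by_cases hyw : y = w
      · rw [hyw, ← H, zero_mul]
      · by_cases hyb : y = b
        · rw [hyb, hxb, zero_mul]
        · rw [h.bary_ne hwT (hface y hy hyb).1 hyw, mul_zero]
  have hnear' : ∀ᶠ y in nhds x, ∀ w ∈ T', w ≠ b → 0 < bary T' w y := by
    rw [Filter.eventually_all_finset]
    intro w hw
    by_cases hwa : w = b
    · simp [hwa]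
    · filter_upwards [(continuous_affine (bary T' w)).continuousAt.eventually_mem
        (Ioi_mem_nhds (hpos' w hw hwa))] with y hy _ using hy
  filter_upwards [hnear, hnear'] with y hy hy'
  rcases le_or_gt 0 (bary T a y) with hya | hya
  · refine Or.inl (h.mem_hull_iff.2 fun w hw => ?_)
    by_cases hwa : w = a
    · rwa [hwa]
    · exact (hy w hw hwa).le
  · refine Or.inr (h'.mem_hull_iff.2 fun w hw => ?_)
    by_cases hwb : w = b
    · have e := h'.affine_eq_sum (bary T a) y
      rw [Finset.sum_eq_single b] at e
      · rw [hwb]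
        by_contra! H
        nlinarith
      · intro c hc hcb
        rw [h.bary_ne ha (hface c hc hcb).1 (hface c hc hcb).2, mul_zero]
      · exact fun H => absurd hb H
    · exact (hy' w hw hwb).le

end Mesh

/-! ### Generic segments and neighborhoods of vertices -/

/-- The zero set of a nonzero affine function has empty interior, so finitely many of them can be
avoided one after the other. -/
lemma exists_generic_point (s : Finset (E n →ᵃ[ℝ] ℝ)) (hs : ∀ f ∈ s, f ≠ 0) {U : Set (E n)}
    (hU : IsOpen U) (hne : U.Nonempty) : ∃ x ∈ U, ∀ f ∈ s, f x ≠ 0 := by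
  classical
  induction s using Finset.induction_on generalizing U with
  | empty => exact ⟨hne.some, hne.some_mem, by simp⟩
  | insert f s _ ih =>
    have hf : f ≠ 0 := hs f (Finset.mem_insert_self f s)
    have hne' : (U ∩ {x | f x ≠ 0}).Nonempty := by
      by_contra H
      rw [not_nonempty_iff_eq_empty] at H
      have h0 : ∀ x ∈ U, f x = 0 := fun x hx => by
        by_contra hfx
        exact (H ▸ (⟨hx, hfx⟩ : x ∈ U ∩ {x | f x ≠ 0}) : x ∈ (∅ : Set (E n)))
      obtain ⟨x, hx⟩ := hne
      refine hf (AffineMap.ext fun y => ?_)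
      have hcont : Continuous fun t : ℝ => x + t • (y - x) := by fun_prop
      have hev : ∀ᶠ t in nhdsWithin (0 : ℝ) (Ioi 0), x + t • (y - x) ∈ U :=
        (hcont.continuousAt.eventually_mem (hU.mem_nhds (by simpa using hx))).filter_mono
          nhdsWithin_le_nhds
      obtain ⟨t, htU, ht0⟩ := (hev.and self_mem_nhdsWithin).exists
      have h1 := f.map_vadd x (t • (y - x))
      have h2 := f.linearMap_vsub y x
      simp only [vadd_eq_add, vsub_eq_sub, map_smul, smul_eq_mul] at h1 h2
      rw [add_comm, h0 _ htU, h0 _ hx, h2, h0 _ hx] at h1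
      have : t * f y = 0 := by linarith
      simpa [ht0.ne'] using this
    obtain ⟨x, hx, hx'⟩ := ih (fun g hg => hs g (Finset.mem_insert_of_mem hg))
      (hU.inter (isOpen_ne.preimage (continuous_affine f))) hne'
    refine ⟨x, hx.1, fun g hg => ?_⟩
    rcases Finset.mem_insert.1 hg with rfl | hg
    · exact hx.2
    · exact hx' g hg

namespace Mesh

variable {𝒯 : Mesh n}

/-- A set of elements with vertex `z` that is closed under passing to neighbors across faces that
contain `z` covers a neighborhood of `z`. -/
lemma biUnion_mem_nhds {𝒞 : Finset (Finset (E n))} {z : E n} (h𝒞 : ∀ T ∈ 𝒞, T ∈ 𝒯.elems)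
    (hz : ∀ T ∈ 𝒞, z ∈ T) (hne : 𝒞.Nonempty)
    (hnb : ∀ T ∈ 𝒞, ∀ a ∈ T, a ≠ z → ∃ T' ∈ 𝒞, T' ≠ T ∧ T.erase a ⊆ T') :
    (⋃ T ∈ 𝒞, hull T) ∈ nhds z := by
  classical
  set C : Set (E n) := ⋃ T ∈ 𝒞, hull T with hC
  have hCc : IsClosed C := isClosed_biUnion_finset fun T' _ => isClosed_hull T'
  have hnear : ∀ᶠ y in nhds z, ∀ T ∈ 𝒞, 0 < bary T z y := by
    rw [Filter.eventually_all_finset]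
    intro T hT
    refine (continuous_affine (bary T z)).continuousAt.eventually_mem (Ioi_mem_nhds ?_)
    rw [(isSimplex (h𝒞 T hT)).bary_self (hz T hT)]
    exact one_pos
  obtain ⟨ε, hε, hball⟩ := Metric.eventually_nhds_iff_ball.1 hnear
  refine Filter.mem_of_superset (Metric.ball_mem_nhds z hε) ?_
  by_contra hnot
  rw [not_subset] at hnot
  obtain ⟨y₀, hy₀, hy₀C⟩ := hnot
  -- If the union missed a point `y₀` near `z`, a nearby missed point `y` could be chosen off all
  -- facet hyperplanes. This serves to make the functions in `s₂` nonzero.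
  set s₁ : Finset (E n →ᵃ[ℝ] ℝ) := 𝒞.biUnion fun T => T.image fun a => bary T a with hs₁
  obtain ⟨y, ⟨hyU, hyC⟩, hy⟩ := exists_generic_point s₁ (by
      intro f hf
      obtain ⟨T, hT, hf⟩ := Finset.mem_biUnion.1 hf
      obtain ⟨a, ha, rfl⟩ := Finset.mem_image.1 hf
      intro h0
      have := (isSimplex (h𝒞 T hT)).bary_self ha
      rw [h0] at this
      simp at this)
    (Metric.isOpen_ball.inter hCc.isOpen_compl) ⟨y₀, hy₀, hy₀C⟩
  have hy' : ∀ T ∈ 𝒞, ∀ a ∈ T, bary T a y ≠ 0 := fun T hT a ha =>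
    hy _ (Finset.mem_biUnion.2 ⟨T, hT, Finset.mem_image_of_mem _ ha⟩)
  obtain ⟨T₀, hT₀⟩ := hne
  -- These determinants vanish whenever two coordinates of the same element vanish at a common point
  -- of the segment from `x` to `y`. Avoiding their zeros makes the segment miss all faces of
  -- codimension two or more.
  set s₂ : Finset (E n →ᵃ[ℝ] ℝ) := 𝒞.biUnion fun T => T.offDiag.image fun q =>
    bary T q.2 y • bary T q.1 - bary T q.1 y • bary T q.2 with hs₂
  have hU0 : (Metric.ball z ε ∩ interior (hull T₀)).Nonempty := by
    have hzc : z ∈ closure (interior (hull T₀)) := by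
      rw [(isSimplex (h𝒞 T₀ hT₀)).closure_interior_hull]
      exact subset_hull (hz T₀ hT₀)
    exact mem_closure_iff.1 hzc _ Metric.isOpen_ball (Metric.mem_ball_self hε)
  obtain ⟨x, ⟨hxU, hxT₀⟩, hx⟩ := exists_generic_point s₂ (by
      intro f hf
      obtain ⟨T, hT, hf⟩ := Finset.mem_biUnion.1 hf
      obtain ⟨⟨a, b⟩, hab, rfl⟩ := Finset.mem_image.1 hf
      rw [Finset.mem_offDiag] at hab
      intro h0
      have h := isSimplex (h𝒞 T hT)
      have := congrArg (fun g : E n →ᵃ[ℝ] ℝ => g a) h0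
      simp [h.bary_self hab.1, h.bary_ne hab.2.1 hab.1 hab.2.2, hy' T hT b hab.2.1] at this)
    (Metric.isOpen_ball.inter isOpen_interior) hU0
  have hx' : ∀ T ∈ 𝒞, ∀ a ∈ T, ∀ b ∈ T, a ≠ b →
      bary T b y * bary T a x - bary T a y * bary T b x ≠ 0 := fun T hT a ha b hb hab => by
    have := hx _ (Finset.mem_biUnion.2 ⟨T, hT, Finset.mem_image_of_mem _
      (Finset.mem_offDiag.2 ⟨ha, hb, hab⟩ : (a, b) ∈ T.offDiag)⟩)
    simpa using this
  -- Every point of the segment in `C` is interior to an element or to a shared face, hence interior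
  -- to `C`. The segment is connected and starts in the interior of `C`, so it cannot leave `C`,
  -- which contradicts the choice of `y`.
  have hseg : segment ℝ x y ⊆ interior C ∪ Cᶜ := by
    intro p hp
    by_cases hpC : p ∈ C
    swap
    · exact Or.inr hpC
    refine Or.inl (mem_interior_iff_mem_nhds.2 ?_)
    obtain ⟨T, hT, hpT⟩ := mem_iUnion₂.1 hpC
    have h := isSimplex (h𝒞 T hT)
    have hpU : p ∈ Metric.ball z ε := (convex_ball z ε).segment_subset hxU hyU hp
    have hp0 := h.mem_hull_iff.1 hpT
    have hsub : hull T ⊆ C := subset_biUnion_of_mem (u := fun T => hull T) hT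
    by_cases hall : ∀ w ∈ T, 0 < bary T w p
    · refine Filter.mem_of_superset (isOpen_interior.mem_nhds ?_) (interior_subset.trans hsub)
      rw [h.interior_hull]
      exact hall
    · push Not at hall
      obtain ⟨a, ha, ha0⟩ := hall
      have hpa : bary T a p = 0 := le_antisymm ha0 (hp0 a ha)
      -- The crossed face contains `z`, because the coordinate of `z` is positive on the whole ball;
      -- so the neighbor hypothesis applies.
      have haz : a ≠ z := by
        rintro rfl
        have := hball p hpU T hT
        rw [hpa] at this
        exact lt_irrefl _ this
      have hpos : ∀ b ∈ T, b ≠ a → 0 < bary T b p := by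
        intro b hb hba
        refine lt_of_le_of_ne (hp0 b hb) fun H => ?_
        rw [segment_eq_image'] at hp
        obtain ⟨t, -, rfl⟩ := hp
        rw [bary_add, map_smul, bary_linear_sub, smul_eq_mul] at hpa H
        refine hx' T hT a ha b hb hba.symm ?_
        linear_combination (bary T b y - bary T b x) * hpa + (bary T a y - bary T a x) * H
      obtain ⟨T', hT', hne', hsub'⟩ := hnb T hT a ha haz
      refine Filter.mem_of_superset (union_mem_nhds (h𝒞 T hT) (h𝒞 T' hT') hne' ha hsub' hpa hpos)
        (union_subset hsub ?_)
      exact subset_biUnion_of_mem (u := fun T => hull T) hT'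
  have hxC : x ∈ interior C :=
    interior_mono (subset_biUnion_of_mem (u := fun T => hull T) hT₀) hxT₀
  have hfin := (convex_segment x y).isPreconnected.subset_left_of_subset_union isOpen_interior
    hCc.isOpen_compl (disjoint_compl_right.mono_left interior_subset) hseg
    ⟨x, left_mem_segment ℝ x y, hxC⟩
  exact hyC (interior_subset (hfin (right_mem_segment ℝ x y)))

end Mesh

/-! ### Shape regularity -/

section Shape

variable {T : Finset (E n)}

/-- The linear part of the coordinate of `a` equals one on `a - b`, and its norm is the inverse of
the height. -/
lemma IsSimplex.height_le_dist (h : IsSimplex T) (hn : 1 ≤ n) {a b : E n} (ha : a ∈ T) (hb : b ∈ T)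
    (hab : a ≠ b) : height T a ≤ dist a b := by
  have hh := h.height_pos hn ha
  obtain ⟨h1, -⟩ := h.linear_edge ha hb hab
  have h2 := (LinearMap.toContinuousLinearMap (bary T a).linear).le_opNorm (a - b)
  rw [LinearMap.coe_toContinuousLinearMap', h1, norm_one, ← dist_eq_norm] at h2
  rw [height]
  rw [height, inv_pos] at hh
  rw [inv_le_iff_one_le_mul₀ hh, mul_comm]
  exact h2

lemma IsSimplex.height_le_diam (h : IsSimplex T) (hn : 1 ≤ n) {a : E n} (ha : a ∈ T) :
    height T a ≤ diam T := by
  obtain ⟨b, hb, hba⟩ := h.exists_other hn a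
  exact (h.height_le_dist hn ha hb hba.symm).trans (dist_le_diam (subset_hull ha) (subset_hull hb))

lemma IsSimplex.diam_pos (h : IsSimplex T) (hn : 1 ≤ n) : 0 < diam T := by
  have hne : T.Nonempty := Finset.card_pos.1 (by rw [h.1]; omega)
  obtain ⟨b, hb⟩ := hne
  exact (h.height_pos hn hb).trans_le (h.height_le_diam hn hb)

lemma diam_nonneg (T : Finset (E n)) : 0 ≤ diam T := Metric.diam_nonneg

/-- The volume of the unit ball. -/
def ballVol (n : ℕ) : ℝ := volume.real (Metric.ball (0 : E n) 1)

lemma ballVol_pos : 0 < ballVol n :=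
  ENNReal.toReal_pos (Metric.measure_ball_pos volume _ one_pos).ne' measure_ball_lt_top.ne

lemma volume_real_closedBall (c : E n) {r : ℝ} (hr : 0 ≤ r) :
    volume.real (Metric.closedBall c r) = r ^ n * ballVol n := by
  rw [Measure.addHaar_real_closedBall _ _ hr, finrank_euclideanSpace_fin, ballVol]

lemma IsSimplex.volume_le (h : IsSimplex T) : volume.real (hull T) ≤ diam T ^ n * ballVol n := by
  have hne : T.Nonempty := Finset.card_pos.1 (by rw [h.1]; omega)
  obtain ⟨b, hb⟩ := hne
  rw [← volume_real_closedBall b (diam_nonneg T)]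
  exact measureReal_mono (fun x hx => dist_le_diam hx (subset_hull hb))
    measure_closedBall_lt_top.ne

end Shape

namespace Mesh

variable {𝒯 : Mesh n} {κ : ℝ}

section Regular

variable (hreg : 𝒯.ShapeRegular κ) (hκ : 0 < κ) (hn : 1 ≤ n)

include hreg hκ in
lemma volume_ge {T : Finset (E n)} (hT : T ∈ 𝒯.elems) :
    diam T ^ n * ballVol n ≤ κ ^ n * volume.real (hull T) := by
  obtain ⟨c, hc⟩ := hreg T hT
  have h1 : volume.real (Metric.closedBall c (diam T / κ)) ≤ volume.real (hull T) :=
    measureReal_mono hc (volume_hull_lt_top T).ne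
  rw [volume_real_closedBall c (div_nonneg (diam_nonneg T) hκ.le), div_pow] at h1
  have : 0 < κ ^ n := by positivity
  calc diam T ^ n * ballVol n = κ ^ n * (diam T ^ n / κ ^ n * ballVol n) := by field_simp
    _ ≤ _ := by gcongr

include hreg hκ hn in
lemma diam_le_height {T : Finset (E n)} (hT : T ∈ 𝒯.elems) {z : E n} (hz : z ∈ T) :
    diam T ≤ κ / 2 * height T z := by
  obtain ⟨c, hc⟩ := hreg T hT
  have := (isSimplex hT).two_mul_radius_le_height hn hz
    (div_nonneg (diam_nonneg T) hκ.le) hc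
  have h2 : κ / 2 * (2 * (diam T / κ)) = diam T := by field_simp
  rw [← h2]
  gcongr

-- The chain `diam ≤ κ/2 · height ≤ κ/2 · diam` gives this; it makes the powers of `κ / 2` along
-- chains of elements increasing in the exponent.
include hreg hκ hn in
lemma two_le_kappa {T : Finset (E n)} (hT : T ∈ 𝒯.elems) : 1 ≤ κ / 2 := by
  have h := isSimplex hT
  have hne : T.Nonempty := Finset.card_pos.1 (by rw [h.1]; omega)
  obtain ⟨b, hb⟩ := hne
  have h1 := diam_le_height hreg hκ hn hT hb
  have h2 := h.height_le_diam hn hb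
  have h3 := h.diam_pos hn
  have h4 : diam T ≤ κ / 2 * diam T := h1.trans (by gcongr)
  by_contra! H
  nlinarith

-- For `n ≥ 2` a face contains an edge, and an edge is at least as long as the height of either of
-- its endpoints. So neighbors across a face have comparable diameters.
include hreg hκ in
lemma diam_le_diam_face (hn : 2 ≤ n) {T F : Finset (E n)} (hT : T ∈ 𝒯.elems) (hF : F ⊆ T)
    (hc : F.card = n) : diam T ≤ κ / 2 * diam F := by
  obtain ⟨a, b, ha, hb, hab⟩ := Finset.one_lt_card_iff.1 (by omega : 1 < F.card)
  refine (diam_le_height hreg hκ (by omega) hT (hF ha)).trans ?_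
  gcongr
  exact ((isSimplex hT).height_le_dist (by omega) (hF ha) (hF hb) hab).trans
    (dist_le_diam (subset_hull ha) (subset_hull hb))

lemma diam_mono {S T : Finset (E n)} (h : S ⊆ T) : diam S ≤ diam T :=
  Metric.diam_mono (hull_mono h) (isCompact_hull T).isBounded

include hreg hκ in
lemma diam_le_neighbor (hn : 2 ≤ n) {T T' F : Finset (E n)} (hT : T ∈ 𝒯.elems) (hF : F ⊆ T)
    (hF' : F ⊆ T') (hc : F.card = n) : diam T ≤ κ / 2 * diam T' := by
  refine (diam_le_diam_face hreg hκ hn hT hF hc).trans ?_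
  gcongr
  exact diam_mono hF'

end Regular

/-! ### Vertex stars and their adjacency graph -/

open Classical in
/-- The elements with vertex `z`. -/
def star (𝒯 : Mesh n) (z : E n) : Finset (Finset (E n)) := 𝒯.elems.filter fun T => z ∈ T

lemma mem_star {T : Finset (E n)} {z : E n} : T ∈ 𝒯.star z ↔ T ∈ 𝒯.elems ∧ z ∈ T := by
  simp [star]

lemma patch_eq (z : E n) : 𝒯.patch z = ⋃ T ∈ 𝒯.star z, hull T := by
  ext x
  simp only [patch, mem_iUnion₂, mem_star]
  rfl

/-- The number of elements with a common vertex is bounded in terms of the shape regularity. -/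
lemma card_star_le (hreg : 𝒯.ShapeRegular κ) (hκ : 0 < κ) (hn : 1 ≤ n) (z : E n) :
    ((𝒯.star z).card : ℝ) ≤ κ ^ n := by
  rcases (𝒯.star z).eq_empty_or_nonempty with h0 | hne
  · rw [h0]; simp; positivity
  obtain ⟨T₀, hT₀, hmin⟩ := (𝒯.star z).exists_min_image diam hne
  -- `t` is the smallest diameter at `z`. Each element, shrunk towards `z` by `t / diam T`, stays
  -- inside itself and inside the ball of radius `t`, and contains a ball of radius `t / κ`. The
  -- interiors are disjoint, so comparing volumes gives `κ ^ n`.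
  set t := diam T₀ with ht
  have ht0 : 0 < t := (isSimplex (mem_star.1 hT₀).1).diam_pos hn
  have hc : ∀ T ∈ 𝒯.star z, ∃ c : E n, Metric.closedBall c (t / κ) ⊆ hull T ∩ Metric.closedBall z t := by
    intro T hT
    obtain ⟨hTe, hzT⟩ := mem_star.1 hT
    have hd : 0 < diam T := (isSimplex hTe).diam_pos hn
    obtain ⟨c, hc⟩ := hreg T hTe
    set s := t / diam T with hs
    have hs0 : 0 < s := by positivity
    have hs1 : s ≤ 1 := by rw [hs, div_le_one hd]; exact hmin T hT
    refine ⟨z + s • (c - z), fun x hx => ?_⟩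
    set y := z + s⁻¹ • (x - z) with hy
    have hyx : x = z + s • (y - z) := by
      rw [hy, add_sub_cancel_left, smul_smul, mul_inv_cancel₀ hs0.ne', one_smul,
        add_sub_cancel]
    have hyT : y ∈ hull T := by
      refine hc ?_
      rw [Metric.mem_closedBall, dist_eq_norm] at hx ⊢
      have : y - c = s⁻¹ • (x - (z + s • (c - z))) := by
        rw [hy, smul_sub, smul_sub, smul_add, smul_smul, inv_mul_cancel₀ hs0.ne']
        module
      rw [this, norm_smul, Real.norm_eq_abs, abs_of_pos (inv_pos.2 hs0)]
      calc s⁻¹ * ‖x - (z + s • (c - z))‖ ≤ s⁻¹ * (t / κ) := by gcongr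
        _ = diam T / κ := by rw [hs]; field_simp
    refine ⟨?_, ?_⟩
    · rw [hyx]
      exact (convex_hull' T).add_smul_sub_mem (subset_hull hzT) hyT ⟨hs0.le, hs1⟩
    · rw [Metric.mem_closedBall, dist_eq_norm, hyx, add_sub_cancel_left, norm_smul,
        Real.norm_eq_abs, abs_of_pos hs0, ← dist_eq_norm]
      calc s * dist y z ≤ s * diam T := by gcongr; exact dist_le_diam hyT (subset_hull hzT)
        _ = t := by rw [hs]; field_simp
  choose! c hc using hc
  have hr : 0 < t / κ := by positivity
  have hdisj : ((𝒯.star z : Finset (Finset (E n))) : Set (Finset (E n))).PairwiseDisjoint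
      fun T => Metric.ball (c T) (t / κ) := by
    intro T hT T' hT' hne
    have h1 : ∀ S ∈ 𝒯.star z, Metric.ball (c S) (t / κ) ⊆ interior (hull S) := fun S hS =>
      interior_maximal (Metric.ball_subset_closedBall.trans ((hc S hS).trans inter_subset_left))
        Metric.isOpen_ball
    exact (pairwise_disjoint_interior (mem_star.1 hT).1 (mem_star.1 hT').1 hne).mono
      (h1 T hT) (h1 T' hT')
  have hsum : ∑ T ∈ 𝒯.star z, volume.real (Metric.ball (c T) (t / κ)) ≤
      volume.real (Metric.closedBall z t) := by
    rw [← measureReal_biUnion_finset hdisj fun T _ => measurableSet_ball]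
    refine measureReal_mono (iUnion₂_subset fun T hT => ?_) measure_closedBall_lt_top.ne
    exact Metric.ball_subset_closedBall.trans ((hc T hT).trans inter_subset_right)
  have hb : ∀ T, volume.real (Metric.ball (c T) (t / κ)) = (t / κ) ^ n * ballVol n := fun T => by
    rw [measureReal_def, Measure.addHaar_ball_of_pos _ _ hr, finrank_euclideanSpace_fin, ballVol,
      ENNReal.toReal_mul, ENNReal.toReal_ofReal (by positivity), measureReal_def]
  rw [volume_real_closedBall z ht0.le] at hsum
  simp only [hb, Finset.sum_const, nsmul_eq_mul] at hsum
  have hω := ballVol_pos (n := n)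
  have h2 : ((𝒯.star z).card : ℝ) * (t ^ n * ballVol n) ≤ κ ^ n * (t ^ n * ballVol n) := by
    calc ((𝒯.star z).card : ℝ) * (t ^ n * ballVol n)
        = κ ^ n * (((𝒯.star z).card : ℝ) * ((t / κ) ^ n * ballVol n)) := by
          rw [div_pow]; field_simp
      _ ≤ _ := by gcongr
  exact le_of_mul_le_mul_right h2 (by positivity)

/-- Adjacency of elements with vertex `z` across faces that contain `z`. -/
def starGraph (𝒯 : Mesh n) (z : E n) : SimpleGraph (𝒯.star z) where
  Adj T T' := T ≠ T' ∧ ∃ F : Finset (E n), z ∈ F ∧ F.card = n ∧ F ⊆ T.1 ∧ F ⊆ T'.1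
  symm := ⟨fun _ _ ⟨h, F, h1, h2, h3, h4⟩ => ⟨h.symm, F, h1, h2, h4, h3⟩⟩
  loopless := ⟨fun _ h => h.1 rfl⟩

/-- Either all faces at `z` of the elements that can be reached from `T` are shared, and then these
elements cover a neighborhood of `z`, or a boundary face can be reached. -/
lemma exists_boundary_face {z : E n} (T : 𝒯.star z)
    (hcov : ¬ (⋃ T' ∈ {T' | ∃ h : T' ∈ 𝒯.star z, (𝒯.starGraph z).Reachable T ⟨T', h⟩}, hull T') ∈
      nhds z) :
    ∃ T' : 𝒯.star z, (𝒯.starGraph z).Reachable T T' ∧ ∃ a ∈ T'.1, a ≠ z ∧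
      ∀ T'' ∈ 𝒯.elems, T'.1.erase a ⊆ T'' → T'' = T'.1 := by
  classical
  by_contra! H
  set 𝒞 : Finset (Finset (E n)) :=
    (𝒯.star z).filter fun T' => ∃ h : T' ∈ 𝒯.star z, (𝒯.starGraph z).Reachable T ⟨T', h⟩
  have hmem : ∀ T', T' ∈ 𝒞 ↔ ∃ h : T' ∈ 𝒯.star z, (𝒯.starGraph z).Reachable T ⟨T', h⟩ := by
    intro T'
    rw [Finset.mem_filter]
    exact ⟨fun h => h.2, fun h => ⟨h.1, h⟩⟩
  refine hcov (Filter.mem_of_superset (biUnion_mem_nhds (𝒯 := 𝒯) (𝒞 := 𝒞) (z := z) ?_ ?_ ?_ ?_) ?_)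
  · exact fun T' hT' => (mem_star.1 (Finset.mem_filter.1 hT').1).1
  · exact fun T' hT' => (mem_star.1 (Finset.mem_filter.1 hT').1).2
  · exact ⟨T.1, (hmem _).2 ⟨T.2, SimpleGraph.Reachable.refl _⟩⟩
  · intro T' hT' a ha haz
    obtain ⟨hs, hr⟩ := (hmem T').1 hT'
    obtain ⟨T'', hT'', hsub, hne⟩ := H ⟨T', hs⟩ hr a ha haz
    have hzF : z ∈ T'.erase a := Finset.mem_erase.2 ⟨haz.symm, (mem_star.1 hs).2⟩
    have hs'' : T'' ∈ 𝒯.star z := mem_star.2 ⟨hT'', hsub hzF⟩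
    refine ⟨T'', (hmem _).2 ⟨hs'', hr.trans (SimpleGraph.Adj.reachable ?_)⟩, hne, hsub⟩
    refine ⟨fun h => hne (congrArg Subtype.val h).symm, T'.erase a, hzF, ?_,
      Finset.erase_subset _ _, hsub⟩
    rw [Finset.card_erase_of_mem ha, (isSimplex (mem_star.1 hs).1).1]
    simp
  · intro x hx
    obtain ⟨T', hT', hx⟩ := mem_iUnion₂.1 hx
    exact mem_iUnion₂.2 ⟨T', (hmem T').1 hT', hx⟩

/-- If the reachable elements covered a neighborhood of `z`, then `z` would be interior to the space
of the complex. -/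
lemma exists_boundary_of_notMem {z : E n} (hz : z ∉ 𝒯.domain) (T : 𝒯.star z) :
    ∃ T' : 𝒯.star z, (𝒯.starGraph z).Reachable T T' ∧ ∃ a ∈ T'.1, a ≠ z ∧
      ∀ T'' ∈ 𝒯.elems, T'.1.erase a ⊆ T'' → T'' = T'.1 := by
  refine exists_boundary_face T fun h => hz ?_
  refine mem_interior_iff_mem_nhds.2 (Filter.mem_of_superset h ?_)
  refine iUnion₂_subset fun T' hT' => ?_
  obtain ⟨hs, -⟩ := hT'
  exact hull_subset_space (mem_star.1 hs).1

/-- At a point of the domain every face is shared, so the reachable elements cover a neighborhood of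
`z`. This neighborhood meets the interior of `T'`, which must then be one of them. -/
lemma reachable_of_mem (hn : 1 ≤ n) {z : E n} (hz : z ∈ 𝒯.domain) (T T' : 𝒯.star z) :
    (𝒯.starGraph z).Reachable T T' := by
  by_cases h : (⋃ T' ∈ {T' | ∃ h : T' ∈ 𝒯.star z, (𝒯.starGraph z).Reachable T ⟨T', h⟩}, hull T') ∈
      nhds z
  · have hzc : z ∈ closure (interior (hull T'.1)) := by
      rw [(isSimplex (mem_star.1 T'.2).1).closure_interior_hull]
      exact subset_hull (mem_star.1 T'.2).2
    obtain ⟨x, hxU, hxT'⟩ := mem_closure_iff_nhds.1 hzc _ h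
    obtain ⟨T'', ⟨hs, hr⟩, hx⟩ := mem_iUnion₂.1 hxU
    have : T'.1 = T'' := eq_of_mem_interior (mem_star.1 T'.2).1 (mem_star.1 hs).1 hxT' hx
    subst this
    exact hr
  · obtain ⟨S, -, a, ha, haz, hS⟩ := exists_boundary_face T h
    have hSe := mem_star.1 S.2
    obtain ⟨T'', hT'', hne, hsub⟩ := exists_neighbor hn hSe.1 ha
      (subset_hull (Finset.mem_erase.2 ⟨haz.symm, hSe.2⟩)) hz
    exact absurd (hS T'' hT'' hsub) hne

end Mesh

/-! ### Clément interpolation of smooth functions -/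

/-- The square of the gradient norm on an element. -/
def gradSq (g : E n → ℝ) (T : Finset (E n)) : ℝ := ∫ x in hull T, ‖fderiv ℝ g x‖ ^ 2

lemma gradSq_nonneg (g : E n → ℝ) (T : Finset (E n)) : 0 ≤ gradSq g T :=
  integral_nonneg fun _ => sq_nonneg _

lemma add_sq_le_two (a b : ℝ) : (a + b) ^ 2 ≤ 2 * a ^ 2 + 2 * b ^ 2 := by
  nlinarith [sq_nonneg (a - b)]

section Face

variable {T : Finset (E n)} {a : E n}

lemma IsSimplex.poincare (h : IsSimplex T) {g : E n → ℝ} (hg : ContDiff ℝ 1 g) :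
    ∫ x in hull T, (g x - mean (hull T) g) ^ 2 ≤ 2 ^ n * diam T ^ 2 * gradSq g T :=
  integral_sub_mean_sq_le (isCompact_hull T) (convex_hull' T) h.volume_real_pos hg

/-- Trace inequality for `g` minus its mean, with the volume term removed by Poincaré's inequality.
-/
lemma IsSimplex.height_mul_integral_face_sub_mean_sq_le (h : IsSimplex T) (hn : 1 ≤ n) (ha : a ∈ T)
    {g : E n → ℝ} (hg : ContDiff ℝ 1 g) :
    height T a * ∫ x in hull (T.erase a), (g x - mean (hull T) g) ^ 2 ∂μHE[n - 1] ≤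
      ((n + 1) * 2 ^ n + 1) * diam T ^ 2 * gradSq g T := by
  have h1 := h.height_mul_integral_face_sq_le hn ha (hg.sub (contDiff_const (c := mean (hull T) g)))
  have h2 := h.poincare hg
  have h3 : ∀ x, fderiv ℝ (fun x => g x - mean (hull T) g) x = fderiv ℝ g x := fun x => by
    rw [fderiv_sub_const]
  simp only [h3] at h1
  refine h1.trans ?_
  change _ + diam T ^ 2 * gradSq g T ≤ _
  have : (n + 1 : ℝ) * ∫ x in hull T, (g x - mean (hull T) g) ^ 2 ≤
      (n + 1) * (2 ^ n * diam T ^ 2 * gradSq g T) := by gcongr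
  linarith

end Face

namespace Mesh

variable {𝒯 : Mesh n} {κ : ℝ}

section Step

variable (hreg : 𝒯.ShapeRegular κ) (hκ : 0 < κ) (hn : 2 ≤ n)

include hreg hκ hn in
/-- Comparison of the mean on an element with another constant on a face. -/
lemma mean_sub_sq_le {T : Finset (E n)} (hT : T ∈ 𝒯.elems) {a : E n} (ha : a ∈ T) {g : E n → ℝ}
    (hg : ContDiff ℝ 1 g) {c Q : ℝ}
    (hQ : ∫ x in hull (T.erase a), (g x - c) ^ 2 ∂μHE[n - 1] ≤ diam T * Q) :
    diam T ^ (n - 2) * (mean (hull T) g - c) ^ 2 ≤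
      2 * κ ^ n * ((n + 1) * 2 ^ n + 1) / ballVol n * (gradSq g T + Q) := by
  have h := isSimplex hT
  have hn1 : 1 ≤ n := by omega
  set m := mean (hull T) g
  set F := hull (T.erase a)
  set A : ℝ := (n + 1) * 2 ^ n + 1
  have hA : 1 ≤ A := by
    have : (0 : ℝ) ≤ (n + 1) * 2 ^ n := by positivity
    simp only [A]; linarith
  have hh := h.height_pos hn1 ha
  have hd := h.diam_pos hn1
  have hω := ballVol_pos (n := n)
  have hint : ∀ b : ℝ, IntegrableOn (fun x => (g x - b) ^ 2) F (μHE[n - 1]) := fun b =>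
    h.integrableOn_face hn1 ha (((hg.continuous.sub continuous_const).pow 2).continuousOn)
  have h1 : (μHE[n - 1]).real F * (m - c) ^ 2 ≤
      2 * (∫ x in F, (g x - m) ^ 2 ∂μHE[n - 1]) + 2 * ∫ x in F, (g x - c) ^ 2 ∂μHE[n - 1] := by
    rw [← integral_const_mul, ← integral_const_mul,
      ← integral_add ((hint m).const_mul 2) ((hint c).const_mul 2)]
    have hfin := h.surface_face_lt_top hn1 ha
    have : (μHE[n - 1]).real F * (m - c) ^ 2 = ∫ _ in F, (m - c) ^ 2 ∂μHE[n - 1] := by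
      rw [setIntegral_const, smul_eq_mul]
    rw [this]
    refine integral_mono (integrableOn_const hfin.ne) (((hint m).const_mul 2).add
      ((hint c).const_mul 2)) fun x => ?_
    have := add_sq_le_two (m - g x) (g x - c)
    simp only [sub_add_sub_cancel] at this
    simp only []
    nlinarith
  have h2 := h.height_mul_integral_face_sub_mean_sq_le hn1 ha hg
  have h3 := h.height_mul_area hn1 ha
  have h4 := volume_ge hreg hκ hT
  have hhd := h.height_le_diam hn1 ha
  have hv := h.volume_real_pos
  have hn' : (1 : ℝ) ≤ n := by exact_mod_cast hn1
  have hQ0 : 0 ≤ diam T * Q :=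
    (integral_nonneg fun _ => sq_nonneg _).trans hQ
  have hQ0' : 0 ≤ Q := nonneg_of_mul_nonneg_right hQ0 hd
  -- The area of the face is traded for the volume by `height * area = n * volume`; the factor `n ≥
  -- 1` is given away.
  have h5 : volume.real (hull T) * (m - c) ^ 2 ≤
      2 * A * diam T ^ 2 * gradSq g T + 2 * diam T ^ 2 * Q := by
    calc volume.real (hull T) * (m - c) ^ 2
        ≤ (n * volume.real (hull T)) * (m - c) ^ 2 := by
          gcongr; exact le_mul_of_one_le_left hv.le hn'
      _ = height T a * ((μHE[n - 1]).real F * (m - c) ^ 2) := by rw [← h3]; ring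
      _ ≤ height T a * (2 * (∫ x in F, (g x - m) ^ 2 ∂μHE[n - 1]) +
            2 * ∫ x in F, (g x - c) ^ 2 ∂μHE[n - 1]) := by gcongr
      _ = 2 * (height T a * ∫ x in F, (g x - m) ^ 2 ∂μHE[n - 1]) +
            2 * (height T a * ∫ x in F, (g x - c) ^ 2 ∂μHE[n - 1]) := by ring
      _ ≤ 2 * (A * diam T ^ 2 * gradSq g T) + 2 * (diam T * (diam T * Q)) := by gcongr
      _ = _ := by ring
  have h6 : diam T ^ n = diam T ^ (n - 2) * diam T ^ 2 := by
    rw [← pow_add]; congr 1; omega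
  have hG := gradSq_nonneg g T
  have h7 : ballVol n * (diam T ^ (n - 2) * (m - c) ^ 2) * diam T ^ 2 ≤
      2 * κ ^ n * A * (gradSq g T + Q) * diam T ^ 2 := by
    calc ballVol n * (diam T ^ (n - 2) * (m - c) ^ 2) * diam T ^ 2
        = (diam T ^ n * ballVol n) * (m - c) ^ 2 := by rw [h6]; ring
      _ ≤ (κ ^ n * volume.real (hull T)) * (m - c) ^ 2 := by gcongr
      _ = κ ^ n * (volume.real (hull T) * (m - c) ^ 2) := by ring
      _ ≤ κ ^ n * (2 * A * diam T ^ 2 * gradSq g T + 2 * diam T ^ 2 * (A * Q)) := by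
          gcongr κ ^ n * ?_
          refine h5.trans ?_
          gcongr
          exact le_mul_of_one_le_left hQ0' hA
      _ = _ := by ring
  have h8 := le_of_mul_le_mul_right h7 (by positivity)
  rw [div_mul_eq_mul_div, le_div_iff₀ hω]
  linarith

-- The mean over `T'` plays the role of the constant `c`, and the trace estimate from the side of
-- `T'` bounds its distance to `g` on the common face. The weight `diam T ^ (n - 2)` makes the
-- inequality invariant under scaling.
include hreg hκ hn in
lemma mean_sub_mean_sq_le {T T' F : Finset (E n)} (hT : T ∈ 𝒯.elems) (hT' : T' ∈ 𝒯.elems)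
    (hF : F ⊆ T) (hF' : F ⊆ T') (hc : F.card = n) {g : E n → ℝ} (hg : ContDiff ℝ 1 g) :
    diam T ^ (n - 2) * (mean (hull T) g - mean (hull T') g) ^ 2 ≤
      2 * κ ^ n * ((n + 1) * 2 ^ n + 1) / ballVol n * (gradSq g T +
        ((n + 1) * 2 ^ n + 1) * (κ / 2) ^ 2 * gradSq g T') := by
  obtain ⟨a, ha, rfl⟩ := exists_erase (isSimplex hT) hF hc
  obtain ⟨b, hb, hbe⟩ := exists_erase (isSimplex hT') hF' hc
  have h' := isSimplex hT'
  refine mean_sub_sq_le hreg hκ hn hT ha hg ?_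
  have hn1 : 1 ≤ n := by omega
  have h1 := h'.height_mul_integral_face_sub_mean_sq_le hn1 hb hg
  have hh := h'.height_pos hn1 hb
  have h2 := diam_le_height hreg hκ hn1 hT' hb
  have h3 := diam_le_neighbor hreg hκ hn hT' hF' hF hc
  have hd' := h'.diam_pos hn1
  have hG := gradSq_nonneg g T'
  rw [hbe]
  have h4 : diam T' * ∫ x in hull (T'.erase b), (g x - mean (hull T') g) ^ 2 ∂μHE[n - 1] ≤
      diam T' * (κ / 2 * diam T' * (((n + 1) * 2 ^ n + 1) * gradSq g T')) := by
    calc diam T' * ∫ x in hull (T'.erase b), (g x - mean (hull T') g) ^ 2 ∂μHE[n - 1]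
        ≤ (κ / 2 * height T' b) *
            ∫ x in hull (T'.erase b), (g x - mean (hull T') g) ^ 2 ∂μHE[n - 1] := by
          refine mul_le_mul_of_nonneg_right h2 (integral_nonneg fun _ => sq_nonneg _)
      _ = κ / 2 * (height T' b *
            ∫ x in hull (T'.erase b), (g x - mean (hull T') g) ^ 2 ∂μHE[n - 1]) := by ring
      _ ≤ κ / 2 * (((n + 1) * 2 ^ n + 1) * diam T' ^ 2 * gradSq g T') := by gcongr
      _ = _ := by ring
  refine (le_of_mul_le_mul_left h4 hd').trans ?_
  calc κ / 2 * diam T' * (((n + 1) * 2 ^ n + 1) * gradSq g T')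
      ≤ κ / 2 * (κ / 2 * diam T) * (((n + 1) * 2 ^ n + 1) * gradSq g T') := by gcongr
    _ = _ := by ring

end Step

/-! ### Chains of elements in a vertex patch -/

/-- The square of the gradient norm on a vertex patch. -/
def starSq (𝒯 : Mesh n) (g : E n → ℝ) (z : E n) : ℝ := ∑ T ∈ 𝒯.star z, gradSq g T

lemma gradSq_le_starSq {g : E n → ℝ} {z : E n} {T : Finset (E n)} (hT : T ∈ 𝒯.star z) :
    gradSq g T ≤ 𝒯.starSq g z :=
  Finset.single_le_sum (f := fun T => gradSq g T) (fun T _ => gradSq_nonneg g T) hT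

lemma starSq_nonneg (g : E n → ℝ) (z : E n) : 0 ≤ 𝒯.starSq g z :=
  Finset.sum_nonneg fun T _ => gradSq_nonneg g T

lemma diam_le_of_walk (hreg : 𝒯.ShapeRegular κ) (hκ : 0 < κ) (hn : 2 ≤ n) {z : E n}
    {T T' : 𝒯.star z} (p : (𝒯.starGraph z).Walk T T') :
    diam T.1 ≤ (κ / 2) ^ p.length * diam T'.1 := by
  induction p with
  | nil => simp
  | @cons u v w hadj p ih =>
    have hadj' := hadj
    obtain ⟨-, F, -, hc, hF, hF'⟩ := hadj'
    have := diam_le_neighbor hreg hκ hn (mem_star.1 u.2).1 hF hF' hc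
    rw [SimpleGraph.Walk.length_cons, pow_succ']
    calc diam u.1 ≤ κ / 2 * diam v.1 := this
      _ ≤ κ / 2 * ((κ / 2) ^ p.length * diam w.1) := by gcongr
      _ = _ := by ring

/-- The constant in the comparison of neighboring means. -/
def stepConst (n : ℕ) (κ : ℝ) : ℝ :=
  2 * κ ^ n * ((n + 1) * 2 ^ n + 1) / ballVol n * (1 + ((n + 1) * 2 ^ n + 1) * (κ / 2) ^ 2)

lemma stepConst_nonneg (hκ : 0 < κ) : 0 ≤ stepConst n κ := by
  have := ballVol_pos (n := n)
  unfold stepConst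
  positivity

lemma mean_sub_mean_sq_le_starSq (hreg : 𝒯.ShapeRegular κ) (hκ : 0 < κ) (hn : 2 ≤ n) {z : E n}
    {T T' : 𝒯.star z} (h : (𝒯.starGraph z).Adj T T') {g : E n → ℝ} (hg : ContDiff ℝ 1 g) :
    diam T.1 ^ (n - 2) * (mean (hull T.1) g - mean (hull T'.1) g) ^ 2 ≤
      stepConst n κ * 𝒯.starSq g z := by
  obtain ⟨-, F, -, hc, hF, hF'⟩ := h
  refine (mean_sub_mean_sq_le hreg hκ hn (mem_star.1 T.2).1 (mem_star.1 T'.2).1 hF hF' hc hg).trans ?_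
  have h1 := gradSq_le_starSq (g := g) T.2
  have h2 := gradSq_le_starSq (g := g) T'.2
  have hω := ballVol_pos (n := n)
  set k : ℝ := ((n + 1) * 2 ^ n + 1) * (κ / 2) ^ 2 with hk
  have hk0 : 0 ≤ k := by positivity
  calc 2 * κ ^ n * ((n + 1) * 2 ^ n + 1) / ballVol n * (gradSq g T + k * gradSq g T')
      ≤ 2 * κ ^ n * ((n + 1) * 2 ^ n + 1) / ballVol n *
          (𝒯.starSq g z + k * 𝒯.starSq g z) := by gcongr
    _ = _ := by rw [stepConst]; ring

/-- Comparison of the means along a chain of elements. -/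
lemma abs_mean_sub_le_of_walk (hreg : 𝒯.ShapeRegular κ) (hκ : 0 < κ) (hn : 2 ≤ n) {z : E n}
    {g : E n → ℝ} (hg : ContDiff ℝ 1 g) {N : ℕ} {T₀ : 𝒯.star z} {T T' : 𝒯.star z}
    (p : (𝒯.starGraph z).Walk T T') (q : (𝒯.starGraph z).Walk T₀ T)
    (hlen : q.length + p.length ≤ N) :
    |mean (hull T.1) g - mean (hull T'.1) g| ≤ p.length *
      √((κ / 2) ^ (N * (n - 2)) * (stepConst n κ * 𝒯.starSq g z) / diam T₀.1 ^ (n - 2)) := by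
  induction p with
  | nil => simp
  | @cons u v w hadj p ih =>
    rw [SimpleGraph.Walk.length_cons] at hlen ⊢
    -- The walk `q` back to the reference element `T₀` grows as `p` shrinks. This keeps the total
    -- length below `N` and measures all steps at the scale of `T₀`.
    have h1 := ih (q.concat hadj) (by rw [SimpleGraph.Walk.length_concat]; omega)
    have hK : 1 ≤ κ / 2 := two_le_kappa hreg hκ (by omega) (mem_star.1 u.2).1
    have hd0 := (isSimplex (mem_star.1 T₀.2).1).diam_pos (by omega : 1 ≤ n)
    have hdu := (isSimplex (mem_star.1 u.2).1).diam_pos (by omega : 1 ≤ n)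
    have h2 : |mean (hull u.1) g - mean (hull v.1) g| ≤
        √((κ / 2) ^ (N * (n - 2)) * (stepConst n κ * 𝒯.starSq g z) / diam T₀.1 ^ (n - 2)) := by
      refine Real.abs_le_sqrt ?_
      rw [le_div_iff₀ (by positivity)]
      have h3 := mean_sub_mean_sq_le_starSq hreg hκ hn hadj hg
      have h4 : diam T₀.1 ^ (n - 2) ≤ (κ / 2) ^ (N * (n - 2)) * diam u.1 ^ (n - 2) := by
        rw [pow_mul, ← mul_pow]
        refine pow_le_pow_left₀ hd0.le ((diam_le_of_walk hreg hκ hn q).trans ?_) _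
        gcongr
        omega
      calc (mean (hull u.1) g - mean (hull v.1) g) ^ 2 * diam T₀.1 ^ (n - 2)
          ≤ (mean (hull u.1) g - mean (hull v.1) g) ^ 2 *
              ((κ / 2) ^ (N * (n - 2)) * diam u.1 ^ (n - 2)) := by gcongr
        _ = (κ / 2) ^ (N * (n - 2)) *
              (diam u.1 ^ (n - 2) * (mean (hull u.1) g - mean (hull v.1) g) ^ 2) := by ring
        _ ≤ _ := by gcongr
    have h5 := abs_sub_le (mean (hull u.1) g) (mean (hull v.1) g) (mean (hull w.1) g)
    push_cast
    linarith

/-- A bound for the number of elements with a common vertex. -/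
def starBound (n : ℕ) (κ : ℝ) : ℕ := ⌈κ ^ n⌉₊

lemma card_star_le_starBound (hreg : 𝒯.ShapeRegular κ) (hκ : 0 < κ) (hn : 1 ≤ n) (z : E n) :
    (𝒯.star z).card ≤ starBound n κ := by
  have := (card_star_le hreg hκ hn z).trans (Nat.le_ceil _)
  exact_mod_cast this

/-- A path visits each element at most once, and the number of elements at `z` is bounded. -/
lemma exists_walk_length_le (hreg : 𝒯.ShapeRegular κ) (hκ : 0 < κ) (hn : 1 ≤ n) {z : E n}
    {T T' : 𝒯.star z} (h : (𝒯.starGraph z).Reachable T T') :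
    ∃ p : (𝒯.starGraph z).Walk T T', p.length ≤ starBound n κ := by
  classical
  obtain ⟨p, hp⟩ := h.exists_isPath
  refine ⟨p, hp.length_lt.le.trans ?_⟩
  rw [Fintype.card_coe]
  exact card_star_le_starBound hreg hκ hn z

open Classical in
/-- The nodal values of the Clément interpolant. -/
def nodal (𝒯 : Mesh n) (g : E n → ℝ) (z : E n) : ℝ :=
  if z ∈ 𝒯.domain then ⨍ x in 𝒯.patch z, g x else 0

/-- The constant in the comparison of means in a vertex patch. -/
def patchConst (n : ℕ) (κ : ℝ) : ℝ :=
  (starBound n κ + 1) ^ 2 * ((κ / 2) ^ (starBound n κ * (n - 2)) * stepConst n κ)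

lemma patchConst_nonneg (hκ : 0 < κ) : 0 ≤ patchConst n κ := by
  have := stepConst_nonneg (n := n) hκ
  unfold patchConst
  positivity

/-- The factor `starBound n κ + 1` leaves room for one step more than the length of a path. It is
needed at boundary vertices, for the last comparison with zero. -/
lemma sq_le_patchConst (hκ : 0 < κ) {m G d : ℝ} (hd : 0 < d) (hG : 0 ≤ G)
    (hm : |m| ≤ (starBound n κ + 1) *
      √((κ / 2) ^ (starBound n κ * (n - 2)) * (stepConst n κ * G) / d ^ (n - 2))) :
    d ^ (n - 2) * m ^ 2 ≤ patchConst n κ * G := by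
  have hs := stepConst_nonneg (n := n) hκ
  have h1 := pow_le_pow_left₀ (abs_nonneg m) hm 2
  rw [sq_abs, mul_pow, Real.sq_sqrt (by positivity)] at h1
  calc d ^ (n - 2) * m ^ 2
      ≤ d ^ (n - 2) * ((starBound n κ + 1) ^ 2 *
          ((κ / 2) ^ (starBound n κ * (n - 2)) * (stepConst n κ * G) / d ^ (n - 2))) := by gcongr
    _ = _ := by
      have : d ^ (n - 2) ≠ 0 := (pow_pos hd _).ne'
      rw [patchConst]
      generalize d ^ (n - 2) = D at *
      field_simp

lemma mean_sub_mean_sq_le_of_reachable (hreg : 𝒯.ShapeRegular κ) (hκ : 0 < κ) (hn : 2 ≤ n)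
    {z : E n} {g : E n → ℝ} (hg : ContDiff ℝ 1 g) {T T' : 𝒯.star z}
    (h : (𝒯.starGraph z).Reachable T T') :
    diam T.1 ^ (n - 2) * (mean (hull T.1) g - mean (hull T'.1) g) ^ 2 ≤
      patchConst n κ * 𝒯.starSq g z := by
  obtain ⟨p, hp⟩ := exists_walk_length_le hreg hκ (by omega) h
  refine sq_le_patchConst hκ ((isSimplex (mem_star.1 T.2).1).diam_pos (by omega))
    (starSq_nonneg _ _) ?_
  refine (abs_mean_sub_le_of_walk hreg hκ hn hg p .nil (N := starBound n κ) (by simpa)).trans ?_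
  gcongr
  have : (p.length : ℝ) ≤ starBound n κ := by exact_mod_cast hp
  linarith

/-- A chain leads to an element with an unshared face. Such a face contains no point of the domain,
so `g` vanishes on it, and the mean on the last element is compared with the constant zero there. -/
lemma mean_sq_le_of_notMem (hreg : 𝒯.ShapeRegular κ) (hκ : 0 < κ) (hn : 2 ≤ n)
    {z : E n} (hz : z ∉ 𝒯.domain) {g : E n → ℝ} (hg : ContDiff ℝ 1 g)
    (hg0 : ∀ x ∉ 𝒯.domain, g x = 0) (T : 𝒯.star z) :
    diam T.1 ^ (n - 2) * mean (hull T.1) g ^ 2 ≤ patchConst n κ * 𝒯.starSq g z := by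
  obtain ⟨T', hr, a, ha, -, hbd⟩ := exists_boundary_of_notMem hz T
  obtain ⟨p, hp⟩ := exists_walk_length_le hreg hκ (by omega) hr
  have hTe := (mem_star.1 T.2).1
  have hTe' := (mem_star.1 T'.2).1
  have hd := (isSimplex hTe).diam_pos (by omega : 1 ≤ n)
  have hd' := (isSimplex hTe').diam_pos (by omega : 1 ≤ n)
  have hK : 1 ≤ κ / 2 := two_le_kappa hreg hκ (by omega) hTe
  have hs := stepConst_nonneg (n := n) hκ
  refine sq_le_patchConst hκ hd (starSq_nonneg _ _) ?_
  have h1 := abs_mean_sub_le_of_walk hreg hκ hn hg p .nil (N := starBound n κ) (by simpa)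
  have hface : ∫ x in hull (T'.1.erase a), (g x - 0) ^ 2 ∂μHE[n - 1] ≤ diam T'.1 * 0 := by
    rw [mul_zero]
    refine le_of_eq ?_
    rw [setIntegral_congr_fun (g := fun _ => (0 : ℝ)) (isClosed_hull _).measurableSet,
      integral_zero]
    intro x hx
    have : x ∉ 𝒯.domain := fun hxD => by
      obtain ⟨T'', hT'', hne, hsub⟩ := exists_neighbor (by omega) hTe' ha hx hxD
      exact hne (hbd T'' hT'' hsub)
    simp [hg0 x this]
  have h2 := mean_sub_sq_le hreg hκ hn hTe' ha hg hface
  have h3 : |mean (hull T'.1) g| ≤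
      √((κ / 2) ^ (starBound n κ * (n - 2)) * (stepConst n κ * 𝒯.starSq g z) /
        diam T.1 ^ (n - 2)) := by
    refine Real.abs_le_sqrt ?_
    rw [le_div_iff₀ (by positivity)]
    have h4 : diam T.1 ^ (n - 2) ≤
        (κ / 2) ^ (starBound n κ * (n - 2)) * diam T'.1 ^ (n - 2) := by
      rw [pow_mul, ← mul_pow]
      refine pow_le_pow_left₀ hd.le ((diam_le_of_walk hreg hκ hn p).trans ?_) _
      gcongr
    have h5 : diam T'.1 ^ (n - 2) * mean (hull T'.1) g ^ 2 ≤ stepConst n κ * 𝒯.starSq g z := by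
      rw [sub_zero, add_zero] at h2
      refine h2.trans ?_
      have h6 := gradSq_le_starSq (g := g) T'.2
      have hω := ballVol_pos (n := n)
      have h7 := starSq_nonneg (𝒯 := 𝒯) g z
      set k : ℝ := ((n + 1) * 2 ^ n + 1) * (κ / 2) ^ 2 with hk
      have hk0 : 0 ≤ k := by positivity
      calc 2 * κ ^ n * ((n + 1) * 2 ^ n + 1) / ballVol n * gradSq g T'
          ≤ 2 * κ ^ n * ((n + 1) * 2 ^ n + 1) / ballVol n * ((1 + k) * 𝒯.starSq g z) := by
            gcongr
            exact h6.trans (le_mul_of_one_le_left h7 (by linarith))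
        _ = _ := by rw [stepConst]; ring
    calc mean (hull T'.1) g ^ 2 * diam T.1 ^ (n - 2)
        ≤ mean (hull T'.1) g ^ 2 *
            ((κ / 2) ^ (starBound n κ * (n - 2)) * diam T'.1 ^ (n - 2)) := by gcongr
      _ = (κ / 2) ^ (starBound n κ * (n - 2)) *
            (diam T'.1 ^ (n - 2) * mean (hull T'.1) g ^ 2) := by ring
      _ ≤ _ := by gcongr
  have h6 : |mean (hull T.1) g| ≤
      |mean (hull T.1) g - mean (hull T'.1) g| + |mean (hull T'.1) g| := by
    have := abs_add_le (mean (hull T.1) g - mean (hull T'.1) g) (mean (hull T'.1) g)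
    simpa using this
  have h8 : (p.length : ℝ) ≤ starBound n κ := by exact_mod_cast hp
  set S := √((κ / 2) ^ (starBound n κ * (n - 2)) * (stepConst n κ * 𝒯.starSq g z) /
        diam T.1 ^ (n - 2))
  have hS : 0 ≤ S := Real.sqrt_nonneg _
  nlinarith

/-- The constant in the vertex estimate for the Clément interpolant. -/
def vertexConst (n : ℕ) (κ : ℝ) : ℝ :=
  ballVol n * patchConst n κ + 2 * (κ / 2) ^ (2 * starBound n κ) *
    (2 ^ n + starBound n κ * (ballVol n * patchConst n κ))

lemma vertexConst_nonneg (hκ : 0 < κ) : 0 ≤ vertexConst n κ := by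
  have := patchConst_nonneg (n := n) hκ
  have := ballVol_pos (n := n)
  unfold vertexConst
  positivity

/-- Subadditivity suffices for nonnegative integrands, so overlaps of the sets need no attention. -/
lemma setIntegral_biUnion_le {ι : Type*} (s : Finset ι) (K : ι → Set (E n)) {f : E n → ℝ}
    (hK : ∀ i ∈ s, MeasurableSet (K i)) (hf : ∀ x, 0 ≤ f x) (hint : ∀ i ∈ s, IntegrableOn f (K i)) :
    ∫ x in ⋃ i ∈ s, K i, f x ≤ ∑ i ∈ s, ∫ x in K i, f x := by
  classical
  induction s using Finset.induction_on with
  | empty => simp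
  | insert i s hi ih =>
    rw [Finset.set_biUnion_insert, Finset.sum_insert hi]
    have h1 := ih (fun j hj => hK j (Finset.mem_insert_of_mem hj))
      (fun j hj => hint j (Finset.mem_insert_of_mem hj))
    have hi1 := hint i (Finset.mem_insert_self i s)
    have hi2 : IntegrableOn f (⋃ j ∈ s, K j) := (integrableOn_finset_iUnion).2
      fun j hj => hint j (Finset.mem_insert_of_mem hj)
    calc ∫ x in K i ∪ ⋃ j ∈ s, K j, f x
        ≤ ∫ x, f x ∂(volume.restrict (K i) + volume.restrict (⋃ j ∈ s, K j)) :=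
          integral_mono_measure (Measure.restrict_union_le _ _) (Filter.Eventually.of_forall hf)
            (Integrable.add_measure hi1 hi2)
      _ = (∫ x in K i, f x) + ∫ x in ⋃ j ∈ s, K j, f x := integral_add_measure hi1 hi2
      _ ≤ _ := by gcongr

/-- The mean on an element differs from the nodal values of the Clément interpolant at its vertices
by the gradient on the vertex patch. -/
lemma volume_mul_mean_sub_nodal_sq_le (hreg : 𝒯.ShapeRegular κ) (hκ : 0 < κ) (hn : 2 ≤ n)
    {g : E n → ℝ} (hg : ContDiff ℝ 1 g) (hg0 : ∀ x ∉ 𝒯.domain, g x = 0) {T : Finset (E n)}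
    (hT : T ∈ 𝒯.elems) {z : E n} (hz : z ∈ T) :
    volume.real (hull T) * (mean (hull T) g - 𝒯.nodal g z) ^ 2 ≤
      vertexConst n κ * diam T ^ 2 * 𝒯.starSq g z := by
  have hn1 : 1 ≤ n := by omega
  have hTs : T ∈ 𝒯.star z := mem_star.2 ⟨hT, hz⟩
  have hω := ballVol_pos (n := n)
  have hP := patchConst_nonneg (n := n) hκ
  have hS := starSq_nonneg (𝒯 := 𝒯) g z
  have hK : 1 ≤ κ / 2 := two_le_kappa hreg hκ hn1 hT
  have hpow : ∀ T : Finset (E n), diam T ^ n = diam T ^ 2 * diam T ^ (n - 2) := fun T => by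
    rw [← pow_add]; congr 1; omega
  unfold nodal
  split_ifs with hzD
  -- Interior vertex: the nodal value is the mean over the patch, and the star is connected.
  · set K := κ / 2
    set N := starBound n κ
    set m := mean (hull T) g
    have hgc : ∀ c : ℝ, Continuous fun x => (g x - c) ^ 2 := fun c => by
      have := hg.continuous; fun_prop
    have hint : ∀ (c : ℝ) (S : Finset (E n)), IntegrableOn (fun x => (g x - c) ^ 2) (hull S) :=
      fun c S => (hgc c).continuousOn.integrableOn_compact (isCompact_hull S)
    have hpatch : IsCompact (𝒯.patch z) := by
      rw [patch_eq]
      exact (𝒯.star z).isCompact_biUnion fun T _ => isCompact_hull T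
    have hsub : hull T ⊆ 𝒯.patch z := by
      rw [patch_eq]
      exact subset_biUnion_of_mem (u := fun T => hull T) hTs
    have hfin : volume (𝒯.patch z) < ⊤ := hpatch.measure_lt_top
    have hv : 0 < volume.real (hull T) := (isSimplex hT).volume_real_pos
    have hvp : volume.real (hull T) ≤ volume.real (𝒯.patch z) := measureReal_mono hsub hfin.ne
    have hvp0 := hv.trans_le hvp
    -- Jensen's inequality for the patch mean; the volume of `T` is at most that of the patch.
    have h1 : volume.real (hull T) * (m - ⨍ x in 𝒯.patch z, g x) ^ 2 ≤
        ∫ x in 𝒯.patch z, (g x - m) ^ 2 := by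
      have hgi : IntegrableOn g (𝒯.patch z) :=
        hg.continuous.continuousOn.integrableOn_compact hpatch
      have hm : m - ⨍ x in 𝒯.patch z, g x =
          -((volume.real (𝒯.patch z))⁻¹ * ∫ x in 𝒯.patch z, (g x - m) * 1) := by
        simp only [mul_one]
        rw [integral_sub hgi (integrableOn_const hfin.ne), setIntegral_const, setAverage_eq,
          smul_eq_mul, smul_eq_mul]
        field_simp
        ring
      have hCS := sq_integral_mul_le
        (memLp_two_of_continuousOn hpatch hfin
          (hg.continuous.sub (continuous_const (y := m))).continuousOn)
        (memLp_two_of_continuousOn hpatch hfin (continuous_const (y := (1 : ℝ))).continuousOn)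
      simp only [mul_one, one_pow, integral_const, measureReal_restrict_apply_univ, smul_eq_mul,
        Pi.sub_apply] at hCS hm
      rw [hm, neg_sq, mul_pow]
      have h0 : 0 ≤ ∫ x in 𝒯.patch z, (g x - m) ^ 2 := integral_nonneg fun _ => sq_nonneg _
      calc volume.real (hull T) * ((volume.real (𝒯.patch z))⁻¹ ^ 2 *
            (∫ x in 𝒯.patch z, (g x - m)) ^ 2)
          ≤ volume.real (𝒯.patch z) * ((volume.real (𝒯.patch z))⁻¹ ^ 2 *
            ((∫ x in 𝒯.patch z, (g x - m) ^ 2) * volume.real (𝒯.patch z))) := by gcongr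
        _ = _ := by field_simp
    have h2 : ∫ x in 𝒯.patch z, (g x - m) ^ 2 ≤
        ∑ T' ∈ 𝒯.star z, ∫ x in hull T', (g x - m) ^ 2 := by
      rw [patch_eq]
      exact setIntegral_biUnion_le _ _ (fun T _ => (isClosed_hull T).measurableSet)
        (fun x => sq_nonneg _) fun T _ => hint m T
    have h3 : ∀ T' ∈ 𝒯.star z, ∫ x in hull T', (g x - m) ^ 2 ≤
        2 * K ^ (2 * N) * diam T ^ 2 * (2 ^ n * gradSq g T' +
          ballVol n * patchConst n κ * 𝒯.starSq g z) := by
      intro T' hT'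
      have hTe' := (mem_star.1 hT').1
      set m' := mean (hull T') g
      have hr := reachable_of_mem hn1 hzD ⟨T', hT'⟩ ⟨T, hTs⟩
      obtain ⟨p, hp⟩ := exists_walk_length_le hreg hκ hn1 hr
      have hd : diam T' ≤ K ^ N * diam T := by
        refine (diam_le_of_walk hreg hκ hn p).trans ?_
        have := diam_nonneg T
        dsimp only
        gcongr
      have hd2 : diam T' ^ 2 ≤ K ^ (2 * N) * diam T ^ 2 := by
        have := pow_le_pow_left₀ (diam_nonneg T') hd 2
        rwa [mul_pow, ← pow_mul, mul_comm N] at this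
      have h4 : ∫ x in hull T', (g x - m) ^ 2 ≤
          2 * (∫ x in hull T', (g x - m') ^ 2) + 2 * (volume.real (hull T') * (m' - m) ^ 2) := by
        have e : volume.real (hull T') * (m' - m) ^ 2 = ∫ _ in hull T', (m' - m) ^ 2 := by
          rw [setIntegral_const, smul_eq_mul]
        have hc : IntegrableOn (fun _ : E n => (m' - m) ^ 2) (hull T') :=
          integrableOn_const (volume_hull_lt_top T').ne
        rw [e, ← integral_const_mul, ← integral_const_mul,
          ← integral_add ((hint m' T').const_mul 2) (hc.const_mul 2)]
        refine integral_mono (hint m T') (((hint m' T').const_mul 2).add (hc.const_mul 2))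
          fun x => ?_
        have := add_sq_le_two (g x - m') (m' - m)
        simpa using this
      have h5 := (isSimplex hTe').poincare hg
      have h6 := mean_sub_mean_sq_le_of_reachable hreg hκ hn hg hr
      have h7 := (isSimplex hTe').volume_le
      have hG := gradSq_nonneg g T'
      have hd' := diam_nonneg T'
      calc ∫ x in hull T', (g x - m) ^ 2
          ≤ 2 * (2 ^ n * diam T' ^ 2 * gradSq g T') +
              2 * ((diam T' ^ n * ballVol n) * (m' - m) ^ 2) := by
            refine h4.trans ?_
            gcongr
        _ = 2 * diam T' ^ 2 * (2 ^ n * gradSq g T' +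
              ballVol n * (diam T' ^ (n - 2) * (m' - m) ^ 2)) := by rw [hpow]; ring
        _ ≤ 2 * (K ^ (2 * N) * diam T ^ 2) * (2 ^ n * gradSq g T' +
              ballVol n * (patchConst n κ * 𝒯.starSq g z)) := by gcongr
        _ = _ := by ring
    refine h1.trans (h2.trans ((Finset.sum_le_sum h3).trans ?_))
    rw [← Finset.mul_sum, Finset.sum_add_distrib, ← Finset.mul_sum, Finset.sum_const, nsmul_eq_mul]
    have hcard : ((𝒯.star z).card : ℝ) ≤ N := by
      exact_mod_cast card_star_le_starBound hreg hκ hn1 z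
    calc 2 * K ^ (2 * N) * diam T ^ 2 * (2 ^ n * ∑ T' ∈ 𝒯.star z, gradSq g T' +
          (𝒯.star z).card * (ballVol n * patchConst n κ * 𝒯.starSq g z))
        ≤ 2 * K ^ (2 * N) * diam T ^ 2 * (2 ^ n * 𝒯.starSq g z +
          N * (ballVol n * patchConst n κ * 𝒯.starSq g z)) := by
          gcongr
          exact le_rfl
      _ = (2 * K ^ (2 * N) * (2 ^ n + N * (ballVol n * patchConst n κ))) *
            (diam T ^ 2 * 𝒯.starSq g z) := by ring
      _ ≤ vertexConst n κ * (diam T ^ 2 * 𝒯.starSq g z) := by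
          gcongr
          rw [vertexConst]
          have : 0 ≤ ballVol n * patchConst n κ := by positivity
          linarith
      _ = _ := by ring
  -- Boundary vertex: the nodal value is zero and the estimate of the mean itself applies.
  · rw [sub_zero]
    have h1 := mean_sq_le_of_notMem hreg hκ hn hzD hg hg0 ⟨T, hTs⟩
    dsimp only at h1
    calc volume.real (hull T) * mean (hull T) g ^ 2
        ≤ (diam T ^ n * ballVol n) * mean (hull T) g ^ 2 := by
          gcongr
          exact (isSimplex hT).volume_le
      _ = diam T ^ 2 * ballVol n * (diam T ^ (n - 2) * mean (hull T) g ^ 2) := by rw [hpow]; ring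
      _ ≤ diam T ^ 2 * ballVol n * (patchConst n κ * 𝒯.starSq g z) := by gcongr
      _ = (ballVol n * patchConst n κ) * (diam T ^ 2 * 𝒯.starSq g z) := by ring
      _ ≤ vertexConst n κ * (diam T ^ 2 * 𝒯.starSq g z) := by
          gcongr
          rw [vertexConst]
          have : 0 ≤ 2 * (κ / 2) ^ (2 * starBound n κ) *
            (2 ^ n + starBound n κ * (ballVol n * patchConst n κ)) := by positivity
          linarith
      _ = _ := by ring

end Mesh

/-! ### The residual of smooth functions -/

section Affine

variable {T : Finset (E n)} {c : E n → ℝ}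

/-- The affine function with prescribed values at the vertices of a simplex. -/
def affInterp (T : Finset (E n)) (c : E n → ℝ) : E n →ᵃ[ℝ] ℝ := ∑ z ∈ T, c z • bary T z

lemma affInterp_apply (T : Finset (E n)) (c : E n → ℝ) (x : E n) :
    affInterp T c x = ∑ z ∈ T, c z * bary T z x := by
  have : ∀ s : Finset (E n), (∑ z ∈ s, c z • bary T z) x = ∑ z ∈ s, c z * bary T z x := by
    intro s
    classical
    induction s using Finset.induction_on with
    | empty => simp
    | insert a s ha ih => rw [Finset.sum_insert ha, Finset.sum_insert ha, ← ih]; simp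
  exact this T

lemma IsSimplex.affInterp_vertex (h : IsSimplex T) {z : E n} (hz : z ∈ T) :
    affInterp T c z = c z := by
  rw [affInterp_apply, Finset.sum_eq_single_of_mem z hz, h.bary_self hz, mul_one]
  intro w hw hwz
  rw [h.bary_ne hw hz hwz.symm, mul_zero]

/-- The left side is the square of a convex combination of the `m - c z` with barycentric weights;
convexity of the square applies. -/
lemma IsSimplex.sq_sub_affInterp_le (h : IsSimplex T) {x : E n} (hx : x ∈ hull T) (m : ℝ) :
    (m - affInterp T c x) ^ 2 ≤ ∑ z ∈ T, (m - c z) ^ 2 := by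
  have e : m - affInterp T c x = ∑ z ∈ T, bary T z x * (m - c z) := by
    rw [affInterp_apply]
    simp only [mul_sub]
    rw [Finset.sum_sub_distrib, ← Finset.sum_mul, h.sum_bary, one_mul]
    congr 1
    exact Finset.sum_congr rfl fun z _ => mul_comm _ _
  have h0 := h.mem_hull_iff.1 hx
  rw [e]
  calc (∑ z ∈ T, bary T z x * (m - c z)) ^ 2
      ≤ ∑ z ∈ T, bary T z x * (m - c z) ^ 2 := by
        have := Even.convexOn_pow (𝕜 := ℝ) (n := 2) even_two
        simpa using this.map_sum_le (t := T) (w := fun z => bary T z x) (p := fun z => m - c z) h0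
          (h.sum_bary x) (fun _ _ => mem_univ _)
    _ ≤ ∑ z ∈ T, (m - c z) ^ 2 := by
        refine Finset.sum_le_sum fun z hz => ?_
        have := h.bary_le_one hz hx
        nlinarith [sq_nonneg (m - c z)]

lemma contDiff_affine (g : E n →ᵃ[ℝ] ℝ) {k : WithTop ℕ∞} : ContDiff ℝ k g := by
  have : (g : E n → ℝ) = fun x => LinearMap.toContinuousLinearMap g.linear x + g 0 := by
    ext x
    have := congrFun g.decomp x
    simpa using this
  rw [this]
  fun_prop

end Affine

namespace Mesh

variable {𝒯 : Mesh n} {κ : ℝ}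

/-- At a common point of two elements only the coordinates of common vertices are nonzero. Hence the
piecewise affine function is single-valued. -/
lemma affInterp_eq {T T' : Finset (E n)} (hT : T ∈ 𝒯.elems) (hT' : T' ∈ 𝒯.elems) {x : E n}
    (hx : x ∈ hull T) (hx' : x ∈ hull T') (c : E n → ℝ) :
    affInterp T c x = affInterp T' c x := by
  have h := isSimplex hT
  rw [h.affine_eq_sum (affInterp T' c) x, affInterp_apply]
  refine Finset.sum_congr rfl fun z hz => ?_
  by_cases h0 : bary T z x = 0
  · simp [h0]
  · rw [(isSimplex hT').affInterp_vertex (mem_of_bary_ne_zero hT hT' hx hx' hz h0), mul_comm]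

open Classical in
/-- The continuous piecewise affine function with prescribed values at the vertices. -/
def pwAffine (𝒯 : Mesh n) (c : E n → ℝ) (x : E n) : ℝ :=
  if h : ∃ T ∈ 𝒯.elems, x ∈ hull T then affInterp h.choose c x else 0

lemma pwAffine_eq {T : Finset (E n)} (hT : T ∈ 𝒯.elems) {x : E n} (hx : x ∈ hull T)
    (c : E n → ℝ) : 𝒯.pwAffine c x = affInterp T c x := by
  have h : ∃ T ∈ 𝒯.elems, x ∈ hull T := ⟨T, hT, hx⟩
  rw [pwAffine, dif_pos h]
  exact affInterp_eq h.choose_spec.1 hT h.choose_spec.2 hx c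

/-- The sum of the gradient norms on the vertex patches of an element. -/
def elemSq (𝒯 : Mesh n) (g : E n → ℝ) (T : Finset (E n)) : ℝ := ∑ z ∈ T, 𝒯.starSq g z

lemma gradSq_le_elemSq {g : E n → ℝ} {T : Finset (E n)} (hT : T ∈ 𝒯.elems) :
    gradSq g T ≤ 𝒯.elemSq g T := by
  obtain ⟨z, hz⟩ : T.Nonempty := by
    rw [← Finset.card_pos, (isSimplex hT).1]; omega
  exact (gradSq_le_starSq (mem_star.2 ⟨hT, hz⟩)).trans
    (Finset.single_le_sum (f := fun z => 𝒯.starSq g z) (fun z _ => starSq_nonneg g z) hz)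

lemma elemSq_nonneg (g : E n → ℝ) (T : Finset (E n)) : 0 ≤ 𝒯.elemSq g T :=
  Finset.sum_nonneg fun z _ => starSq_nonneg g z

section Interp

variable (hreg : 𝒯.ShapeRegular κ) (hκ : 0 < κ) (hn : 2 ≤ n)

include hreg hκ hn in
lemma volume_mul_sq_mean_sub_le {g : E n → ℝ} (hg : ContDiff ℝ 1 g)
    (hg0 : ∀ x ∉ 𝒯.domain, g x = 0) {T : Finset (E n)} (hT : T ∈ 𝒯.elems) {x : E n}
    (hx : x ∈ hull T) :
    volume.real (hull T) * (mean (hull T) g - affInterp T (𝒯.nodal g) x) ^ 2 ≤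
      vertexConst n κ * diam T ^ 2 * 𝒯.elemSq g T := by
  calc _ ≤ volume.real (hull T) * ∑ z ∈ T, (mean (hull T) g - 𝒯.nodal g z) ^ 2 := by
        gcongr
        exact (isSimplex hT).sq_sub_affInterp_le hx _
    _ ≤ ∑ z ∈ T, vertexConst n κ * diam T ^ 2 * 𝒯.starSq g z := by
        rw [Finset.mul_sum]
        exact Finset.sum_le_sum fun z hz =>
          volume_mul_mean_sub_nodal_sq_le hreg hκ hn hg hg0 hT hz
    _ = _ := by rw [elemSq, Finset.mul_sum]

/-- The constant in the interpolation estimate on elements. -/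
def elemConst (n : ℕ) (κ : ℝ) : ℝ := 2 * 2 ^ n + 2 * vertexConst n κ

-- Split at the mean `m` of `g` on `T`: Poincaré's inequality handles `g - m`, and the vertex
-- estimates handle `m` minus the interpolant.
include hreg hκ hn in
lemma integral_sq_sub_affInterp_le {g : E n → ℝ} (hg : ContDiff ℝ 1 g)
    (hg0 : ∀ x ∉ 𝒯.domain, g x = 0) {T : Finset (E n)} (hT : T ∈ 𝒯.elems) :
    ∫ x in hull T, (g x - affInterp T (𝒯.nodal g) x) ^ 2 ≤
      elemConst n κ * diam T ^ 2 * 𝒯.elemSq g T := by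
  have h := isSimplex hT
  have hpos := h.volume_real_pos
  set m := mean (hull T) g
  set p := affInterp T (𝒯.nodal g)
  have hgc := hg.continuous
  have hpc := continuous_affine p
  have hi : ∀ {φ : E n → ℝ}, Continuous φ → IntegrableOn φ (hull T) := fun hφ =>
    hφ.continuousOn.integrableOn_compact (isCompact_hull T)
  have hvc := vertexConst_nonneg (n := n) hκ
  calc ∫ x in hull T, (g x - p x) ^ 2
      ≤ ∫ x in hull T, (2 * (g x - m) ^ 2 +
          2 * (vertexConst n κ * diam T ^ 2 * 𝒯.elemSq g T / volume.real (hull T))) := by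
        refine setIntegral_mono_on (hi (by fun_prop)) (hi (by fun_prop))
          (isClosed_hull T).measurableSet fun x hx => ?_
        have h1 := add_sq_le_two (g x - m) (m - p x)
        have h2 := volume_mul_sq_mean_sub_le hreg hκ hn hg hg0 hT hx
        rw [mul_comm, ← le_div_iff₀ hpos] at h2
        have e : g x - p x = (g x - m) + (m - p x) := by ring
        rw [e]
        linarith
    _ = 2 * (∫ x in hull T, (g x - m) ^ 2) + 2 * (vertexConst n κ * diam T ^ 2 * 𝒯.elemSq g T) := by
        rw [integral_add (hi (by fun_prop)) (hi (by fun_prop)), integral_const_mul,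
          setIntegral_const, smul_eq_mul]
        field_simp
    _ ≤ 2 * (2 ^ n * diam T ^ 2 * 𝒯.elemSq g T) +
          2 * (vertexConst n κ * diam T ^ 2 * 𝒯.elemSq g T) := by
        gcongr
        refine (h.poincare hg).trans ?_
        gcongr
        exact gradSq_le_elemSq hT
    _ = _ := by rw [elemConst]; ring

/-- The constant in the interpolation estimate on faces. -/
def faceConst (n : ℕ) (κ : ℝ) : ℝ :=
  (κ / 2) ^ 2 * (2 * ((n + 1) * 2 ^ n + 1) + 2 * n * vertexConst n κ)

-- The same splitting at the mean, with the trace inequality in place of Poincaré's. Shape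
-- regularity then exchanges the height first for `diam T` and then for the diameter of the face,
-- which uses `κ / 2` twice.
include hreg hκ hn in
lemma integral_face_sq_sub_affInterp_le {g : E n → ℝ} (hg : ContDiff ℝ 1 g)
    (hg0 : ∀ x ∉ 𝒯.domain, g x = 0) {T : Finset (E n)} (hT : T ∈ 𝒯.elems) {a : E n} (ha : a ∈ T) :
    ∫ x in hull (T.erase a), (g x - affInterp T (𝒯.nodal g) x) ^ 2 ∂μHE[n - 1] ≤
      faceConst n κ * diam (T.erase a) * 𝒯.elemSq g T := by
  have h := isSimplex hT
  have hn1 : 1 ≤ n := by omega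
  have hpos := h.volume_real_pos
  have hd := h.diam_pos hn1
  have hh := h.height_pos hn1 ha
  have hc : (T.erase a).card = n := by rw [Finset.card_erase_of_mem ha, h.1]; simp
  set m := mean (hull T) g
  set p := affInterp T (𝒯.nodal g)
  have hgc := hg.continuous
  have hpc := continuous_affine p
  have hi : ∀ {φ : E n → ℝ}, Continuous φ → IntegrableOn φ (hull (T.erase a)) μHE[n - 1] :=
    fun hφ => h.integrableOn_face hn1 ha hφ.continuousOn
  have hvc := vertexConst_nonneg (n := n) hκ
  have hE := elemSq_nonneg (𝒯 := 𝒯) g T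
  have key : height T a * ∫ x in hull (T.erase a), (g x - p x) ^ 2 ∂μHE[n - 1] ≤
      (2 * ((n + 1) * 2 ^ n + 1) + 2 * n * vertexConst n κ) * diam T ^ 2 * 𝒯.elemSq g T := by
    calc height T a * ∫ x in hull (T.erase a), (g x - p x) ^ 2 ∂μHE[n - 1]
        ≤ height T a * ∫ x in hull (T.erase a), (2 * (g x - m) ^ 2 +
            2 * (vertexConst n κ * diam T ^ 2 * 𝒯.elemSq g T / volume.real (hull T)))
              ∂μHE[n - 1] := by
          refine mul_le_mul_of_nonneg_left ?_ hh.le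
          refine setIntegral_mono_on (hi (by fun_prop)) (hi (by fun_prop))
            (isClosed_hull _).measurableSet fun x hx => ?_
          have h1 := add_sq_le_two (g x - m) (m - p x)
          have h2 := volume_mul_sq_mean_sub_le hreg hκ hn hg hg0 hT
            (hull_mono (Finset.erase_subset a T) hx)
          rw [mul_comm, ← le_div_iff₀ hpos] at h2
          have e : g x - p x = (g x - m) + (m - p x) := by ring
          rw [e]
          linarith
      _ = 2 * (height T a * ∫ x in hull (T.erase a), (g x - m) ^ 2 ∂μHE[n - 1]) +
            2 * n * (vertexConst n κ * diam T ^ 2 * 𝒯.elemSq g T) := by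
          have i1 : IntegrableOn (fun x => 2 * (g x - m) ^ 2) (hull (T.erase a)) μHE[n - 1] :=
            hi (by fun_prop)
          rw [integral_add i1 (hi continuous_const), integral_const_mul,
            setIntegral_const, smul_eq_mul, mul_add, ← mul_assoc (height T a) (Measure.real _ _),
            h.height_mul_area hn1 ha]
          field_simp
      _ ≤ 2 * (((n + 1) * 2 ^ n + 1) * diam T ^ 2 * 𝒯.elemSq g T) +
            2 * n * (vertexConst n κ * diam T ^ 2 * 𝒯.elemSq g T) := by
          refine add_le_add (mul_le_mul_of_nonneg_left
            ((h.height_mul_integral_face_sub_mean_sq_le hn1 ha hg).trans ?_) zero_le_two) le_rfl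
          gcongr
          exact gradSq_le_elemSq hT
      _ = _ := by ring
  have h1 := diam_le_height hreg hκ hn1 hT ha
  have h2 := diam_le_diam_face hreg hκ hn hT (Finset.erase_subset a T) hc
  have hI : 0 ≤ ∫ x in hull (T.erase a), (g x - p x) ^ 2 ∂μHE[n - 1] :=
    integral_nonneg fun x => sq_nonneg _
  set K : ℝ := 2 * ((n + 1) * 2 ^ n + 1) + 2 * n * vertexConst n κ with hK
  have hK0 : 0 ≤ K := by positivity
  have h3 : diam T * ∫ x in hull (T.erase a), (g x - p x) ^ 2 ∂μHE[n - 1] ≤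
      diam T * (κ / 2 * K * diam T * 𝒯.elemSq g T) := by
    calc _ ≤ (κ / 2 * height T a) *
          ∫ x in hull (T.erase a), (g x - p x) ^ 2 ∂μHE[n - 1] := by gcongr
      _ = κ / 2 * (height T a * ∫ x in hull (T.erase a), (g x - p x) ^ 2 ∂μHE[n - 1]) := by ring
      _ ≤ κ / 2 * (K * diam T ^ 2 * 𝒯.elemSq g T) := by gcongr
      _ = _ := by ring
  refine (le_of_mul_le_mul_left h3 hd).trans ?_
  calc κ / 2 * K * diam T * 𝒯.elemSq g T
      ≤ κ / 2 * K * (κ / 2 * diam (T.erase a)) * 𝒯.elemSq g T := by gcongr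
    _ = _ := by rw [faceConst]; ring

end Interp
end Mesh

/-! ### From element boundaries to interior faces -/

namespace Mesh

variable {𝒯 : Mesh n} {κ : ℝ}

lemma mem_intFaces {F : Finset (E n)} : F ∈ 𝒯.intFaces ↔ F ∈ 𝒯.K.faces ∧ F.card = n ∧
    ∃ T ∈ 𝒯.elems, ∃ T' ∈ 𝒯.elems, T ≠ T' ∧ F ⊆ T ∧ F ⊆ T' := by
  simp [intFaces]

lemma erase_mem_intFaces (hn : 1 ≤ n) {T T' : Finset (E n)} {a : E n} (hT : T ∈ 𝒯.elems)
    (ha : a ∈ T) (hT' : T' ∈ 𝒯.elems) (hne : T' ≠ T) (hsub : T.erase a ⊆ T') :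
    T.erase a ∈ 𝒯.intFaces := by
  have hc : (T.erase a).card = n := by rw [Finset.card_erase_of_mem ha, (isSimplex hT).1]; simp
  refine mem_intFaces.2 ⟨𝒯.K.down_closed (mem_elems 𝒯 |>.1 hT).1 (Finset.erase_subset a T) ?_, hc,
    T, hT, T', hT', hne.symm, Finset.erase_subset a T, hsub⟩
  rw [← Finset.card_pos, hc]
  omega

/-- An unshared face contains no point of the domain, so both `g` and the nodal values vanish on it.
Boundary faces therefore do not contribute to the residual. -/
lemma sub_affInterp_eq_zero (hn : 1 ≤ n) {g : E n → ℝ} (hg0 : ∀ x ∉ 𝒯.domain, g x = 0)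
    {T : Finset (E n)} {a : E n} (hT : T ∈ 𝒯.elems) (ha : a ∈ T) (hF : T.erase a ∉ 𝒯.intFaces)
    {x : E n} (hx : x ∈ hull (T.erase a)) : g x - affInterp T (𝒯.nodal g) x = 0 := by
  have hD : ∀ w ∈ hull (T.erase a), w ∉ 𝒯.domain := fun w hw hwD => by
    obtain ⟨T', hT', hne, hsub⟩ := exists_neighbor hn hT ha hw hwD
    exact hF (erase_mem_intFaces hn hT ha hT' hne hsub)
  rw [hg0 x (hD x hx), affInterp_apply, Finset.sum_eq_zero, sub_zero]
  intro z hz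
  by_cases hza : z = a
  · rw [hza, (((isSimplex hT).mem_face_iff ha).1 hx).2, mul_zero]
  · rw [nodal, if_neg (hD z (subset_hull (Finset.mem_erase.2 ⟨hza, hz⟩))), zero_mul]

lemma sum_faces_eq (J : Finset (E n) → Finset (E n) → ℝ)
    (hJ : ∀ T ∈ 𝒯.elems, ∀ a ∈ T, T.erase a ∉ 𝒯.intFaces → J T (T.erase a) = 0) :
    ∑ T ∈ 𝒯.elems, ∑ a ∈ T, J T (T.erase a) =
      ∑ F ∈ 𝒯.intFaces, ∑ T ∈ 𝒯.elems with F ⊆ T, J T F := by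
  classical
  have h1 : ∀ T ∈ 𝒯.elems, ∑ a ∈ T, J T (T.erase a) = ∑ F ∈ 𝒯.intFaces with F ⊆ T, J T F := by
    intro T hT
    rw [← Finset.sum_image (s := T) (g := fun a => T.erase a) (f := fun F => J T F)]
    · symm
      refine Finset.sum_subset (fun F hF => ?_) (fun F hF hF' => ?_)
      · obtain ⟨hF, hFT⟩ := Finset.mem_filter.1 hF
        obtain ⟨a, ha, rfl⟩ := exists_erase (isSimplex hT) hFT (mem_intFaces.1 hF).2.1
        exact Finset.mem_image_of_mem _ ha
      · obtain ⟨a, ha, rfl⟩ := Finset.mem_image.1 hF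
        exact hJ T hT a ha fun h => hF' (Finset.mem_filter.2 ⟨h, Finset.erase_subset a T⟩)
    · intro a ha b hb hab
      by_contra hne
      have : a ∈ T.erase b := Finset.mem_erase.2 ⟨hne, ha⟩
      have hab' : T.erase a = T.erase b := hab
      rw [← hab'] at this
      exact Finset.notMem_erase a T this
  rw [Finset.sum_congr rfl h1]
  refine Finset.sum_comm' fun T F => ?_
  simp only [Finset.mem_filter]
  tauto

lemma card_intFaces_le {T : Finset (E n)} (hT : T ∈ 𝒯.elems) :
    ({F ∈ 𝒯.intFaces | F ⊆ T} : Finset (Finset (E n))).card ≤ n + 1 := by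
  calc _ ≤ (T.powersetCard n).card := Finset.card_le_card fun F hF => by
        obtain ⟨hF, hFT⟩ := Finset.mem_filter.1 hF
        exact Finset.mem_powersetCard.2 ⟨hFT, (mem_intFaces.1 hF).2.1⟩
    _ = _ := by rw [Finset.card_powersetCard, (isSimplex hT).1]; simp

lemma memLp_hull {f : E n → ℝ} (hf : MemLp f 2 (volume.restrict 𝒯.domain)) {T : Finset (E n)}
    (hT : T ∈ 𝒯.elems) : MemLp f 2 (volume.restrict (hull T)) := by
  rw [← Measure.restrict_congr_set (interior_ae_eq_hull T)]
  exact hf.mono_measure (Measure.restrict_mono (interior_hull_subset_domain hT) le_rfl)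

end Mesh

/-- The divergence theorem for the field `ψ X` and the product rule. -/
lemma IsSimplex.integral_residual {T : Finset (E n)} (h : IsSimplex T) (hn : 1 ≤ n) {f ψ : E n → ℝ}
    {X : E n → E n} (hf : MemLp f 2 (volume.restrict (hull T))) (hψ : ContDiff ℝ 1 ψ)
    (hX : ContDiff ℝ 1 X) :
    ∫ x in hull T, (f x * ψ x - fderiv ℝ ψ x (X x)) =
      (∫ x in hull T, (f x + divergence X x) * ψ x) -
        ∑ a ∈ T, ∫ x in hull (T.erase a), ψ x * ⟪outerNormal T (T.erase a), X x⟫ ∂μHE[n - 1] := by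
  have hi : ∀ {φ : E n → ℝ}, Continuous φ → IntegrableOn φ (hull T) := fun hφ =>
    hφ.continuousOn.integrableOn_compact (isCompact_hull T)
  have hψc := hψ.continuous
  have hXc := hX.continuous
  have hdX := continuous_divergence hX
  have hψ' : Continuous fun x => fderiv ℝ ψ x (X x) :=
    (hψ.continuous_fderiv one_ne_zero).clm_apply hXc
  have hfψ : IntegrableOn (fun x => f x * ψ x) (hull T) := by
    have := hf.integrable_mul (memLp_two_of_continuousOn (isCompact_hull T) (volume_hull_lt_top T)
      hψc.continuousOn)
    exact this
  have hdiv := h.integral_divergence hn (X := fun y => ψ y • X y) (hψ.smul hX)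
  simp only [divergence_smul hψ hX, inner_smul_right] at hdiv
  rw [← hdiv, ← integral_sub]
  · refine integral_congr_ae (Filter.Eventually.of_forall fun x => ?_)
    simp only
    ring
  · have : IntegrableOn (fun x => f x * ψ x + divergence X x * ψ x) (hull T) :=
      hfψ.add (hi (hdX.mul hψc))
    exact this.congr_fun (fun x _ => by simp only; ring) (isClosed_hull T).measurableSet
  · exact hi ((hψc.mul hdX).add hψ')

/-- The discrete Cauchy–Schwarz inequality, which collects the element and face contributions. -/
lemma sum_sqrt_mul_le {ι : Type*} (s : Finset ι) {a b : ι → ℝ} (ha : ∀ i ∈ s, 0 ≤ a i)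
    (hb : ∀ i ∈ s, 0 ≤ b i) :
    ∑ i ∈ s, √(a i) * √(b i) ≤ √(∑ i ∈ s, a i) * √(∑ i ∈ s, b i) := by
  rw [← Real.sqrt_mul (Finset.sum_nonneg ha)]
  refine Real.le_sqrt_of_sq_le ((Finset.sum_mul_sq_le_sq_mul_sq s _ _).trans_eq ?_)
  rw [Finset.sum_congr rfl fun i hi => Real.sq_sqrt (ha i hi),
    Finset.sum_congr rfl fun i hi => Real.sq_sqrt (hb i hi)]

/-! ### The residual estimate for smooth test functions -/

namespace Mesh

variable {𝒯 : Mesh n} {κ : ℝ}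

/-- The square of the residual estimator of a piecewise `C¹` flux. -/
def resSq (𝒯 : Mesh n) (f : E n → ℝ) (X : Finset (E n) → E n → E n) : ℝ :=
  ∑ T ∈ 𝒯.elems, diam T ^ 2 * (∫ x in hull T, (f x + divergence (X T) x) ^ 2) +
  ∑ F ∈ 𝒯.intFaces, diam F * ∫ x in hull F,
    (∑ T ∈ 𝒯.elems with F ⊆ T, ⟪outerNormal T F, X T x⟫) ^ 2 ∂μHE[n - 1]

/-- The constant in the residual estimate. -/
def resConst (n : ℕ) (κ : ℝ) : ℝ :=
  √(elemConst n κ * ((n + 1) * starBound n κ)) +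
    √(faceConst n κ * ((n + 1) * ((n + 1) * starBound n κ)))

section Sum

variable (hreg : 𝒯.ShapeRegular κ) (hκ : 0 < κ) (hn : 2 ≤ n)

-- Finite overlap: an element is counted once for each of its `n + 1` vertices and each element at
-- that vertex.
include hreg hκ hn in
lemma sum_elemSq_le (g : E n → ℝ) :
    ∑ T ∈ 𝒯.elems, 𝒯.elemSq g T ≤ (n + 1) * starBound n κ * ∑ T ∈ 𝒯.elems, gradSq g T := by
  have e : ∑ T ∈ 𝒯.elems, 𝒯.elemSq g T =
      ∑ T' ∈ 𝒯.elems, ∑ z ∈ T', (𝒯.star z).card * gradSq g T' := by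
    classical
    calc ∑ T ∈ 𝒯.elems, 𝒯.elemSq g T
        = ∑ T ∈ 𝒯.elems, ∑ z ∈ T, ∑ T' ∈ 𝒯.star z, gradSq g T' := rfl
      _ = ∑ z ∈ 𝒯.elems.biUnion id, ∑ T ∈ 𝒯.star z, ∑ T' ∈ 𝒯.star z, gradSq g T' :=
          Finset.sum_comm' fun T z => by
            simp only [Finset.mem_biUnion, mem_star, id]
            constructor
            · rintro ⟨h1, h2⟩; exact ⟨⟨h1, h2⟩, T, h1, h2⟩
            · rintro ⟨h, -⟩; exact h
      _ = ∑ z ∈ 𝒯.elems.biUnion id, ∑ T' ∈ 𝒯.star z, (𝒯.star z).card * gradSq g T' := by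
          refine Finset.sum_congr rfl fun z _ => ?_
          rw [Finset.sum_const, nsmul_eq_mul, Finset.mul_sum]
      _ = _ := Finset.sum_comm' fun z T => by
            simp only [Finset.mem_biUnion, mem_star, id]
            constructor
            · rintro ⟨-, h⟩; exact ⟨h.2, h.1⟩
            · rintro ⟨h1, h2⟩; exact ⟨⟨T, h2, h1⟩, h2, h1⟩
  rw [e, Finset.mul_sum]
  refine Finset.sum_le_sum fun T hT => ?_
  have hG := gradSq_nonneg g T
  calc ∑ z ∈ T, ((𝒯.star z).card : ℝ) * gradSq g T
      ≤ ∑ z ∈ T, (starBound n κ : ℝ) * gradSq g T := by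
        refine Finset.sum_le_sum fun z _ => ?_
        have : ((𝒯.star z).card : ℝ) ≤ starBound n κ := by
          exact_mod_cast card_star_le_starBound hreg hκ (by omega) z
        gcongr
    _ = _ := by
        rw [Finset.sum_const, (isSimplex hT).1, nsmul_eq_mul]
        push_cast
        ring

include hreg hκ hn in
/-- The residual of a piecewise `C¹` flux, tested with the difference of a `C¹` function that
vanishes outside of the domain and its Clément interpolant. -/
lemma abs_sum_residual_le {f : E n → ℝ} (hf : MemLp f 2 (volume.restrict 𝒯.domain))
    {X : Finset (E n) → E n → E n} (hX : ∀ T ∈ 𝒯.elems, ContDiff ℝ 1 (X T)) {g : E n → ℝ}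
    (hg : ContDiff ℝ 1 g) (hg0 : ∀ x ∉ 𝒯.domain, g x = 0) :
    |∑ T ∈ 𝒯.elems, ∫ x in hull T, (f x * (g x - affInterp T (𝒯.nodal g) x) -
      fderiv ℝ (fun y => g y - affInterp T (𝒯.nodal g) y) x (X T x))| ≤
      resConst n κ * √(𝒯.resSq f X) * √(∑ T ∈ 𝒯.elems, gradSq g T) := by
  classical
  have hn1 : 1 ≤ n := by omega
  have hvc := vertexConst_nonneg (n := n) hκ
  set G := ∑ T ∈ 𝒯.elems, gradSq g T with hG
  have hG0 : 0 ≤ G := Finset.sum_nonneg fun T _ => gradSq_nonneg g T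
  set ψ : Finset (E n) → E n → ℝ := fun T y => g y - affInterp T (𝒯.nodal g) y with hψ
  have hψ1 : ∀ T, ContDiff ℝ 1 (ψ T) := fun T => hg.sub (contDiff_affine _)
  -- `Ψ` glues the `ψ T`. Being single-valued on a face, it can be factored out, and the normal
  -- fluxes from the two sides add up to the jump.
  set Ψ : E n → ℝ := fun x => g x - 𝒯.pwAffine (𝒯.nodal g) x with hΨ
  have hΨψ : ∀ T ∈ 𝒯.elems, ∀ x ∈ hull T, Ψ x = ψ T x := fun T hT x hx => by
    simp only [hΨ, hψ, pwAffine_eq hT hx]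
  set R : Finset (E n) → E n → ℝ := fun T x => f x + divergence (X T) x with hR
  set j : Finset (E n) → E n → ℝ := fun F x =>
    ∑ T ∈ 𝒯.elems with F ⊆ T, ⟪outerNormal T F, X T x⟫ with hj
  have hjc : ∀ F, Continuous (j F) := fun F => continuous_finsetSum _ fun T hT => by
    have := (hX T (Finset.mem_filter.1 hT).1).continuous
    fun_prop
  have hface : ∑ T ∈ 𝒯.elems, ∑ a ∈ T,
      ∫ x in hull (T.erase a), ψ T x * ⟪outerNormal T (T.erase a), X T x⟫ ∂μHE[n - 1] =
      ∑ F ∈ 𝒯.intFaces, ∫ x in hull F, j F x * Ψ x ∂μHE[n - 1] := by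
    rw [sum_faces_eq (fun T F => ∫ x in hull F, ψ T x * ⟪outerNormal T F, X T x⟫ ∂μHE[n - 1])]
    · refine Finset.sum_congr rfl fun F hF => ?_
      have hFT : ∀ T ∈ ({T ∈ 𝒯.elems | F ⊆ T} : Finset _), ∃ a ∈ T, F = T.erase a := fun T hT =>
        exists_erase (isSimplex (Finset.mem_filter.1 hT).1) (Finset.mem_filter.1 hT).2
          (mem_intFaces.1 hF).2.1
      rw [← integral_finsetSum]
      · refine setIntegral_congr_fun (isClosed_hull F).measurableSet fun x hx => ?_
        simp only [hj, Finset.sum_mul]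
        refine Finset.sum_congr rfl fun T hT => ?_
        rw [hΨψ T (Finset.mem_filter.1 hT).1 x (hull_mono (Finset.mem_filter.1 hT).2 hx), mul_comm]
      · intro T hT
        obtain ⟨a, ha, rfl⟩ := hFT T hT
        have hTe := (Finset.mem_filter.1 hT).1
        have := (hX T hTe).continuous
        have := (hψ1 T).continuous
        exact (isSimplex hTe).integrableOn_face hn1 ha (by fun_prop)
    · intro T hT a ha hF
      refine setIntegral_eq_zero_of_forall_eq_zero fun x hx => ?_
      have h0 : ψ T x = 0 := sub_affInterp_eq_zero hn1 hg0 hT ha hF hx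
      rw [h0, zero_mul]
  have hsum : ∑ T ∈ 𝒯.elems, ∫ x in hull T, (f x * ψ T x - fderiv ℝ (ψ T) x (X T x)) =
      ∑ T ∈ 𝒯.elems, (∫ x in hull T, R T x * ψ T x) -
        ∑ F ∈ 𝒯.intFaces, ∫ x in hull F, j F x * Ψ x ∂μHE[n - 1] := by
    rw [← hface, ← Finset.sum_sub_distrib]
    exact Finset.sum_congr rfl fun T hT =>
      (isSimplex hT).integral_residual hn1 (memLp_hull hf hT) (hψ1 T) (hX T hT)
  set A : Finset (E n) → ℝ := fun T => diam T ^ 2 * (∫ x in hull T, R T x ^ 2) with hA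
  set A' : Finset (E n) → ℝ := fun F => diam F * ∫ x in hull F, j F x ^ 2 ∂μHE[n - 1] with hA'
  have hA0 : ∀ T, 0 ≤ A T := fun T => mul_nonneg (sq_nonneg _) (integral_nonneg fun x => sq_nonneg _)
  have hA'0 : ∀ F, 0 ≤ A' F := fun F =>
    mul_nonneg (diam_nonneg _) (integral_nonneg fun x => sq_nonneg _)
  have hEC : 0 ≤ elemConst n κ := by unfold elemConst; positivity
  have hFC : 0 ≤ faceConst n κ := by unfold faceConst; positivity
  have helem : ∀ T ∈ 𝒯.elems, |∫ x in hull T, R T x * ψ T x| ≤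
      √(A T) * √(elemConst n κ * 𝒯.elemSq g T) := by
    intro T hT
    have hfR : MemLp (R T) 2 (volume.restrict (hull T)) := (memLp_hull hf hT).add
      (memLp_two_of_continuousOn (isCompact_hull T) (volume_hull_lt_top T)
        (continuous_divergence (hX T hT)).continuousOn)
    refine (abs_integral_mul_le hfR (memLp_two_of_continuousOn (isCompact_hull T)
      (volume_hull_lt_top T) (hψ1 T).continuous.continuousOn)).trans ?_
    rw [← Real.sqrt_mul (integral_nonneg fun x => sq_nonneg _), ← Real.sqrt_mul (hA0 T)]
    refine Real.sqrt_le_sqrt ?_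
    calc (∫ x in hull T, R T x ^ 2) * ∫ x in hull T, ψ T x ^ 2
        ≤ (∫ x in hull T, R T x ^ 2) * (elemConst n κ * diam T ^ 2 * 𝒯.elemSq g T) := by
          refine mul_le_mul_of_nonneg_left ?_ (integral_nonneg fun x => sq_nonneg _)
          exact integral_sq_sub_affInterp_le hreg hκ hn hg hg0 hT
      _ = _ := by rw [hA]; ring
  have hfaceb : ∀ F ∈ 𝒯.intFaces, |∫ x in hull F, j F x * Ψ x ∂μHE[n - 1]| ≤
      √(A' F) * √(faceConst n κ * ∑ T ∈ 𝒯.elems with F ⊆ T, 𝒯.elemSq g T) := by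
    intro F hF
    obtain ⟨-, hc, T, hT, -, -, -, hFT, -⟩ := mem_intFaces.1 hF
    obtain ⟨a, ha, hFa⟩ := exists_erase (isSimplex hT) hFT hc
    have hle : 𝒯.elemSq g T ≤ ∑ T ∈ 𝒯.elems with F ⊆ T, 𝒯.elemSq g T :=
      Finset.single_le_sum (f := fun T => 𝒯.elemSq g T) (fun T _ => elemSq_nonneg g T)
        (Finset.mem_filter.2 ⟨hT, hFT⟩)
    have hlt : (μHE[n - 1] : Measure (E n)) (hull F) < ⊤ := by
      rw [hFa]; exact (isSimplex hT).surface_face_lt_top hn1 ha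
    have hΨ' : ∫ x in hull F, j F x * Ψ x ∂μHE[n - 1] =
        ∫ x in hull F, j F x * ψ T x ∂μHE[n - 1] :=
      setIntegral_congr_fun (isClosed_hull F).measurableSet fun x hx => by
        simp only [hΨψ T hT x (hull_mono hFT hx)]
    rw [hΨ']
    refine (abs_integral_mul_le (memLp_two_of_continuousOn (isCompact_hull F) hlt
      (hjc F).continuousOn) (memLp_two_of_continuousOn (isCompact_hull F) hlt
      (hψ1 T).continuous.continuousOn)).trans ?_
    rw [← Real.sqrt_mul (integral_nonneg fun x => sq_nonneg _), ← Real.sqrt_mul (hA'0 F)]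
    refine Real.sqrt_le_sqrt ?_
    calc (∫ x in hull F, j F x ^ 2 ∂μHE[n - 1]) * ∫ x in hull F, ψ T x ^ 2 ∂μHE[n - 1]
        ≤ (∫ x in hull F, j F x ^ 2 ∂μHE[n - 1]) *
            (faceConst n κ * diam F * ∑ T ∈ 𝒯.elems with F ⊆ T, 𝒯.elemSq g T) := by
          refine mul_le_mul_of_nonneg_left ?_ (integral_nonneg fun x => sq_nonneg _)
          have := integral_face_sq_sub_affInterp_le hreg hκ hn hg hg0 hT ha
          rw [← hFa] at this
          refine this.trans (mul_le_mul_of_nonneg_left hle (mul_nonneg hFC (diam_nonneg _)))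
      _ = _ := by rw [hA']; ring
  have hS1 : ∑ T ∈ 𝒯.elems, elemConst n κ * 𝒯.elemSq g T ≤
      elemConst n κ * ((n + 1) * starBound n κ) * G := by
    rw [← Finset.mul_sum, mul_assoc]
    exact mul_le_mul_of_nonneg_left (sum_elemSq_le hreg hκ hn g) hEC
  -- An element has at most `n + 1` interior faces, which gives the additional factor.
  have hS2 : ∑ F ∈ 𝒯.intFaces, faceConst n κ * ∑ T ∈ 𝒯.elems with F ⊆ T, 𝒯.elemSq g T ≤
      faceConst n κ * ((n + 1) * ((n + 1) * starBound n κ)) * G := by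
    rw [← Finset.mul_sum, mul_assoc]
    refine mul_le_mul_of_nonneg_left ?_ hFC
    calc ∑ F ∈ 𝒯.intFaces, ∑ T ∈ 𝒯.elems with F ⊆ T, 𝒯.elemSq g T
        = ∑ T ∈ 𝒯.elems, ∑ F ∈ 𝒯.intFaces with F ⊆ T, 𝒯.elemSq g T :=
          Finset.sum_comm' fun F T => by simp only [Finset.mem_filter]; tauto
      _ ≤ ∑ T ∈ 𝒯.elems, (n + 1 : ℝ) * 𝒯.elemSq g T := by
          refine Finset.sum_le_sum fun T hT => ?_
          rw [Finset.sum_const, nsmul_eq_mul]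
          refine mul_le_mul_of_nonneg_right ?_ (elemSq_nonneg g T)
          exact_mod_cast card_intFaces_le hT
      _ ≤ (n + 1) * ((n + 1) * starBound n κ * G) := by
          rw [← Finset.mul_sum]
          exact mul_le_mul_of_nonneg_left (sum_elemSq_le hreg hκ hn g) (by positivity)
      _ = _ := by ring
  have hres : 𝒯.resSq f X = ∑ T ∈ 𝒯.elems, A T + ∑ F ∈ 𝒯.intFaces, A' F := rfl
  have hsA : 0 ≤ ∑ T ∈ 𝒯.elems, A T := Finset.sum_nonneg fun T _ => hA0 T
  have hsA' : 0 ≤ ∑ F ∈ 𝒯.intFaces, A' F := Finset.sum_nonneg fun F _ => hA'0 F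
  rw [hsum]
  calc _ ≤ |∑ T ∈ 𝒯.elems, ∫ x in hull T, R T x * ψ T x| +
        |∑ F ∈ 𝒯.intFaces, ∫ x in hull F, j F x * Ψ x ∂μHE[n - 1]| := abs_sub _ _
    _ ≤ ∑ T ∈ 𝒯.elems, √(A T) * √(elemConst n κ * 𝒯.elemSq g T) +
        ∑ F ∈ 𝒯.intFaces, √(A' F) * √(faceConst n κ * ∑ T ∈ 𝒯.elems with F ⊆ T, 𝒯.elemSq g T) :=
      add_le_add ((Finset.abs_sum_le_sum_abs _ _).trans (Finset.sum_le_sum helem))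
        ((Finset.abs_sum_le_sum_abs _ _).trans (Finset.sum_le_sum hfaceb))
    _ ≤ √(∑ T ∈ 𝒯.elems, A T) * √(∑ T ∈ 𝒯.elems, elemConst n κ * 𝒯.elemSq g T) +
        √(∑ F ∈ 𝒯.intFaces, A' F) *
          √(∑ F ∈ 𝒯.intFaces, faceConst n κ * ∑ T ∈ 𝒯.elems with F ⊆ T, 𝒯.elemSq g T) :=
      add_le_add (sum_sqrt_mul_le _ (fun T _ => hA0 T)
          fun T _ => mul_nonneg hEC (elemSq_nonneg g T))
        (sum_sqrt_mul_le _ (fun F _ => hA'0 F) fun F _ =>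
          mul_nonneg hFC (Finset.sum_nonneg fun T _ => elemSq_nonneg g T))
    _ ≤ √(𝒯.resSq f X) * √(elemConst n κ * ((n + 1) * starBound n κ) * G) +
        √(𝒯.resSq f X) * √(faceConst n κ * ((n + 1) * ((n + 1) * starBound n κ)) * G) := by
      rw [hres]
      gcongr
      · linarith
      · linarith
    _ = _ := by
      rw [Real.sqrt_mul (show 0 ≤ elemConst n κ * ((n + 1) * starBound n κ) by positivity) G,
        Real.sqrt_mul (show 0 ≤ faceConst n κ * ((n + 1) * ((n + 1) * starBound n κ)) by
          positivity) G, resConst]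
      ring

end Sum
end Mesh

/-! ### The space `H¹₀(D)` -/

lemma gradient_inner {g : E n → ℝ} (x v : E n) : ⟪gradient g x, v⟫ = fderiv ℝ g x v := by
  simp [gradient]

lemma norm_gradient (g : E n → ℝ) (x : E n) : ‖gradient g x‖ = ‖fderiv ℝ g x‖ := by
  simp [gradient]

lemma continuous_gradient {g : E n → ℝ} (hg : ContDiff ℝ 1 g) : Continuous (gradient g) :=
  (InnerProductSpace.toDual ℝ (E n)).symm.continuous.comp (hg.continuous_fderiv one_ne_zero)

lemma integrable_inner_of_memLp {α : Type*} [MeasurableSpace α] {μ : Measure α} {F G : α → E n}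
    (hF : MemLp F 2 μ) (hG : MemLp G 2 μ) : Integrable (fun x => ⟪F x, G x⟫) μ :=
  (hF.norm.integrable_mul hG.norm).mono' (hF.1.inner hG.1)
    (Filter.Eventually.of_forall fun _ => norm_inner_le_norm _ _)

namespace H10

variable {D : Set (E n)}

/-- The underlying function as a continuous linear map. -/
def valL : H10 D →L[ℝ] Lp ℝ 2 (volume.restrict D) :=
  (ContinuousLinearMap.fst ℝ _ _).comp (H10 D).subtypeL

/-- The weak gradient as a continuous linear map. -/
def gradL : H10 D →L[ℝ] Lp (E n) 2 (volume.restrict D) :=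
  (ContinuousLinearMap.snd ℝ _ _).comp (H10 D).subtypeL

lemma val_memLp (v : H10 D) : MemLp (val v) 2 (volume.restrict D) := Lp.memLp (valL v)

lemma grad_memLp (v : H10 D) : MemLp (grad v) 2 (volume.restrict D) := Lp.memLp (gradL v)

lemma val_add (v w : H10 D) : val (v + w) =ᵐ[volume.restrict D] fun x => val v x + val w x :=
  Lp.coeFn_add (valL v) (valL w)

lemma grad_add (v w : H10 D) : grad (v + w) =ᵐ[volume.restrict D] fun x => grad v x + grad w x :=
  Lp.coeFn_add (gradL v) (gradL w)

lemma val_sub (v w : H10 D) : val (v - w) =ᵐ[volume.restrict D] fun x => val v x - val w x :=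
  Lp.coeFn_sub (valL v) (valL w)

lemma grad_sub (v w : H10 D) : grad (v - w) =ᵐ[volume.restrict D] fun x => grad v x - grad w x :=
  Lp.coeFn_sub (gradL v) (gradL w)

lemma val_smul (c : ℝ) (v : H10 D) : val (c • v) =ᵐ[volume.restrict D] fun x => c * val v x :=
  Lp.coeFn_smul c (valL v)

lemma val_sum {ι : Type*} (s : Finset ι) (v : ι → H10 D) :
    val (∑ i ∈ s, v i) =ᵐ[volume.restrict D] fun x => ∑ i ∈ s, val (v i) x := by
  classical
  induction s using Finset.induction_on with
  | empty => simp only [Finset.sum_empty]; exact Lp.coeFn_zero ℝ 2 (volume.restrict D)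
  | insert a s ha ih =>
    rw [Finset.sum_insert ha]
    filter_upwards [val_add (v a) (∑ i ∈ s, v i), ih] with x h1 h2
    rw [h1, h2, Finset.sum_insert ha]

lemma ext_ae {v w : H10 D} (h1 : val v =ᵐ[volume.restrict D] val w)
    (h2 : grad v =ᵐ[volume.restrict D] grad w) : v = w :=
  Subtype.ext (Prod.ext (Lp.ext h1) (Lp.ext h2))

/-- Written as an inner product in `L²`, the integral is visibly continuous in `v`. Density
arguments with `induction` depend on this. -/
lemma integral_mul_val {h : E n → ℝ} (hh : MemLp h 2 (volume.restrict D)) (v : H10 D) :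
    ∫ x in D, h x * val v x = ⟪hh.toLp h, valL v⟫ := by
  rw [L2.inner_def]
  refine integral_congr_ae ?_
  filter_upwards [hh.coeFn_toLp] with x hx
  rw [hx, real_inner_eq_re_inner]
  simp only [RCLike.inner_apply, conj_trivial, RCLike.re_to_real]
  exact mul_comm _ _

lemma integral_inner_grad {S : E n → E n} (hS : MemLp S 2 (volume.restrict D)) (v : H10 D) :
    ∫ x in D, ⟪S x, grad v x⟫ = ⟪hS.toLp S, gradL v⟫ := by
  rw [L2.inner_def]
  refine integral_congr_ae ?_
  filter_upwards [hS.coeFn_toLp] with x hx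
  rw [hx]
  rfl

lemma continuous_integral_mul_val {h : E n → ℝ} (hh : MemLp h 2 (volume.restrict D)) :
    Continuous fun v : H10 D => ∫ x in D, h x * val v x := by
  simp only [integral_mul_val hh]
  fun_prop

lemma continuous_integral_inner_grad {S : E n → E n} (hS : MemLp S 2 (volume.restrict D)) :
    Continuous fun v : H10 D => ∫ x in D, ⟪S x, grad v x⟫ := by
  simp only [integral_inner_grad hS]
  fun_prop

/-- `v` is the element of `H¹₀(D)` given by the test function `g`. -/
structure IsTest (v : H10 D) (g : E n → ℝ) : Prop where
  contDiff : ContDiff ℝ ∞ g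
  compact : HasCompactSupport g
  support : tsupport g ⊆ D
  val_eq : val v =ᵐ[volume.restrict D] g
  grad_eq : grad v =ᵐ[volume.restrict D] gradient g

/-- A closed property of all test functions holds on `H¹₀(D)`. -/
lemma induction {P : H10 D → Prop} (hP : IsClosed {v | P v}) (h : ∀ v g, IsTest v g → P v)
    (v : H10 D) : P v := by
  set S : Set (PairL2 D) := {v : PairL2 D | ∃ g : E n → ℝ, ContDiff ℝ ∞ g ∧ HasCompactSupport g ∧
    tsupport g ⊆ D ∧ v.1 =ᵐ[volume.restrict D] g ∧ v.2 =ᵐ[volume.restrict D] gradient g} with hS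
  -- The test functions already form a subspace, so every element of `H10 D` is a limit of test
  -- functions themselves.
  have hsub : ∀ w ∈ Submodule.span ℝ S, w ∈ S := by
    intro w hw
    induction hw using Submodule.span_induction with
    | mem w hw => exact hw
    | zero =>
      refine ⟨fun _ => 0, contDiff_const, HasCompactSupport.zero, ?_, Lp.coeFn_zero _ _ _, ?_⟩
      · have : tsupport (fun _ : E n => (0 : ℝ)) = ∅ := by simp [tsupport, Function.support]
        rw [this]
        exact empty_subset _
      · have : gradient (fun _ : E n => (0 : ℝ)) = 0 := by
          ext x
          simp [gradient]
        rw [this]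
        exact Lp.coeFn_zero _ _ _
    | add v w _ _ hv hw =>
      obtain ⟨g, hg1, hg2, hg3, hg4, hg5⟩ := hv
      obtain ⟨k, hk1, hk2, hk3, hk4, hk5⟩ := hw
      refine ⟨fun x => g x + k x, hg1.add hk1, hg2.add hk2,
        (tsupport_add g k).trans (union_subset hg3 hk3), ?_, ?_⟩
      · filter_upwards [Lp.coeFn_add v.1 w.1, hg4, hk4] with x h1 h2 h3
        rw [Prod.fst_add, h1, Pi.add_apply, h2, h3]
      · filter_upwards [Lp.coeFn_add v.2 w.2, hg5, hk5] with x h1 h2 h3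
        rw [Prod.snd_add, h1, Pi.add_apply, h2, h3]
        simp only [gradient]
        rw [fderiv_fun_add (hg1.differentiable (by simp) x) (hk1.differentiable (by simp) x), map_add]
    | smul c v _ hv =>
      obtain ⟨g, hg1, hg2, hg3, hg4, hg5⟩ := hv
      refine ⟨fun x => c * g x, contDiff_const.mul hg1, hg2.mul_left,
        (tsupport_mul_subset_right).trans hg3, ?_, ?_⟩
      · filter_upwards [Lp.coeFn_smul c v.1, hg4] with x h1 h2
        rw [Prod.smul_fst, h1, Pi.smul_apply, h2, smul_eq_mul]
      · filter_upwards [Lp.coeFn_smul c v.2, hg5] with x h1 h2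
        rw [Prod.smul_snd, h1, Pi.smul_apply, h2]
        simp only [gradient]
        rw [fderiv_const_mul (hg1.differentiable (by simp) x), map_smulₛₗ]
        rfl
  have hv : v.1 ∈ closure (Submodule.span ℝ S : Set (PairL2 D)) := v.2
  obtain ⟨x, hx, hlim⟩ := mem_closure_iff_seq_limit.1 hv
  have hxH : ∀ k, x k ∈ H10 D := fun k => subset_closure (hx k)
  have hlim' : Filter.Tendsto (fun k => (⟨x k, hxH k⟩ : H10 D)) Filter.atTop (nhds v) :=
    tendsto_subtype_rng.2 hlim
  refine hP.mem_of_tendsto hlim' (Filter.Eventually.of_forall fun k => ?_)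
  obtain ⟨g, h1, h2, h3, h4, h5⟩ := hsub _ (hx k)
  exact h _ g ⟨h1, h2, h3, h4, h5⟩

lemma memLp_of_hasCompactSupport {F : Type*} [NormedAddCommGroup F] {g : E n → F}
    (hg : Continuous g) (hc : HasCompactSupport g) : MemLp g 2 (volume.restrict D) :=
  (hg.memLp_of_hasCompactSupport hc).restrict D

lemma hasCompactSupport_gradient {g : E n → ℝ} (hc : HasCompactSupport g) :
    HasCompactSupport (gradient g) :=
  (hc.fderiv (𝕜 := ℝ)).comp_left (g := fun L => (InnerProductSpace.toDual ℝ (E n)).symm L)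
    (map_zero _)

lemma exists_isTest {g : E n → ℝ} (hg : ContDiff ℝ ∞ g) (hc : HasCompactSupport g)
    (hs : tsupport g ⊆ D) : ∃ v : H10 D, IsTest v g := by
  have h1 : MemLp g 2 (volume.restrict D) := memLp_of_hasCompactSupport hg.continuous hc
  have h2 : MemLp (gradient g) 2 (volume.restrict D) := memLp_of_hasCompactSupport
    (continuous_gradient (hg.of_le (by exact_mod_cast le_top))) (hasCompactSupport_gradient hc)
  refine ⟨⟨(h1.toLp g, h2.toLp _), subset_closure (Submodule.subset_span
    ⟨g, hg, hc, hs, h1.coeFn_toLp, h2.coeFn_toLp⟩)⟩, hg, hc, hs, h1.coeFn_toLp, h2.coeFn_toLp⟩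

lemma IsTest.eq_zero {v : H10 D} {g : E n → ℝ} (h : IsTest v g) {x : E n} (hx : x ∉ D) : g x = 0 :=
  image_eq_zero_of_notMem_tsupport fun hx' => hx (h.support hx')

/-- Integration by parts. -/
lemma integral_val_mul_fderiv (v : H10 D) {φ : E n → ℝ} (hφ : ContDiff ℝ ∞ φ)
    (hc : HasCompactSupport φ) (e : E n) :
    ∫ x in D, fderiv ℝ φ x e * val v x = -∫ x in D, ⟪φ x • e, grad v x⟫ := by
  have hφ1 : ContDiff ℝ 1 φ := hφ.of_le (by exact_mod_cast le_top)
  have hd : Continuous fun x => fderiv ℝ φ x e :=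
    (hφ1.continuous_fderiv one_ne_zero).clm_apply continuous_const
  have hdc : HasCompactSupport fun x => fderiv ℝ φ x e :=
    (hc.fderiv (𝕜 := ℝ)).comp_left (g := fun L : E n →L[ℝ] ℝ => L e) (by simp)
  refine induction (P := fun v => ∫ x in D, fderiv ℝ φ x e * val v x =
    -∫ x in D, ⟪φ x • e, grad v x⟫) (isClosed_eq ?_ ?_) (fun v g hv => ?_) v
  · exact continuous_integral_mul_val (memLp_of_hasCompactSupport hd hdc)
  · exact (continuous_integral_inner_grad (memLp_of_hasCompactSupport
      (hφ.continuous.smul (continuous_const (y := e))) hc.smul_right)).neg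
  · have hg1 : ContDiff ℝ 1 g := hv.contDiff.of_le (by exact_mod_cast le_top)
    have hgd : Continuous fun x => fderiv ℝ g x e :=
      (hg1.continuous_fderiv one_ne_zero).clm_apply continuous_const
    have hgdc : HasCompactSupport fun x => fderiv ℝ g x e :=
      (hv.compact.fderiv (𝕜 := ℝ)).comp_left (g := fun L : E n →L[ℝ] ℝ => L e) (by simp)
    have e1 : ∫ x in D, fderiv ℝ φ x e * val v x = ∫ x, fderiv ℝ φ x e * g x := by
      refine Eq.trans (integral_congr_ae ?_) (setIntegral_eq_integral_of_forall_compl_eq_zero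
        (s := D) fun x hx => by rw [hv.eq_zero hx, mul_zero])
      filter_upwards [hv.val_eq] with x hx
      rw [hx]
    have e2 : ∫ x in D, ⟪φ x • e, grad v x⟫ = ∫ x, φ x * fderiv ℝ g x e := by
      refine Eq.trans (integral_congr_ae ?_) (setIntegral_eq_integral_of_forall_compl_eq_zero
        (s := D) fun x hx => ?_)
      · filter_upwards [hv.grad_eq] with x hx
        rw [hx, real_inner_smul_left, real_inner_comm, gradient_inner]
      · have : fderiv ℝ g x = 0 := image_eq_zero_of_notMem_tsupport fun h =>
          hx (hv.support (tsupport_fderiv_subset ℝ h))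
        rw [this]
        simp
    rw [e1, e2, integral_mul_fderiv_eq_neg_fderiv_mul_of_integrable, neg_neg]
    · exact (hd.mul hg1.continuous).integrable_of_hasCompactSupport hv.compact.mul_left
    · exact (hφ1.continuous.mul hgd).integrable_of_hasCompactSupport hgdc.mul_left
    · exact (hφ1.continuous.mul hg1.continuous).integrable_of_hasCompactSupport hv.compact.mul_left
    · exact fun x _ => hφ1.differentiable one_ne_zero x
    · exact fun x _ => hg1.differentiable one_ne_zero x

/-- The weak gradient is the classical gradient where the function is smooth. -/
lemma grad_eq_gradient (v : H10 D) {U : Set (E n)} (hU : IsOpen U) (hUD : U ⊆ D) {G : E n → ℝ}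
    (hG : ContDiff ℝ 1 G) (h : val v =ᵐ[volume.restrict U] G) :
    grad v =ᵐ[volume.restrict U] gradient G := by
  have hGc := continuous_gradient hG
  have hrU : (volume.restrict U : Measure (E n)) ≤ volume.restrict D :=
    Measure.restrict_mono hUD le_rfl
  have key : ∀ e : E n, ∀ᵐ x, x ∈ U → ⟪e, grad v x - gradient G x⟫ = 0 := by
    intro e
    have hL : LocallyIntegrableOn (fun x => ⟪e, grad v x - gradient G x⟫) U volume := by
      have h1 : LocallyIntegrableOn (fun x => ⟪e, grad v x⟫) U volume := by
        have := ((grad_memLp v).mono_measure hrU).locallyIntegrable one_le_two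
        have h2 : LocallyIntegrable (fun x => ⟪e, grad v x⟫) (volume.restrict U) := fun x => by
          obtain ⟨s, hs, hi⟩ := this x
          exact ⟨s, hs, hi.const_inner e⟩
        exact locallyIntegrableOn_of_locallyIntegrable_restrict h2
      have h2 : LocallyIntegrableOn (fun x => ⟪e, gradient G x⟫) U volume :=
        (show Continuous fun x => ⟪e, gradient G x⟫ by fun_prop).locallyIntegrable.locallyIntegrableOn U
      simp only [inner_sub_right]
      exact h1.sub h2
    -- By the fundamental lemma it suffices to test with bumps supported in `U`. There `v` and `G`
    -- agree, and both can be integrated by parts.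
    refine hU.ae_eq_zero_of_integral_contDiff_smul_eq_zero hL fun φ hφ hc hs => ?_
    have hφ1 : ContDiff ℝ 1 φ := hφ.of_le (by exact_mod_cast le_top)
    have hd : Continuous fun x => fderiv ℝ φ x e :=
      (hφ1.continuous_fderiv one_ne_zero).clm_apply continuous_const
    have hdc : HasCompactSupport fun x => fderiv ℝ φ x e :=
      (hc.fderiv (𝕜 := ℝ)).comp_left (g := fun L : E n →L[ℝ] ℝ => L e) (by simp)
    have hφ0 : ∀ x ∉ U, φ x = 0 := fun x hx => image_eq_zero_of_notMem_tsupport fun hx' => hx (hs hx')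
    have hφd0 : ∀ x ∉ U, fderiv ℝ φ x e = 0 := fun x hx => by
      have : fderiv ℝ φ x = 0 := image_eq_zero_of_notMem_tsupport fun h =>
          hx (hs (tsupport_fderiv_subset ℝ h))
      simp [this]
    have hGe : Continuous fun x => fderiv ℝ G x e :=
      (hG.continuous_fderiv one_ne_zero).clm_apply continuous_const
    have i1 : IntegrableOn (fun x => ⟪φ x • e, grad v x⟫) U := by
      exact integrable_inner_of_memLp (memLp_of_hasCompactSupport (D := U)
        (hφ.continuous.smul (continuous_const (y := e))) hc.smul_right)
        ((grad_memLp v).mono_measure hrU)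
    have i2 : Integrable (fun x => φ x * fderiv ℝ G x e) :=
      (hφ1.continuous.mul hGe).integrable_of_hasCompactSupport hc.mul_right
    have ibp := integral_val_mul_fderiv v hφ hc e
    have hrestr : ∀ F : E n → ℝ, (∀ x ∉ U, F x = 0) → ∫ x in D, F x = ∫ x in U, F x := by
      intro F hF
      have hFU : F = U.indicator F := by
        ext x
        by_cases hx : x ∈ U <;> simp [hx, hF]
      conv_lhs => rw [hFU]
      rw [integral_indicator hU.measurableSet, Measure.restrict_restrict hU.measurableSet,
        inter_eq_self_of_subset_left hUD]
    have hparts : ∫ x, fderiv ℝ φ x e * G x = -∫ x, φ x * fderiv ℝ G x e := by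
      rw [integral_mul_fderiv_eq_neg_fderiv_mul_of_integrable, neg_neg]
      · exact (hd.mul hG.continuous).integrable_of_hasCompactSupport hdc.mul_right
      · exact i2
      · exact (hφ1.continuous.mul hG.continuous).integrable_of_hasCompactSupport hc.mul_right
      · exact fun x _ => hφ1.differentiable one_ne_zero x
      · exact fun x _ => hG.differentiable one_ne_zero x
    have e0 : ∫ x, φ x • ⟪e, grad v x - gradient G x⟫ =
        ∫ x in U, φ x • ⟪e, grad v x - gradient G x⟫ :=
      (setIntegral_eq_integral_of_forall_compl_eq_zero fun x hx => by simp [hφ0 x hx]).symm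
    have e1 : ∫ x in U, φ x • ⟪e, grad v x - gradient G x⟫ =
        (∫ x in U, ⟪φ x • e, grad v x⟫) - ∫ x in U, φ x * fderiv ℝ G x e := by
      rw [← integral_sub i1 i2.integrableOn]
      refine integral_congr_ae (Filter.Eventually.of_forall fun x => ?_)
      simp only [smul_eq_mul, inner_sub_right, real_inner_smul_left]
      rw [real_inner_comm (gradient G x) e, gradient_inner]
      ring
    have e2 : ∫ x in U, φ x * fderiv ℝ G x e = ∫ x, φ x * fderiv ℝ G x e :=
      setIntegral_eq_integral_of_forall_compl_eq_zero fun x hx => by simp [hφ0 x hx]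
    have e3 : ∫ x in D, fderiv ℝ φ x e * val v x = ∫ x, fderiv ℝ φ x e * G x := by
      rw [hrestr _ fun x hx => by simp [hφd0 x hx]]
      refine Eq.trans (integral_congr_ae ?_) (setIntegral_eq_integral_of_forall_compl_eq_zero
        (s := U) fun x hx => by simp [hφd0 x hx])
      filter_upwards [h] with x hx
      rw [hx]
    have e4 : ∫ x in D, ⟪φ x • e, grad v x⟫ = ∫ x in U, ⟪φ x • e, grad v x⟫ :=
      hrestr _ fun x hx => by simp [hφ0 x hx]
    rw [e0, e1, e2, ← e4]
    linarith
  have hb : ∀ᵐ x, ∀ i : Fin n, x ∈ U →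
      ⟪(EuclideanSpace.single i 1 : E n), grad v x - gradient G x⟫ = 0 :=
    ae_all_iff.2 fun i => key _
  filter_upwards [(ae_restrict_iff' hU.measurableSet).2 (hb.mono fun x hx hxU i => hx i hxU)]
    with x hx
  rw [← sub_eq_zero]
  ext i
  simpa [EuclideanSpace.inner_single_left] using hx i

end H10

/-! ### Friedrichs' inequality -/

namespace H10

variable {D : Set (E n)}

lemma IsTest.contDiff_one {v : H10 D} {g : E n → ℝ} (h : IsTest v g) : ContDiff ℝ 1 g :=
  h.contDiff.of_le (by exact_mod_cast le_top)

/-- The exponent whose Sobolev conjugate is `2`, from `1/p = 1/2 + 1/n`. The condition `n ≥ 2` is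
exactly what gives `p ≥ 1`. -/
lemma exists_exponent (hn : 2 ≤ n) : ∃ p : NNReal, 1 ≤ p ∧ p < n ∧ p ≤ 2 ∧
    (p : ℝ)⁻¹ - (n : ℝ)⁻¹ = 2⁻¹ := by
  have hn0 : (0 : ℝ) < n := by positivity
  have hn2 : (2 : ℝ) ≤ n := by exact_mod_cast hn
  have hn1 : 0 < (n : ℝ)⁻¹ := by positivity
  have hni : (n : ℝ)⁻¹ ≤ 2⁻¹ := inv_anti₀ two_pos hn2
  obtain ⟨p, hpr⟩ : ∃ p : NNReal, (p : ℝ)⁻¹ = 2⁻¹ + (n : ℝ)⁻¹ :=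
    ⟨(2⁻¹ + (n : NNReal)⁻¹)⁻¹, by simp⟩
  have hp0 : (0 : ℝ) < p := by
    rw [← inv_pos, hpr]; positivity
  have h1 : (1 : ℝ) ≤ p := by
    rw [← inv_le_inv₀ hp0 one_pos, hpr]; linarith
  have h2 : (p : ℝ) < n := by
    rw [← inv_lt_inv₀ hn0 hp0, hpr]; linarith
  have h3 : (p : ℝ) ≤ 2 := by
    rw [← inv_le_inv₀ two_pos hp0, hpr]; linarith
  exact ⟨p, by exact_mod_cast h1, by exact_mod_cast h2, by exact_mod_cast h3, by rw [hpr]; ring⟩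

lemma exists_eLpNorm_le_of_exponent (hD : Bornology.IsBounded D) {p : NNReal} (hp1 : 1 ≤ p)
    (hpn : p < n) (hp : (p : ℝ)⁻¹ - (n : ℝ)⁻¹ = 2⁻¹) :
    ∃ c : NNReal, ∀ g : E n → ℝ, ContDiff ℝ 1 g → g.support ⊆ D →
      eLpNorm g 2 volume ≤ c * eLpNorm (fderiv ℝ g) p volume := by
  have hf : Module.finrank ℝ (E n) = n := finrank_euclideanSpace_fin
  refine ⟨eLpNormLESNormFDerivOfLeConst ℝ (volume : Measure (E n)) D p 2, fun g hg hs => ?_⟩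
  exact eLpNorm_le_eLpNorm_fderiv_of_le (volume : Measure (E n)) hg hs hp1 (by rwa [hf])
    (by rw [hf, NNReal.coe_inv, hp]; simp) hD

lemma exists_eLpNorm_le_mul {α F : Type*} [MeasurableSpace α] {μ : Measure α} [IsFiniteMeasure μ]
    [NormedAddCommGroup F] {p q : ENNReal} (hp : 1 ≤ p) (hpq : p ≤ q) (hq : q ≠ ⊤) :
    ∃ c : NNReal, ∀ f : α → F, AEStronglyMeasurable f μ → eLpNorm f p μ ≤ c * eLpNorm f q μ := by
  have hp0 : 0 < p.toReal := ENNReal.toReal_pos (one_pos.trans_le hp).ne' (ne_top_of_le_ne_top hq hpq)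
  have hX : μ univ ^ (1 / p.toReal - 1 / q.toReal) ≠ ⊤ := by
    refine ENNReal.rpow_ne_top_of_nonneg ?_ (measure_ne_top _ _)
    rw [one_div, one_div, sub_nonneg]
    exact inv_anti₀ hp0 (ENNReal.toReal_mono hq hpq)
  refine ⟨(μ univ ^ (1 / p.toReal - 1 / q.toReal)).toNNReal, fun f hf => ?_⟩
  rw [ENNReal.coe_toNNReal hX, mul_comm]
  exact eLpNorm_le_eLpNorm_mul_rpow_measure_univ hpq hf

lemma eLpNorm_restrict_eq {α F : Type*} [MeasurableSpace α] {μ : Measure α} [NormedAddCommGroup F]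
    {f : α → F} {s : Set α} {p : ENNReal} (h : Function.support f ⊆ s) :
    eLpNorm f p μ = eLpNorm f p (μ.restrict s) :=
  (eLpNorm_restrict_eq_of_support_subset h).symm

/-- The Sobolev inequality bounds the `L²` norm by the `L^p` norm of the gradient, and Hölder's
inequality on the bounded set raises `p` to `2`. -/
lemma exists_eLpNorm_le (hn : 2 ≤ n) (hD : Bornology.IsBounded D) :
    ∃ c : NNReal, ∀ g : E n → ℝ, ContDiff ℝ 1 g → tsupport g ⊆ D →
      eLpNorm g 2 volume ≤ c * eLpNorm (fderiv ℝ g) 2 (volume.restrict D) := by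
  have : IsFiniteMeasure (volume.restrict D) := ⟨by
    rw [Measure.restrict_apply_univ]; exact hD.measure_lt_top⟩
  obtain ⟨p, hp1, hpn, hp2, hp⟩ := exists_exponent hn
  obtain ⟨c, hc⟩ := exists_eLpNorm_le_of_exponent hD hp1 hpn hp
  obtain ⟨c', hc'⟩ := exists_eLpNorm_le_mul (F := E n →L[ℝ] ℝ) (μ := volume.restrict D)
    (p := p) (q := 2) (by exact_mod_cast hp1) (by exact_mod_cast hp2) ENNReal.ofNat_ne_top
  refine ⟨c * c', fun g hg hs => ?_⟩
  have h1 : Function.support (fderiv ℝ g) ⊆ D := fun _ hx =>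
    hs (tsupport_fderiv_subset ℝ (subset_tsupport _ hx))
  refine (hc g hg ((subset_tsupport g).trans hs)).trans ?_
  rw [eLpNorm_restrict_eq h1, ENNReal.coe_mul, mul_assoc]
  exact mul_le_mul_right (hc' _ (hg.continuous_fderiv one_ne_zero).aestronglyMeasurable) _

/-- Friedrichs' inequality. -/
lemma exists_norm_valL_le (hn : 2 ≤ n) (hD : Bornology.IsBounded D) :
    ∃ C : ℝ, 0 ≤ C ∧ ∀ v : H10 D, ‖valL v‖ ≤ C * normX v := by
  obtain ⟨c, hc⟩ := exists_eLpNorm_le hn hD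
  refine ⟨c, c.2, fun v => ?_⟩
  refine induction (P := fun v => ‖valL v‖ ≤ c * normX v) (isClosed_le (by fun_prop) ?_)
    (fun v g hv => ?_) v
  · exact continuous_const.mul (continuous_norm.comp gradL.continuous)
  have h4 : eLpNorm (fderiv ℝ g) 2 (volume.restrict D) = eLpNorm (grad v) 2 (volume.restrict D) := by
    refine eLpNorm_congr_norm_ae ?_
    filter_upwards [hv.grad_eq] with x hx
    rw [hx, norm_gradient]
  have h5 : eLpNorm (val v) 2 (volume.restrict D) ≤ c * eLpNorm (grad v) 2 (volume.restrict D) := by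
    calc eLpNorm (val v) 2 (volume.restrict D) = eLpNorm g 2 (volume.restrict D) :=
          eLpNorm_congr_ae hv.val_eq
      _ ≤ eLpNorm g 2 volume := eLpNorm_mono_measure _ Measure.restrict_le_self
      _ ≤ _ := by
          rw [← h4]
          exact hc g hv.contDiff_one hv.support
  have := ENNReal.toReal_mono (ENNReal.mul_ne_top ENNReal.coe_ne_top (grad_memLp v).2.ne) h5
  rw [ENNReal.toReal_mul, ENNReal.coe_toReal] at this
  exact this

end H10

/-- Dominated convergence: on a finite measure space a uniform bound turns convergence almost
everywhere into convergence in `L²`. -/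
lemma tendsto_Lp_of_bounded {α F : Type*} [MeasurableSpace α] {μ : Measure α} [IsFiniteMeasure μ]
    [NormedAddCommGroup F] {f : ℕ → Lp F 2 μ} {g : α → F} {C : ℝ}
    (hb : ∀ k, ∀ᵐ x ∂μ, ‖f k x‖ ≤ C)
    (hlim : ∀ᵐ x ∂μ, Filter.Tendsto (fun k => f k x) Filter.atTop (nhds (g x))) :
    ∃ G : Lp F 2 μ, G =ᵐ[μ] g ∧ Filter.Tendsto f Filter.atTop (nhds G) := by
  have hgm : AEStronglyMeasurable g μ :=
    aestronglyMeasurable_of_tendsto_ae _ (fun k => (Lp.memLp (f k)).1) hlim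
  have hball := ae_all_iff.2 hb
  have hgb : ∀ᵐ x ∂μ, ‖g x‖ ≤ C := by
    filter_upwards [hball, hlim] with x h1 h2
    exact le_of_tendsto h2.norm (Filter.Eventually.of_forall h1)
  have hg : MemLp g 2 μ := MemLp.of_bound hgm C hgb
  refine ⟨hg.toLp g, hg.coeFn_toLp, ?_⟩
  rw [Lp.tendsto_Lp_iff_tendsto_eLpNorm']
  have e : ∀ k, eLpNorm (⇑(f k) - ⇑(hg.toLp g)) 2 μ =
      (∫⁻ x, ‖f k x - g x‖ₑ ^ (2 : ℝ) ∂μ) ^ (1 / (2 : ℝ)) := by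
    intro k
    rw [eLpNorm_eq_lintegral_rpow_enorm_toReal two_ne_zero ENNReal.ofNat_ne_top]
    simp only [ENNReal.toReal_ofNat]
    congr 1
    refine lintegral_congr_ae ?_
    filter_upwards [hg.coeFn_toLp] with x hx
    rw [Pi.sub_apply, hx]
  simp only [e]
  have h0 : Filter.Tendsto (fun k => ∫⁻ x, ‖f k x - g x‖ₑ ^ (2 : ℝ) ∂μ) Filter.atTop
      (nhds (∫⁻ _, 0 ∂μ)) := by
    refine tendsto_lintegral_of_dominated_convergence' (fun _ => (ENNReal.ofReal (2 * C)) ^ (2 : ℝ))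
      (fun k => (((Lp.memLp (f k)).1.sub hgm).enorm.pow_const _)) (fun k => ?_) ?_ ?_
    · filter_upwards [hb k, hgb] with x h1 h2
      refine ENNReal.rpow_le_rpow ?_ (by norm_num)
      rw [← ofReal_norm]
      refine ENNReal.ofReal_le_ofReal ((norm_sub_le _ _).trans ?_)
      linarith
    · rw [lintegral_const]
      exact ENNReal.mul_ne_top (ENNReal.rpow_ne_top_of_nonneg (by norm_num) ENNReal.ofReal_ne_top)
        (measure_ne_top _ _)
    · filter_upwards [hlim] with x hx
      have h1 : Filter.Tendsto (fun k => ‖f k x - g x‖ₑ) Filter.atTop (nhds 0) := by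
        have := (hx.sub_const (g x)).enorm
        simpa using this
      have := h1.ennrpow_const (2 : ℝ)
      simpa using this
  have := h0.ennrpow_const (1 / (2 : ℝ))
  simpa using this

namespace H10

variable {D : Set (E n)}

/-- `H10 D` is closed in the space of pairs, so it contains simultaneous limits of functions and
gradients. -/
lemma exists_of_tendsto [IsFiniteMeasure (volume.restrict D)] {v : ℕ → H10 D} {w : E n → ℝ}
    {G : E n → E n} {C : ℝ} (hb : ∀ k, ∀ᵐ x ∂volume.restrict D, ‖val (v k) x‖ ≤ C)
    (hb' : ∀ k, ∀ᵐ x ∂volume.restrict D, ‖grad (v k) x‖ ≤ C)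
    (hw : ∀ᵐ x ∂volume.restrict D,
      Filter.Tendsto (fun k => val (v k) x) Filter.atTop (nhds (w x)))
    (hG : ∀ᵐ x ∂volume.restrict D,
      Filter.Tendsto (fun k => grad (v k) x) Filter.atTop (nhds (G x))) :
    ∃ u : H10 D, val u =ᵐ[volume.restrict D] w ∧ grad u =ᵐ[volume.restrict D] G := by
  obtain ⟨a, ha, hta⟩ := tendsto_Lp_of_bounded (f := fun k => valL (v k)) hb hw
  obtain ⟨b, hb, htb⟩ := tendsto_Lp_of_bounded (f := fun k => gradL (v k)) hb' hG
  have hmem : (a, b) ∈ H10 D := (Submodule.isClosed_topologicalClosure _).mem_of_tendsto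
    (hta.prodMk_nhds htb) (Filter.Eventually.of_forall fun k => (v k).2)
  exact ⟨⟨(a, b), hmem⟩, ha, hb⟩

end H10

/-! ### Mollification -/

section Mollify

variable (φ : ContDiffBump (0 : E n)) {w : E n → ℝ}

/-- The mollification of a function. -/
def mollify (w : E n → ℝ) (x : E n) : ℝ := ∫ t, φ.normed volume t * w (x - t)

lemma integrable_mollify (hw : Continuous w) (x : E n) :
    Integrable fun t => φ.normed volume t * w (x - t) :=
  (φ.continuous_normed.mul (hw.comp (continuous_const.sub continuous_id))).integrable_of_hasCompactSupport
    φ.hasCompactSupport_normed.mul_right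

lemma contDiff_mollify (hw : Continuous w) : ContDiff ℝ ∞ (mollify φ w) :=
  φ.hasCompactSupport_normed.contDiff_convolution_left (ContinuousLinearMap.lsmul ℝ ℝ)
    φ.contDiff_normed hw.locallyIntegrable

/-- Only translates shorter than `rOut` carry weight, so an increment common to all of them
survives. In this way a locally affine function keeps its gradient. -/
lemma mollify_sub_eq (hw : Continuous w) {x y : E n} {c : ℝ}
    (h : ∀ t, ‖t‖ < φ.rOut → w (x - t) - w (y - t) = c) : mollify φ w x - mollify φ w y = c := by
  rw [mollify, mollify, ← integral_sub (integrable_mollify φ hw x) (integrable_mollify φ hw y)]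
  calc _ = ∫ t, φ.normed volume t * c := by
        refine integral_congr_ae (Filter.Eventually.of_forall fun t => ?_)
        simp only [← mul_sub]
        by_cases ht : ‖t‖ < φ.rOut
        · rw [h t ht]
        · have : φ.normed volume t = 0 := by
            rw [← Function.notMem_support, φ.support_normed_eq, mem_ball_zero_iff]
            exact ht
          rw [this, zero_mul, zero_mul]
    _ = c := by rw [integral_mul_const, φ.integral_normed (μ := volume), one_mul]

lemma abs_mollify_sub_le (hw : Continuous w) {x y : E n} {c : ℝ}
    (h : ∀ t, |w (x - t) - w (y - t)| ≤ c) : |mollify φ w x - mollify φ w y| ≤ c := by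
  rw [mollify, mollify, ← integral_sub (integrable_mollify φ hw x) (integrable_mollify φ hw y)]
  rw [← Real.norm_eq_abs]
  calc _ ≤ ∫ t, φ.normed volume t * c := by
        refine norm_integral_le_of_norm_le ((φ.integrable_normed (μ := volume)).mul_const c)
          (Filter.Eventually.of_forall fun t => ?_)
        rw [← mul_sub, norm_mul, Real.norm_of_nonneg (φ.nonneg_normed t)]
        exact mul_le_mul_of_nonneg_left (h t) (φ.nonneg_normed t)
    _ = c := by rw [integral_mul_const, φ.integral_normed (μ := volume), one_mul]

lemma abs_mollify_sub_self_le (hw : Continuous w) {x : E n} {c : ℝ}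
    (h : ∀ t, ‖t‖ < φ.rOut → |w (x - t) - w x| ≤ c) : |mollify φ w x - w x| ≤ c := by
  have := φ.dist_normed_convolution_le (μ := volume) (g := w) (x₀ := x) (ε := c)
    hw.aestronglyMeasurable fun y hy => by
      have := h (x - y) (by rwa [← dist_eq_norm, dist_comm])
      rwa [sub_sub_cancel] at this
  exact this

end Mollify

namespace H10

variable {D : Set (E n)}

/-- The mollifications are test functions of `D`, bounded and Lipschitz uniformly in the radius. At
a point around which `w` is affine their gradients equal `G` as soon as the radius is small, so
pointwise limits exist almost everywhere. -/
lemma exists_of_lipschitz_of_compact (hD : IsOpen D) (hDb : Bornology.IsBounded D) {w : E n → ℝ}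
    {K : NNReal} (hw : LipschitzWith K w) (hc : HasCompactSupport w) (hs : tsupport w ⊆ D)
    {G : E n → E n} (hG : ∀ᵐ x, ∀ᶠ y in nhds x, w y = w x + ⟪G x, y - x⟫) :
    ∃ u : H10 D, val u =ᵐ[volume.restrict D] w ∧ grad u =ᵐ[volume.restrict D] G := by
  have : IsFiniteMeasure (volume.restrict D) := ⟨by
    rw [Measure.restrict_apply_univ]; exact hDb.measure_lt_top⟩
  have hwc := hw.continuous
  obtain ⟨δ, hδ, hδD⟩ := hc.isCompact.exists_cthickening_subset_open hD hs
  set r : ℕ → ℝ := fun k => δ / (k + 1) with hr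
  have hr0 : ∀ k, 0 < r k := fun k => by positivity
  have hrlim : Filter.Tendsto r Filter.atTop (nhds 0) := by
    have := (tendsto_one_div_add_atTop_nhds_zero_nat (𝕜 := ℝ)).const_mul δ
    simpa [hr, div_eq_mul_inv] using this
  have hrδ : ∀ k, r k ≤ δ := fun k => div_le_self hδ.le (by
    have : (0 : ℝ) ≤ k := k.cast_nonneg
    linarith)
  set φ : ℕ → ContDiffBump (0 : E n) := fun k => ⟨r k / 2, r k, half_pos (hr0 k), half_lt_self (hr0 k)⟩
  set g : ℕ → E n → ℝ := fun k => mollify (φ k) w with hg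
  have hgs : ∀ k, ContDiff ℝ ∞ (g k) := fun k => contDiff_mollify _ hwc
  have hgd : ∀ k x, |g k x - w x| ≤ K * r k := fun k x => by
    refine abs_mollify_sub_self_le (φ k) hwc fun t ht => ?_
    have h1 := hw.dist_le_mul (x - t) x
    rw [Real.dist_eq, dist_eq_norm, sub_sub_cancel_left, norm_neg] at h1
    exact h1.trans (mul_le_mul_of_nonneg_left ht.le K.2)
  have hgL : ∀ k, LipschitzWith K (g k) := fun k => by
    refine LipschitzWith.of_dist_le_mul fun x y => ?_
    rw [Real.dist_eq]
    refine abs_mollify_sub_le (φ k) hwc fun t => ?_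
    have h1 := hw.dist_le_mul (x - t) (y - t)
    rwa [dist_sub_right, Real.dist_eq] at h1
  have hsupp : ∀ k, Function.support (g k) ⊆ Metric.cthickening δ (tsupport w) := fun k x hx => by
    by_contra hxn
    refine hx ?_
    have h0 : ∀ t, ‖t‖ < r k → w (x - t) = 0 := fun t ht => by
      refine image_eq_zero_of_notMem_tsupport fun hmem => hxn ?_
      refine Metric.mem_cthickening_of_dist_le x (x - t) δ _ hmem ?_
      rw [dist_eq_norm, sub_sub_cancel]
      exact ht.le.trans (hrδ k)
    have := abs_mollify_sub_self_le (φ k) hwc (x := x) (c := 0) fun t ht => by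
      rw [h0 t ht, ← sub_zero x, h0 0 (by simpa using hr0 k)]; simp
    have hx0 : w x = 0 := by simpa using h0 0 (by simpa using hr0 k)
    rw [hx0, sub_zero] at this
    exact abs_nonpos_iff.1 this
  have hts : ∀ k, tsupport (g k) ⊆ Metric.cthickening δ (tsupport w) := fun k =>
    closure_minimal (hsupp k) Metric.isClosed_cthickening
  have hgc : ∀ k, HasCompactSupport (g k) := fun k =>
    HasCompactSupport.intro hc.isCompact.cthickening fun x hx => by
      by_contra h; exact hx (hsupp k h)
  choose v hv using fun k => exists_isTest (D := D) (hgs k) (hgc k) ((hts k).trans hδD)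
  obtain ⟨C, hC⟩ := hc.exists_bound_of_continuous hwc
  have hC0 : 0 ≤ C := (norm_nonneg _).trans (hC 0)
  refine exists_of_tendsto (v := v) (C := C + K * δ + K) (fun k => ?_) (fun k => ?_) ?_ ?_
  · filter_upwards [(hv k).val_eq] with x hx
    rw [hx]
    have h1 := hgd k x
    have h2 := hC x
    have h3 : (K : ℝ) * r k ≤ K * δ := mul_le_mul_of_nonneg_left (hrδ k) K.2
    have h4 : ‖g k x‖ ≤ |g k x - w x| + ‖w x‖ := by
      have := norm_add_le (g k x - w x) (w x)
      simpa using this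
    have := K.2
    linarith
  · filter_upwards [(hv k).grad_eq] with x hx
    rw [hx, norm_gradient]
    have := norm_fderiv_le_of_lipschitz ℝ (hgL k) (x₀ := x)
    have h3 : 0 ≤ (K : ℝ) * δ := mul_nonneg K.2 hδ.le
    linarith
  · filter_upwards [ae_all_iff.2 fun k => (hv k).val_eq] with x hx
    simp only [hx]
    rw [tendsto_iff_dist_tendsto_zero]
    refine squeeze_zero (fun _ => dist_nonneg) (fun k => hgd k x) ?_
    simpa using hrlim.const_mul (K : ℝ)
  · filter_upwards [ae_all_iff.2 fun k => (hv k).grad_eq, ae_restrict_of_ae hG] with x hx hxG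
    simp only [hx]
    obtain ⟨ε, hε, hball⟩ := Metric.eventually_nhds_iff.1 hxG
    refine tendsto_const_nhds.congr' ?_
    -- One half of `ε` is reserved for the distance of `y` to `x` and the other half for the
    -- mollification radius.
    filter_upwards [hrlim.eventually (gt_mem_nhds (half_pos hε))] with k hk
    set L : E n →L[ℝ] ℝ := InnerProductSpace.toDual ℝ (E n) (G x) with hL
    have hd : HasFDerivAt (g k) L x := by
      have h1 : HasFDerivAt (fun y => g k x + (L y - L x)) L x :=
        (L.hasFDerivAt.sub_const _).const_add _
      refine h1.congr_of_eventuallyEq ?_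
      filter_upwards [Metric.ball_mem_nhds x (half_pos hε)] with y hy
      have := mollify_sub_eq (φ k) hwc (x := y) (y := x) (c := ⟪G x, y - x⟫) fun t ht => by
        have ht' : ‖t‖ < ε / 2 := lt_trans ht hk
        have hy' : dist y x < ε / 2 := hy
        have e1 := hball (y := y - t) (by
          calc dist (y - t) x ≤ dist (y - t) y + dist y x := dist_triangle _ _ _
            _ < ε := by rw [dist_eq_norm, sub_sub_cancel_left, norm_neg]; linarith)
        have e2 := hball (y := x - t) (by
          rw [dist_eq_norm, sub_sub_cancel_left, norm_neg]; linarith)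
        rw [e1, e2]
        have : y - t - x = (y - x) + (x - t - x) := by abel
        rw [this, inner_add_right]
        ring
      rw [← map_sub, hL, InnerProductSpace.toDual_apply_apply]
      change mollify (φ k) w y = mollify (φ k) w x + _
      linarith
    rw [hasGradientAt_iff_hasFDerivAt.2 hd |>.gradient]

end H10

/-! ### Piecewise affine functions -/

section AffineGradient

/-- The gradient of an affine function. -/
def affGrad (g : E n →ᵃ[ℝ] ℝ) : E n :=
  (InnerProductSpace.toDual ℝ (E n)).symm (LinearMap.toContinuousLinearMap g.linear)

lemma inner_affGrad (g : E n →ᵃ[ℝ] ℝ) (v : E n) : ⟪affGrad g, v⟫ = g.linear v := by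
  simp [affGrad]

lemma affine_apply_eq (g : E n →ᵃ[ℝ] ℝ) (x y : E n) : g y = g x + ⟪affGrad g, y - x⟫ := by
  have := g.linearMap_vsub y x
  rw [inner_affGrad]
  simp only [vsub_eq_sub] at this
  linarith

/-- A level set of a nonconstant affine function lies in a hyperplane, which is a null set. -/
lemma ae_affine_eq (g : E n →ᵃ[ℝ] ℝ) (c : ℝ) : ∀ᵐ x : E n, g x = c → affGrad g = 0 := by
  by_cases h0 : affGrad g = 0
  · exact Filter.Eventually.of_forall fun _ _ => h0
  set s : AffineSubspace ℝ (E n) := (AffineSubspace.mk' c (⊥ : Submodule ℝ ℝ)).comap g with hs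
  have hmem : ∀ x, x ∈ s ↔ g x = c := fun x => by
    rw [hs, AffineSubspace.mem_comap, AffineSubspace.mem_mk', Submodule.mem_bot, vsub_eq_sub,
      sub_eq_zero]
  have hne : s ≠ ⊤ := fun htop => h0 <| by
    have hall : ∀ x, g x = c := fun x => (hmem x).1 (htop ▸ AffineSubspace.mem_top ℝ (E n) x)
    have := affine_apply_eq g 0 (affGrad g)
    rw [hall, hall, sub_zero, real_inner_self_eq_norm_sq] at this
    have h2 : ‖affGrad g‖ ^ 2 = 0 := by linarith
    simpa using h2
  have := measure_eq_zero_iff_ae_notMem.1 (Measure.addHaar_affineSubspace volume s hne)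
  filter_upwards [this] with x hx hxc
  exact absurd ((hmem x).2 hxc) hx

end AffineGradient

section Lipschitz

/-- Local bounds centered at every point, with the same constant, propagate along segments. -/
lemma lipschitzWith_of_eventually {f : E n → ℝ} {K : NNReal}
    (h : ∀ x, ∀ᶠ y in nhds x, |f y - f x| ≤ K * dist y x) : LipschitzWith K f := by
  have hf : Continuous f := continuous_iff_continuousAt.2 fun x => by
    refine tendsto_iff_dist_tendsto_zero.2 ?_
    have h0 : Filter.Tendsto (fun y => (K : ℝ) * dist y x) (nhds x) (nhds 0) := by
      have : Continuous fun y => (K : ℝ) * dist y x := by fun_prop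
      simpa using this.tendsto x
    exact squeeze_zero' (Filter.Eventually.of_forall fun _ => dist_nonneg) (h x) h0
  refine LipschitzWith.of_dist_le_mul fun x y => ?_
  set γ : ℝ → E n := fun t => y + t • (x - y) with hγ
  have hγc : Continuous γ := by fun_prop
  have hγd : ∀ s t, dist (γ s) (γ t) = |s - t| * dist x y := fun s t => by
    rw [dist_eq_norm, dist_eq_norm, hγ]
    have : y + s • (x - y) - (y + t • (x - y)) = (s - t) • (x - y) := by rw [sub_smul]; abel
    rw [this, norm_smul, Real.norm_eq_abs]
  -- The parameters at which the bound holds form a closed set that can always be continued to the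
  -- right, hence all of `[0, 1]`.
  set S : Set ℝ := {t | |f (γ t) - f (γ 0)| ≤ K * (t * dist x y)} with hS
  have hSc : IsClosed S := isClosed_le (by fun_prop) (by fun_prop)
  have := (hSc.inter isClosed_Icc).Icc_subset_of_forall_exists_gt (a := 0) (b := 1) (s := S)
    (by simp [hS]) (fun t ht u hu => by
      have hu' : t < u := hu
      have h1 := (hγc.tendsto t).eventually (h (γ t))
      have h2 : ∀ᶠ s in nhdsWithin t (Ioi t), |f (γ s) - f (γ t)| ≤ K * dist (γ s) (γ t) :=
        h1.filter_mono nhdsWithin_le_nhds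
      obtain ⟨s, hs1, hs2⟩ := (h2.and (Ioc_mem_nhdsGT hu')).exists
      refine ⟨s, ?_, hs2⟩
      rw [hγd, abs_of_pos (sub_pos.2 hs2.1)] at hs1
      have h3 : |f (γ t) - f (γ 0)| ≤ K * (t * dist x y) := ht.1
      change |f (γ s) - f (γ 0)| ≤ K * (s * dist x y)
      have := abs_sub_le (f (γ s)) (f (γ t)) (f (γ 0))
      nlinarith)
  have h1 : (1 : ℝ) ∈ S := this ⟨zero_le_one, le_rfl⟩
  simpa [hS, hγ, Real.dist_eq] using h1

end Lipschitz

/-! ### Lipschitz functions with zero boundary values -/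

namespace H10

variable {D : Set (E n)}

/-- Soft thresholding. -/
def softThreshold (ε s : ℝ) : ℝ := max (s - ε) 0 + min (s + ε) 0

lemma softThreshold_of_gt {ε s : ℝ} (hε : 0 < ε) (h : ε < s) : softThreshold ε s = s - ε := by
  rw [softThreshold, max_eq_left (by linarith), min_eq_right (by linarith), add_zero]

lemma softThreshold_of_lt {ε s : ℝ} (hε : 0 < ε) (h : s < -ε) : softThreshold ε s = s + ε := by
  rw [softThreshold, max_eq_right (by linarith), min_eq_left (by linarith), zero_add]

lemma softThreshold_of_abs_le {ε s : ℝ} (h : |s| ≤ ε) : softThreshold ε s = 0 := by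
  obtain ⟨h1, h2⟩ := abs_le.1 h
  rw [softThreshold, max_eq_right (by linarith), min_eq_right (by linarith), add_zero]

lemma abs_softThreshold_sub_le {ε : ℝ} (hε : 0 < ε) (s : ℝ) : |softThreshold ε s - s| ≤ ε := by
  rcases lt_or_ge ε s with h | h
  · rw [softThreshold_of_gt hε h, sub_sub_cancel_left, abs_neg, abs_of_pos hε]
  rcases lt_or_ge s (-ε) with h' | h'
  · rw [softThreshold_of_lt hε h', add_sub_cancel_left, abs_of_pos hε]
  · have := abs_le.2 ⟨h', h⟩
    rwa [softThreshold_of_abs_le this, zero_sub, abs_neg]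

lemma lipschitzWith_softThreshold (ε : ℝ) : LipschitzWith (1 + 1) (softThreshold ε) := by
  have h1 : LipschitzWith 1 fun s : ℝ => max (s - ε) 0 :=
    (LipschitzWith.of_dist_le_mul fun x y => by simp).max_const 0
  have h2 : LipschitzWith 1 fun s : ℝ => min (s + ε) 0 :=
    (LipschitzWith.of_dist_le_mul fun x y => by simp).min_const 0
  exact h1.add h2

open Classical in
/-- A Lipschitz function with zero boundary values, whose level sets are not charged by its
gradient, belongs to `H¹₀(D)`. -/
lemma exists_of_lipschitz (hD : IsOpen D) (hDb : Bornology.IsBounded D) {w : E n → ℝ}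
    {K : NNReal} (hw : LipschitzWith K w) (h0 : ∀ x ∉ D, w x = 0)
    {G : E n → E n} (hG : ∀ᵐ x, ∀ᶠ y in nhds x, w y = w x + ⟪G x, y - x⟫)
    (hG0 : ∀ c, ∀ᵐ x, w x = c → G x = 0) :
    ∃ u : H10 D, val u =ᵐ[volume.restrict D] w ∧ grad u =ᵐ[volume.restrict D] G := by
  have : IsFiniteMeasure (volume.restrict D) := ⟨by
    rw [Measure.restrict_apply_univ]; exact hDb.measure_lt_top⟩
  have hwc := hw.continuous
  have hcpt : HasCompactSupport w := HasCompactSupport.intro hDb.isCompact_closure fun x hx =>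
    h0 x fun h => hx (subset_closure h)
  set ε : ℕ → ℝ := fun k => 1 / ((k : ℝ) + 1) with hε
  have hε0 : ∀ k, 0 < ε k := fun k => by positivity
  have hεlim : Filter.Tendsto ε Filter.atTop (nhds 0) := tendsto_one_div_add_atTop_nhds_zero_nat
  have hε1 : ∀ k, ε k ≤ 1 := fun k => by
    rw [hε, div_le_one (by positivity)]
    have : (0 : ℝ) ≤ k := k.cast_nonneg
    linarith
  set wk : ℕ → E n → ℝ := fun k x => softThreshold (ε k) (w x) with hwk
  -- Thresholding moves the support into `{|w| ≥ ε}`, a subset of `D` at which `w` does not vanish;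
  -- the gradient is kept where `|w| > ε` and removed elsewhere.
  set Gk : ℕ → E n → E n := fun k x => if ε k < |w x| then G x else 0 with hGk
  have hts : ∀ k, tsupport (wk k) ⊆ {x | ε k ≤ |w x|} := fun k =>
    closure_minimal (fun x hx => by
      by_contra hlt
      exact hx (softThreshold_of_abs_le (not_le.1 hlt).le)) (isClosed_le (by fun_prop) (by fun_prop))
  have hsub : ∀ k, {x | ε k ≤ |w x|} ⊆ D := fun k x hx => by
    by_contra hxD
    have : ε k ≤ |w x| := hx
    rw [h0 x hxD, abs_zero] at this
    exact absurd (hε0 k) (not_lt.2 this)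
  have hloc : ∀ k, ∀ᵐ x, ∀ᶠ y in nhds x, wk k y = wk k x + ⟪Gk k x, y - x⟫ := by
    intro k
    filter_upwards [hG, hG0 (ε k), hG0 (-ε k)] with x hx hx1 hx2
    rcases lt_trichotomy (|w x|) (ε k) with h | h | h
    · have hev : ∀ᶠ y in nhds x, |w y| < ε k :=
        (hwc.abs.tendsto x).eventually (gt_mem_nhds h)
      filter_upwards [hev] with y hy
      simp only [hwk, hGk]
      rw [if_neg h.le.not_gt, softThreshold_of_abs_le hy.le, softThreshold_of_abs_le h.le]
      simp
    -- The threshold has a kink at the levels `±ε`. It does no harm, since almost everywhere on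
    -- these levels `G` vanishes and `w` is locally constant.
    · have hGx : G x = 0 := by
        rcases (abs_eq (hε0 k).le).1 h with h | h
        · exact hx1 h
        · exact hx2 h
      filter_upwards [hx] with y hy
      simp only [hwk, hGk]
      rw [hy, hGx, ite_self, inner_zero_left, add_zero, add_zero]
    · rcases lt_abs.1 h with h1 | h1
      · have hev : ∀ᶠ y in nhds x, ε k < w y := (hwc.tendsto x).eventually (lt_mem_nhds h1)
        filter_upwards [hev, hx] with y hy hyx
        simp only [hwk, hGk]
        rw [if_pos h, softThreshold_of_gt (hε0 k) hy, softThreshold_of_gt (hε0 k) h1, hyx]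
        ring
      · have h1' : w x < -ε k := by linarith
        have hev : ∀ᶠ y in nhds x, w y < -ε k := (hwc.tendsto x).eventually (gt_mem_nhds h1')
        filter_upwards [hev, hx] with y hy hyx
        simp only [hwk, hGk]
        rw [if_pos h, softThreshold_of_lt (hε0 k) hy, softThreshold_of_lt (hε0 k) h1', hyx]
        ring
  have hex : ∀ k, ∃ u : H10 D, val u =ᵐ[volume.restrict D] wk k ∧
      grad u =ᵐ[volume.restrict D] Gk k := fun k => by
    have hL : LipschitzWith ((1 + 1) * K) (wk k) := (lipschitzWith_softThreshold (ε k)).comp hw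
    refine exists_of_lipschitz_of_compact hD hDb hL ?_ ((hts k).trans (hsub k)) (hloc k)
    exact HasCompactSupport.intro hDb.isCompact_closure fun x hx =>
      image_eq_zero_of_notMem_tsupport fun h => hx (subset_closure (hsub k (hts k h)))
  choose v hv using hex
  obtain ⟨C, hC⟩ := hcpt.exists_bound_of_continuous hwc
  have hC0 : 0 ≤ C := (norm_nonneg _).trans (hC 0)
  have hGb : ∀ᵐ x, ‖G x‖ ≤ K := by
    filter_upwards [hG] with x hx
    have hd : HasFDerivAt w (InnerProductSpace.toDual ℝ (E n) (G x)) x := by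
      have h1 : HasFDerivAt (fun y => w x + (InnerProductSpace.toDual ℝ (E n) (G x) y -
          InnerProductSpace.toDual ℝ (E n) (G x) x)) (InnerProductSpace.toDual ℝ (E n) (G x)) x :=
        ((InnerProductSpace.toDual ℝ (E n) (G x)).hasFDerivAt.sub_const _).const_add _
      refine h1.congr_of_eventuallyEq ?_
      filter_upwards [hx] with y hy
      rw [← map_sub, InnerProductSpace.toDual_apply_apply, hy]
    simpa using hd.le_of_lipschitz hw
  refine exists_of_tendsto (v := v) (C := C + 1 + K) (fun k => ?_) (fun k => ?_) ?_ ?_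
  · filter_upwards [(hv k).1] with x hx
    rw [hx]
    have h1 := abs_softThreshold_sub_le (hε0 k) (w x)
    have h2 := hC x
    have h4 : ‖wk k x‖ ≤ |wk k x - w x| + ‖w x‖ := by
      have := norm_add_le (wk k x - w x) (w x)
      simpa using this
    have h5 : |wk k x - w x| ≤ ε k := h1
    have := K.2
    have := hε1 k
    linarith
  · filter_upwards [(hv k).2, ae_restrict_of_ae hGb] with x hx hxb
    rw [hx]
    have h1 : ‖Gk k x‖ ≤ ‖G x‖ := by
      simp only [hGk]
      split_ifs
      · exact le_rfl
      · simp
    linarith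
  · filter_upwards [ae_all_iff.2 fun k => (hv k).1] with x hx
    simp only [hx]
    rw [tendsto_iff_dist_tendsto_zero]
    exact squeeze_zero (fun _ => dist_nonneg)
      (fun k => abs_softThreshold_sub_le (hε0 k) (w x)) hεlim
  · filter_upwards [ae_all_iff.2 fun k => (hv k).2, ae_restrict_of_ae (hG0 0)] with x hx hx0
    simp only [hx, hGk]
    by_cases hwx : w x = 0
    · simp [hx0 hwx]
    · refine tendsto_const_nhds.congr' ?_
      filter_upwards [hεlim.eventually (gt_mem_nhds (abs_pos.2 hwx))] with k hk
      rw [if_pos hk]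

end H10

/-! ### Piecewise affine functions belong to H¹₀ -/

namespace Mesh

variable {𝒯 : Mesh n}

lemma bary_eq_bary {T T' : Finset (E n)} (hT : T ∈ 𝒯.elems) (hT' : T' ∈ 𝒯.elems) {x z : E n}
    (hx : x ∈ hull T) (hx' : x ∈ hull T') (hz : z ∈ T) (hz' : z ∈ T') :
    bary T z x = bary T' z x := by
  classical
  have h := affInterp_eq hT hT' hx hx' (fun w => if w = z then 1 else 0)
  simpa [affInterp_apply, hz, hz'] using h

/-- Points near `x` are contracted towards `z` into a neighborhood of `z` covered by elements with
vertex `z`. Expanding again, the coordinates at the other vertices are only scaled and remain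
nonnegative, while the coordinate at `z` is positive near `x`. So these elements cover a
neighborhood of `x`. -/
lemma mem_domain_of_bary_pos {T : Finset (E n)} (hT : T ∈ 𝒯.elems) {x z : E n} (hz : z ∈ T)
    (hzD : z ∈ 𝒯.domain) (hx : x ∈ hull T) (hpos : 0 < bary T z x) : x ∈ 𝒯.domain := by
  have hU : ∀ᶠ y in nhds z, y ∈ 𝒯.K.space ∧ ∀ T' ∈ 𝒯.elems, z ∉ hull T' → y ∉ hull T' := by
    refine Filter.Eventually.and (mem_interior_iff_mem_nhds.1 hzD) ?_
    rw [Filter.eventually_all_finset]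
    intro T' _
    by_cases h : z ∈ hull T'
    · exact Filter.Eventually.of_forall fun y hn => absurd h hn
    · exact Filter.mem_of_superset ((isClosed_hull T').isOpen_compl.mem_nhds h) fun y hy _ => hy
  have hcont : Filter.Tendsto (fun t : ℝ => z + t • (x - z)) (nhdsWithin 0 (Ioi 0)) (nhds z) := by
    have : Continuous fun t : ℝ => z + t • (x - z) := by fun_prop
    have h := this.tendsto 0
    simp only [zero_smul, add_zero] at h
    exact h.mono_left nhdsWithin_le_nhds
  obtain ⟨t, htU, ht0⟩ := ((hcont.eventually (eventually_eventually_nhds.2 hU)).and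
    (Ioc_mem_nhdsGT (zero_lt_one' ℝ))).exists
  have hcont' : Filter.Tendsto (fun y : E n => z + t • (y - z)) (nhds x)
      (nhds (z + t • (x - z))) := by
    have : Continuous fun y : E n => z + t • (y - z) := by fun_prop
    exact this.tendsto x
  have hb : ∀ T' (w y : E n), bary T' w (z + t • (y - z)) =
      (1 - t) * bary T' w z + t * bary T' w y := fun T' w y => by
    rw [bary_add, map_smul, bary_linear_sub, smul_eq_mul]
    ring
  have hsel : ∀ᶠ y in nhds x, ∀ T' ∈ 𝒯.elems, z ∈ T' → z + t • (y - z) ∈ hull T' →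
      0 < bary T' z y := by
    rw [Filter.eventually_all_finset]
    intro T' hT'
    by_cases hzT' : z ∈ T'
    · by_cases hxt : z + t • (x - z) ∈ hull T'
      · have hxt0 : z + t • (x - z) ∈ hull T := by
          refine (isSimplex hT).mem_hull_iff.2 fun w hw => ?_
          rw [hb]
          have h1 := (isSimplex hT).mem_hull_iff.1 hx w hw
          have h2 := (isSimplex hT).mem_hull_iff.1 (subset_hull hz) w hw
          have := sub_nonneg.2 ht0.2
          have := ht0.1.le
          positivity
        have e := bary_eq_bary hT hT' hxt0 hxt hz hzT'
        rw [hb, hb, (isSimplex hT).bary_self hz, (isSimplex hT').bary_self hzT'] at e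
        have e' : bary T' z x = bary T z x := by
          have := ht0.1.ne'
          have : t * (bary T' z x - bary T z x) = 0 := by linarith
          rcases mul_eq_zero.1 this with h | h
          · exact absurd h ht0.1.ne'
          · linarith
        have : ∀ᶠ y in nhds x, 0 < bary T' z y :=
          ((continuous_affine (bary T' z)).tendsto x).eventually (lt_mem_nhds (e' ▸ hpos))
        exact this.mono fun y hy _ _ => hy
      · have := hcont'.eventually ((isClosed_hull T').isOpen_compl.mem_nhds hxt)
        exact this.mono fun y hy _ hy' => absurd hy' hy
    · exact Filter.Eventually.of_forall fun y h => absurd h hzT'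
  refine mem_interior_iff_mem_nhds.2 ?_
  filter_upwards [hsel, hcont'.eventually htU] with y hy1 hy2
  obtain ⟨hsp, hno⟩ := hy2
  rw [space_eq] at hsp
  obtain ⟨T', hT', hyT'⟩ := mem_iUnion₂.1 hsp
  have hzh : z ∈ hull T' := by
    by_contra h; exact hno T' hT' h hyT'
  have hzT' : z ∈ T' := mem_of_bary_ne_zero hT hT' (subset_hull hz) hzh hz (by
    rw [(isSimplex hT).bary_self hz]; exact one_ne_zero)
  refine hull_subset_space hT' ((isSimplex hT').mem_hull_iff.2 fun w hw => ?_)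
  by_cases hwz : w = z
  · rw [hwz]; exact (hy1 T' hT' hzT' hyT').le
  · have h1 := (isSimplex hT').mem_hull_iff.1 hyT' w hw
    rw [hb, (isSimplex hT').bary_ne hw hzT' (Ne.symm hwz), mul_zero, zero_add] at h1
    exact nonneg_of_mul_nonneg_right h1 ht0.1

variable {c : E n → ℝ}

/-- At a point of the boundary each term vanishes: either the vertex lies on the boundary and its
value is zero, or the coordinate of the interior vertex is zero by `mem_domain_of_bary_pos`. -/
lemma pwAffine_eq_zero (hc : ∀ z ∉ 𝒯.domain, c z = 0) {x : E n} (hx : x ∉ 𝒯.domain) :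
    𝒯.pwAffine c x = 0 := by
  by_cases h : ∃ T ∈ 𝒯.elems, x ∈ hull T
  · obtain ⟨T, hT, hxT⟩ := h
    rw [pwAffine_eq hT hxT, affInterp_apply]
    refine Finset.sum_eq_zero fun z hz => ?_
    by_cases hzD : z ∈ 𝒯.domain
    · have h1 := (isSimplex hT).mem_hull_iff.1 hxT z hz
      have h2 : ¬ 0 < bary T z x := fun hp => hx (mem_domain_of_bary_pos hT hz hzD hxT hp)
      rw [le_antisymm (not_lt.1 h2) h1, mul_zero]
    · rw [hc z hzD, zero_mul]
  · rw [pwAffine, dif_neg h]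

/-- Near `x` only elements containing `x` matter. So a nearby increment either belongs to a single
affine piece or is zero, and the sum of the gradient norms serves all pieces. -/
lemma exists_lipschitzWith_pwAffine (hc : ∀ z ∉ 𝒯.domain, c z = 0) :
    ∃ K, LipschitzWith K (𝒯.pwAffine c) := by
  set K : NNReal := ∑ T ∈ 𝒯.elems, ‖affGrad (affInterp T c)‖₊ with hK
  refine ⟨K, lipschitzWith_of_eventually fun x => ?_⟩
  have h1 : ∀ᶠ y in nhds x, ∀ T ∈ 𝒯.elems, x ∉ hull T → y ∉ hull T := by
    rw [Filter.eventually_all_finset]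
    intro T _
    by_cases h : x ∈ hull T
    · exact Filter.Eventually.of_forall fun y hn => absurd h hn
    · exact Filter.mem_of_superset ((isClosed_hull T).isOpen_compl.mem_nhds h) fun y hy _ => hy
  have h2 : ∀ᶠ y in nhds x, x ∈ 𝒯.domain → y ∈ 𝒯.domain := by
    by_cases h : x ∈ 𝒯.domain
    · exact Filter.mem_of_superset (isOpen_domain.mem_nhds h) fun y hy _ => hy
    · exact Filter.Eventually.of_forall fun y hn => absurd hn h
  filter_upwards [h1, h2] with y hy1 hy2
  by_cases hyD : y ∈ 𝒯.domain
  · obtain ⟨T, hT, hyT⟩ := exists_mem_hull hyD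
    have hxT : x ∈ hull T := by
      by_contra h; exact hy1 T hT h hyT
    rw [pwAffine_eq hT hyT, pwAffine_eq hT hxT, affine_apply_eq _ x y, add_sub_cancel_left,
      dist_eq_norm]
    refine (abs_real_inner_le_norm _ _).trans ?_
    gcongr
    have : ‖affGrad (affInterp T c)‖₊ ≤ K :=
      Finset.single_le_sum (f := fun T => ‖affGrad (affInterp T c)‖₊) (fun _ _ => bot_le) hT
    exact_mod_cast this
  · have hxD : x ∉ 𝒯.domain := fun h => hyD (hy2 h)
    rw [pwAffine_eq_zero hc hyD, pwAffine_eq_zero hc hxD, sub_zero, abs_zero]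
    positivity

open Classical in
/-- The gradient of a continuous piecewise affine function. -/
def pwGrad (𝒯 : Mesh n) (c : E n → ℝ) (x : E n) : E n :=
  if h : ∃ T ∈ 𝒯.elems, x ∈ interior (hull T) then affGrad (affInterp h.choose c) else 0

lemma pwGrad_eq {T : Finset (E n)} (hT : T ∈ 𝒯.elems) {x : E n} (hx : x ∈ interior (hull T)) :
    𝒯.pwGrad c x = affGrad (affInterp T c) := by
  have h : ∃ T ∈ 𝒯.elems, x ∈ interior (hull T) := ⟨T, hT, hx⟩
  rw [pwGrad, dif_pos h,
    eq_of_mem_interior hT h.choose_spec.1 hx (interior_subset h.choose_spec.2)]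

lemma ae_mem_interior_or (𝒯 : Mesh n) :
    ∀ᵐ x, (∃ T ∈ 𝒯.elems, x ∈ interior (hull T)) ∨ x ∈ 𝒯.K.spaceᶜ := by
  have h1 : ∀ᵐ x ∂(volume : Measure (E n)), ∀ T ∈ 𝒯.elems, x ∉ frontier (hull T) := by
    rw [Filter.eventually_all_finset]
    intro T _
    exact measure_eq_zero_iff_ae_notMem.1 (volume_frontier_hull T)
  filter_upwards [h1] with x hx
  by_cases h : x ∈ 𝒯.K.space
  · rw [space_eq] at h
    obtain ⟨T, hT, hxT⟩ := mem_iUnion₂.1 h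
    refine Or.inl ⟨T, hT, ?_⟩
    by_contra hni
    exact hx T hT ⟨subset_closure hxT, hni⟩
  · exact Or.inr h

lemma isBounded_domain : Bornology.IsBounded 𝒯.domain :=
  isCompact_space.isBounded.subset domain_subset_space

/-- Continuous piecewise affine functions with zero boundary values belong to `H¹₀(D)`. -/
lemma exists_pwAffine (hc : ∀ z ∉ 𝒯.domain, c z = 0) :
    ∃ u : H10 𝒯.domain, H10.val u =ᵐ[volume.restrict 𝒯.domain] 𝒯.pwAffine c := by
  obtain ⟨K, hK⟩ := exists_lipschitzWith_pwAffine hc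
  obtain ⟨u, hu, -⟩ := H10.exists_of_lipschitz isOpen_domain isBounded_domain hK
    (fun x hx => pwAffine_eq_zero hc hx) (G := 𝒯.pwGrad c) (by
      filter_upwards [𝒯.ae_mem_interior_or] with x hx
      rcases hx with ⟨T, hT, hx⟩ | hx
      · filter_upwards [isOpen_interior.mem_nhds hx] with y hy
        rw [pwGrad_eq hT hx, pwAffine_eq hT (interior_subset hx),
          pwAffine_eq hT (interior_subset hy), ← affine_apply_eq]
      · have h0 : ∀ y ∈ 𝒯.K.spaceᶜ, 𝒯.pwAffine c y = 0 := fun y hy =>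
          pwAffine_eq_zero hc fun h => hy (domain_subset_space h)
        filter_upwards [isCompact_space.isClosed.isOpen_compl.mem_nhds hx] with y hy
        have hg : 𝒯.pwGrad c x = 0 := dif_neg fun ⟨T, hT, hxT⟩ =>
          hx (hull_subset_space hT (interior_subset hxT))
        rw [h0 y hy, h0 x hx, hg, inner_zero_left, add_zero])
    (fun b => by
      have hall : ∀ᵐ x : E n, ∀ T ∈ 𝒯.elems, affInterp T c x = b → affGrad (affInterp T c) = 0 := by
        rw [Filter.eventually_all_finset]
        exact fun T _ => ae_affine_eq _ b
      filter_upwards [hall] with x hx hxb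
      by_cases h : ∃ T ∈ 𝒯.elems, x ∈ interior (hull T)
      · obtain ⟨T, hT, hxT⟩ := h
        rw [pwGrad_eq hT hxT]
        exact hx T hT (by rw [← pwAffine_eq hT (interior_subset hxT)]; exact hxb)
      · exact dif_neg h)
  exact ⟨u, hu⟩

end Mesh

/-! ### Polynomials on elements -/

section Poly

open MvPolynomial

lemma contDiff_eval (P : MvPolynomial (Fin n) ℝ) {k : WithTop ℕ∞} :
    ContDiff ℝ k fun x : E n => eval x.ofLp P := by
  induction P using MvPolynomial.induction_on with
  | C a => simpa using contDiff_const
  | add p q hp hq => simpa using hp.add hq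
  | mul_X p i hp => simpa using hp.mul (show ContDiff ℝ k fun x : E n => x.ofLp i by fun_prop)

lemma hasFDerivAt_eval (P : MvPolynomial (Fin n) ℝ) (x : E n) :
    HasFDerivAt (fun x : E n => eval x.ofLp P)
      (∑ j, eval x.ofLp (pderiv j P) • (EuclideanSpace.proj j : E n →L[ℝ] ℝ)) x := by
  induction P using MvPolynomial.induction_on with
  | C a => simpa using hasFDerivAt_const a x
  | add p q hp hq => simpa [add_smul, Finset.sum_add_distrib] using hp.fun_add hq
  | mul_X p i hp =>
    have h := hp.fun_mul (EuclideanSpace.proj i : E n →L[ℝ] ℝ).hasFDerivAt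
    have e : (∑ j, eval x.ofLp (pderiv j (p * X i)) • (EuclideanSpace.proj j : E n →L[ℝ] ℝ)) =
        eval x.ofLp p • (EuclideanSpace.proj i : E n →L[ℝ] ℝ) +
        x.ofLp i • ∑ j, eval x.ofLp (pderiv j p) • (EuclideanSpace.proj j : E n →L[ℝ] ℝ) := by
      simp only [Derivation.leibniz, smul_eq_mul, pderiv_X, map_add, map_mul, eval_X, add_smul,
        Finset.sum_add_distrib]
      congr 1
      · rw [Finset.sum_eq_single i]
        · simp
        · intro j _ hj
          simp [hj.symm]
        · simp
      · rw [Finset.smul_sum]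
        simp [smul_smul]
    rw [e]
    simpa using h

lemma gradient_eval (P : MvPolynomial (Fin n) ℝ) (x : E n) :
    gradient (fun x : E n => eval x.ofLp P) x = WithLp.toLp 2 fun j => eval x.ofLp (pderiv j P) := by
  refine ext_inner_right ℝ fun e => ?_
  rw [gradient_inner, (hasFDerivAt_eval P x).fderiv, PiLp.inner_apply]
  simp [mul_comm]

/-- A monomial of total degree at most one is a constant or a multiple of a single variable. -/
lemma exists_affine_eq_eval {P : MvPolynomial (Fin n) ℝ} (hP : P.totalDegree ≤ 1) :
    ∃ g : E n →ᵃ[ℝ] ℝ, ∀ x : E n, eval x.ofLp P = g x := by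
  classical
  have hm : ∀ m ∈ P.support, ∃ g : E n →ᵃ[ℝ] ℝ, ∀ x : E n,
      P.coeff m * ∏ i, x.ofLp i ^ m i = g x := by
    intro m hmP
    have hdeg : ∑ i, m i ≤ 1 := by
      have := (le_totalDegree hmP).trans hP
      rwa [Finsupp.sum_fintype _ _ (fun _ => rfl)] at this
    by_cases h0 : ∀ i, m i = 0
    · exact ⟨AffineMap.const ℝ (E n) (P.coeff m), fun x => by simp [h0]⟩
    · push Not at h0
      obtain ⟨i, hi⟩ := h0
      have hsum := Finset.add_sum_erase Finset.univ (fun i => m i) (Finset.mem_univ i)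
      have hi1 : m i = 1 := by
        omega
      have hrest : ∀ j, j ≠ i → m j = 0 := fun j hj => by
        have h1 : ∑ k ∈ Finset.univ.erase i, m k = 0 := by
          omega
        exact (Finset.sum_eq_zero_iff.1 h1) j (Finset.mem_erase.2 ⟨hj, Finset.mem_univ j⟩)
      refine ⟨((P.coeff m) • (EuclideanSpace.proj i : E n →L[ℝ] ℝ)).toLinearMap.toAffineMap,
        fun x => ?_⟩
      rw [Finset.prod_eq_single i (fun j _ hj => by rw [hrest j hj, pow_zero]) (by simp), hi1]
      simp
  choose! g hg using hm
  have hsum : ∀ s : Finset (Fin n →₀ ℕ), ∀ x, (∑ m ∈ s, g m) x = ∑ m ∈ s, g m x := by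
    intro s x
    induction s using Finset.induction_on with
    | empty => simp
    | insert a s ha ih => rw [Finset.sum_insert ha, Finset.sum_insert ha, ← ih]; rfl
  refine ⟨∑ m ∈ P.support, g m, fun x => ?_⟩
  rw [hsum, eval_eq']
  exact Finset.sum_congr rfl fun m hmP => hg m hmP x

lemma exists_eval_eq_affine (g : E n →ᵃ[ℝ] ℝ) :
    ∃ P : MvPolynomial (Fin n) ℝ, P.totalDegree ≤ 1 ∧ ∀ x : E n, eval x.ofLp P = g x := by
  refine ⟨C (g 0) + ∑ j, C ((affGrad g).ofLp j) * X j, ?_, fun x => ?_⟩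
  · refine (totalDegree_add _ _).trans (max_le (by simp) (totalDegree_finsetSum_le fun j _ => ?_))
    exact (totalDegree_mul _ _).trans (by simp)
  · rw [affine_apply_eq g 0 x, sub_zero, PiLp.inner_apply]
    simp [mul_comm]

end Poly

namespace Mesh

variable {𝒯 : Mesh n}

lemma restrict_domain_inter {T : Finset (E n)} (hT : T ∈ 𝒯.elems) :
    𝒯.domain ∩ interior (hull T) = interior (hull T) :=
  inter_eq_self_of_subset_right (interior_hull_subset_domain hT)

lemma isPolyOn_iff {v : H10 𝒯.domain} {T : Finset (E n)} (hT : T ∈ 𝒯.elems)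
    {P : MvPolynomial (Fin n) ℝ} : IsPolyOn v T P ↔
    H10.val v =ᵐ[volume.restrict (interior (hull T))] fun x => MvPolynomial.eval x.ofLp P := by
  rw [IsPolyOn, restrict_domain_inter hT]

lemma isPolyOn_polyOn {v : H10 𝒯.domain} {T : Finset (E n)} (h : ∃ P, IsPolyOn v T P) :
    IsPolyOn v T (polyOn v T) := by
  rw [polyOn, dif_pos h]
  exact h.choose_spec

lemma eqOn_hull_of_ae_eq {T : Finset (E n)} (hT : IsSimplex T) {f g : E n → ℝ} (hf : Continuous f)
    (hg : Continuous g) (h : f =ᵐ[volume.restrict (interior (hull T))] g) :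
    ∀ x ∈ hull T, f x = g x := by
  have h1 : EqOn f g (interior (hull T)) :=
    Measure.eqOn_open_of_ae_eq h isOpen_interior hf.continuousOn hg.continuousOn
  have h2 := h1.closure hf hg
  rw [hT.closure_interior_hull] at h2
  exact h2

lemma eval_polyOn {v : H10 𝒯.domain} {T : Finset (E n)} (hT : T ∈ 𝒯.elems)
    {P : MvPolynomial (Fin n) ℝ} (hP : IsPolyOn v T P) {x : E n} (hx : x ∈ hull T) :
    MvPolynomial.eval x.ofLp (polyOn v T) = MvPolynomial.eval x.ofLp P := by
  have h1 := (isPolyOn_iff hT).1 (isPolyOn_polyOn ⟨P, hP⟩)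
  have h2 := (isPolyOn_iff hT).1 hP
  exact eqOn_hull_of_ae_eq (isSimplex hT) (contDiff_eval (k := 0) _).continuous
    (contDiff_eval (k := 0) _).continuous (h1.symm.trans h2) x hx

lemma gradOn_eq (v : H10 𝒯.domain) (T : Finset (E n)) :
    gradOn v T = gradient fun x => MvPolynomial.eval x.ofLp (polyOn v T) := by
  ext1 x
  rw [gradient_eval]
  rfl

lemma contDiff_gradOn (v : H10 𝒯.domain) (T : Finset (E n)) {k : WithTop ℕ∞} :
    ContDiff ℝ k (gradOn v T) := by
  unfold gradOn
  exact (PiLp.contDiff_toLp).comp (contDiff_pi.2 fun j => contDiff_eval _)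

/-- The weak gradient of a finite element function. -/
lemma grad_ae_eq_gradOn {p : ℕ} {v : H10 𝒯.domain} (hv : v ∈ 𝒯.fe p) {T : Finset (E n)}
    (hT : T ∈ 𝒯.elems) :
    H10.grad v =ᵐ[volume.restrict (interior (hull T))] gradOn v T := by
  obtain ⟨P, -, hP⟩ := hv T hT
  rw [gradOn_eq]
  exact H10.grad_eq_gradient v isOpen_interior (interior_hull_subset_domain hT) (contDiff_eval _)
    ((isPolyOn_iff hT).1 (isPolyOn_polyOn ⟨P, hP⟩))

lemma ae_restrict_domain_iff {p : E n → Prop} :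
    (∀ᵐ x ∂volume.restrict 𝒯.domain, p x) ↔
      ∀ T ∈ 𝒯.elems, ∀ᵐ x ∂volume.restrict (interior (hull T)), p x := by
  rw [Measure.restrict_congr_set domain_ae_eq]
  exact ae_restrict_biUnion_finset_iff _ _ _

/-! ### The Clément operator -/

lemma space_ae_eq : 𝒯.K.space =ᵐ[volume] 𝒯.domain := by
  refine Filter.EventuallyLE.antisymm ?_ domain_subset_space.eventuallyLE
  filter_upwards [𝒯.ae_mem_interior_or] with x hx hxs
  rcases hx with ⟨T, hT, hx⟩ | hx
  · exact interior_hull_subset_domain hT hx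
  · exact absurd hxs hx

lemma patch_subset_space (z : E n) : 𝒯.patch z ⊆ 𝒯.K.space :=
  iUnion₂_subset fun _ hT => hull_subset_space hT.1

lemma restrict_patch_le (z : E n) :
    (volume.restrict (𝒯.patch z) : Measure (E n)) ≤ volume.restrict 𝒯.domain := by
  rw [← Measure.restrict_congr_set space_ae_eq]
  exact Measure.restrict_mono (patch_subset_space z) le_rfl

lemma measurableSet_patch (z : E n) : MeasurableSet (𝒯.patch z) := by
  rw [patch_eq]
  exact Finset.measurableSet_biUnion _ fun T _ => (isClosed_hull T).measurableSet

lemma nodal_congr {g g' : E n → ℝ} (h : g =ᵐ[volume.restrict 𝒯.domain] g') :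
    𝒯.nodal g = 𝒯.nodal g' := by
  ext z
  unfold nodal
  split_ifs
  · refine average_congr ?_
    exact (Measure.absolutelyContinuous_of_le (restrict_patch_le z)).ae_eq h
  · rfl

lemma nodal_eq_zero {g : E n → ℝ} : ∀ z ∉ 𝒯.domain, 𝒯.nodal g z = 0 := fun _ hz => if_neg hz

lemma val_ae_eq_pwAffine {w : H10 𝒯.domain} {c : E n → ℝ} (hw : w ∈ 𝒯.fe 1)
    (hc : ∀ T ∈ 𝒯.elems, ∀ z ∈ T, MvPolynomial.eval z.ofLp (polyOn w T) = c z) :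
    H10.val w =ᵐ[volume.restrict 𝒯.domain] 𝒯.pwAffine c := by
  refine ae_restrict_domain_iff.2 fun T hT => ?_
  obtain ⟨P, hP1, hP⟩ := hw T hT
  obtain ⟨g, hg⟩ := exists_affine_eq_eval hP1
  have h1 := (isPolyOn_iff hT).1 hP
  filter_upwards [h1, ae_restrict_mem isOpen_interior.measurableSet] with x hx hxT
  have hxT' := interior_subset hxT
  rw [hx, pwAffine_eq hT hxT', hg, (isSimplex hT).affine_eq_sum g, affInterp_apply]
  refine Finset.sum_congr rfl fun z hz => ?_
  rw [← hc T hT z hz, eval_polyOn hT hP (subset_hull hz), hg, mul_comm]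

lemma isClement_of_val_ae_eq {v w : H10 𝒯.domain}
    (h : H10.val w =ᵐ[volume.restrict 𝒯.domain] 𝒯.pwAffine (𝒯.nodal (H10.val v))) :
    𝒯.IsClement v w := by
  have key : ∀ T ∈ 𝒯.elems, ∃ P : MvPolynomial (Fin n) ℝ, P.totalDegree ≤ 1 ∧
      (∀ x : E n, MvPolynomial.eval x.ofLp P = affInterp T (𝒯.nodal (H10.val v)) x) ∧
      IsPolyOn w T P := by
    intro T hT
    obtain ⟨P, hP1, hP⟩ := exists_eval_eq_affine (affInterp T (𝒯.nodal (H10.val v)))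
    refine ⟨P, hP1, hP, (isPolyOn_iff hT).2 ?_⟩
    filter_upwards [ae_restrict_domain_iff.1 h T hT,
      ae_restrict_mem isOpen_interior.measurableSet] with x hx hxT
    rw [hx, hP, pwAffine_eq hT (interior_subset hxT)]
  refine ⟨fun T hT => ?_, fun T hT z hz => ?_⟩
  · obtain ⟨P, hP1, -, hP⟩ := key T hT
    exact ⟨P, hP1, hP⟩
  · obtain ⟨P, -, hP2, hP⟩ := key T hT
    rw [eval_polyOn hT hP (subset_hull hz), hP2, (isSimplex hT).affInterp_vertex hz]
    rfl

/-- An element with vanishing function has vanishing weak gradient, so the function determines the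
pair. -/
lemma eq_of_val_ae_eq {v w : H10 𝒯.domain} {D' : Set (E n)} (hD' : D' = 𝒯.domain)
    (h : H10.val v =ᵐ[volume.restrict D'] H10.val w) : v = w := by
  subst hD'
  refine H10.ext_ae h ?_
  have h0 : H10.val (v - w) =ᵐ[volume.restrict 𝒯.domain] fun _ => (0 : ℝ) := by
    filter_upwards [h, H10.val_sub v w] with x h1 h2
    rw [h2, h1, sub_self]
  have h1 := H10.grad_eq_gradient (v - w) isOpen_domain subset_rfl contDiff_const h0
  filter_upwards [h1, H10.grad_sub v w] with x h1 h2
  rw [h2] at h1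
  have : gradient (fun _ : E n => (0 : ℝ)) x = 0 := by simp [gradient]
  rw [this] at h1
  exact sub_eq_zero.1 h1

/-- Existence of the interpolant in `H10` justifies the choice made in the definition of `clement`.
-/
lemma isClement_clement (v : H10 𝒯.domain) : 𝒯.IsClement v (𝒯.clement v) := by
  obtain ⟨u, hu⟩ := exists_pwAffine (𝒯 := 𝒯) (c := 𝒯.nodal (H10.val v)) nodal_eq_zero
  exact Classical.epsilon_spec (p := 𝒯.IsClement v) ⟨u, isClement_of_val_ae_eq hu⟩

lemma val_clement (v : H10 𝒯.domain) :
    H10.val (𝒯.clement v) =ᵐ[volume.restrict 𝒯.domain] 𝒯.pwAffine (𝒯.nodal (H10.val v)) :=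
  val_ae_eq_pwAffine (isClement_clement v).1 fun T hT z hz => (isClement_clement v).2 T hT z hz

/-- The mean on a vertex patch as a continuous linear functional. -/
lemma exists_patchMean (𝒯 : Mesh n) (z : E n) : ∃ L : H10 𝒯.domain →L[ℝ] ℝ,
    ∀ v, L v = 𝒯.nodal (H10.val v) z := by
  classical
  by_cases hz : z ∈ 𝒯.domain
  · set h : E n → ℝ := (𝒯.patch z).indicator fun _ => 1 with hh
    have hfin : IsFiniteMeasure (volume.restrict 𝒯.domain) := ⟨by
      rw [Measure.restrict_apply_univ]; exact isBounded_domain.measure_lt_top⟩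
    have hL : MemLp h 2 (volume.restrict 𝒯.domain) :=
      (memLp_const (1 : ℝ)).indicator (measurableSet_patch z)
    refine ⟨(volume.real (𝒯.patch z))⁻¹ • (innerSL ℝ (hL.toLp h)).comp H10.valL, fun v => ?_⟩
    rw [smul_apply, ContinuousLinearMap.comp_apply, innerSL_apply_apply, ← H10.integral_mul_val hL,
      nodal, if_pos hz, setAverage_eq, smul_eq_mul, smul_eq_mul]
    congr 1
    have e : ∀ x, h x * H10.val v x = (𝒯.patch z).indicator (H10.val v) x := fun x => by
      by_cases hx : x ∈ 𝒯.patch z <;> simp [hh, hx]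
    simp only [e]
    rw [← Measure.restrict_congr_set space_ae_eq, setIntegral_indicator (measurableSet_patch z),
      inter_eq_self_of_subset_right (patch_subset_space z)]
  · exact ⟨0, fun v => by simp [nodal, hz]⟩

-- The expansion in hat functions of interior vertices, which will exhibit the Clément operator as a
-- finite sum of bounded functionals times fixed functions.
open Classical in
lemma pwAffine_eq_sum {c : E n → ℝ} (hc : ∀ z ∉ 𝒯.domain, c z = 0) {T : Finset (E n)}
    (hT : T ∈ 𝒯.elems) {x : E n} (hx : x ∈ hull T) :
    𝒯.pwAffine c x = ∑ z ∈ 𝒯.elems.biUnion id,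
      c z * 𝒯.pwAffine (fun w => if w = z ∧ w ∈ 𝒯.domain then 1 else 0) x := by
  rw [pwAffine_eq hT hx, affInterp_apply]
  refine Finset.sum_subset_zero_on_sdiff (Finset.subset_biUnion_of_mem id hT) (fun z hz => ?_)
    (fun z hz => ?_)
  · rw [pwAffine_eq hT hx, affInterp_apply, Finset.sum_eq_zero, mul_zero]
    intro w hw
    have : w ≠ z := by rintro rfl; exact (Finset.mem_sdiff.1 hz).2 hw
    simp [this]
  · by_cases hzD : z ∈ 𝒯.domain
    · rw [pwAffine_eq hT hx, affInterp_apply, Finset.sum_eq_single_of_mem z hz]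
      · simp [hzD]
      · intro w _ hwz
        simp [hwz]
    · rw [hc z hzD, zero_mul, zero_mul]

open Classical in
/-- The Clément operator is a continuous linear map. -/
lemma exists_clementL (𝒯 : Mesh n) :
    ∃ L : H10 𝒯.domain →L[ℝ] H10 𝒯.domain, ∀ v, L v = 𝒯.clement v := by
  choose m hm using 𝒯.exists_patchMean
  have hex : ∀ z : E n, ∃ u : H10 𝒯.domain, H10.val u =ᵐ[volume.restrict 𝒯.domain]
      𝒯.pwAffine fun w => if w = z ∧ w ∈ 𝒯.domain then 1 else 0 := fun z =>
    exists_pwAffine fun w hw => if_neg fun h => hw h.2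
  choose φ hφ using hex
  refine ⟨∑ z ∈ 𝒯.elems.biUnion id, (m z).smulRight (φ z), fun v => ?_⟩
  rw [sum_apply]
  refine eq_of_val_ae_eq rfl ?_
  have hall : ∀ᵐ x ∂volume.restrict 𝒯.domain, ∀ z ∈ 𝒯.elems.biUnion id,
      H10.val (m z v • φ z) x = m z v * H10.val (φ z) x ∧ H10.val (φ z) x =
        𝒯.pwAffine (fun w => if w = z ∧ w ∈ 𝒯.domain then 1 else 0) x := by
    rw [Filter.eventually_all_finset]
    exact fun z _ => (H10.val_smul _ _).and (hφ z)
  filter_upwards [H10.val_sum (𝒯.elems.biUnion id) fun z => (m z).smulRight (φ z) v, hall,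
    val_clement v, ae_restrict_mem isOpen_domain.measurableSet] with x h1 h2 h3 hx
  obtain ⟨T, hT, hxT⟩ := exists_mem_hull hx
  rw [h1, h3, pwAffine_eq_sum nodal_eq_zero hT hxT]
  refine Finset.sum_congr rfl fun z hz => ?_
  rw [ContinuousLinearMap.smulRight_apply, (h2 z hz).1, (h2 z hz).2, hm]

lemma clement_mem_fe (v : H10 𝒯.domain) : 𝒯.clement v ∈ 𝒯.fe 1 := (isClement_clement v).1

lemma setIntegral_domain {f : E n → ℝ} (hf : IntegrableOn f 𝒯.domain) :
    ∫ x in 𝒯.domain, f x = ∑ T ∈ 𝒯.elems, ∫ x in interior (hull T), f x := by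
  rw [setIntegral_congr_set domain_ae_eq, integral_biUnion_finset]
  · exact fun T _ => isOpen_interior.measurableSet
  · exact pairwise_disjoint_interior
  · exact fun T hT => hf.mono_set (interior_hull_subset_domain hT)

lemma gradSq_eq (g : E n → ℝ) (T : Finset (E n)) :
    gradSq g T = ∫ x in interior (hull T), ‖gradient g x‖ ^ 2 := by
  rw [gradSq, setIntegral_congr_set (interior_ae_eq_hull T)]
  simp only [norm_gradient]

end Mesh

lemma H10.normX_sq {D : Set (E n)} (v : H10 D) : H10.normX v ^ 2 = ∫ x in D, ‖H10.grad v x‖ ^ 2 := by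
  have : H10.normX v ^ 2 = ⟪gradL v, gradL v⟫ := (real_inner_self_eq_norm_sq _).symm
  rw [this, L2.inner_def]
  simp only [real_inner_self_eq_norm_sq]
  rfl

namespace Mesh

variable {𝒯 : Mesh n} {κ : ℝ}

/-- The residual of a piecewise `C¹` flux, tested with the Clément interpolation error. -/
lemma abs_residual_sub_clement_le (hreg : 𝒯.ShapeRegular κ) (hκ : 0 < κ) (hn : 2 ≤ n) {f : E n → ℝ}
    (hf : MemLp f 2 (volume.restrict 𝒯.domain)) {X : Finset (E n) → E n → E n}
    (hX : ∀ T ∈ 𝒯.elems, ContDiff ℝ 1 (X T)) {S : E n → E n}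
    (hS : MemLp S 2 (volume.restrict 𝒯.domain))
    (hSX : ∀ T ∈ 𝒯.elems, S =ᵐ[volume.restrict (interior (hull T))] X T) (v : H10 𝒯.domain) :
    |(∫ x in 𝒯.domain, f x * H10.val (v - 𝒯.clement v) x) -
      ∫ x in 𝒯.domain, ⟪S x, H10.grad (v - 𝒯.clement v) x⟫| ≤
      resConst n κ * √(𝒯.resSq f X) * H10.normX v := by
  obtain ⟨L, hL⟩ := 𝒯.exists_clementL
  have hLc : Continuous fun v => v - 𝒯.clement v := by
    simp only [← hL]
    fun_prop
  -- Both sides are continuous in `v`, because the Clément operator is bounded; so test functions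
  -- suffice.
  refine H10.induction (P := fun v => |(∫ x in 𝒯.domain, f x * H10.val (v - 𝒯.clement v) x) -
      ∫ x in 𝒯.domain, ⟪S x, H10.grad (v - 𝒯.clement v) x⟫| ≤
      resConst n κ * √(𝒯.resSq f X) * H10.normX v) (isClosed_le ?_ ?_) (fun v g hv => ?_) v
  · exact (((H10.continuous_integral_mul_val hf).comp hLc).sub
      ((H10.continuous_integral_inner_grad hS).comp hLc)).abs
  · exact continuous_const.mul (continuous_norm.comp H10.gradL.continuous)
  have hg := hv.contDiff_one
  have hcl : H10.val (𝒯.clement v) =ᵐ[volume.restrict 𝒯.domain] 𝒯.pwAffine (𝒯.nodal g) := by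
    rw [← nodal_congr hv.val_eq]
    exact val_clement v
  have key := abs_sum_residual_le hreg hκ hn hf hX hg fun x hx => hv.eq_zero hx
  have h1 : IntegrableOn (fun x => f x * H10.val (v - 𝒯.clement v) x) 𝒯.domain :=
    hf.integrable_mul (H10.val_memLp _)
  have h2 : IntegrableOn (fun x => ⟪S x, H10.grad (v - 𝒯.clement v) x⟫) 𝒯.domain :=
    integrable_inner_of_memLp hS (H10.grad_memLp _)
  have e1 : (∫ x in 𝒯.domain, f x * H10.val (v - 𝒯.clement v) x) -
      ∫ x in 𝒯.domain, ⟪S x, H10.grad (v - 𝒯.clement v) x⟫ =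
      ∑ T ∈ 𝒯.elems, ∫ x in hull T, (f x * (g x - affInterp T (𝒯.nodal g) x) -
        fderiv ℝ (fun y => g y - affInterp T (𝒯.nodal g) y) x (X T x)) := by
    rw [← integral_sub h1 h2, setIntegral_domain (f := fun x => f x * H10.val (v - 𝒯.clement v) x -
      ⟪S x, H10.grad (v - 𝒯.clement v) x⟫) (h1.sub h2)]
    refine Finset.sum_congr rfl fun T hT => ?_
    rw [← setIntegral_congr_set (interior_ae_eq_hull T)]
    have hψ : ContDiff ℝ 1 fun y => g y - affInterp T (𝒯.nodal g) y := hg.sub (contDiff_affine _)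
    have hval : H10.val (v - 𝒯.clement v) =ᵐ[volume.restrict (interior (hull T))]
        fun y => g y - affInterp T (𝒯.nodal g) y := by
      filter_upwards [ae_restrict_domain_iff.1 (H10.val_sub v (𝒯.clement v)) T hT,
        ae_restrict_domain_iff.1 hcl T hT, ae_restrict_domain_iff.1 hv.val_eq T hT,
        ae_restrict_mem isOpen_interior.measurableSet] with x h1 h2 h3 hxT
      rw [h1, h2, h3, pwAffine_eq hT (interior_subset hxT)]
    refine integral_congr_ae ?_
    filter_upwards [hval, H10.grad_eq_gradient _ isOpen_interior (interior_hull_subset_domain hT)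
      hψ hval, hSX T hT] with x h1 h2 h3
    rw [h1, h2, h3, real_inner_comm, gradient_inner]
  have e2 : H10.normX v = √(∑ T ∈ 𝒯.elems, gradSq g T) := by
    have h0 : 0 ≤ H10.normX v := norm_nonneg _
    rw [← Real.sqrt_sq h0, H10.normX_sq,
      setIntegral_domain ((H10.grad_memLp v).integrable_norm_pow (by norm_num))]
    congr 1
    refine Finset.sum_congr rfl fun T hT => ?_
    rw [gradSq_eq]
    refine integral_congr_ae ?_
    filter_upwards [ae_restrict_domain_iff.1 hv.grad_eq T hT] with x hx
    rw [hx]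
  rw [e1, e2]
  exact key

end Mesh

/-! ### Gaussian measures and Hermite polynomials -/

section Hermite

open Polynomial in
theorem integrable_eval_mul_exp_neg_mul_sq (p : Polynomial ℝ) {b : ℝ} (hb : 0 < b) :
    Integrable fun t : ℝ => p.eval t * Real.exp (-b * t ^ 2) := by
  induction p using Polynomial.induction_on' with
  | add p q hp hq => simpa only [Polynomial.eval_add, add_mul] using hp.fun_add hq
  | monomial k a =>
    have h := (integrable_rpow_mul_exp_neg_mul_sq hb (s := (k : ℝ)) (by
      have : (0 : ℝ) ≤ k := k.cast_nonneg
      linarith)).const_mul a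
    refine h.congr (Filter.Eventually.of_forall fun t => ?_)
    simp [Polynomial.eval_monomial, Real.rpow_natCast, mul_assoc]

theorem gaussianPDFReal_zero_eq {v : NNReal} (t : ℝ) :
    gaussianPDFReal 0 v t = (√(2 * Real.pi * v))⁻¹ * Real.exp (-(2 * v : ℝ)⁻¹ * t ^ 2) := by
  rw [gaussianPDFReal]
  congr 2
  rw [sub_zero]; ring

theorem integrable_gaussianReal_iff {v : NNReal} (hv : v ≠ 0) {f : ℝ → ℝ} :
    Integrable f (gaussianReal 0 v) ↔
      Integrable fun t => f t * Real.exp (-(2 * v : ℝ)⁻¹ * t ^ 2) := by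
  have hv' : (0 : ℝ) < v := NNReal.coe_pos.mpr (pos_iff_ne_zero.mpr hv)
  rw [gaussianReal_of_var_ne_zero 0 hv,
    integrable_withDensity_iff_integrable_smul₀' (measurable_gaussianPDF 0 v).aemeasurable
      (Filter.Eventually.of_forall fun t => gaussianPDF_lt_top)]
  have hc : IsUnit (√(2 * Real.pi * v))⁻¹ := by
    refine IsUnit.mk0 _ (inv_ne_zero (Real.sqrt_ne_zero'.mpr (by positivity)))
  refine Iff.trans ?_ (integrable_const_mul_iff hc _)
  refine integrable_congr (Filter.Eventually.of_forall fun t => ?_)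
  simp only [toReal_gaussianPDF, smul_eq_mul]
  rw [gaussianPDFReal_zero_eq]; ring

theorem integrable_eval_gaussianReal (p : Polynomial ℝ) {v : NNReal} (hv : v ≠ 0) :
    Integrable (fun t => p.eval t) (gaussianReal 0 v) := by
  have hv' : (0 : ℝ) < v := NNReal.coe_pos.mpr (pos_iff_ne_zero.mpr hv)
  rw [integrable_gaussianReal_iff hv]
  exact integrable_eval_mul_exp_neg_mul_sq p (by positivity)

/-- Stein's identity: the difference of the integrands times the density is the derivative of `-p`
times the density, which is integrable together with its derivative. -/
theorem integral_X_mul_gaussianReal (p : Polynomial ℝ) :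
    ∫ t, t * p.eval t ∂gaussianReal 0 1 = ∫ t, p.derivative.eval t ∂gaussianReal 0 1 := by
  have h1 := integrable_eval_gaussianReal (Polynomial.X * p) (v := 1) one_ne_zero
  have h2 := integrable_eval_gaussianReal p.derivative (v := 1) one_ne_zero
  simp only [Polynomial.eval_mul, Polynomial.eval_X] at h1
  rw [← sub_eq_zero, ← integral_sub h1 h2,
    integral_gaussianReal_eq_integral_smul one_ne_zero]
  have hd : ∀ t : ℝ, HasDerivAt
      (fun t => -((√(2 * Real.pi * (1 : NNReal)))⁻¹ *
        (p.eval t * Real.exp (-(1 / 2) * t ^ 2))))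
      (gaussianPDFReal 0 1 t • (t * p.eval t - p.derivative.eval t)) t := by
    intro t
    have he : HasDerivAt (fun t : ℝ => Real.exp (-(1 / 2) * t ^ 2))
        (Real.exp (-(1 / 2) * t ^ 2) * (-(1 / 2) * (2 * t))) t := by
      have := ((hasDerivAt_pow 2 t).const_mul (-(1 / 2) : ℝ)).exp
      simpa using this
    refine (((p.hasDerivAt t).fun_mul he).const_mul _).fun_neg.congr_deriv ?_
    rw [gaussianPDFReal_zero_eq, smul_eq_mul]
    have : -(2 * ((1 : NNReal) : ℝ))⁻¹ * t ^ 2 = -(1 / 2) * t ^ 2 := by norm_num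
    rw [this]; ring
  refine integral_eq_zero_of_hasDerivAt_of_integrable hd ?_ ?_
  · have h3 : Integrable (fun t => t * p.eval t - p.derivative.eval t) (gaussianReal 0 1) :=
      h1.sub h2
    rw [gaussianReal_of_var_ne_zero 0 one_ne_zero,
      integrable_withDensity_iff_integrable_smul₀' (measurable_gaussianPDF 0 1).aemeasurable
      (Filter.Eventually.of_forall fun t => gaussianPDF_lt_top)] at h3
    simpa only [toReal_gaussianPDF] using h3
  · exact ((integrable_eval_mul_exp_neg_mul_sq p (b := 1 / 2) (by norm_num)).const_mul _).neg

/-- The Hermite polynomials with real coefficients. -/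
def hermiteR (k : ℕ) : Polynomial ℝ := (Polynomial.hermite k).map (Int.castRingHom ℝ)

theorem hermiteN_eq (k : ℕ) (t : ℝ) : hermiteN k t = (hermiteR k).eval t / √(k.factorial : ℝ) := by
  rw [hermiteN, hermiteR, Polynomial.aeval_def, Polynomial.eval_map]; rfl

theorem hermiteR_succ (k : ℕ) :
    hermiteR (k + 1) = Polynomial.X * hermiteR k - Polynomial.derivative (hermiteR k) := by
  rw [hermiteR, Polynomial.hermite_succ]
  simp [hermiteR, Polynomial.derivative_map]

theorem hermiteR_monic (k : ℕ) : (hermiteR k).Monic := (Polynomial.hermite_monic k).map _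

theorem natDegree_hermiteR (k : ℕ) : (hermiteR k).natDegree = k := by
  rw [hermiteR, (Polynomial.hermite_monic k).natDegree_map, Polynomial.natDegree_hermite]

/-- The recursion `H_{k+1} = X H_k - H_k'` and Stein's identity move one derivative onto `p` in each
step. -/
theorem integral_hermiteR_mul (k : ℕ) (p : Polynomial ℝ) :
    ∫ t, (hermiteR k).eval t * p.eval t ∂gaussianReal 0 1 =
      ∫ t, (Polynomial.derivative^[k] p).eval t ∂gaussianReal 0 1 := by
  induction k generalizing p with
  | zero => simp [hermiteR]
  | succ k ih =>
    rw [Function.iterate_succ_apply, ← ih]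
    have h := integral_X_mul_gaussianReal (hermiteR k * p)
    have h1 := integrable_eval_gaussianReal (Polynomial.X * (hermiteR k * p)) (v := 1) one_ne_zero
    have h2 := integrable_eval_gaussianReal (Polynomial.derivative (hermiteR k) * p)
      (v := 1) one_ne_zero
    have h3 := integrable_eval_gaussianReal (hermiteR k * Polynomial.derivative p)
      (v := 1) one_ne_zero
    simp only [Polynomial.eval_mul, Polynomial.eval_X, Polynomial.derivative_mul,
      Polynomial.eval_add] at h h1 h2 h3
    rw [integral_add h2 h3] at h
    have : ∀ t, (hermiteR (k + 1)).eval t * p.eval t =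
        t * ((hermiteR k).eval t * p.eval t) - (Polynomial.derivative (hermiteR k)).eval t * p.eval t := by
      intro t; rw [hermiteR_succ]; simp; ring
    simp_rw [this]
    rw [integral_sub h1 h2, h]; ring

theorem integral_hermiteR_mul_of_lt {k : ℕ} {p : Polynomial ℝ} (h : p.natDegree < k) :
    ∫ t, (hermiteR k).eval t * p.eval t ∂gaussianReal 0 1 = 0 := by
  rw [integral_hermiteR_mul, Polynomial.iterate_derivative_eq_zero h]; simp

/-- The `k`-th derivative of a monic polynomial of degree `k` is the constant `k!`. -/
theorem integral_hermiteR_mul_self (k : ℕ) :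
    ∫ t, (hermiteR k).eval t * (hermiteR k).eval t ∂gaussianReal 0 1 = k.factorial := by
  rw [integral_hermiteR_mul]
  have h : Polynomial.derivative^[k] (hermiteR k) = Polynomial.C (k.factorial : ℝ) := by
    have h1 := Polynomial.natDegree_iterate_derivative (hermiteR k) k
    rw [natDegree_hermiteR, Nat.sub_self] at h1
    rw [Polynomial.eq_C_of_natDegree_le_zero h1, Polynomial.coeff_iterate_derivative]
    have : (hermiteR k).coeff (0 + k) = 1 := by
      have := hermiteR_monic k
      rw [Polynomial.Monic, Polynomial.leadingCoeff, natDegree_hermiteR] at this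
      rwa [zero_add]
    rw [this, zero_add, Nat.descFactorial_self]; simp
  rw [h]; simp

/-- Orthonormality of the normalized Hermite polynomials. -/
theorem integral_hermiteN_mul (i j : ℕ) :
    ∫ t, hermiteN i t * hermiteN j t ∂gaussianReal 0 1 = if i = j then 1 else 0 := by
  have h : ∀ t, hermiteN i t * hermiteN j t = ((√(i.factorial : ℝ))⁻¹ * (√(j.factorial : ℝ))⁻¹) *
      ((hermiteR i).eval t * (hermiteR j).eval t) := by
    intro t; rw [hermiteN_eq, hermiteN_eq]; ring
  simp_rw [h]
  rw [integral_const_mul]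
  rcases lt_trichotomy i j with hij | rfl | hij
  · rw [if_neg hij.ne]
    simp_rw [mul_comm ((hermiteR i).eval _)]
    rw [integral_hermiteR_mul_of_lt (by rwa [natDegree_hermiteR]), mul_zero]
  · rw [if_pos rfl, integral_hermiteR_mul_self, ← mul_inv, Real.mul_self_sqrt (Nat.cast_nonneg _)]
    exact inv_mul_cancel₀ (by positivity)
  · rw [if_neg hij.ne', integral_hermiteR_mul_of_lt (by rwa [natDegree_hermiteR]), mul_zero]

/-- The normalized Hermite polynomials as polynomials. -/
def hermiteP (k : ℕ) : Polynomial ℝ := Polynomial.C (√(k.factorial : ℝ))⁻¹ * hermiteR k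

theorem eval_hermiteP (k : ℕ) (t : ℝ) : (hermiteP k).eval t = hermiteN k t := by
  rw [hermiteN_eq, hermiteP, Polynomial.eval_mul, Polynomial.eval_C]; ring

theorem natDegree_hermiteP_le (k : ℕ) : (hermiteP k).natDegree ≤ k :=
  (Polynomial.natDegree_C_mul_le _ _).trans (natDegree_hermiteR k).le

theorem coeff_hermiteP_self (k : ℕ) : (hermiteP k).coeff k = (√(k.factorial : ℝ))⁻¹ := by
  have := hermiteR_monic k
  rw [Polynomial.Monic, Polynomial.leadingCoeff, natDegree_hermiteR] at this
  rw [hermiteP, Polynomial.coeff_C_mul, this, mul_one]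

theorem exists_eq_sum_hermiteP (m : ℕ) (p : Polynomial ℝ) (hp : p.degree < m) :
    ∃ c : ℕ → ℝ, p = ∑ k ∈ Finset.range m, Polynomial.C (c k) * hermiteP k := by
  induction m generalizing p with
  | zero => exact ⟨0, by simpa using hp⟩
  | succ m ih =>
    -- `hermiteP m` has leading coefficient `1 / √m!`, so subtracting `b` times it removes the
    -- leading term of `p`.
    set b : ℝ := p.coeff m * √(m.factorial : ℝ) with hb
    obtain ⟨c, hc⟩ := ih (p - Polynomial.C b * hermiteP m) (by
      rw [Polynomial.degree_lt_iff_coeff_zero]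
      intro j hj
      rcases hj.eq_or_lt with rfl | hj
      · rw [Polynomial.coeff_sub, Polynomial.coeff_C_mul, coeff_hermiteP_self, hb, mul_assoc,
          mul_inv_cancel₀ (Real.sqrt_ne_zero'.mpr (by positivity)), mul_one, sub_self]
      · rw [Polynomial.coeff_sub, Polynomial.coeff_C_mul,
          Polynomial.coeff_eq_zero_of_natDegree_lt ((natDegree_hermiteP_le m).trans_lt hj),
          mul_zero, sub_zero]
        exact (Polynomial.degree_lt_iff_coeff_zero p (m + 1)).mp hp j hj)
    refine ⟨Function.update c m b, ?_⟩
    rw [Finset.sum_range_succ, Function.update_self, ← sub_eq_iff_eq_add, hc]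
    refine Finset.sum_congr rfl fun k hk => ?_
    rw [Function.update_of_ne (Finset.mem_range.mp hk).ne]

theorem integrable_hermiteN_mul (i j : ℕ) :
    Integrable (fun t => hermiteN i t * hermiteN j t) (gaussianReal 0 1) := by
  simpa [eval_hermiteP] using
    integrable_eval_gaussianReal (hermiteP i * hermiteP j) (v := 1) one_ne_zero

/-- Linearization of a product of two Hermite polynomials. -/
theorem hermiteN_mul_hermiteN {i j m : ℕ} (h : i + j < m) (t : ℝ) :
    hermiteN i t * hermiteN j t = ∑ k ∈ Finset.range m, tripleCoeff i j k * hermiteN k t := by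
  obtain ⟨c, hc⟩ := exists_eq_sum_hermiteP m (hermiteP i * hermiteP j) (by
    refine (Polynomial.degree_le_natDegree).trans_lt ?_
    exact_mod_cast (Polynomial.natDegree_mul_le.trans
      (add_le_add (natDegree_hermiteP_le i) (natDegree_hermiteP_le j))).trans_lt h)
  have he : ∀ t, hermiteN i t * hermiteN j t = ∑ k ∈ Finset.range m, c k * hermiteN k t := by
    intro t
    have := congrArg (Polynomial.eval t) hc
    simpa [Polynomial.eval_finsetSum, eval_hermiteP] using this
  rw [he t]
  refine Finset.sum_congr rfl fun k hk => ?_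
  congr 1
  -- Orthonormality identifies the coefficient: integration against the `k`-th polynomial picks out
  -- `c k`.
  rw [tripleCoeff]
  simp_rw [he, Finset.sum_mul]
  rw [integral_finsetSum _ fun k' _ => by
    simpa [mul_assoc] using (integrable_hermiteN_mul k' k).const_mul (c k')]
  simp_rw [mul_assoc, integral_const_mul, integral_hermiteN_mul]
  simp [Finset.mem_range.mp hk]

end Hermite

/-! ### Tensor products of Hermite polynomials -/

section

variable {Ω : Type*} {mΩ : MeasurableSpace Ω} {m : Measure Ω}

/-- Membership in `L^p` for all finite exponents. -/
def AllLp (f : Ω → ℝ) (m : Measure Ω) : Prop := ∀ p : ENNReal, p ≠ ⊤ → MemLp f p m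

theorem AllLp.add {f g : Ω → ℝ} (hf : AllLp f m) (hg : AllLp g m) :
    AllLp (fun x => f x + g x) m := fun p hp => (hf p hp).add (hg p hp)

theorem AllLp.mul {f g : Ω → ℝ} (hf : AllLp f m) (hg : AllLp g m) :
    AllLp (fun x => f x * g x) m := fun p hp => by
  have h2 : 2 * p ≠ ⊤ := ENNReal.mul_ne_top (by simp) hp
  have : ENNReal.HolderTriple (2 * p) (2 * p) p := ⟨by
    rw [ENNReal.mul_inv (by simp) (by simp), ← add_mul, ENNReal.inv_two_add_inv_two, one_mul]⟩
  exact (hg _ h2).mul' (hf _ h2)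

theorem AllLp.const [IsFiniteMeasure m] (c : ℝ) : AllLp (fun _ : Ω => c) m :=
  fun _ _ => memLp_const c

theorem AllLp.sum {ι : Type*} {s : Finset ι} {f : ι → Ω → ℝ} (hf : ∀ i ∈ s, AllLp (f i) m) :
    AllLp (fun x => ∑ i ∈ s, f i x) m := fun p hp =>
  memLp_finsetSum s fun i hi => hf i hi p hp

theorem AllLp.prod [IsFiniteMeasure m] {ι : Type*} {s : Finset ι} {f : ι → Ω → ℝ}
    (hf : ∀ i ∈ s, AllLp (f i) m) : AllLp (fun x => ∏ i ∈ s, f i x) m := by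
  classical
  induction s using Finset.induction_on with
  | empty => simpa using AllLp.const 1
  | insert i s hi ih =>
    simp_rw [Finset.prod_insert hi]
    exact (hf i (Finset.mem_insert_self ..)).mul
      (ih fun j hj => hf j (Finset.mem_insert_of_mem hj))

theorem AllLp.abs {f : Ω → ℝ} (hf : AllLp f m) : AllLp (fun x => |f x|) m :=
  fun p hp => (hf p hp).abs

theorem AllLp.integrable {f : Ω → ℝ} (hf : AllLp f m) : Integrable f m :=
  memLp_one_iff_integrable.mp (hf 1 (by simp))

theorem allLp_eval_gaussianReal (p : Polynomial ℝ) (v : NNReal) :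
    AllLp (fun t => p.eval t) (gaussianReal 0 v) := by
  have hid : AllLp (fun t : ℝ => t) (gaussianReal 0 v) := fun p hp => memLp_id_gaussianReal' p hp
  induction p using Polynomial.induction_on' with
  | add p q hp hq => simpa only [Polynomial.eval_add] using hp.add hq
  | monomial k a =>
    have : ∀ t : ℝ, (Polynomial.monomial k a).eval t = a * ∏ _i ∈ Finset.range k, t := by simp
    simp_rw [this]
    exact (AllLp.const a).mul (AllLp.prod fun _ _ => hid)

theorem hermiteN_div_eq (k : ℕ) (s t : ℝ) :
    hermiteN k (t / s) = ((hermiteP k).comp (Polynomial.C s⁻¹ * Polynomial.X)).eval t := by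
  rw [Polynomial.eval_comp, eval_hermiteP]; simp [div_eq_inv_mul]

theorem allLp_hermiteN_div (k : ℕ) (s : ℝ) (v : NNReal) :
    AllLp (fun t => hermiteN k (t / s)) (gaussianReal 0 v) := by
  simp_rw [hermiteN_div_eq]
  exact allLp_eval_gaussianReal _ v

theorem continuous_hermiteN (k : ℕ) : Continuous (hermiteN k) := by
  have : hermiteN k = fun t => (hermiteP k).eval t := funext fun t => (eval_hermiteP k t).symm
  rw [this]; exact (hermiteP k).continuous

theorem integral_hermiteN_div_mul {s : ℝ} (hs : 0 < s) (i j : ℕ) :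
    ∫ t, hermiteN i (t / s) * hermiteN j (t / s) ∂gaussianReal 0 (Real.toNNReal (s ^ 2)) =
      if i = j then 1 else 0 := by
  rw [← integral_hermiteN_mul]
  have h := gaussianReal_map_div_const (μ := 0) (v := Real.toNNReal (s ^ 2)) s
  have h1 : Real.toNNReal (s ^ 2) / NNReal.mk (s ^ 2) (sq_nonneg _) = 1 := by
    have : NNReal.mk (s ^ 2) (sq_nonneg _) = Real.toNNReal (s ^ 2) :=
      (Real.toNNReal_of_nonneg (sq_nonneg _)).symm
    rw [this]
    exact div_self (Real.toNNReal_pos.mpr (by positivity)).ne'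
  rw [zero_div, h1] at h
  rw [← h, integral_map (by fun_prop)
    ((continuous_hermiteN i).fun_mul (continuous_hermiteN j)).aestronglyMeasurable]

end

/-! ### Gaussian densities and multivariate Hermite polynomials -/

theorem withDensity_gaussianReal {s : ℝ} (hs : 0 < s) :
    (gaussianReal 0 1).withDensity
      (fun t => ENNReal.ofReal (s⁻¹ * Real.exp ((1 - (s ^ 2)⁻¹) / 2 * t ^ 2))) =
      gaussianReal 0 (Real.toNNReal (s ^ 2)) := by
  have hv : Real.toNNReal (s ^ 2) ≠ 0 := (Real.toNNReal_pos.mpr (by positivity)).ne'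
  rw [gaussianReal_of_var_ne_zero 0 one_ne_zero, gaussianReal_of_var_ne_zero 0 hv,
    ← withDensity_mul _ (measurable_gaussianPDF 0 1) (by fun_prop)]
  congr 1
  ext t
  rw [Pi.mul_apply, gaussianPDF_def, gaussianPDF_def,
    ← ENNReal.ofReal_mul (gaussianPDFReal_nonneg _ _ _), gaussianPDFReal_zero_eq]
  beta_reduce
  rw [gaussianPDFReal_zero_eq, Real.coe_toNNReal _ (sq_nonneg s)]
  congr 1
  rw [Real.sqrt_mul (by positivity) (s ^ 2), Real.sqrt_sq hs.le, mul_inv, NNReal.coe_one, mul_one]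
  rw [mul_mul_mul_comm, ← Real.exp_add]
  congr 2
  rw [mul_inv]; ring

/-- It suffices to compare both measures on boxes, where the integral of the product density
factorizes. -/
theorem pi_withDensity {ι : Type*} [Fintype ι] (m : Measure ℝ) [IsFiniteMeasure m]
    {g : ι → ℝ → ℝ} (hg : ∀ i t, 0 ≤ g i t) (hgm : ∀ i, Integrable (g i) m) :
    (Measure.pi fun _ : ι => m).withDensity (fun y => ENNReal.ofReal (∏ i, g i (y i))) =
      Measure.pi fun i => m.withDensity fun t => ENNReal.ofReal (g i t) := by
  classical
  have : ∀ i, IsFiniteMeasure (m.withDensity fun t => ENNReal.ofReal (g i t)) := fun i =>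
    isFiniteMeasure_withDensity_ofReal (hgm i).2
  symm
  refine Measure.pi_eq fun s hs => ?_
  rw [withDensity_apply _ (MeasurableSet.univ_pi hs), ← lintegral_indicator (MeasurableSet.univ_pi hs)]
  have h1 : (Set.univ.pi s).indicator (fun y => ENNReal.ofReal (∏ i, g i (y i))) =
      fun y => ENNReal.ofReal (∏ i, (s i).indicator (g i) (y i)) := by
    ext y
    by_cases hy : y ∈ Set.univ.pi s
    · rw [indicator_of_mem hy]
      congr 1
      refine Finset.prod_congr rfl fun i _ => ?_
      rw [indicator_of_mem (hy i (mem_univ i))]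
    · rw [indicator_of_notMem hy]
      obtain ⟨i, hi⟩ : ∃ i, y i ∉ s i := by simpa [Set.mem_pi] using hy
      rw [Finset.prod_eq_zero (Finset.mem_univ i) (indicator_of_notMem hi _), ENNReal.ofReal_zero]
  have hi : ∀ i, Integrable ((s i).indicator (g i)) m := fun i => (hgm i).indicator (hs i)
  have hi0 : ∀ i t, 0 ≤ (s i).indicator (g i) t := fun i t => indicator_nonneg (fun t _ => hg i t) t
  rw [h1, ← ofReal_integral_eq_lintegral_ofReal (Integrable.fintype_prod hi)
    (Filter.Eventually.of_forall fun y => Finset.prod_nonneg fun i _ => hi0 i _),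
    integral_fintype_prod_eq_prod,
    ENNReal.ofReal_prod_of_nonneg fun i _ => integral_nonneg (hi0 i)]
  refine Finset.prod_congr rfl fun i _ => ?_
  rw [withDensity_apply _ (hs i), ofReal_integral_eq_lintegral_ofReal (hi i)
    (Filter.Eventually.of_forall (hi0 i)), ← lintegral_indicator (hs i)]
  congr 1
  ext t
  by_cases ht : t ∈ s i <;> simp [ht]

namespace Data

variable {𝒯 : Mesh n} (P : Data 𝒯)

theorem σ_pos (l : Fin P.L) : 0 < P.σ l := Real.exp_pos _

instance : IsProbabilityMeasure P.γ := by unfold γ; infer_instance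

instance : IsProbabilityMeasure P.γρ := by unfold γρ; infer_instance

theorem ζ_pos (y : Fin P.L → ℝ) : 0 < P.ζ y :=
  Finset.prod_pos fun l _ => mul_pos (inv_pos.mpr (P.σ_pos l)) (Real.exp_pos _)

theorem continuous_ζ : Continuous P.ζ := by unfold ζ; fun_prop

theorem continuous_H (μ : Fin P.L → ℕ) : Continuous (P.H μ) :=
  continuous_finsetProd _ fun l _ => (continuous_hermiteN _).comp (by fun_prop)

theorem integrable_density (l : Fin P.L) :
    Integrable (fun t => (P.σ l)⁻¹ * Real.exp ((1 - (P.σ l ^ 2)⁻¹) / 2 * t ^ 2))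
      (gaussianReal 0 1) := by
  have hs := P.σ_pos l
  rw [integrable_gaussianReal_iff one_ne_zero]
  have h := integrable_eval_mul_exp_neg_mul_sq (Polynomial.C (P.σ l)⁻¹)
    (b := (P.σ l ^ 2)⁻¹ / 2) (by positivity)
  refine h.congr (Filter.Eventually.of_forall fun t => ?_)
  simp only [Polynomial.eval_C]
  rw [mul_assoc, ← Real.exp_add]
  congr 2
  rw [NNReal.coe_one]; ring

theorem γρ_eq : P.γρ = P.γ.withDensity fun y => ENNReal.ofReal (P.ζ y) := by
  unfold γ γρ ζ
  rw [pi_withDensity (gaussianReal 0 1)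
    (g := fun l t => (P.σ l)⁻¹ * Real.exp ((1 - (P.σ l ^ 2)⁻¹) / 2 * t ^ 2))
    (fun l t => by have := P.σ_pos l; positivity) P.integrable_density]
  congr 1
  ext1 l
  exact (withDensity_gaussianReal (P.σ_pos l)).symm

theorem γρ_ac : P.γρ ≪ P.γ := by
  rw [γρ_eq]; exact withDensity_absolutelyContinuous _ _

theorem integrable_γρ_iff {G : Type*} [NormedAddCommGroup G] [NormedSpace ℝ G]
    {g : (Fin P.L → ℝ) → G} :
    Integrable g P.γρ ↔ Integrable (fun y => P.ζ y • g y) P.γ := by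
  rw [γρ_eq, integrable_withDensity_iff_integrable_smul₀'
    P.continuous_ζ.measurable.ennreal_ofReal.aemeasurable
    (Filter.Eventually.of_forall fun y => ENNReal.ofReal_lt_top)]
  simp_rw [ENNReal.toReal_ofReal (P.ζ_pos _).le]

theorem integral_γρ {G : Type*} [NormedAddCommGroup G] [NormedSpace ℝ G]
    (g : (Fin P.L → ℝ) → G) : ∫ y, g y ∂P.γρ = ∫ y, P.ζ y • g y ∂P.γ := by
  rw [γρ_eq, integral_withDensity_eq_integral_toReal_smul
    P.continuous_ζ.measurable.ennreal_ofReal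
    (Filter.Eventually.of_forall fun y => ENNReal.ofReal_lt_top)]
  simp_rw [ENNReal.toReal_ofReal (P.ζ_pos _).le]

theorem allLp_H_γρ (μ : Fin P.L → ℕ) : AllLp (P.H μ) P.γρ := by
  refine AllLp.prod fun l _ p hp => ?_
  exact (allLp_hermiteN_div (μ l) (P.σ l) (Real.toNNReal (P.σ l ^ 2)) p hp).comp_measurePreserving
    (measurePreserving_eval (fun l => gaussianReal 0 (Real.toNNReal (P.σ l ^ 2))) l)

theorem allLp_H_γ (μ : Fin P.L → ℕ) : AllLp (P.H μ) P.γ := by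
  refine AllLp.prod fun l _ p hp => ?_
  exact (allLp_hermiteN_div (μ l) (P.σ l) 1 p hp).comp_measurePreserving
    (measurePreserving_eval (fun _ : Fin P.L => gaussianReal 0 1) l)

theorem integral_H_mul (μ ν : Fin P.L → ℕ) :
    ∫ y, P.H μ y * P.H ν y ∂P.γρ = if μ = ν then 1 else 0 := by
  simp only [H, ← Finset.prod_mul_distrib]
  rw [γρ, integral_fintype_prod_eq_prod
    (f := fun l t => hermiteN (μ l) (t / P.σ l) * hermiteN (ν l) (t / P.σ l))]
  simp_rw [integral_hermiteN_div_mul (P.σ_pos _)]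
  split_ifs with h
  · subst h; simp
  · obtain ⟨l, hl⟩ : ∃ l, μ l ≠ ν l := by
      by_contra hc; push Not at hc; exact h (funext hc)
    exact Finset.prod_eq_zero (Finset.mem_univ l) (if_neg hl)

theorem integral_H_mul_γ (μ ν : Fin P.L → ℕ) :
    ∫ y, P.H μ y * P.H ν y ∂P.γ =
      ∏ l, ∫ t, hermiteN (μ l) (t / P.σ l) * hermiteN (ν l) (t / P.σ l) ∂(gaussianReal 0 1) := by
  simp only [H, ← Finset.prod_mul_distrib]
  rw [γ, integral_fintype_prod_eq_prod
    (f := fun l t => hermiteN (μ l) (t / P.σ l) * hermiteN (ν l) (t / P.σ l))]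

theorem dimΛ_pos (l : Fin P.L) : 1 ≤ P.dimΛ l := by
  unfold dimΛ; split_ifs
  · exact P.dim_pos l
  · exact le_rfl

/-- The one-dimensional linearization in each parameter, multiplied out. The degrees are at most `q
- 1` and `dimΛ - 1`, so their sum is below the bound `q + dimΛ - 1` that defines `Ξ`. -/
theorem H_mul_H {μ ν : Fin P.L → ℕ} (hμ : μ ∈ P.Λ) (hν : ν ∈ P.Δ) (y : Fin P.L → ℝ) :
    P.H ν y * P.H μ y = ∑ η ∈ P.Ξ, (∏ l, tripleCoeff (μ l) (ν l) (η l)) * P.H η y := by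
  have h : ∀ l, hermiteN (ν l) (y l / P.σ l) * hermiteN (μ l) (y l / P.σ l) =
      ∑ k ∈ Finset.range (P.q l + P.dimΛ l - 1),
        tripleCoeff (μ l) (ν l) k * hermiteN k (y l / P.σ l) := by
    intro l
    rw [mul_comm]
    refine hermiteN_mul_hermiteN ?_ _
    have h1 := Finset.mem_range.mp (Fintype.mem_piFinset.mp hμ l)
    have h2 := Finset.mem_range.mp (Fintype.mem_piFinset.mp hν l)
    omega
  simp only [H, ← Finset.prod_mul_distrib]
  simp_rw [h]
  rw [Finset.prod_univ_sum]
  rfl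

theorem Λ_subset_Ξ : P.Λ ⊆ P.Ξ := by
  intro μ hμ
  refine Fintype.mem_piFinset.mpr fun l => Finset.mem_range.mpr ?_
  have h1 := Finset.mem_range.mp (Fintype.mem_piFinset.mp hμ l)
  have := P.q_pos l
  beta_reduce
  omega

/-- After factorization the integrand in each parameter is a polynomial times `exp (-(σ⁻² - 1/2)
t²)`. The exponent decays precisely because `σ² < 2`. -/
theorem memLp_H_mul_ζ (hσ : ∀ l, P.σ l ^ 2 < 2) (μ : Fin P.L → ℕ) :
    MemLp (fun y => P.H μ y * P.ζ y) 2 P.γ := by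
  rw [memLp_two_iff_integrable_sq ((P.continuous_H μ).fun_mul P.continuous_ζ).aestronglyMeasurable]
  have h : ∀ y, (P.H μ y * P.ζ y) ^ 2 = ∏ l, (hermiteN (μ l) (y l / P.σ l) *
      ((P.σ l)⁻¹ * Real.exp ((1 - (P.σ l ^ 2)⁻¹) / 2 * y l ^ 2))) ^ 2 := by
    intro y; rw [H, ζ, ← Finset.prod_mul_distrib, Finset.prod_pow]
  simp_rw [h]
  refine Integrable.fintype_prod (f := fun l t => (hermiteN (μ l) (t / P.σ l) *
      ((P.σ l)⁻¹ * Real.exp ((1 - (P.σ l ^ 2)⁻¹) / 2 * t ^ 2))) ^ 2) fun l => ?_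
  rw [integrable_gaussianReal_iff one_ne_zero]
  have hs := P.σ_pos l
  have hb : 0 < (P.σ l ^ 2)⁻¹ - 1 / 2 := by
    rw [sub_pos, one_div]
    exact inv_strictAnti₀ (by positivity) (hσ l)
  have h := integrable_eval_mul_exp_neg_mul_sq (Polynomial.C ((P.σ l)⁻¹ ^ 2) *
    ((hermiteP (μ l)).comp (Polynomial.C (P.σ l)⁻¹ * Polynomial.X)) ^ 2) hb
  refine h.congr (Filter.Eventually.of_forall fun t => ?_)
  simp only [Polynomial.eval_mul, Polynomial.eval_C, Polynomial.eval_pow, ← hermiteN_div_eq,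
    NNReal.coe_one]
  rw [mul_pow, mul_pow, ← Real.exp_nat_mul, ← mul_assoc, mul_assoc _ (Real.exp _) (Real.exp _),
    ← Real.exp_add]
  rw [mul_comm ((P.σ l)⁻¹ ^ 2)]
  congr 2
  push_cast
  ring

end Data

/-! ### The parametric bilinear form -/

section

variable {D : Set (E n)}

lemma coeFn_finsetSum {α F ι : Type*} {mα : MeasurableSpace α} {m : Measure α}
    [NormedAddCommGroup F] {p : ENNReal} (s : Finset ι) (g : ι → Lp F p m) :
    (∑ i ∈ s, g i : Lp F p m) =ᵐ[m] fun x => ∑ i ∈ s, g i x := by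
  classical
  induction s using Finset.induction_on with
  | empty =>
    simp only [Finset.sum_empty]
    exact Lp.coeFn_zero F p m
  | insert i s hi ih =>
    rw [Finset.sum_insert hi]
    filter_upwards [ih, Lp.coeFn_add (g i) (∑ j ∈ s, g j)] with x h1 h2
    rw [h2, Pi.add_apply, h1, Finset.sum_insert hi]

instance (k : ℕ) : SecondCountableTopologyEither (Fin k → ℝ) (H10 D) := ⟨Or.inl inferInstance⟩

/-- Multiplication of square integrable vector fields by bounded functions. -/
def mulL (D : Set (E n)) : Lp ℝ ⊤ (volume.restrict D) →L[ℝ]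
    Lp (E n) 2 (volume.restrict D) →L[ℝ] Lp (E n) 2 (volume.restrict D) :=
  (ContinuousLinearMap.lsmul ℝ ℝ).holderL (volume.restrict D) ⊤ 2 2

lemma coeFn_mulL (g : Lp ℝ ⊤ (volume.restrict D)) (G : Lp (E n) 2 (volume.restrict D)) :
    mulL D g G =ᵐ[volume.restrict D] fun x => g x • G x :=
  ContinuousLinearMap.coeFn_holder (r := 2) (ContinuousLinearMap.lsmul ℝ ℝ) g G

lemma norm_mulL_le (g : Lp ℝ ⊤ (volume.restrict D)) (G : Lp (E n) 2 (volume.restrict D)) :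
    ‖mulL D g G‖ ≤ ‖g‖ * ‖G‖ := by
  have h := (ContinuousLinearMap.lsmul ℝ ℝ : ℝ →L[ℝ] E n →L[ℝ] E n).norm_holder_apply_apply_le
    (r := 2) g G
  refine h.trans ?_
  have h1 := ContinuousLinearMap.opNorm_lsmul_le (𝕜 := ℝ) (R := ℝ) (E := E n)
  calc _ ≤ 1 * ‖g‖ * ‖G‖ := by gcongr
    _ = _ := by rw [one_mul]

lemma inner_mulL (g : Lp ℝ ⊤ (volume.restrict D)) (F G : Lp (E n) 2 (volume.restrict D)) :
    ⟪mulL D g F, G⟫ = ∫ x in D, g x * ⟪F x, G x⟫ := by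
  rw [L2.inner_def]
  refine integral_congr_ae ?_
  filter_upwards [coeFn_mulL g F] with x hx
  rw [hx, real_inner_smul_left]

lemma integrable_mul_inner (g : Lp ℝ ⊤ (volume.restrict D))
    (F G : Lp (E n) 2 (volume.restrict D)) :
    IntegrableOn (fun x => g x * ⟪F x, G x⟫) D := by
  refine (L2.integrable_inner (𝕜 := ℝ) (mulL D g F) G).congr ?_
  filter_upwards [coeFn_mulL g F] with x hx
  rw [hx, real_inner_smul_left]

end

namespace Data

variable {𝒯 : Mesh n} (P : Data 𝒯)

/-- On each of the finitely many elements the function agrees with one that is continuous on the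
compact closed element; the skeleton is a null set. -/
lemma a0_memLp (k : Fin (P.s 0)) : MemLp (P.a0 k) ⊤ (volume.restrict 𝒯.domain) := by
  choose! G hG hGe using P.a0_smooth k
  have hb : ∀ T ∈ 𝒯.elems, ∃ C, ∀ x ∈ hull T, ‖G T x‖ ≤ C := fun T hT =>
    (isCompact_hull T).exists_bound_of_continuousOn (hG T hT).continuous.continuousOn
  choose! C hC using hb
  refine memLp_top_of_bound ?_ (∑ T ∈ 𝒯.elems, |C T|) ?_
  · rw [Measure.restrict_congr_set Mesh.domain_ae_eq]
    have := aestronglyMeasurable_iUnion_iff (μ := volume) (f := P.a0 k)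
      (s := fun T : {T // T ∈ 𝒯.elems} => interior (hull T.1))
    rw [iUnion_subtype] at this
    refine this.2 fun T => ?_
    refine ((hG T.1 T.2).continuous.aestronglyMeasurable).congr ?_
    filter_upwards [ae_restrict_mem isOpen_interior.measurableSet] with x hx
    exact (hGe T.1 T.2 hx).symm
  · refine Mesh.ae_restrict_domain_iff.2 fun T hT => ?_
    filter_upwards [ae_restrict_mem isOpen_interior.measurableSet] with x hx
    rw [hGe T hT hx]
    exact ((hC T hT x (interior_subset hx)).trans (le_abs_self _)).trans
      (Finset.single_le_sum (f := fun T => |C T|) (fun _ _ => abs_nonneg _) hT)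

lemma coeff_memLp (ν : Fin P.L → ℕ) :
    MemLp (fun x => P.ttEval (fun k => P.a0 k x) ν) ⊤ (volume.restrict 𝒯.domain) := by
  unfold ttEval
  exact memLp_finsetSum _ fun k _ => (P.a0_memLp (k 0)).mul_const _

/-- The Hermite coefficients of the coefficient as bounded functions. -/
def coeffL (ν : Fin P.L → ℕ) : Lp ℝ ⊤ (volume.restrict 𝒯.domain) := (P.coeff_memLp ν).toLp _

/-- The coefficient at a parameter as a bounded function. -/
def aL (y : Fin P.L → ℝ) : Lp ℝ ⊤ (volume.restrict 𝒯.domain) := ∑ ν ∈ P.Δ, P.H ν y • P.coeffL ν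

lemma coeFn_aL (y : Fin P.L → ℝ) : P.aL y =ᵐ[volume.restrict 𝒯.domain] fun x => P.a x y := by
  have h : ∀ ν ∈ P.Δ, (fun x => (P.H ν y • P.coeffL ν : Lp ℝ ⊤ (volume.restrict 𝒯.domain)) x)
      =ᵐ[volume.restrict 𝒯.domain] fun x => P.ttEval (fun k => P.a0 k x) ν * P.H ν y := by
    intro ν _
    filter_upwards [Lp.coeFn_smul (P.H ν y) (P.coeffL ν), (P.coeff_memLp ν).coeFn_toLp] with x h1 h2
    rw [h1, Pi.smul_apply, coeffL, h2, smul_eq_mul, mul_comm]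
  have h2 := (Filter.eventually_all_finset P.Δ).2 h
  filter_upwards [h2, coeFn_finsetSum P.Δ fun ν => P.H ν y • P.coeffL ν] with x h1 h3
  rw [aL, h3, a]
  exact Finset.sum_congr rfl fun ν hν => h1 ν hν

lemma continuous_aL : Continuous P.aL :=
  continuous_finsetSum _ fun ν _ => (P.continuous_H ν).smul continuous_const

lemma norm_aL_le (y : Fin P.L → ℝ) : ‖P.aL y‖ ≤ ∑ ν ∈ P.Δ, |P.H ν y| * ‖P.coeffL ν‖ :=
  (norm_sum_le _ _).trans (Finset.sum_le_sum fun ν _ => by rw [norm_smul, Real.norm_eq_abs])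

/-- The bilinear form at a fixed parameter. -/
def form (y : Fin P.L → ℝ) (v w : H10 𝒯.domain) : ℝ :=
  ⟪mulL 𝒯.domain (P.aL y) (H10.gradL v), H10.gradL w⟫

/-- The quadratic form of the modulus of the coefficient at a fixed parameter. -/
def absForm (y : Fin P.L → ℝ) (v : H10 𝒯.domain) : ℝ :=
  ⟪mulL 𝒯.domain |P.aL y| (H10.gradL v), H10.gradL v⟫

lemma form_eq (y : Fin P.L → ℝ) (v w : H10 𝒯.domain) :
    P.form y v w = ∫ x in 𝒯.domain, P.a x y * ⟪H10.grad v x, H10.grad w x⟫ := by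
  rw [form, inner_mulL]
  refine integral_congr_ae ?_
  filter_upwards [P.coeFn_aL y] with x hx
  rw [hx]; rfl

lemma coeFn_abs_aL (y : Fin P.L → ℝ) :
    (|P.aL y| : Lp ℝ ⊤ (volume.restrict 𝒯.domain)) =ᵐ[volume.restrict 𝒯.domain]
      fun x => |P.a x y| := by
  filter_upwards [P.coeFn_aL y, Lp.coeFn_abs (P.aL y)] with x h1 h2
  rw [h2, h1]

lemma absForm_eq (y : Fin P.L → ℝ) (v : H10 𝒯.domain) :
    P.absForm y v = ∫ x in 𝒯.domain, |P.a x y| * ‖H10.grad v x‖ ^ 2 := by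
  rw [absForm, inner_mulL]
  refine integral_congr_ae ?_
  filter_upwards [P.coeFn_abs_aL y] with x hx
  rw [hx, real_inner_self_eq_norm_sq]; rfl

lemma integrable_form (y : Fin P.L → ℝ) (v w : H10 𝒯.domain) :
    IntegrableOn (fun x => P.a x y * ⟪H10.grad v x, H10.grad w x⟫) 𝒯.domain := by
  refine (integrable_mul_inner (P.aL y) (H10.gradL v) (H10.gradL w)).congr ?_
  filter_upwards [P.coeFn_aL y] with x hx
  rw [hx]; rfl

lemma integrable_absForm (y : Fin P.L → ℝ) (v : H10 𝒯.domain) :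
    IntegrableOn (fun x => |P.a x y| * ‖H10.grad v x‖ ^ 2) 𝒯.domain := by
  refine (integrable_mul_inner |P.aL y| (H10.gradL v) (H10.gradL v)).congr ?_
  filter_upwards [P.coeFn_abs_aL y] with x hx
  rw [hx, real_inner_self_eq_norm_sq]; rfl

lemma absForm_nonneg (y : Fin P.L → ℝ) (v : H10 𝒯.domain) : 0 ≤ P.absForm y v := by
  rw [absForm_eq]
  exact integral_nonneg fun x => by positivity

/-- Young's inequality under the integral. The coefficient may change sign, so the form of its
modulus, not the form itself, controls integrability. -/
lemma abs_form_le (y : Fin P.L → ℝ) (v w : H10 𝒯.domain) :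
    |P.form y v w| ≤ P.absForm y v + P.absForm y w := by
  rw [form_eq, absForm_eq, absForm_eq, ← integral_add (P.integrable_absForm y v)
    (P.integrable_absForm y w)]
  refine (abs_integral_le_integral_abs).trans (integral_mono (P.integrable_form y v w).abs
    ((P.integrable_absForm y v).add (P.integrable_absForm y w)) fun x => ?_)
  simp only [abs_mul, ← mul_add]
  refine mul_le_mul_of_nonneg_left ?_ (abs_nonneg _)
  have h := abs_real_inner_le_norm (H10.grad v x) (H10.grad w x)
  nlinarith [sq_nonneg (‖H10.grad v x‖ - ‖H10.grad w x‖), norm_nonneg (H10.grad v x),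
    norm_nonneg (H10.grad w x), sq_nonneg (‖H10.grad v x‖), sq_nonneg ‖H10.grad w x‖]

lemma absForm_add_le (y : Fin P.L → ℝ) (v w : H10 𝒯.domain) :
    P.absForm y (v + w) ≤ 2 * P.absForm y v + 2 * P.absForm y w := by
  simp only [absForm_eq]
  rw [← integral_const_mul, ← integral_const_mul,
    ← integral_add ((P.integrable_absForm y v).const_mul 2) ((P.integrable_absForm y w).const_mul 2)]
  refine integral_mono_ae (P.integrable_absForm y (v + w))
    (((P.integrable_absForm y v).const_mul 2).add ((P.integrable_absForm y w).const_mul 2)) ?_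
  filter_upwards [H10.grad_add v w] with x hx
  rw [hx]
  have h : ‖H10.grad v x + H10.grad w x‖ ^ 2 ≤ 2 * ‖H10.grad v x‖ ^ 2 + 2 * ‖H10.grad w x‖ ^ 2 := by
    have h1 := norm_add_le (H10.grad v x) (H10.grad w x)
    have h2 := norm_nonneg (H10.grad v x + H10.grad w x)
    nlinarith [sq_nonneg (‖H10.grad v x‖ - ‖H10.grad w x‖)]
  have := mul_le_mul_of_nonneg_left h (abs_nonneg (P.a x y))
  linarith

lemma absForm_smul (y : Fin P.L → ℝ) (r : ℝ) (v : H10 𝒯.domain) :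
    P.absForm y (r • v) = r ^ 2 * P.absForm y v := by
  simp only [absForm, map_smul, real_inner_smul_left, real_inner_smul_right]
  ring

lemma absForm_le (y : Fin P.L → ℝ) (v : H10 𝒯.domain) :
    P.absForm y v ≤ (∑ ν ∈ P.Δ, |P.H ν y| * ‖P.coeffL ν‖) * H10.normX v ^ 2 := by
  refine (real_inner_le_norm _ _).trans ?_
  have h1 := norm_mulL_le |P.aL y| (H10.gradL v)
  rw [norm_abs_eq_norm] at h1
  have h2 := P.norm_aL_le y
  have h3 : H10.normX v = ‖H10.gradL v‖ := rfl
  calc _ ≤ ‖P.aL y‖ * ‖H10.gradL v‖ * ‖H10.gradL v‖ := by gcongr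
    _ = ‖P.aL y‖ * H10.normX v ^ 2 := by rw [h3]; ring
    _ ≤ _ := by gcongr

lemma abs_continuous_aL : Continuous fun y => |P.aL y| := by
  have : ∀ y, |P.aL y| = P.aL y ⊔ -P.aL y := fun y => rfl
  simp_rw [this]
  exact P.continuous_aL.sup P.continuous_aL.neg

/-- The form is a continuous expression in the `L^∞` coefficient, which depends continuously on `y`,
and in the gradients; no joint measurability in `x` and `y` is required. -/
lemma aestronglyMeasurable_form {m : Measure (Fin P.L → ℝ)} {v w : P.Fn}
    (hv : AEStronglyMeasurable v m) (hw : AEStronglyMeasurable w m) :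
    AEStronglyMeasurable (fun y => P.form y (v y) (w y)) m := by
  have h1 := (mulL 𝒯.domain).aestronglyMeasurable_comp₂
    (P.continuous_aL.aestronglyMeasurable (μ := m))
    (H10.gradL.continuous.comp_aestronglyMeasurable hv)
  exact h1.inner (H10.gradL.continuous.comp_aestronglyMeasurable hw)

lemma aestronglyMeasurable_absForm {m : Measure (Fin P.L → ℝ)} {v : P.Fn}
    (hv : AEStronglyMeasurable v m) :
    AEStronglyMeasurable (fun y => P.absForm y (v y)) m := by
  have h1 := (mulL 𝒯.domain).aestronglyMeasurable_comp₂
    (P.abs_continuous_aL.aestronglyMeasurable (μ := m))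
    (H10.gradL.continuous.comp_aestronglyMeasurable hv)
  exact h1.inner (H10.gradL.continuous.comp_aestronglyMeasurable hv)

lemma memV_iff {v : P.Fn} :
    P.MemV v ↔ AEStronglyMeasurable v P.γ ∧ Integrable (fun y => P.absForm y (v y)) P.γρ := by
  simp only [MemV, absForm_eq]

variable {P}

lemma MemV.aestronglyMeasurable {v : P.Fn} (hv : P.MemV v) : AEStronglyMeasurable v P.γρ :=
  hv.1.mono_ac P.γρ_ac

lemma MemV.add {v w : P.Fn} (hv : P.MemV v) (hw : P.MemV w) : P.MemV (v + w) := by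
  refine P.memV_iff.2 ⟨hv.1.add hw.1, ?_⟩
  refine Integrable.mono' (((P.memV_iff.1 hv).2.const_mul 2).add ((P.memV_iff.1 hw).2.const_mul 2))
    (P.aestronglyMeasurable_absForm (hv.aestronglyMeasurable.add hw.aestronglyMeasurable)) ?_
  refine Filter.Eventually.of_forall fun y => ?_
  rw [Real.norm_of_nonneg (P.absForm_nonneg _ _)]
  exact P.absForm_add_le y (v y) (w y)

lemma MemV.smul {v : P.Fn} (hv : P.MemV v) (r : ℝ) : P.MemV (r • v) := by
  refine P.memV_iff.2 ⟨hv.1.const_smul r, ?_⟩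
  simp only [Pi.smul_apply, absForm_smul]
  exact (P.memV_iff.1 hv).2.const_mul _

lemma MemV.neg {v : P.Fn} (hv : P.MemV v) : P.MemV (-v) := by
  have h : -v = (-1 : ℝ) • v := by
    ext1 y; exact (neg_one_smul ℝ (v y)).symm
  rw [h]; exact hv.smul (-1)

lemma MemV.sub {v w : P.Fn} (hv : P.MemV v) (hw : P.MemV w) : P.MemV (v - w) := by
  rw [sub_eq_add_neg]; exact hv.add hw.neg

/-- The coefficient is dominated by a sum of moduli of Hermite polynomials, all of whose moments are
finite. -/
lemma memV_smul_const {h : (Fin P.L → ℝ) → ℝ} (hc : Continuous h) (hh : AllLp h P.γρ)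
    (φ : H10 𝒯.domain) : P.MemV (fun y => h y • φ) := by
  have hm : Continuous fun y => h y • φ := hc.smul continuous_const
  refine P.memV_iff.2 ⟨hm.aestronglyMeasurable, ?_⟩
  have hi : AllLp (fun y => h y * h y * ((∑ ν ∈ P.Δ, |P.H ν y| * ‖P.coeffL ν‖) * H10.normX φ ^ 2))
      P.γρ := (hh.mul hh).mul ((AllLp.sum fun ν _ => (P.allLp_H_γρ ν).abs.mul (AllLp.const _)).mul
        (AllLp.const _))
  refine hi.integrable.mono' (P.aestronglyMeasurable_absForm hm.aestronglyMeasurable) ?_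
  refine Filter.Eventually.of_forall fun y => ?_
  rw [Real.norm_of_nonneg (P.absForm_nonneg _ _), absForm_smul, sq]
  exact mul_le_mul_of_nonneg_left (P.absForm_le y φ) (mul_self_nonneg _)

lemma MemV.sum {ι : Type*} {s : Finset ι} {v : ι → P.Fn} (hv : ∀ i ∈ s, P.MemV (v i)) :
    P.MemV (fun y => ∑ i ∈ s, v i y) := by
  classical
  induction s using Finset.induction_on with
  | empty =>
    refine P.memV_iff.2 ⟨aestronglyMeasurable_const, ?_⟩
    simp [absForm]
  | insert i s hi ih =>
    simp only [Finset.sum_insert hi]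
    exact (hv i (Finset.mem_insert_self ..)).add
      (ih fun j hj => hv j (Finset.mem_insert_of_mem hj))

lemma MemV.integrable_form {v w : P.Fn} (hv : P.MemV v) (hw : P.MemV w) :
    Integrable (fun y => P.form y (v y) (w y)) P.γρ :=
  Integrable.mono' ((P.memV_iff.1 hv).2.add (P.memV_iff.1 hw).2)
    (P.aestronglyMeasurable_form hv.aestronglyMeasurable hw.aestronglyMeasurable)
    (Filter.Eventually.of_forall fun y => P.abs_form_le y (v y) (w y))

variable (P)

lemma B_eq (v w : P.Fn) : P.B v w = ∫ y, P.form y (v y) (w y) ∂P.γρ := by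
  simp only [B, form_eq]

lemma B_comm (v w : P.Fn) : P.B v w = P.B w v := by
  simp only [B, real_inner_comm]

variable {P}

lemma MemV.B_add_left {v v' w : P.Fn} (hv : P.MemV v) (hv' : P.MemV v') (hw : P.MemV w) :
    P.B (v + v') w = P.B v w + P.B v' w := by
  rw [B_eq, B_eq, B_eq, ← integral_add (hv.integrable_form hw) (hv'.integrable_form hw)]
  refine integral_congr_ae (Filter.Eventually.of_forall fun y => ?_)
  simp [form, inner_add_left]

lemma B_smul_left (r : ℝ) (v w : P.Fn) : P.B (r • v) w = r * P.B v w := by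
  rw [B_eq, B_eq, ← integral_const_mul]
  refine integral_congr_ae (Filter.Eventually.of_forall fun y => ?_)
  simp [form, real_inner_smul_left]

lemma MemV.B_sub_left {v v' w : P.Fn} (hv : P.MemV v) (hv' : P.MemV v') (hw : P.MemV w) :
    P.B (v - v') w = P.B v w - P.B v' w := by
  have h : v - v' = v + (-1 : ℝ) • v' := by
    ext1 y
    exact (sub_eq_add_neg _ _).trans (congrArg (v y + ·) (neg_one_smul ℝ (v' y)).symm)
  rw [h, hv.B_add_left (hv'.smul (-1)) hw, B_smul_left]; ring

lemma MemV.B_add_right {v w w' : P.Fn} (hv : P.MemV v) (hw : P.MemV w) (hw' : P.MemV w') :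
    P.B v (w + w') = P.B v w + P.B v w' := by
  rw [B_comm, hw.B_add_left hw' hv, B_comm, P.B_comm w']

lemma B_smul_right (r : ℝ) (v w : P.Fn) : P.B v (r • w) = r * P.B v w := by
  rw [B_comm, B_smul_left, B_comm]

lemma MemV.B_sub_right {v w w' : P.Fn} (hv : P.MemV v) (hw : P.MemV w) (hw' : P.MemV w') :
    P.B v (w - w') = P.B v w - P.B v w' := by
  rw [B_comm, hw.B_sub_left hw' hv, B_comm, P.B_comm w']

end Data

/-! ### Consequences of coercivity -/

/-- The norm of a pair is the larger of two `L²` norms, and Friedrichs' inequality controls the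
first by the second. -/
lemma H10.exists_norm_le (hn : 2 ≤ n) {D : Set (E n)} (hD : Bornology.IsBounded D) :
    ∃ C, 0 ≤ C ∧ ∀ v : H10 D, ‖v‖ ≤ C * H10.normX v := by
  obtain ⟨C, hC, h⟩ := H10.exists_norm_valL_le hn hD
  refine ⟨max C 1, hC.trans (le_max_left _ _), fun v => ?_⟩
  have h0 : 0 ≤ H10.normX v := norm_nonneg _
  have h1 : ‖v‖ = max ‖H10.valL v‖ ‖H10.gradL v‖ := rfl
  rw [h1]
  refine max_le ((h v).trans (mul_le_mul_of_nonneg_right (le_max_left _ _) h0)) ?_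
  calc ‖H10.gradL v‖ = 1 * H10.normX v := (one_mul _).symm
    _ ≤ _ := mul_le_mul_of_nonneg_right (le_max_right _ _) h0

lemma abs_integral_inner_le {Ω F : Type*} {mΩ : MeasurableSpace Ω} {m : Measure Ω}
    [NormedAddCommGroup F] [InnerProductSpace ℝ F] {f g : Ω → F} (hf : MemLp f 2 m)
    (hg : MemLp g 2 m) :
    |∫ y, ⟪f y, g y⟫ ∂m| ≤ √(∫ y, ‖f y‖ ^ 2 ∂m) * √(∫ y, ‖g y‖ ^ 2 ∂m) := by
  have h := abs_real_inner_le_norm (hf.toLp f) (hg.toLp g)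
  have e : ∀ {k : Ω → F} (hk : MemLp k 2 m), ‖hk.toLp k‖ = √(∫ y, ‖k y‖ ^ 2 ∂m) := by
    intro k hk
    rw [← Real.sqrt_sq (norm_nonneg (hk.toLp k)), ← real_inner_self_eq_norm_sq, L2.inner_def]
    congr 1
    refine integral_congr_ae ?_
    filter_upwards [hk.coeFn_toLp] with y hy
    rw [hy, real_inner_self_eq_norm_sq]
  rw [e, e, L2.inner_def] at h
  convert h using 2
  refine integral_congr_ae ?_
  filter_upwards [hf.coeFn_toLp, hg.coeFn_toLp] with y h1 h2
  rw [h1, h2]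

namespace Data

variable {𝒯 : Mesh n} {P : Data 𝒯}

/-- The norm of `L²(Γ, γ; 𝒳)`. -/
def l2Norm (P : Data 𝒯) (v : P.Fn) : ℝ := √(∫ y, H10.normX (v y) ^ 2 ∂P.γ)

lemma l2Norm_nonneg (v : P.Fn) : 0 ≤ P.l2Norm v := Real.sqrt_nonneg _

lemma energyNorm_nonneg (v : P.Fn) : 0 ≤ P.energyNorm v := Real.sqrt_nonneg _

lemma l2Norm_sq (v : P.Fn) : P.l2Norm v ^ 2 = ∫ y, H10.normX (v y) ^ 2 ∂P.γ :=
  Real.sq_sqrt (integral_nonneg fun _ => sq_nonneg _)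

section

variable {c : ℝ} (hco : P.Coercive c)

include hco

lemma Coercive.sq_mul_l2Norm_le {v : P.Fn} (hv : P.MemV v) :
    c ^ 2 * P.l2Norm v ^ 2 ≤ P.B v v := by
  rw [l2Norm_sq]; exact (hco v hv).2

lemma Coercive.B_self_nonneg {v : P.Fn} (hv : P.MemV v) : 0 ≤ P.B v v :=
  le_trans (by positivity) (hco.sq_mul_l2Norm_le hv)

lemma Coercive.energyNorm_sq {v : P.Fn} (hv : P.MemV v) : P.energyNorm v ^ 2 = P.B v v :=
  Real.sq_sqrt (hco.B_self_nonneg hv)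

lemma Coercive.l2Norm_le (hc : 0 < c) {v : P.Fn} (hv : P.MemV v) :
    P.l2Norm v ≤ c⁻¹ * P.energyNorm v := by
  rw [le_inv_mul_iff₀ hc]
  refine le_of_sq_le_sq ?_ (energyNorm_nonneg v)
  rw [mul_pow, hco.energyNorm_sq hv]
  exact hco.sq_mul_l2Norm_le hv

/-- The Cauchy–Schwarz inequality. -/
lemma Coercive.abs_B_le {v w : P.Fn} (hv : P.MemV v) (hw : P.MemV w) :
    |P.B v w| ≤ P.energyNorm v * P.energyNorm w := by
  refine abs_le_of_sq_le_sq ?_ (mul_nonneg (energyNorm_nonneg v) (energyNorm_nonneg w))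
  rw [mul_pow, hco.energyNorm_sq hv, hco.energyNorm_sq hw]
  have h : ∀ t : ℝ, 0 ≤ P.B w w * (t * t) + (2 * P.B v w) * t + P.B v v := by
    intro t
    have h1 := hco.B_self_nonneg (hv.add (hw.smul t))
    rw [hv.B_add_left (hw.smul t) (hv.add (hw.smul t)), hv.B_add_right hv (hw.smul t),
      (hw.smul t).B_add_right hv (hw.smul t), B_smul_left, B_smul_right, B_smul_left, B_smul_right,
      P.B_comm w v] at h1
    linarith
  have := discrim_le_zero h
  rw [discrim] at this
  linarith

lemma Coercive.energyNorm_add_le {v w : P.Fn} (hv : P.MemV v) (hw : P.MemV w) :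
    P.energyNorm (v + w) ≤ P.energyNorm v + P.energyNorm w := by
  refine le_of_sq_le_sq ?_ (add_nonneg (energyNorm_nonneg v) (energyNorm_nonneg w))
  rw [hco.energyNorm_sq (hv.add hw), hv.B_add_left hw (hv.add hw), hv.B_add_right hv hw,
    hw.B_add_right hv hw, P.B_comm w v, add_sq, hco.energyNorm_sq hv, hco.energyNorm_sq hw]
  have := (le_abs_self _).trans (hco.abs_B_le hv hw)
  linarith

lemma Coercive.energyNorm_sum_le {ι : Type*} {s : Finset ι} {v : ι → P.Fn}
    (hv : ∀ i ∈ s, P.MemV (v i)) :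
    P.energyNorm (fun y => ∑ i ∈ s, v i y) ≤ ∑ i ∈ s, P.energyNorm (v i) := by
  classical
  induction s using Finset.induction_on with
  | empty => simp [energyNorm, B_eq, form]
  | insert i s hi ih =>
    simp only [Finset.sum_insert hi]
    have h := fun j hj => hv j (Finset.mem_insert_of_mem hj)
    exact (hco.energyNorm_add_le (hv i (Finset.mem_insert_self ..)) (MemV.sum h)).trans
      (add_le_add_right (ih h) _)

/-- Coercivity yields integrability of the squared gradient norm, which is equivalent to the full
norm. -/
lemma Coercive.memLp (hn : 2 ≤ n) {v : P.Fn} (hv : P.MemV v) : MemLp v 2 P.γ := by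
  obtain ⟨C, hC, h⟩ := H10.exists_norm_le hn 𝒯.isBounded_domain
  rw [memLp_two_iff_integrable_sq_norm hv.1]
  refine ((hco v hv).1.const_mul (C ^ 2)).mono' (hv.1.norm.pow 2) ?_
  refine Filter.Eventually.of_forall fun y => ?_
  rw [Real.norm_of_nonneg (by positivity), ← mul_pow]
  exact pow_le_pow_left₀ (norm_nonneg _) (h _) 2

end

/-! ### Hermite coefficients -/

variable (P) in
/-- The Hermite coefficients of a function of the parameter. -/
def moment (v : P.Fn) (μ : Fin P.L → ℕ) : H10 𝒯.domain := ∫ y, P.H μ y • v y ∂P.γρ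

/-- Hölder's inequality with respect to `γ`: both `H μ * ζ` and `v` are square integrable. -/
lemma integrable_H_smul (hσ : ∀ l, P.σ l ^ 2 < 2) {v : P.Fn} (hv : MemLp v 2 P.γ)
    (μ : Fin P.L → ℕ) : Integrable (fun y => P.H μ y • v y) P.γρ := by
  rw [integrable_γρ_iff]
  have h := hv.smul (P.memLp_H_mul_ζ hσ μ) (r := 1)
  refine (memLp_one_iff_integrable.1 h).congr (Filter.Eventually.of_forall fun y => ?_)
  change (P.H μ y * P.ζ y) • v y = P.ζ y • P.H μ y • v y
  rw [smul_smul, mul_comm]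

lemma integral_H_mul_clm (hσ : ∀ l, P.σ l ^ 2 < 2) {v : P.Fn} (hv : MemLp v 2 P.γ)
    (μ : Fin P.L → ℕ) (T : H10 𝒯.domain →L[ℝ] ℝ) :
    ∫ y, P.H μ y * T (v y) ∂P.γρ = T (P.moment v μ) := by
  rw [moment, ← T.integral_comp_comm (integrable_H_smul hσ hv μ)]
  simp only [map_smul, smul_eq_mul]

lemma integrable_H_mul_clm (hσ : ∀ l, P.σ l ^ 2 < 2) {v : P.Fn} (hv : MemLp v 2 P.γ)
    (μ : Fin P.L → ℕ) (T : H10 𝒯.domain →L[ℝ] ℝ) :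
    Integrable (fun y => P.H μ y * T (v y)) P.γρ := by
  have := T.integrable_comp (integrable_H_smul hσ hv μ)
  simpa only [map_smul, smul_eq_mul] using this

variable (P) in
lemma H_zero (y : Fin P.L → ℝ) : P.H 0 y = 1 := by
  simp [H, hermiteN]

variable (P) in
lemma zero_mem_Λ : (0 : Fin P.L → ℕ) ∈ P.Λ :=
  Fintype.mem_piFinset.mpr fun l => Finset.mem_range.mpr (P.dimΛ_pos l)

lemma memV_H_smul (μ : Fin P.L → ℕ) (φ : H10 𝒯.domain) : P.MemV fun y => P.H μ y • φ :=
  memV_smul_const (P.continuous_H μ) (P.allLp_H_γρ μ) φ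

lemma memV_interp (v : P.Fn) : P.MemV (P.interp v) := MemV.sum fun _ _ => memV_H_smul _ _

lemma interp_apply (v : P.Fn) (y : Fin P.L → ℝ) :
    P.interp v y = ∑ μ ∈ P.Λ, P.H μ y • 𝒯.clement (P.moment v μ) := rfl

lemma integral_H_mul_sum (s : Finset (Fin P.L → ℕ)) (b : (Fin P.L → ℕ) → ℝ) (η : Fin P.L → ℕ) :
    ∫ y, P.H η y * ∑ μ ∈ s, P.H μ y * b μ ∂P.γρ = if η ∈ s then b η else 0 := by
  simp_rw [Finset.mul_sum, ← mul_assoc]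
  rw [integral_finsetSum _ fun μ _ =>
    ((P.allLp_H_γρ η).mul (P.allLp_H_γρ μ)).integrable.mul_const _]
  simp_rw [integral_mul_const, integral_H_mul]
  simp

lemma integral_H_mul_interp (v : P.Fn) (η : Fin P.L → ℕ) (T : H10 𝒯.domain →L[ℝ] ℝ) :
    ∫ y, P.H η y * T (P.interp v y) ∂P.γρ =
      if η ∈ P.Λ then T (𝒯.clement (P.moment v η)) else 0 := by
  rw [← integral_H_mul_sum P.Λ (fun μ => T (𝒯.clement (P.moment v μ))) η]
  simp only [interp_apply, map_sum, map_smul, smul_eq_mul]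

/-! ### The norm of the interpolation error -/

lemma exists_energyNorm_H_smul_le (μ : Fin P.L → ℕ) :
    ∃ K, 0 ≤ K ∧ ∀ φ : H10 𝒯.domain, P.energyNorm (fun y => P.H μ y • φ) ≤ K * H10.normX φ := by
  have hA : AllLp (fun y => P.H μ y * P.H μ y * ∑ ν ∈ P.Δ, |P.H ν y| * ‖P.coeffL ν‖) P.γρ :=
    ((P.allLp_H_γρ μ).mul (P.allLp_H_γρ μ)).mul
      (AllLp.sum fun ν _ => (P.allLp_H_γρ ν).abs.mul (AllLp.const _))
  refine ⟨√(∫ y, P.H μ y * P.H μ y * ∑ ν ∈ P.Δ, |P.H ν y| * ‖P.coeffL ν‖ ∂P.γρ),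
    Real.sqrt_nonneg _, fun φ => ?_⟩
  have h0 : 0 ≤ H10.normX φ := norm_nonneg _
  rw [energyNorm]
  conv_rhs => rw [← Real.sqrt_sq h0]
  rw [← Real.sqrt_mul (integral_nonneg fun y => by
    have := mul_self_nonneg (P.H μ y); positivity)]
  refine Real.sqrt_le_sqrt ?_
  rw [B_eq, ← integral_mul_const]
  have hV := memV_H_smul (P := P) μ φ
  refine integral_mono (hV.integrable_form hV) (hA.integrable.mul_const _) fun y => ?_
  have h1 : P.form y (P.H μ y • φ) (P.H μ y • φ) = P.H μ y * P.H μ y * P.form y φ φ := by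
    simp only [form, map_smul, real_inner_smul_left, real_inner_smul_right]
    ring
  simp only [h1]
  rw [mul_assoc (P.H μ y * P.H μ y)]
  refine mul_le_mul_of_nonneg_left ?_ (mul_self_nonneg _)
  refine (real_inner_le_norm _ _).trans ?_
  have h3 : H10.normX φ = ‖H10.gradL φ‖ := rfl
  calc _ ≤ ‖P.aL y‖ * ‖H10.gradL φ‖ * ‖H10.gradL φ‖ := by
        gcongr; exact norm_mulL_le (P.aL y) (H10.gradL φ)
    _ = ‖P.aL y‖ * H10.normX φ ^ 2 := by rw [h3]; ring
    _ ≤ _ := by gcongr; exact P.norm_aL_le y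

lemma exists_norm_moment_le (hn : 2 ≤ n) (hσ : ∀ l, P.σ l ^ 2 < 2) (μ : Fin P.L → ℕ) :
    ∃ K, 0 ≤ K ∧ ∀ v : P.Fn, MemLp v 2 P.γ → ‖P.moment v μ‖ ≤ K * P.l2Norm v := by
  obtain ⟨C, hC, hle⟩ := H10.exists_norm_le hn 𝒯.isBounded_domain
  refine ⟨√(∫ y, ‖P.H μ y * P.ζ y‖ ^ 2 ∂P.γ) * C, by positivity, fun v hv => ?_⟩
  have hg : MemLp (fun y => H10.normX (v y)) 2 P.γ :=
    (H10.gradL.comp_memLp' hv).norm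
  rw [moment, integral_γρ]
  refine (norm_integral_le_integral_norm _).trans ?_
  have hH := P.memLp_H_mul_ζ hσ μ
  have hi : Integrable (fun y => ‖P.H μ y * P.ζ y‖ * H10.normX (v y)) P.γ :=
    hH.norm.integrable_mul hg
  have hcs := (le_abs_self _).trans (abs_integral_inner_le hH.norm hg)
  simp only [RCLike.inner_apply, conj_trivial, norm_norm] at hcs
  have hl : √(∫ y, ‖H10.normX (v y)‖ ^ 2 ∂P.γ) = P.l2Norm v := by
    simp only [l2Norm, Real.norm_eq_abs, sq_abs]
  rw [hl] at hcs
  calc ∫ y, ‖P.ζ y • P.H μ y • v y‖ ∂P.γ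
      ≤ ∫ y, C * (‖P.H μ y * P.ζ y‖ * H10.normX (v y)) ∂P.γ := by
        refine integral_mono_of_nonneg (Filter.Eventually.of_forall fun y => norm_nonneg _)
          (hi.const_mul C) (Filter.Eventually.of_forall fun y => ?_)
        beta_reduce
        rw [smul_smul, norm_smul, mul_comm (P.ζ y)]
        calc _ ≤ ‖P.H μ y * P.ζ y‖ * (C * H10.normX (v y)) := by gcongr; exact hle _
          _ = _ := by ring
    _ = C * ∫ y, H10.normX (v y) * ‖P.H μ y * P.ζ y‖ ∂P.γ := by
        rw [integral_const_mul]; simp only [mul_comm]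
    _ ≤ C * (√(∫ y, ‖P.H μ y * P.ζ y‖ ^ 2 ∂P.γ) * P.l2Norm v) := by gcongr
    _ = _ := by ring

/-- A finite sum over `Λ` of bounded maps: moment, Clément operator, multiplication by `H μ`. The
size of `K` is irrelevant; only finiteness is used, to make `cI` a genuine supremum. -/
lemma Coercive.exists_energyNorm_interp_le (hn : 2 ≤ n) (hσ : ∀ l, P.σ l ^ 2 < 2) {c : ℝ}
    (hc : 0 < c) (hco : P.Coercive c) :
    ∃ K, 0 ≤ K ∧ ∀ v : P.Fn, P.MemV v → P.energyNorm (P.interp v) ≤ K * P.energyNorm v := by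
  obtain ⟨L, hL⟩ := 𝒯.exists_clementL
  choose K1 hK1 h1 using exists_energyNorm_H_smul_le (P := P)
  choose K2 hK2 h2 using exists_norm_moment_le (P := P) hn hσ
  refine ⟨∑ μ ∈ P.Λ, K1 μ * (‖(H10.gradL (D := 𝒯.domain)).comp L‖ * (K2 μ * c⁻¹)),
    Finset.sum_nonneg fun μ _ => by have := hK1 μ; have := hK2 μ; positivity, fun v hv => ?_⟩
  refine (hco.energyNorm_sum_le fun μ _ => memV_H_smul _ _).trans ?_
  rw [Finset.sum_mul]
  refine Finset.sum_le_sum fun μ _ => (h1 μ _).trans ?_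
  rw [mul_assoc]
  refine mul_le_mul_of_nonneg_left ?_ (hK1 μ)
  have h3 : H10.normX (𝒯.clement (P.moment v μ)) ≤
      ‖(H10.gradL (D := 𝒯.domain)).comp L‖ * ‖P.moment v μ‖ := by
    rw [← hL]; exact (H10.gradL.comp L).le_opNorm _
  refine h3.trans ?_
  rw [mul_assoc, mul_assoc]
  refine mul_le_mul_of_nonneg_left ((h2 μ v (hco.memLp hn hv)).trans ?_)
    (ContinuousLinearMap.opNorm_nonneg _)
  exact mul_le_mul_of_nonneg_left (hco.l2Norm_le hc hv) (hK2 μ)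

lemma cI_nonneg (P : Data 𝒯) : 0 ≤ P.cI := by
  refine Real.sSup_nonneg ?_
  rintro r ⟨v, _, _, rfl⟩
  exact div_nonneg (energyNorm_nonneg _) (energyNorm_nonneg _)

lemma Coercive.energyNorm_sub_interp_le (hn : 2 ≤ n) (hσ : ∀ l, P.σ l ^ 2 < 2) {c : ℝ}
    (hc : 0 < c) (hco : P.Coercive c) {v : P.Fn} (hv : P.MemV v) (h0 : P.energyNorm v ≠ 0) :
    P.energyNorm (v - P.interp v) ≤ P.cI * P.energyNorm v := by
  have hpos : ∀ {w : P.Fn}, P.energyNorm w ≠ 0 → 0 < P.energyNorm w := fun h =>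
    lt_of_le_of_ne (energyNorm_nonneg _) (Ne.symm h)
  rw [← div_le_iff₀ (hpos h0)]
  -- The set of quotients must be bounded above, since otherwise its `sSup` would be zero by
  -- convention.
  refine le_csSup ?_ ⟨v, hv, h0, rfl⟩
  obtain ⟨K, hK, h⟩ := hco.exists_energyNorm_interp_le hn hσ hc
  refine ⟨1 + K, ?_⟩
  rintro r ⟨w, hw, hw0, rfl⟩
  rw [div_le_iff₀ (hpos hw0)]
  have hI := memV_interp (P := P) w
  have h1 := hco.energyNorm_add_le hw hI.neg
  rw [← sub_eq_add_neg] at h1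
  have h2 : P.energyNorm (-P.interp w) = P.energyNorm (P.interp w) := by
    simp [energyNorm, B_eq, form]
  rw [h2] at h1
  linarith [h w hw]

end Data

/-! ### The algebraic estimator -/

open Matrix in
/-- The dual norm of a positive definite matrix bounds the Euclidean pairing. -/
lemma abs_dotProduct_le_of_posDef {ι : Type*} [Fintype ι] [DecidableEq ι] {A : Matrix ι ι ℝ}
    (hA : A.PosDef) (R V : ι → ℝ) :
    |R ⬝ᵥ V| ≤ ‖WithLp.toLp 2 (cfc (fun t : ℝ => (√t)⁻¹) A *ᵥ R)‖ * √(V ⬝ᵥ A *ᵥ V) := by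
  have hsa : IsSelfAdjoint A := hA.isHermitian.isSelfAdjoint
  have hpos : ∀ t ∈ spectrum ℝ A, 0 < t := by
    intro t ht
    rw [hA.isHermitian.spectrum_real_eq_range_eigenvalues] at ht
    obtain ⟨i, rfl⟩ := ht
    exact hA.eigenvalues_pos i
  have hcS : ContinuousOn (fun t : ℝ => √t) (spectrum ℝ A) := Real.continuous_sqrt.continuousOn
  have hcK : ContinuousOn (fun t : ℝ => (√t)⁻¹) (spectrum ℝ A) :=
    hcS.inv₀ fun t ht => (Real.sqrt_pos.mpr (hpos t ht)).ne'
  set S := cfc (fun t : ℝ => √t) A with hS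
  set K := cfc (fun t : ℝ => (√t)⁻¹) A with hK
  have hKS : K * S = 1 := by
    rw [hK, hS, ← cfc_mul _ _ A hcK hcS, ← cfc_one ℝ A]
    refine cfc_congr fun t ht => ?_
    exact inv_mul_cancel₀ (Real.sqrt_pos.mpr (hpos t ht)).ne'
  have hSS : S * S = A := by
    rw [hS, ← cfc_mul _ _ A hcS hcS]
    conv_rhs => rw [← cfc_id' ℝ A]
    exact cfc_congr fun t ht => Real.mul_self_sqrt (hpos t ht).le
  have hKt : Kᵀ = K := by
    have h : IsSelfAdjoint K := cfc_predicate _ A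
    have h' : Kᴴ = K := h
    rwa [conjTranspose_eq_transpose_of_trivial] at h'
  have hSt : Sᵀ = S := by
    have h : IsSelfAdjoint S := cfc_predicate _ A
    have h' : Sᴴ = S := h
    rwa [conjTranspose_eq_transpose_of_trivial] at h'
  -- With `S` the root of `A` and `K` its inverse, both symmetric, the pairing becomes one of `K R`
  -- with `S V`.
  have e1 : R ⬝ᵥ V = (K *ᵥ R) ⬝ᵥ (S *ᵥ V) := by
    have h1 : K *ᵥ R = R ᵥ* K := by rw [← mulVec_transpose, hKt]
    rw [h1, ← dotProduct_mulVec, mulVec_mulVec, hKS, one_mulVec]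
  have e2 : V ⬝ᵥ A *ᵥ V = (S *ᵥ V) ⬝ᵥ (S *ᵥ V) := by
    have h1 : (S *ᵥ V) ⬝ᵥ (S *ᵥ V) = (V ᵥ* S) ⬝ᵥ (S *ᵥ V) := by
      rw [← mulVec_transpose, hSt]
    rw [h1, ← dotProduct_mulVec, mulVec_mulVec, hSS]
  have e3 : ∀ x y : ι → ℝ, x ⬝ᵥ y = ⟪WithLp.toLp 2 x, WithLp.toLp 2 y⟫ := by
    intro x y
    simp [PiLp.inner_apply, dotProduct, mul_comm]
  rw [e1, e2, e3, e3 (S *ᵥ V), real_inner_self_eq_norm_sq, Real.sqrt_sq (norm_nonneg _)]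
  exact abs_real_inner_le_norm _ _

lemma eq_zero_of_sum_smul_basis {M : Type*} [AddCommGroup M] [Module ℝ M] {S : Submodule ℝ M}
    {N : ℕ} (φ : Module.Basis (Fin N) ℝ S) {c : Fin N → ℝ} (h : ∑ i, c i • (φ i : M) = 0)
    (i : Fin N) : c i = 0 := by
  have h4 : ∑ i, c i • φ i = 0 := by
    refine Subtype.ext ?_
    rw [Submodule.coe_sum, Submodule.coe_zero]
    exact h
  exact Fintype.linearIndependent_iff.1 φ.linearIndependent c h4 i

lemma exists_eq_sum_smul_basis {M : Type*} [AddCommGroup M] [Module ℝ M] {S : Submodule ℝ M}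
    {N : ℕ} (φ : Module.Basis (Fin N) ℝ S) {x : M} (hx : x ∈ S) :
    ∃ c : Fin N → ℝ, x = ∑ i, c i • (φ i : M) := by
  refine ⟨fun i => φ.repr ⟨x, hx⟩ i, ?_⟩
  have h := congrArg Subtype.val (φ.sum_repr ⟨x, hx⟩)
  rw [Submodule.coe_sum] at h
  exact h.symm

namespace Data

variable {𝒯 : Mesh n} {P : Data 𝒯}

/-- The load at a fixed parameter. -/
def loadL (P : Data 𝒯) : H10 𝒯.domain →L[ℝ] ℝ :=
  (innerSL ℝ (P.f_memLp.toLp P.f)).comp H10.valL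

lemma loadL_apply (v : H10 𝒯.domain) :
    P.loadL v = ∫ x in 𝒯.domain, P.f x * H10.val v x :=
  (H10.integral_mul_val P.f_memLp v).symm

lemma load_eq (v : P.Fn) : P.load v = ∫ y, P.loadL (v y) ∂P.γρ := by
  simp only [load, loadL_apply]

section

variable {N p : ℕ} (φ : Module.Basis (Fin N) ℝ (𝒯.fe p))

/-- The tensor product basis functions. -/
def basisFn (P : Data 𝒯) (φ : Module.Basis (Fin N) ℝ (𝒯.fe p)) (i : Fin N × P.Λ) : P.Fn :=
  fun y => P.H i.2 y • (φ i.1 : H10 𝒯.domain)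

lemma memV_basisFn (i : Fin N × P.Λ) : P.MemV (P.basisFn φ i) := memV_H_smul _ _

lemma discreteFn_eq (W : Fin N × P.Λ → ℝ) :
    P.discreteFn φ W = fun y => ∑ i, (W i • P.basisFn φ i) y := by
  ext1 y
  refine Finset.sum_congr rfl fun i _ => ?_
  exact (smul_smul _ _ _).symm

lemma memV_discreteFn (W : Fin N × P.Λ → ℝ) : P.MemV (P.discreteFn φ W) := by
  rw [discreteFn_eq]
  exact MemV.sum fun i _ => (memV_basisFn φ i).smul _

lemma discreteFn_sub (V W : Fin N × P.Λ → ℝ) :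
    P.discreteFn φ (V - W) = P.discreteFn φ V - P.discreteFn φ W := by
  ext1 y
  simp only [discreteFn, Pi.sub_apply, ← Finset.sum_sub_distrib, sub_mul]
  exact Finset.sum_congr rfl fun i _ =>
    sub_smul (V i * P.H i.2 y) (W i * P.H i.2 y) (φ i.1 : H10 𝒯.domain)

lemma MemV.B_sum_left {ι : Type*} {s : Finset ι} {v : ι → P.Fn} {w : P.Fn}
    (hv : ∀ i ∈ s, P.MemV (v i)) (hw : P.MemV w) :
    P.B (fun y => ∑ i ∈ s, v i y) w = ∑ i ∈ s, P.B (v i) w := by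
  classical
  induction s using Finset.induction_on with
  | empty => simp [B_eq, form]
  | insert i s hi ih =>
    simp only [Finset.sum_insert hi]
    have h := fun j hj => hv j (Finset.mem_insert_of_mem hj)
    rw [← ih h]
    exact (hv i (Finset.mem_insert_self ..)).B_add_left (MemV.sum h) hw

lemma B_discreteFn_left (W : Fin N × P.Λ → ℝ) {w : P.Fn} (hw : P.MemV w) :
    P.B (P.discreteFn φ W) w = ∑ i, W i * P.B (P.basisFn φ i) w := by
  rw [discreteFn_eq, MemV.B_sum_left (fun i _ => (memV_basisFn φ i).smul _) hw]
  simp only [B_smul_left]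

open Matrix in
lemma B_discreteFn (W V : Fin N × P.Λ → ℝ) :
    P.B (P.discreteFn φ W) (P.discreteFn φ V) = (P.galerkinMatrix φ *ᵥ W) ⬝ᵥ V := by
  rw [B_comm, B_discreteFn_left φ V (memV_discreteFn φ W), dotProduct]
  refine Finset.sum_congr rfl fun i _ => ?_
  rw [B_comm, B_discreteFn_left φ W (memV_basisFn φ i), mul_comm]
  congr 1
  refine Finset.sum_congr rfl fun j _ => ?_
  rw [mul_comm]; rfl

open Matrix in
set_option maxHeartbeats 1000000 in
lemma load_discreteFn (V : Fin N × P.Λ → ℝ) :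
    P.load (P.discreteFn φ V) = P.loadVector φ ⬝ᵥ V := by
  have h : ∀ i : Fin N × P.Λ, P.loadVector φ i = ∫ y, P.H i.2 y * P.loadL (φ i.1) ∂P.γρ := by
    intro i
    rw [loadVector, load_eq]
    simp only [map_smul, smul_eq_mul]
  simp only [dotProduct, h]
  rw [load_eq]
  simp only [discreteFn, map_sum, map_smul, smul_eq_mul]
  rw [integral_finsetSum _ fun i _ =>
    (((P.allLp_H_γρ i.2).integrable.const_mul (V i)).mul_const _)]
  refine Finset.sum_congr rfl fun i _ => ?_
  simp only [mul_assoc]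
  rw [integral_const_mul, mul_comm]

-- `basisChange` is the Gram matrix of the tensor basis in `L²(Γ, γ; 𝒳)`. The Hermite polynomials
-- are orthonormal for `γρ` but not in general for `γ`, hence the one-dimensional integrals in it.
open Matrix in
set_option maxHeartbeats 1000000 in
lemma l2Norm_discreteFn_sq (V : Fin N × P.Λ → ℝ) :
    P.l2Norm (P.discreteFn φ V) ^ 2 = V ⬝ᵥ P.basisChange φ *ᵥ V := by
  have h1 : ∀ y, H10.normX (P.discreteFn φ V y) ^ 2 = ∑ i, ∑ j, (P.H i.2 y * P.H j.2 y) *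
      (V i * V j * ⟪H10.gradL (φ i.1 : H10 𝒯.domain), H10.gradL (φ j.1 : H10 𝒯.domain)⟫) := by
    intro y
    have : H10.normX (P.discreteFn φ V y) ^ 2 =
      ⟪H10.gradL (P.discreteFn φ V y), H10.gradL (P.discreteFn φ V y)⟫ :=
      (real_inner_self_eq_norm_sq _).symm
    rw [this]
    have hG : H10.gradL (P.discreteFn φ V y) =
        ∑ i, (V i * P.H i.2 y) • H10.gradL (φ i.1 : H10 𝒯.domain) := by
      simp only [discreteFn, map_sum, map_smul]
    rw [hG, sum_inner]
    refine Finset.sum_congr rfl fun i _ => ?_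
    rw [inner_sum]
    refine Finset.sum_congr rfl fun j _ => ?_
    rw [real_inner_smul_left, real_inner_smul_right]
    ring
  have h2 : ∀ i j : Fin N × P.Λ, Integrable (fun y => (P.H i.2 y * P.H j.2 y) *
      (V i * V j * ⟪H10.gradL (φ i.1 : H10 𝒯.domain), H10.gradL (φ j.1 : H10 𝒯.domain)⟫)) P.γ :=
    fun i j => ((P.allLp_H_γ i.2).mul (P.allLp_H_γ j.2)).integrable.mul_const _
  rw [l2Norm_sq]
  simp only [h1]
  rw [integral_finsetSum _ fun i _ => integrable_finsetSum _ fun j _ => h2 i j]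
  simp only [dotProduct, mulVec, Finset.mul_sum]
  refine Finset.sum_congr rfl fun i _ => ?_
  rw [integral_finsetSum _ fun j _ => h2 i j]
  refine Finset.sum_congr rfl fun j _ => ?_
  rw [integral_mul_const, integral_H_mul_γ]
  have h3 : (∫ x in 𝒯.domain, ⟪H10.grad (φ i.1 : H10 𝒯.domain) x,
      H10.grad (φ j.1 : H10 𝒯.domain) x⟫) =
      ⟪H10.gradL (φ i.1 : H10 𝒯.domain), H10.gradL (φ j.1 : H10 𝒯.domain)⟫ := (L2.inner_def _ _).symm
  rw [basisChange, h3]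
  ring

-- Orthonormality with respect to `γρ` isolates the mode `η`.
set_option maxHeartbeats 1000000 in
lemma moment_discreteFn (V : Fin N × P.Λ → ℝ) (η : P.Λ) :
    P.moment (P.discreteFn φ V) η = ∑ i, V (i, η) • (φ i : H10 𝒯.domain) := by
  have h1 : ∀ y, P.H η y • P.discreteFn φ V y =
      ∑ i : Fin N × P.Λ, (P.H η y * P.H i.2 y) • (V i • (φ i.1 : H10 𝒯.domain)) := by
    intro y
    simp only [discreteFn, Finset.smul_sum, smul_smul]
    refine Finset.sum_congr rfl fun i _ => ?_
    congr 1; ring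
  simp only [moment, h1]
  rw [integral_finsetSum _ fun i _ =>
    ((P.allLp_H_γρ η).mul (P.allLp_H_γρ i.2)).integrable.smul_const _]
  simp only [integral_smul_const, integral_H_mul]
  rw [Fintype.sum_prod_type]
  refine Finset.sum_congr rfl fun i _ => ?_
  rw [Finset.sum_eq_single η]
  · rw [if_pos rfl, one_smul]
  · intro ν _ hν
    rw [if_neg fun h => hν (Subtype.ext h.symm), zero_smul]
  · intro h; exact absurd (Finset.mem_univ _) h

-- A function of norm zero vanishes `γρ`-almost everywhere by Friedrichs' inequality and absolute
-- continuity. Its moments are then zero, and these are combinations of the independent `φ i`.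
set_option maxHeartbeats 1000000 in
lemma eq_zero_of_l2Norm_discreteFn (hn : 2 ≤ n) {V : Fin N × P.Λ → ℝ} {c : ℝ} (hco : P.Coercive c)
    (h : P.l2Norm (P.discreteFn φ V) = 0) : V = 0 := by
  obtain ⟨C, hC, hle⟩ := H10.exists_norm_le hn 𝒯.isBounded_domain
  have h1 : ∫ y, H10.normX (P.discreteFn φ V y) ^ 2 ∂P.γ = 0 := by
    rw [← l2Norm_sq, h]; ring
  rw [integral_eq_zero_iff_of_nonneg (fun _ => sq_nonneg _) (hco _ (memV_discreteFn φ V)).1] at h1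
  have h2 : ∀ᵐ y ∂P.γρ, P.discreteFn φ V y = 0 := by
    refine P.γρ_ac.ae_le ?_
    filter_upwards [h1] with y hy
    have h3 : H10.normX (P.discreteFn φ V y) = 0 := by simpa using hy
    have h4 := hle (P.discreteFn φ V y)
    rw [h3, mul_zero] at h4
    exact norm_le_zero_iff.1 h4
  ext ⟨i, η⟩
  have h3 : P.moment (P.discreteFn φ V) η = 0 := by
    refine integral_eq_zero_of_ae ?_
    filter_upwards [h2] with y hy
    rw [hy, smul_zero]; rfl
  rw [moment_discreteFn] at h3
  exact eq_zero_of_sum_smul_basis φ h3 i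

open Matrix in
lemma basisChange_posDef (hn : 2 ≤ n) {c : ℝ} (hco : P.Coercive c) :
    (P.basisChange φ).PosDef := by
  refine PosDef.of_dotProduct_mulVec_pos ?_ fun V hV => ?_
  · ext i j
    rw [conjTranspose_apply, star_trivial, basisChange, basisChange]
    congr 1
    · exact integral_congr_ae (Filter.Eventually.of_forall fun x => real_inner_comm _ _)
    · refine Finset.prod_congr rfl fun l _ => ?_
      exact integral_congr_ae (Filter.Eventually.of_forall fun x => mul_comm _ _)
  · rw [star_trivial, ← l2Norm_discreteFn_sq]
    have h0 : P.l2Norm (P.discreteFn φ V) ≠ 0 := fun h =>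
      hV (eq_zero_of_l2Norm_discreteFn φ hn hco h)
    positivity

open Matrix in
lemma abs_dotProduct_le_estDisc (hn : 2 ≤ n) {c : ℝ} (hco : P.Coercive c)
    (W V : Fin N × P.Λ → ℝ) :
    |(P.galerkinMatrix φ *ᵥ W - P.loadVector φ) ⬝ᵥ V| ≤
      P.estDisc φ W * P.l2Norm (P.discreteFn φ V) := by
  refine (abs_dotProduct_le_of_posDef (basisChange_posDef φ hn hco) _ V).trans ?_
  rw [← l2Norm_discreteFn_sq, Real.sqrt_sq (l2Norm_nonneg _)]
  rfl

open Matrix in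
/-- Solvability of the Galerkin system. -/
lemma exists_galerkin (hn : 2 ≤ n) {c : ℝ} (hc : 0 < c) (hco : P.Coercive c) :
    ∃ V, P.galerkinMatrix φ *ᵥ V = P.loadVector φ := by
  have hinj : Function.Injective (P.galerkinMatrix φ).mulVecLin := by
    rw [injective_iff_map_eq_zero]
    intro V hV
    have h1 := B_discreteFn φ V V
    rw [mulVecLin_apply] at hV
    rw [hV, zero_dotProduct] at h1
    have h2 := hco.sq_mul_l2Norm_le (memV_discreteFn φ V)
    rw [h1] at h2
    refine eq_zero_of_l2Norm_discreteFn φ hn hco ?_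
    have h3 : 0 < c ^ 2 := by positivity
    have h4 := sq_nonneg (P.l2Norm (P.discreteFn φ V))
    have h5 : P.l2Norm (P.discreteFn φ V) ^ 2 = 0 := by nlinarith
    exact pow_eq_zero_iff two_ne_zero |>.1 h5
  exact LinearMap.injective_iff_surjective.1 hinj (P.loadVector φ)

/-- The Clément interpolants are piecewise affine and `1 ≤ p`, so `interp v` is a discrete function
and is seen by Galerkin orthogonality. -/
lemma exists_interp_eq (hp : 1 ≤ p) (v : P.Fn) : ∃ V, P.interp v = P.discreteFn φ V := by
  have hmem : ∀ μ, 𝒯.clement (P.moment v μ) ∈ 𝒯.fe p := by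
    intro μ T hT
    obtain ⟨Q, hQ, h⟩ := Mesh.clement_mem_fe (P.moment v μ) T hT
    exact ⟨Q, hQ.trans hp, h⟩
  choose c hc using fun μ => exists_eq_sum_smul_basis φ (hmem μ)
  refine ⟨fun i => c i.2 i.1, ?_⟩
  ext1 y
  rw [interp_apply, discreteFn, Fintype.sum_prod_type_right, ← Finset.sum_coe_sort P.Λ]
  refine Finset.sum_congr rfl fun μ _ => ?_
  refine (congrArg (P.H μ y • ·) (hc μ)).trans ?_
  beta_reduce
  rw [Finset.smul_sum]
  refine Finset.sum_congr rfl fun i _ => ?_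
  rw [smul_smul, mul_comm]

end

end Data

/-! ### The flux -/

lemma ae_eq_sum_smul {α F ι : Type*} {mα : MeasurableSpace α} {m : Measure α}
    [NormedAddCommGroup F] [NormedSpace ℝ F] {q : ENNReal} {s : Finset ι} (c : ι → ℝ)
    {g : ι → Lp F q m} {k : ι → α → F} (hk : ∀ i ∈ s, g i =ᵐ[m] k i) :
    (∑ i ∈ s, c i • g i : Lp F q m) =ᵐ[m] fun x => ∑ i ∈ s, c i • k i x := by
  have h : ∀ᵐ x ∂m, ∀ i ∈ s, (c i • g i : Lp F q m) x = c i • k i x := by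
    refine (Filter.eventually_all_finset _).2 fun i hi => ?_
    filter_upwards [Lp.coeFn_smul (c i) (g i), hk i hi] with x h1 h2
    rw [h1, Pi.smul_apply, h2]
  filter_upwards [h, coeFn_finsetSum s fun i => c i • g i] with x h1 h2
  rw [h2]
  exact Finset.sum_congr rfl h1

lemma map_sum_smul_sum_smul {A G H ι κ : Type*} [NormedAddCommGroup A] [NormedSpace ℝ A]
    [NormedAddCommGroup G] [NormedSpace ℝ G] [NormedAddCommGroup H] [NormedSpace ℝ H]
    (M : A →L[ℝ] G →L[ℝ] H) (s : Finset ι) (t : Finset κ)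
    (h : ι → ℝ) (w : κ → ℝ) (C : ι → A) (g : κ → G) :
    M (∑ i ∈ s, h i • C i) (∑ k ∈ t, w k • g k) =
      ∑ j ∈ s ×ˢ t, (h j.1 * w j.2) • M (C j.1) (g j.2) := by
  rw [Finset.sum_product]
  simp only [map_sum, map_smul, sum_apply, smul_apply, Finset.smul_sum,
    smul_smul]
  rw [Finset.sum_comm]
  exact Finset.sum_congr rfl fun i _ => Finset.sum_congr rfl fun k _ => by rw [mul_comm]

lemma sum_smul_eq_sum_smul_sum {G ι κ : Type*} [NormedAddCommGroup G] [NormedSpace ℝ G] {s : Finset ι}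
    {t : Finset κ} {a : ι → ℝ} {b : κ → ℝ} {c : κ → ι → ℝ} (g : ι → G)
    (h : ∀ i ∈ s, a i = ∑ k ∈ t, b k * c k i) :
    ∑ i ∈ s, a i • g i = ∑ k ∈ t, b k • ∑ i ∈ s, c k i • g i := by
  simp only [Finset.smul_sum, smul_smul]
  rw [Finset.sum_comm]
  refine Finset.sum_congr rfl fun i hi => ?_
  rw [h i hi, Finset.sum_smul]

namespace Data

variable {𝒯 : Mesh n} {P : Data 𝒯} {N p : ℕ} (φ : Module.Basis (Fin N) ℝ (𝒯.fe p))
  (W : Fin N × P.Λ → ℝ)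

/-- The flux coefficients as square integrable vector fields. -/
def resL (η : Fin P.L → ℕ) : Lp (E n) 2 (volume.restrict 𝒯.domain) :=
  ∑ j ∈ P.Δ ×ˢ (Finset.univ : Finset (Fin N × P.Λ)),
    (W j.2 * ∏ l, tripleCoeff (j.2.2.1 l) (j.1 l) (η l)) •
      mulL 𝒯.domain (P.coeffL j.1) (H10.gradL (φ j.2.1 : H10 𝒯.domain))

lemma coeFn_mulL_coeffL (ν : Fin P.L → ℕ) (v : H10 𝒯.domain) :
    mulL 𝒯.domain (P.coeffL ν) (H10.gradL v) =ᵐ[volume.restrict 𝒯.domain]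
      fun x => P.ttEval (fun k => P.a0 k x) ν • H10.grad v x := by
  filter_upwards [coeFn_mulL (P.coeffL ν) (H10.gradL v), (P.coeff_memLp ν).coeFn_toLp] with x e2 e3
  have e3' : P.coeffL ν x = P.ttEval (fun k => P.a0 k x) ν := e3
  rw [e2, e3']; rfl

lemma coeFn_resL (η : Fin P.L → ℕ) :
    resL φ W η =ᵐ[volume.restrict 𝒯.domain] P.res φ W η := by
  have h := ae_eq_sum_smul (s := P.Δ ×ˢ (Finset.univ : Finset (Fin N × P.Λ)))
    (fun j => W j.2 * ∏ l, tripleCoeff (j.2.2.1 l) (j.1 l) (η l))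
    fun j _ => coeFn_mulL_coeffL j.1 (φ j.2.1 : H10 𝒯.domain)
  refine h.trans (Filter.Eventually.of_forall fun x => ?_)
  beta_reduce
  rw [Finset.sum_product, res, resCoeff]
  refine Finset.sum_congr rfl fun ν _ => Finset.sum_congr rfl fun i _ => ?_
  rw [smul_smul]
  congr 1
  ring

set_option maxHeartbeats 1000000 in
/-- The flux of the discrete function in terms of its Hermite coefficients. -/
lemma mulL_gradL_discreteFn (y : Fin P.L → ℝ) :
    mulL 𝒯.domain (P.aL y) (H10.gradL (P.discreteFn φ W y)) =
      ∑ η ∈ P.Ξ, P.H η y • resL φ W η := by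
  have h := map_sum_smul_sum_smul (mulL 𝒯.domain) P.Δ
    (Finset.univ : Finset (Fin N × P.Λ)) (fun ν => P.H ν y) (fun i => W i * P.H i.2 y) P.coeffL
    fun i => H10.gradL (φ i.1 : H10 𝒯.domain)
  have h1 : H10.gradL (P.discreteFn φ W y) =
      ∑ i, (W i * P.H i.2 y) • H10.gradL (φ i.1 : H10 𝒯.domain) := by
    simp only [discreteFn, map_sum, map_smul]
  have h0 : P.aL y = ∑ ν ∈ P.Δ, P.H ν y • P.coeffL ν := rfl
  rw [← h1, ← h0] at h
  have h4 := sum_smul_eq_sum_smul_sum (s := P.Δ ×ˢ (Finset.univ : Finset (Fin N × P.Λ))) (t := P.Ξ)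
    (a := fun j => P.H j.1 y * (W j.2 * P.H j.2.2 y)) (b := fun η => P.H η y)
    (c := fun η j => W j.2 * ∏ l, tripleCoeff (j.2.2.1 l) (j.1 l) (η l))
    (fun j => mulL 𝒯.domain (P.coeffL j.1) (H10.gradL (φ j.2.1 : H10 𝒯.domain))) (by
      intro j hj
      have h2 := P.H_mul_H j.2.2.2 (Finset.mem_product.1 hj).1 y
      rw [mul_left_comm, h2, Finset.mul_sum]
      exact Finset.sum_congr rfl fun η _ => by ring)
  simp only [resL]
  exact h.trans h4

/-- The functional of a flux coefficient. -/
def resFun (η : Fin P.L → ℕ) : H10 𝒯.domain →L[ℝ] ℝ := (innerSL ℝ (resL φ W η)).comp H10.gradL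

lemma resFun_apply (η : Fin P.L → ℕ) (v : H10 𝒯.domain) :
    resFun φ W η v = ⟪resL φ W η, H10.gradL v⟫ := rfl

lemma form_discreteFn (y : Fin P.L → ℝ) (z : H10 𝒯.domain) :
    P.form y (P.discreteFn φ W y) z = ∑ η ∈ P.Ξ, P.H η y * resFun φ W η z := by
  rw [form, mulL_gradL_discreteFn, sum_inner]
  simp only [real_inner_smul_left, resFun_apply]

/-- The modes of the residual are split into `Λ` and `Ξ \ Λ`. The load is written as a moment with
`H 0 = 1`, to be treated together with the active modes. -/
lemma load_sub_B_discreteFn (hσ : ∀ l, P.σ l ^ 2 < 2) {z : P.Fn} (hz : MemLp z 2 P.γ) :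
    P.load z - P.B (P.discreteFn φ W) z =
      ((∫ y, P.H 0 y * P.loadL (z y) ∂P.γρ) -
        ∑ η ∈ P.Λ, ∫ y, P.H η y * resFun φ W η (z y) ∂P.γρ) -
      ∑ η ∈ P.Ξ \ P.Λ, ∫ y, P.H η y * resFun φ W η (z y) ∂P.γρ := by
  rw [load_eq, B_eq]
  simp only [form_discreteFn, H_zero, one_mul]
  rw [integral_finsetSum _ fun η _ => integrable_H_mul_clm hσ hz η _,
    ← Finset.sum_sdiff P.Λ_subset_Ξ]
  ring

section

variable {v : P.Fn} (hσ : ∀ l, P.σ l ^ 2 < 2) (hv : MemLp v 2 P.γ)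
  (hI : MemLp (P.interp v) 2 P.γ) {η : Fin P.L → ℕ} (T : H10 𝒯.domain →L[ℝ] ℝ)

include hσ hv hI

/-- By orthonormality the interpolant contributes to the mode `η` only if `η ∈ Λ`, and then by the
Clément interpolant of the moment of `v`. -/
lemma integral_H_mul_sub_interp :
    ∫ y, P.H η y * T ((v - P.interp v) y) ∂P.γρ =
      T (P.moment v η) - if η ∈ P.Λ then T (𝒯.clement (P.moment v η)) else 0 := by
  simp only [Pi.sub_apply, map_sub, mul_sub]
  rw [integral_sub (integrable_H_mul_clm hσ hv η T) (integrable_H_mul_clm hσ hI η T),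
    integral_H_mul_clm hσ hv, integral_H_mul_interp]

lemma integral_H_mul_sub_interp_of_notMem (hη : η ∉ P.Λ) :
    ∫ y, P.H η y * T ((v - P.interp v) y) ∂P.γρ = ∫ y, P.H η y * T (v y) ∂P.γρ := by
  rw [integral_H_mul_sub_interp hσ hv hI, if_neg hη, sub_zero, integral_H_mul_clm hσ hv]

/-- The bounded operator `L` commutes with the moment integral, so for active modes interpolation of
moments may be replaced by interpolation of `v y` at each parameter. -/
lemma integral_H_mul_sub_interp_of_mem {L : H10 𝒯.domain →L[ℝ] H10 𝒯.domain}
    (hL : ∀ w, L w = 𝒯.clement w) (hη : η ∈ P.Λ) :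
    ∫ y, P.H η y * T ((v - P.interp v) y) ∂P.γρ =
      ∫ y, P.H η y * (T - T.comp L) (v y) ∂P.γρ := by
  rw [integral_H_mul_sub_interp hσ hv hI, if_pos hη, integral_H_mul_clm hσ hv, ← hL]
  rfl

end

/-- The parametric part of the residual. -/
lemma abs_param_le (hσ : ∀ l, P.σ l ^ 2 < 2) {v : P.Fn} (hv : MemLp v 2 P.γ) :
    |∑ η ∈ P.Ξ \ P.Λ, ∫ y, P.H η y * resFun φ W η (v y) ∂P.γρ| ≤
      P.estParam φ W * P.l2Norm v := by
  have h1 : MemLp (fun y => ∑ η ∈ P.Ξ \ P.Λ, (P.H η y * P.ζ y) • resL φ W η) 2 P.γ :=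
    memLp_finsetSum _ fun η _ =>
      (ContinuousLinearMap.toSpanSingleton ℝ (resL φ W η)).comp_memLp' (P.memLp_H_mul_ζ hσ η)
  have h2 : MemLp (fun y => H10.gradL (v y)) 2 P.γ := H10.gradL.comp_memLp' hv
  have h3 : ∑ η ∈ P.Ξ \ P.Λ, ∫ y, P.H η y * resFun φ W η (v y) ∂P.γρ =
      ∫ y, ⟪∑ η ∈ P.Ξ \ P.Λ, (P.H η y * P.ζ y) • resL φ W η, H10.gradL (v y)⟫ ∂P.γ := by
    rw [← integral_finsetSum _ fun η _ => integrable_H_mul_clm hσ hv η _, integral_γρ]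
    refine integral_congr_ae (Filter.Eventually.of_forall fun y => ?_)
    beta_reduce
    rw [sum_inner, smul_eq_mul, Finset.mul_sum]
    refine Finset.sum_congr rfl fun η _ => ?_
    rw [real_inner_smul_left, resFun_apply]; ring
  rw [h3]
  refine (abs_integral_inner_le h1 h2).trans (le_of_eq ?_)
  congr 1
  rw [estParam]
  congr 1
  refine integral_congr_ae (Filter.Eventually.of_forall fun y => ?_)
  beta_reduce
  rw [← real_inner_self_eq_norm_sq, L2.inner_def]
  refine integral_congr_ae ?_
  filter_upwards [ae_eq_sum_smul (s := P.Ξ \ P.Λ) (fun η => P.H η y * P.ζ y)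
    fun η _ => coeFn_resL φ W η] with x e
  rw [real_inner_self_eq_norm_sq, e]

end Data

/-! ### The deterministic part of the residual -/

/-- Expanding the square separates the variables into finitely many products of functions of `y` and
integrals over `x`. -/
lemma integrable_integral_sum_sq {α Ω ι : Type*} {mα : MeasurableSpace α} {mΩ : MeasurableSpace Ω}
    {m : Measure α} {μ : Measure Ω} {s : Finset ι} {d : ι → α → ℝ} {h : ι → Ω → ℝ}
    (hd : ∀ i ∈ s, MemLp (d i) 2 m) (hh : ∀ i ∈ s, MemLp (h i) 2 μ) :
    Integrable (fun y => ∫ x, (∑ i ∈ s, d i x * h i y) ^ 2 ∂m) μ := by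
  have h1 : ∀ y, ∫ x, (∑ i ∈ s, d i x * h i y) ^ 2 ∂m =
      ∑ i ∈ s, ∑ j ∈ s, (h i y * h j y) * ∫ x, d i x * d j x ∂m := by
    intro y
    have hi : ∀ i ∈ s, ∀ j ∈ s, Integrable (fun x => (h i y * h j y) * (d i x * d j x)) m :=
      fun i hi j hj => ((hd i hi).integrable_mul (hd j hj)).const_mul _
    have h2 : ∀ x, (∑ i ∈ s, d i x * h i y) ^ 2 =
        ∑ i ∈ s, ∑ j ∈ s, (h i y * h j y) * (d i x * d j x) := by
      intro x
      rw [sq, Finset.sum_mul_sum]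
      exact Finset.sum_congr rfl fun i _ => Finset.sum_congr rfl fun j _ => by ring
    simp only [h2]
    rw [integral_finsetSum _ fun i hi' => integrable_finsetSum _ fun j hj => hi i hi' j hj]
    refine Finset.sum_congr rfl fun i hi' => ?_
    rw [integral_finsetSum _ fun j hj => hi i hi' j hj]
    simp only [integral_const_mul]
  simp only [h1]
  exact integrable_finsetSum _ fun i hi => integrable_finsetSum _ fun j hj =>
    ((hh i hi).integrable_mul (hh j hj)).mul_const _

lemma divergence_sum_smul {ι : Type*} (s : Finset ι) (c : ι → ℝ) {X : ι → E n → E n}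
    (hX : ∀ i ∈ s, ContDiff ℝ 1 (X i)) (x : E n) :
    divergence (fun x => ∑ i ∈ s, c i • X i x) x = ∑ i ∈ s, divergence (X i) x * c i := by
  have h : HasFDerivAt (fun x => ∑ i ∈ s, c i • X i x) (∑ i ∈ s, c i • fderiv ℝ (X i) x) x :=
    HasFDerivAt.fun_sum fun i hi =>
      (((hX i hi).differentiable one_ne_zero).differentiableAt.hasFDerivAt).const_smul (c i)
  simp only [divergence, h.fderiv, Finset.sum_mul]
  rw [Finset.sum_comm]
  refine Finset.sum_congr rfl fun j _ => ?_
  rw [sum_apply, WithLp.ofLp_sum, Finset.sum_apply]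
  refine Finset.sum_congr rfl fun i _ => ?_
  rw [smul_apply, PiLp.smul_apply, smul_eq_mul, mul_comm]

namespace Data

variable {𝒯 : Mesh n} {P : Data 𝒯} {N p : ℕ} (φ : Module.Basis (Fin N) ℝ (𝒯.fe p))
  (W : Fin N × P.Λ → ℝ)

variable (P) in
lemma extOn_a0 {T : Finset (E n)} (hT : T ∈ 𝒯.elems) (k : Fin (P.s 0)) :
    ContDiff ℝ 1 (extOn T (P.a0 k)) ∧ EqOn (P.a0 k) (extOn T (P.a0 k)) (interior (hull T)) := by
  have h := P.a0_smooth k T hT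
  rw [extOn, dif_pos h]
  exact h.choose_spec

lemma contDiff_resOn {T : Finset (E n)} (hT : T ∈ 𝒯.elems) (η : Fin P.L → ℕ) :
    ContDiff ℝ 1 (P.resOn φ W T η) := by
  unfold resOn resCoeff ttEval
  refine ContDiff.sum fun ν _ => ContDiff.sum fun i _ => ContDiff.fun_smul ?_
    (Mesh.contDiff_gradOn (φ i.1 : H10 𝒯.domain) T)
  refine ContDiff.mul (ContDiff.mul (ContDiff.sum fun k _ => ?_) contDiff_const) contDiff_const
  exact (P.extOn_a0 hT (k 0)).1.mul contDiff_const

lemma res_ae_eq {T : Finset (E n)} (hT : T ∈ 𝒯.elems) (η : Fin P.L → ℕ) :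
    P.res φ W η =ᵐ[volume.restrict (interior (hull T))] P.resOn φ W T η := by
  have h : ∀ᵐ x ∂volume.restrict (interior (hull T)), ∀ i : Fin N,
      H10.grad (φ i : H10 𝒯.domain) x = gradOn (φ i : H10 𝒯.domain) T x :=
    ae_all_iff.2 fun i => Mesh.grad_ae_eq_gradOn (p := p) (v := (φ i : H10 𝒯.domain)) (φ i).2 hT
  filter_upwards [h, ae_restrict_mem isOpen_interior.measurableSet] with x h1 h2
  have h3 : (fun k => P.a0 k x) = fun k => extOn T (P.a0 k) x :=
    funext fun k => (P.extOn_a0 hT k).2 h2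
  have h4 : (fun i => H10.grad (φ i : H10 𝒯.domain) x) = fun i => gradOn (φ i : H10 𝒯.domain) T x :=
    funext h1
  exact congrArg₂ (fun c g => P.resCoeff W c g η) h3 h4

lemma integrable_activeRes (hσ : ∀ l, P.σ l ^ 2 < 2) {T : Finset (E n)} (hT : T ∈ 𝒯.elems) :
    Integrable (fun y => ∫ x in hull T, (P.activeRes φ W T x y * P.ζ y) ^ 2) P.γ := by
  -- The source term enters as an additional summand, paired with `H 0 = 1`.
  have h := integrable_integral_sum_sq (m := volume.restrict (hull T)) (μ := P.γ)
    (s := Finset.insertNone P.Λ)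
    (d := fun o x => o.elim (P.f x) fun η => divergence (P.resOn φ W T η) x)
    (h := fun o y => (o.elim (P.H 0 y) fun η => P.H η y) * P.ζ y) ?_ ?_
  · refine h.congr (Filter.Eventually.of_forall fun y => ?_)
    beta_reduce
    congr 1
    ext x
    rw [Finset.sum_insertNone]
    simp only [Option.elim_none, Option.elim_some, H_zero, activeRes]
    rw [add_mul, Finset.sum_mul]
    congr 2
    · ring
    · exact Finset.sum_congr rfl fun η _ => by ring
  · rintro (_ | η) _
    · exact Mesh.memLp_hull P.f_memLp hT
    · exact memLp_two_of_continuousOn (isCompact_hull T) (volume_hull_lt_top T)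
        (continuous_divergence (contDiff_resOn φ W hT η)).continuousOn
  · rintro (_ | η) _
    · exact P.memLp_H_mul_ζ hσ 0
    · exact P.memLp_H_mul_ζ hσ η

lemma integrable_activeJump (hn : 2 ≤ n) (hσ : ∀ l, P.σ l ^ 2 < 2) {F : Finset (E n)}
    (hF : F ∈ 𝒯.intFaces) :
    Integrable (fun y => ∫ x in hull F, (P.activeJump φ W F x y * P.ζ y) ^ 2 ∂(μHE[n - 1])) P.γ := by
  obtain ⟨-, hc, T, hT, -, -, -, hFT, -⟩ := Mesh.mem_intFaces.1 hF
  obtain ⟨a, ha, hFa⟩ := Mesh.exists_erase (Mesh.isSimplex hT) hFT hc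
  have hlt : (μHE[n - 1] : Measure (E n)) (hull F) < ⊤ := by
    rw [hFa]; exact (Mesh.isSimplex hT).surface_face_lt_top (by omega) ha
  have h := integrable_integral_sum_sq (m := (μHE[n - 1] : Measure (E n)).restrict (hull F))
    (μ := P.γ) (s := P.Λ)
    (d := fun η x => ∑ T ∈ 𝒯.elems with F ⊆ T, ⟪outerNormal T F, P.resOn φ W T η x⟫)
    (h := fun η y => P.H η y * P.ζ y) (fun η _ => ?_) fun η _ => P.memLp_H_mul_ζ hσ η
  · refine h.congr (Filter.Eventually.of_forall fun y => ?_)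
    beta_reduce
    congr 1
    ext x
    congr 1
    rw [activeJump, Finset.sum_comm, Finset.sum_mul]
    refine Finset.sum_congr rfl fun η _ => ?_
    rw [Finset.sum_mul, Finset.sum_mul]
    exact Finset.sum_congr rfl fun T _ => by ring
  · refine memLp_two_of_continuousOn (isCompact_hull F) hlt (Continuous.continuousOn ?_)
    refine continuous_finsetSum _ fun T hT => ?_
    exact continuous_const.inner (contDiff_resOn φ W (Finset.mem_filter.1 hT).1 η).continuous

/-- The active flux on an element. -/
def activeFlux (y : Fin P.L → ℝ) (T : Finset (E n)) (x : E n) : E n :=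
  ∑ η ∈ P.Λ, P.H η y • P.resOn φ W T η x

/-- At fixed `y`, the deterministic estimator of the active flux is the integrand of the squared
estimator `estDet`. -/
lemma resSq_mul_ζ (y : Fin P.L → ℝ) :
    𝒯.resSq P.f (activeFlux φ W y) * P.ζ y ^ 2 =
      ∑ T ∈ 𝒯.elems, diam T ^ 2 * (∫ x in hull T, (P.activeRes φ W T x y * P.ζ y) ^ 2) +
      ∑ F ∈ 𝒯.intFaces, diam F *
        ∫ x in hull F, (P.activeJump φ W F x y * P.ζ y) ^ 2 ∂(μHE[n - 1]) := by
  rw [Mesh.resSq, add_mul, Finset.sum_mul, Finset.sum_mul]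
  simp only [mul_pow, integral_mul_const, ← mul_assoc]
  congr 1
  · refine Finset.sum_congr rfl fun T hT => ?_
    congr 3
    ext x
    congr 1
    rw [activeRes]
    congr 1
    exact divergence_sum_smul P.Λ (fun η => P.H η y) (fun η _ => contDiff_resOn φ W hT η) x
  · refine Finset.sum_congr rfl fun F hF => ?_
    congr 3
    ext x
    congr 1
    rw [activeJump]
    refine Finset.sum_congr rfl fun T _ => ?_
    rw [activeFlux, inner_sum]
    exact Finset.sum_congr rfl fun η _ => by rw [real_inner_smul_right, mul_comm]

lemma resSq_nonneg (𝒯 : Mesh n) (f : E n → ℝ) (X : Finset (E n) → E n → E n) : 0 ≤ 𝒯.resSq f X :=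
  add_nonneg
    (Finset.sum_nonneg fun _ _ => mul_nonneg (sq_nonneg _) (integral_nonneg fun _ => sq_nonneg _))
    (Finset.sum_nonneg fun _ _ =>
      mul_nonneg (diam_nonneg _) (integral_nonneg fun _ => sq_nonneg _))

lemma integrable_resSq_mul_ζ (hn : 2 ≤ n) (hσ : ∀ l, P.σ l ^ 2 < 2) :
    Integrable (fun y => 𝒯.resSq P.f (activeFlux φ W y) * P.ζ y ^ 2) P.γ := by
  simp only [resSq_mul_ζ]
  exact (integrable_finsetSum _ fun T hT => (integrable_activeRes φ W hσ hT).const_mul _).add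
    (integrable_finsetSum _ fun F hF => (integrable_activeJump φ W hn hσ hF).const_mul _)

lemma sqrt_integral_resSq (hn : 2 ≤ n) (hσ : ∀ l, P.σ l ^ 2 < 2) :
    √(∫ y, 𝒯.resSq P.f (activeFlux φ W y) * P.ζ y ^ 2 ∂P.γ) = P.estDet φ W := by
  simp only [resSq_mul_ζ]
  rw [integral_add
    (integrable_finsetSum _ fun T hT => (integrable_activeRes φ W hσ hT).const_mul _)
    (integrable_finsetSum _ fun F hF => (integrable_activeJump φ W hn hσ hF).const_mul _),
    integral_finsetSum _ fun T hT => (integrable_activeRes φ W hσ hT).const_mul _,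
    integral_finsetSum _ fun F hF => (integrable_activeJump φ W hn hσ hF).const_mul _, estDet]
  congr 2
  · refine Finset.sum_congr rfl fun T _ => ?_
    rw [estDetT, mul_pow, Real.sq_sqrt (integral_nonneg fun y => integral_nonneg fun x =>
      sq_nonneg _), integral_const_mul]
  · refine Finset.sum_congr rfl fun F _ => ?_
    rw [estDetF, mul_pow, Real.sq_sqrt (integral_nonneg fun y => integral_nonneg fun x =>
      sq_nonneg _), Real.sq_sqrt (diam_nonneg _), integral_const_mul]

/-- The deterministic part of the residual at a fixed parameter. -/
lemma abs_active_le {κ : ℝ} (hreg : 𝒯.ShapeRegular κ) (hκ : 0 < κ) (hn : 2 ≤ n)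
    (y : Fin P.L → ℝ) (v : H10 𝒯.domain) :
    |P.loadL (v - 𝒯.clement v) -
      ∑ η ∈ P.Λ, P.H η y * resFun φ W η (v - 𝒯.clement v)| ≤
      Mesh.resConst n κ * √(𝒯.resSq P.f (activeFlux φ W y)) * H10.normX v := by
  have hS : (∑ η ∈ P.Λ, P.H η y • resL φ W η : Lp (E n) 2 (volume.restrict 𝒯.domain))
      =ᵐ[volume.restrict 𝒯.domain] fun x => ∑ η ∈ P.Λ, P.H η y • P.res φ W η x :=
    ae_eq_sum_smul _ fun η _ => coeFn_resL φ W η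
  have h := Mesh.abs_residual_sub_clement_le hreg hκ hn P.f_memLp (X := activeFlux φ W y)
    (fun T hT => ContDiff.sum fun η _ => contDiff_const.fun_smul (contDiff_resOn φ W hT η))
    (Lp.memLp (∑ η ∈ P.Λ, P.H η y • resL φ W η)) (fun T hT => ?_) v
  · convert h using 3
    · exact loadL_apply _
    · calc ∑ η ∈ P.Λ, P.H η y * resFun φ W η (v - 𝒯.clement v)
          = ⟪∑ η ∈ P.Λ, P.H η y • resL φ W η, H10.gradL (v - 𝒯.clement v)⟫ := by
            rw [sum_inner]
            simp only [real_inner_smul_left, resFun_apply]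
        _ = _ := L2.inner_def _ _
  · filter_upwards [Mesh.ae_restrict_domain_iff.1 hS T hT, (Filter.eventually_all_finset P.Λ).2
      fun η _ => res_ae_eq φ W hT η] with x h1 h2
    rw [h1, activeFlux]
    exact Finset.sum_congr rfl fun η hη => by rw [h2 η hη]

lemma integrable_H_mul_sub_clement (hσ : ∀ l, P.σ l ^ 2 < 2) {v : P.Fn} (hv : MemLp v 2 P.γ)
    (η : Fin P.L → ℕ) (T : H10 𝒯.domain →L[ℝ] ℝ) :
    Integrable (fun y => P.H η y * T (v y - 𝒯.clement (v y))) P.γρ := by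
  obtain ⟨L, hL⟩ := 𝒯.exists_clementL
  refine (integrable_H_mul_clm hσ hv η (T - T.comp L)).congr
    (Filter.Eventually.of_forall fun y => ?_)
  beta_reduce
  rw [map_sub T, ← hL]
  rfl

lemma integral_H_mul_sub_interp_eq (hσ : ∀ l, P.σ l ^ 2 < 2) {v : P.Fn} (hv : MemLp v 2 P.γ)
    (hI : MemLp (P.interp v) 2 P.γ) {η : Fin P.L → ℕ} (hη : η ∈ P.Λ) (T : H10 𝒯.domain →L[ℝ] ℝ) :
    ∫ y, P.H η y * T ((v - P.interp v) y) ∂P.γρ =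
      ∫ y, P.H η y * T (v y - 𝒯.clement (v y)) ∂P.γρ := by
  obtain ⟨L, hL⟩ := 𝒯.exists_clementL
  rw [integral_H_mul_sub_interp_of_mem hσ hv hI T hL hη]
  refine integral_congr_ae (Filter.Eventually.of_forall fun y => ?_)
  beta_reduce
  rw [map_sub T, ← hL]
  rfl

/-- The active residual at a parameter, tested with the Clément interpolation error. -/
def activeFun (y : Fin P.L → ℝ) (v : H10 𝒯.domain) : ℝ :=
  P.loadL (v - 𝒯.clement v) - ∑ η ∈ P.Λ, P.H η y * resFun φ W η (v - 𝒯.clement v)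

/-- Since `0 ∈ Λ`, the load counts as an active mode too. Once the modes are collected again, the
test function at `y` is `v y` minus its own Clément interpolant, which decouples the parameters. -/
lemma det_eq (hσ : ∀ l, P.σ l ^ 2 < 2) {v : P.Fn} (hv : MemLp v 2 P.γ)
    (hI : MemLp (P.interp v) 2 P.γ) :
    (∫ y, P.H 0 y * P.loadL ((v - P.interp v) y) ∂P.γρ) -
      ∑ η ∈ P.Λ, ∫ y, P.H η y * resFun φ W η ((v - P.interp v) y) ∂P.γρ =
      ∫ y, P.ζ y * activeFun φ W y (v y) ∂P.γ := by
  rw [integral_H_mul_sub_interp_eq hσ hv hI P.zero_mem_Λ P.loadL,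
    Finset.sum_congr rfl fun η hη => integral_H_mul_sub_interp_eq hσ hv hI hη (resFun φ W η),
    ← integral_finsetSum _ fun η _ => integrable_H_mul_sub_clement hσ hv η _,
    ← integral_sub (integrable_H_mul_sub_clement hσ hv 0 _)
      (integrable_finsetSum _ fun η _ => integrable_H_mul_sub_clement hσ hv η _), integral_γρ]
  refine integral_congr_ae (Filter.Eventually.of_forall fun y => ?_)
  beta_reduce
  rw [H_zero, one_mul, smul_eq_mul, activeFun]

/-- The deterministic part of the residual. -/
lemma abs_det_le {κ : ℝ} (hreg : 𝒯.ShapeRegular κ) (hκ : 0 < κ) (hn : 2 ≤ n)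
    (hσ : ∀ l, P.σ l ^ 2 < 2) {v : P.Fn} (hv : MemLp v 2 P.γ)
    (hI : MemLp (P.interp v) 2 P.γ) :
    |(∫ y, P.H 0 y * P.loadL ((v - P.interp v) y) ∂P.γρ) -
      ∑ η ∈ P.Λ, ∫ y, P.H η y * resFun φ W η ((v - P.interp v) y) ∂P.γρ| ≤
      Mesh.resConst n κ * P.estDet φ W * P.l2Norm v := by
  have hR : 0 ≤ Mesh.resConst n κ := by unfold Mesh.resConst; positivity
  rw [det_eq φ W hσ hv hI]
  -- `R` is the pointwise estimator including the density; its `L²(γ)` norm is `estDet`.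
  set R : (Fin P.L → ℝ) → ℝ := fun y => √(𝒯.resSq P.f (activeFlux φ W y) * P.ζ y ^ 2) with hRdef
  have hRsq : ∀ y, R y ^ 2 = 𝒯.resSq P.f (activeFlux φ W y) * P.ζ y ^ 2 := fun y =>
    Real.sq_sqrt (mul_nonneg (resSq_nonneg _ _ _) (sq_nonneg _))
  have hi := integrable_resSq_mul_ζ φ W hn hσ
  have hRm : MemLp R 2 P.γ := by
    rw [memLp_two_iff_integrable_sq
      (Real.continuous_sqrt.comp_aestronglyMeasurable hi.aestronglyMeasurable)]
    exact hi.congr (Filter.Eventually.of_forall fun y => (hRsq y).symm)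
  have hg : MemLp (fun y => H10.normX (v y)) 2 P.γ := (H10.gradL.comp_memLp' hv).norm
  have hcs : ∫ y, H10.normX (v y) * R y ∂P.γ ≤ P.estDet φ W * P.l2Norm v := by
    have h := (le_abs_self _).trans (abs_integral_inner_le hRm hg)
    simp only [RCLike.inner_apply, conj_trivial, Real.norm_eq_abs, sq_abs, hRsq] at h
    rwa [sqrt_integral_resSq φ W hn hσ] at h
  refine (abs_integral_le_integral_abs).trans ?_
  calc ∫ y, |P.ζ y * activeFun φ W y (v y)| ∂P.γ
      ≤ ∫ y, Mesh.resConst n κ * (H10.normX (v y) * R y) ∂P.γ := by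
        refine integral_mono_of_nonneg (Filter.Eventually.of_forall fun y => abs_nonneg _)
          ((hg.integrable_mul hRm).const_mul _) (Filter.Eventually.of_forall fun y => ?_)
        beta_reduce
        have h1 : |activeFun φ W y (v y)| ≤ _ := abs_active_le φ W hreg hκ hn y (v y)
        have hζ := P.ζ_pos y
        have h2 : R y = √(𝒯.resSq P.f (activeFlux φ W y)) * P.ζ y := by
          rw [hRdef]
          beta_reduce
          rw [Real.sqrt_mul (resSq_nonneg _ _ _), Real.sqrt_sq hζ.le]
        rw [abs_mul, abs_of_pos hζ, h2]
        refine (mul_le_mul_of_nonneg_left h1 hζ.le).trans (le_of_eq ?_)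
        ring
    _ = Mesh.resConst n κ * ∫ y, H10.normX (v y) * R y ∂P.γ := integral_const_mul _ _
    _ ≤ Mesh.resConst n κ * (P.estDet φ W * P.l2Norm v) := mul_le_mul_of_nonneg_left hcs hR
    _ = _ := by ring

end Data

/-! ### Combination of the three parts of the error -/

namespace Data

variable {𝒯 : Mesh n} {P : Data 𝒯} {N p : ℕ} (φ : Module.Basis (Fin N) ℝ (𝒯.fe p))
  (W : Fin N × P.Λ → ℝ)

open Matrix in
/-- Reliability of the error estimator. -/
theorem energyNorm_sub_discreteFn_sq_le {κ : ℝ} (hreg : 𝒯.ShapeRegular κ) (hκ : 0 < κ)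
    (hn : 2 ≤ n) (hσ : ∀ l, P.σ l ^ 2 < 2) {c : ℝ} (hc : 0 < c) (hco : P.Coercive c)
    (hp : 1 ≤ p) {u : P.Fn} (hu : P.IsSolution u) :
    P.energyNorm (u - P.discreteFn φ W) ^ 2 ≤
      (c ^ 2)⁻¹ * P.estAllSq φ W (Mesh.resConst n κ + 1) := by
  obtain ⟨V, hV⟩ := exists_galerkin φ hn hc hco
  have hW := memV_discreteFn φ W
  have hVm := memV_discreteFn φ V
  set w := P.discreteFn φ W with hw
  set g := P.discreteFn φ V with hg
  set v : P.Fn := u - g with hv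
  set d : P.Fn := g - w with hd
  have hvm : P.MemV v := hu.1.sub hVm
  have hdm : P.MemV d := hVm.sub hW
  have hdV : d = P.discreteFn φ (V - W) := (discreteFn_sub φ V W).symm
  -- Galerkin orthogonality. It yields both the Pythagorean identity and the freedom to subtract the
  -- interpolant.
  have horth : ∀ X, P.B v (P.discreteFn φ X) = 0 := by
    intro X
    rw [hv, hu.1.B_sub_left hVm (memV_discreteFn φ X), hu.2 _ (memV_discreteFn φ X),
      load_discreteFn, hg, B_discreteFn, hV, sub_self]
  have hR0 : 0 ≤ Mesh.resConst n κ := by unfold Mesh.resConst; positivity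
  have hdet0 : 0 ≤ P.estDet φ W := Real.sqrt_nonneg _
  have hpar0 : 0 ≤ P.estParam φ W := Real.sqrt_nonneg _
  have hdisc0 : 0 ≤ P.estDisc φ W := norm_nonneg _
  have hcI0 := P.cI_nonneg
  have hEv := energyNorm_nonneg (P := P) v
  have hEd := energyNorm_nonneg (P := P) d
  -- `B d d` pairs the algebraic residual with `V - W`; the dual norm and coercivity bound it by one
  -- power of the energy norm of `d`, which is then cancelled.
  have hd_le : P.energyNorm d ≤ c⁻¹ * P.estDisc φ W := by
    have h1 : P.B d d = -((P.galerkinMatrix φ *ᵥ W - P.loadVector φ) ⬝ᵥ (V - W)) := by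
      rw [hdV, B_discreteFn, mulVec_sub, hV, ← neg_dotProduct, neg_sub]
    have h2 := abs_dotProduct_le_estDisc φ hn hco W (V - W)
    rw [← hdV] at h2
    have h3 := hco.l2Norm_le hc hdm
    have h4 : P.energyNorm d ^ 2 ≤ c⁻¹ * P.estDisc φ W * P.energyNorm d := by
      rw [hco.energyNorm_sq hdm, h1]
      refine (neg_le_abs _).trans (h2.trans ?_)
      calc P.estDisc φ W * P.l2Norm d ≤ P.estDisc φ W * (c⁻¹ * P.energyNorm d) := by gcongr
        _ = _ := by ring
    rcases hEd.eq_or_lt with h0 | h0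
    · rw [← h0]; positivity
    · rw [sq] at h4
      exact le_of_mul_le_mul_right h4 h0
  have hv_le : P.energyNorm v ≤ c⁻¹ * ((Mesh.resConst n κ + 1) * P.estDet φ W +
      P.estParam φ W + P.cI * P.estDisc φ W) := by
    rcases hEv.eq_or_lt with h0 | h0
    · rw [← h0]; positivity
    have hI := memV_interp (P := P) v
    obtain ⟨X, hX⟩ := exists_interp_eq φ hp v
    set z : P.Fn := v - P.interp v with hz
    have hzm : P.MemV z := hvm.sub hI
    have hvL := hco.memLp hn hvm
    have hIL := hco.memLp hn hI
    -- Subtracting the interpolant from the test function costs nothing, and `v = (u - w) - d`.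
    have e1 : P.B v v = (P.load z - P.B w z) - P.B d z := by
      have h1 : P.B v z = P.B v v := by
        rw [hz, hvm.B_sub_right hvm hI, hX, horth, sub_zero]
      have h2 : P.B v z = P.B u z - P.B g z := hu.1.B_sub_left hVm hzm
      have h3 : P.B d z = P.B g z - P.B w z := hVm.B_sub_left hW hzm
      rw [← h1, h2, h3, hu.2 z hzm]; ring
    have e2 := load_sub_B_discreteFn φ W hσ (hco.memLp hn hzm)
    have b1 := abs_det_le φ W hreg hκ hn hσ hvL hIL
    have b2 := abs_param_le φ W hσ hvL
    -- The tail modes do not see the interpolant, so no interpolation constant appears before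
    -- `estParam`.
    have e3 : ∑ η ∈ P.Ξ \ P.Λ, ∫ y, P.H η y * resFun φ W η (z y) ∂P.γρ =
        ∑ η ∈ P.Ξ \ P.Λ, ∫ y, P.H η y * resFun φ W η (v y) ∂P.γρ :=
      Finset.sum_congr rfl fun η hη =>
        integral_H_mul_sub_interp_of_notMem hσ hvL hIL _ (Finset.mem_sdiff.1 hη).2
    have b3 : |P.B d z| ≤ c⁻¹ * P.estDisc φ W * (P.cI * P.energyNorm v) :=
      (hco.abs_B_le hdm hzm).trans (mul_le_mul hd_le
        (hco.energyNorm_sub_interp_le hn hσ hc hvm h0.ne') (energyNorm_nonneg _) (by positivity))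
    have b4 := hco.l2Norm_le hc hvm
    have h5 : P.energyNorm v ^ 2 ≤ (Mesh.resConst n κ + 1) * P.estDet φ W *
        (c⁻¹ * P.energyNorm v) + P.estParam φ W * (c⁻¹ * P.energyNorm v) +
        c⁻¹ * P.estDisc φ W * (P.cI * P.energyNorm v) := by
      rw [hco.energyNorm_sq hvm, e1, e2, e3]
      have b1' := (le_abs_self _).trans b1
      have b2' := (neg_le_abs _).trans b2
      have b3' := (neg_le_abs _).trans b3
      have c1 : Mesh.resConst n κ * P.estDet φ W * P.l2Norm v ≤
          (Mesh.resConst n κ + 1) * P.estDet φ W * (c⁻¹ * P.energyNorm v) := by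
        gcongr
        · exact l2Norm_nonneg v
        · linarith
      have c2 : P.estParam φ W * P.l2Norm v ≤ P.estParam φ W * (c⁻¹ * P.energyNorm v) := by
        gcongr
      linarith
    refine le_of_mul_le_mul_right ?_ h0
    rw [← sq]
    refine h5.trans (le_of_eq ?_)
    ring
  have hsum : u - w = v + d := by rw [hv, hd]; exact (sub_add_sub_cancel u g w).symm
  -- `d` is discrete, so the mixed terms vanish; this is why `estDisc` appears once more outside the
  -- squared sum.
  have hpyth : P.energyNorm (u - w) ^ 2 = P.energyNorm v ^ 2 + P.energyNorm d ^ 2 := by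
    rw [hsum, hco.energyNorm_sq (hvm.add hdm), hco.energyNorm_sq hvm, hco.energyNorm_sq hdm,
      hvm.B_add_left hdm (hvm.add hdm), hvm.B_add_right hvm hdm, hdm.B_add_right hvm hdm,
      P.B_comm d v]
    have h0 : P.B v d = 0 := by rw [hdV]; exact horth _
    rw [h0]; ring
  rw [hpyth, estAllSq, mul_add, ← inv_pow, ← mul_pow, ← mul_pow]
  gcongr

end Data

end LognormalTT

end

theorem mainTheorem1 (n : ℕ) (hn : 2 ≤ n) (κ : ℝ) (hκ : 0 < κ) :
    ∃ cdet : ℝ, 0 < cdet ∧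
      ∀ (𝒯 : LognormalTT.Mesh n), 𝒯.ShapeRegular κ →
      ∀ (P : LognormalTT.Data 𝒯), (∀ l, P.σ l ^ 2 < 2) →
      ∀ (c : ℝ), 0 < c → P.Coercive c →
      ∀ (p : ℕ), 1 ≤ p → ∀ (N : ℕ) (φ : Module.Basis (Fin N) ℝ (𝒯.fe p)),
      ∀ (u : P.Fn), P.IsSolution u →
      ∀ (W : Fin N × P.Λ → ℝ),
        P.energyNorm (u - P.discreteFn φ W) ^ 2 ≤ (c ^ 2)⁻¹ * P.estAllSq φ W cdet := by
  have hR : 0 ≤ LognormalTT.Mesh.resConst n κ := by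
    unfold LognormalTT.Mesh.resConst; positivity
  -- The summand `1` only ensures that the constant is strictly positive.
  refine ⟨LognormalTT.Mesh.resConst n κ + 1, by positivity, ?_⟩
  intro 𝒯 hreg P hσ c hc hco p hp N φ u hu W
  exact LognormalTT.Data.energyNorm_sub_discreteFn_sq_le φ W hreg hκ hn hσ hc hco hp hu
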